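/- Let $\mathbb{K}$ be $\mathbb{R}$ or $\mathbb{C}$. Let $\mathcal{E}$ be a $\mathbb{Z}$-graded locally convex Hausdorff space over $\mathbb{K}$ and $\mathcal{A}$ a unital graded commutative topological $\mathbb{K}$-algebra which is locally convex, Hausdorff and complete; both are finite topological direct sums of their homogeneous components. (This covers every family of free field theories: $\mathcal{E}=\Gamma(M,E)$ is the nuclear Fréchet space of smooth sections of a $\mathbb{Z}$-graded vector bundle on a compact manifold and $\mathcal{A}$ is $C^\infty(\Delta^n,\mathbb{K})$ or $\Omega^\bullet(\Delta^n,\mathbb{K})$; no other part of the free theory enters. For such spaces $\mathrm{Hom}_{\mathbb K}(\mathcal{E}^{\hat\otimes l},\mathcal{A})=(\mathcal{E}^\dagger)^{\hat\otimes l}\hat\otimes\mathcal{A}$.) The Koszul sign rule is used throughout. **Interactions.** A *cyclic decomposition* of a finite set is a partition into cyclically ordered subsets, called cycles. For $k,l\ge 0$ let $\mathcal{C}_{k,l}$ be the space of sums of products of $k$ nonempty cyclic words of total length $l$ in $\mathcal{E}^\dagger$ with coefficients in $\mathcal{A}$, that is, the order $l$ part of the $S_k$-coinvariants of the $k$-th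 tensor power of $\prod_{n\ge1}\mathrm{Hom}(\mathcal{E}^{\hat\otimes n},\mathbb{K})_{\mathbb{Z}/n}$, with $\mathcal{A}$-coefficients; precisely $$\mathcal{C}_{k,l}=\Bigl[\bigoplus_{C}\mathrm{Hom}_{\mathbb K}(\mathcal{E}^{\hat\otimes l},\mathcal{A})\Bigr]_{S_l},$$ where $C$ runs over the cyclic decompositions of $\{1,\dots,l\}$ into $k$ cycles and $S_l$ acts simultaneously on these and on the tensor powers. A *family of interactions* is a series $I=\sum_{i,j,k,l\ge 0}\gamma^i\nu^jI_{ijkl}$ with $I_{ijkl}\in\mathcal{C}_{k,l}$ of total degree zero, such that $I_{i00l}=0$ for all $i,l$ and $I_{ijkl}=0$ whenever $2(2i+j+k-1)+l<3$. A *family of propagators* is a tensor $P\in\mathcal{E}\hat\otimes\mathcal{E}\hat\otimes\mathcal{A}$ (completed projective tensor product) of total degree zero with $(\tau\hat\otimes 1)P=P$, where $\tau(p\otimes q)=(-1)^{|p||q|}q\otimes p$. **Graphs.** A *stable ribbon graph* $\Gamma$ consists of finite sets $H(\Gamma)$ of half-edges and $V(\Gamma)$ of vertices, an incidence map $H(\Gamma)\to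 V(\Gamma)$, an involution $\kappa_\Gamma$ of $H(\Gamma)$ (its fixed points are the legs $L(\Gamma)$, its two-element orbits the edges $E(\Gamma)$), a cyclic decomposition $C(v)$ of the set of half-edges incident to each vertex $v$, and integers $g(v),b(v)\ge0$ with $|C(v)|+b(v)>0$ and $2(2g(v)+b(v)+|C(v)|-1)+|v|\ge3$, where $|v|$ is the number of half-edges incident to $v$. Contracting an edge deletes its two half-edges; if they lie in different cycles these cycles are joined, and if they lie in one cycle this cycle is cut into two; empty cycles are discarded. If $\Gamma$ is connected (in particular nonempty), contracting all edges leaves the *canonical* cyclic decomposition of $L(\Gamma)$, whose number of cycles is denoted $|C(\Gamma/\Gamma)|$. Let $c_\Gamma$ be the permutation of $H(\Gamma)$ whose cycles are those of all the $C(v)$, let $|C(\Gamma)|$ be their number, let $\beta$ be the number of cycles of $c_\Gamma\kappa_\Gamma$ (1-cycles included in both counts), and put $$g(\Gamma)=1-|V(\Gamma)|+\tfrac12\bigl(|E(\Gamma)|+|C(\Gamma)|-\beta\bigr)+\sum_v g(v),\qquad b(\Gamma)=\beta+\sum_v b(v)-|C(\Gamma/\Gamma)|.$$ **The flow.** Attach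 to every vertex $v$ the functional $I(v)$ of the fields on its half-edges obtained from $I_{g(v)\,b(v)\,|C(v)|\,|v|}$ by summing over all ways of matching its cyclic words with the cycles of $C(v)$ and rotating each of them. The Feynman amplitude $F_\Gamma(I,P)\in\mathrm{Hom}(\mathcal{E}^{\hat\otimes L(\Gamma)},\mathcal{A})$ is obtained by evaluating $\bigotimes_vI(v)$ on $P$ at every edge and on the fields at the legs, and multiplying all resulting elements of $\mathcal{A}$. For $\Gamma$ connected, the weight $w_\Gamma(I,P)\in\mathcal{C}_{k,l}$, with $k=|C(\Gamma/\Gamma)|$ and $l=|L(\Gamma)|$, is the class of $F_\Gamma(I,P)$ attached to the canonical cyclic decomposition of $L(\Gamma)$. The noncommutative renormalization group flow is $$W(I,P)=\sum_\Gamma\frac{\gamma^{g(\Gamma)}\nu^{b(\Gamma)}}{|\mathrm{Aut}(\Gamma)|}\,w_\Gamma(I,P),$$ the sum being over isomorphism classes of connected stable ribbon graphs. **Theorem.** The flow is well defined: for connected $\Gamma$ the numbers $g(\Gamma),b(\Gamma)$ are nonnegative integers; for given $i,j,k,l$ there are only finitely many isomorphism classes of connected stable ribbon graphs with $g(\Gamma)=i$,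 $b(\Gamma)=j$, $|C(\Gamma/\Gamma)|=k$, $|L(\Gamma)|=l$; for all families of interactions $I$ and of propagators $P$ the amplitudes $F_\Gamma(I,P)$ exist and are unique, and $W(I,P)$ is again a family of interactions. Moreover, for every family of interactions $I$ and all families of propagators $P_1,P_2$, $$W(I,0)=I,\qquad W(I,P_1+P_2)=W\bigl(W(I,P_1),P_2\bigr),$$ so the additive group of propagators acts on the set of interactions. -/

import Mathlib

open scoped TensorProduct

noncomputable section

namespace NCRG

/-! ### Gradings and Koszul signs -/

section Signs

/-- The Koszul sign of a reordering.  The objects `ι`, of degrees `deg`, are first written in the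
order given by `u` and then in the order given by `w`; each pair of odd objects whose relative
order is reversed contributes a factor `-1`. -/
def koszulSign {ι K K' : Type*} [LT K] [LT K'] (u : ι → K) (w : ι → K') (deg : ι → ℤ) : ℤ :=
  (-1) ^ Nat.card {p : ι × ι //
    Odd (deg p.1) ∧ Odd (deg p.2) ∧ u p.1 < u p.2 ∧ w p.2 < w p.1}

theorem koszulSign_comp_equiv {ι ι' K K' : Type*} [LT K] [LT K'] (e : ι' ≃ ι)
    (u : ι → K) (w : ι → K') (deg : ι → ℤ) :
    koszulSign (u ∘ e) (w ∘ e) (deg ∘ e) = koszulSign u w deg := by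
  unfold koszulSign
  congr 1
  exact Nat.card_congr ((Equiv.prodCongr e e).subtypeEquiv (fun p => Iff.rfl))

open Classical in
theorem koszulSign_eq_prod {ι K K' : Type*} [Fintype ι] [LT K] [LT K']
    (u : ι → K) (w : ι → K') (deg : ι → ℤ) :
    koszulSign u w deg = ∏ p : ι × ι,
      if Odd (deg p.1) ∧ Odd (deg p.2) ∧ u p.1 < u p.2 ∧ w p.2 < w p.1 then (-1 : ℤ) else 1 := by
  unfold koszulSign
  rw [Finset.prod_ite, Finset.prod_const, Finset.prod_const_one, mul_one, Nat.card_eq_fintype_card,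
    Fintype.card_subtype]

open Classical in
theorem koszulSign_mul {ι K K' K'' : Type*} [Fintype ι] [LinearOrder K] [LinearOrder K']
    [LinearOrder K''] (u : ι → K) (w : ι → K') (z : ι → K'') (deg : ι → ℤ)
    (hu : Function.Injective u) (hw : Function.Injective w) (hz : Function.Injective z) :
    koszulSign u w deg * koszulSign w z deg = koszulSign u z deg := by
  have key : koszulSign w z deg = ∏ p : ι × ι,
      if Odd (deg p.1) ∧ Odd (deg p.2) ∧ u p.1 < u p.2 ∧
        ((w p.1 < w p.2 ∧ z p.2 < z p.1) ∨ (w p.2 < w p.1 ∧ z p.1 < z p.2))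
        then (-1 : ℤ) else 1 := by
    have h1 : koszulSign w z deg =
        (∏ p : ι × ι, if Odd (deg p.1) ∧ Odd (deg p.2) ∧ u p.1 < u p.2 ∧
          (w p.1 < w p.2 ∧ z p.2 < z p.1) then (-1 : ℤ) else 1) *
        (∏ p : ι × ι, if Odd (deg p.1) ∧ Odd (deg p.2) ∧ u p.2 < u p.1 ∧
          (w p.1 < w p.2 ∧ z p.2 < z p.1) then (-1 : ℤ) else 1) := by
      rw [koszulSign_eq_prod, ← Finset.prod_mul_distrib]
      refine Finset.prod_congr rfl fun p _ => ?_
      rcases lt_trichotomy (u p.1) (u p.2) with h | h | h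
      · simp [h, h.not_gt]
      · have := hu h
        simp [this]
      · simp [h, h.not_gt]
    rw [h1, ← (Equiv.prodComm ι ι).prod_comp (fun p : ι × ι =>
      if Odd (deg p.1) ∧ Odd (deg p.2) ∧ u p.2 < u p.1 ∧
          (w p.1 < w p.2 ∧ z p.2 < z p.1) then (-1 : ℤ) else 1), ← Finset.prod_mul_distrib]
    refine Finset.prod_congr rfl fun p _ => ?_
    simp only [Equiv.prodComm_apply, Prod.fst_swap, Prod.snd_swap]
    by_cases h1 : Odd (deg p.1) <;> by_cases h2 : Odd (deg p.2) <;>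
      by_cases h3 : u p.1 < u p.2 <;>
      rcases lt_trichotomy (w p.1) (w p.2) with h | h | h <;>
      simp [h1, h2, h3, h, h.not_gt]
  rw [key, koszulSign_eq_prod u w, koszulSign_eq_prod u z, ← Finset.prod_mul_distrib]
  refine Finset.prod_congr rfl fun p _ => ?_
  by_cases h0 : p.1 = p.2
  · simp [h0]
  by_cases h1 : Odd (deg p.1) <;> by_cases h2 : Odd (deg p.2) <;>
    by_cases h3 : u p.1 < u p.2 <;>
    rcases lt_or_gt_of_ne (hw.ne h0) with h | h <;>
    rcases lt_or_gt_of_ne (hz.ne h0) with h' | h' <;>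
    simp [h1, h2, h3, h, h', h.not_gt, h'.not_gt]

end Signs

/-- A `ℤ`-grading of a topological vector space as a (finite) topological direct sum: only
finitely many components are nonzero and the projections onto them are continuous. -/
def IsTopologicalGrading {𝕂 V : Type*} [Semiring 𝕂] [AddCommMonoid V] [Module 𝕂 V]
    [TopologicalSpace V] (𝒱 : ℤ → Submodule 𝕂 V) [DirectSum.Decomposition 𝒱] : Prop :=
  {i | 𝒱 i ≠ ⊥}.Finite ∧ ∀ i, Continuous fun x : V => (DirectSum.decompose 𝒱 x i : V)

/-- Graded commutativity `a b = (-1)^{|a||b|} b a`. -/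
def IsGradedCommutative {𝕂 A : Type*} [CommRing 𝕂] [Ring A] [Algebra 𝕂 A]
    (𝒜 : ℤ → Submodule 𝕂 A) : Prop :=
  ∀ i j : ℤ, ∀ a ∈ 𝒜 i, ∀ b ∈ 𝒜 j, a * b = (if Odd i ∧ Odd j then (-1 : ℤ) else 1) • (b * a)

/-! ### The completed projective tensor product `E ⊗̂ E ⊗̂ A` and propagators -/

section Propagators

variable (𝕂 E A : Type*) [RCLike 𝕂] [AddCommGroup E] [Module 𝕂 E] [TopologicalSpace E]
  [AddCommGroup A] [Module 𝕂 A] [TopologicalSpace A]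

/-- The algebraic tensor product `E ⊗ E ⊗ A`, to be given the projective topology. -/
def ProjTensor : Type _ := (E ⊗[𝕂] E) ⊗[𝕂] A

instance : AddCommGroup (ProjTensor 𝕂 E A) :=
  inferInstanceAs (AddCommGroup ((E ⊗[𝕂] E) ⊗[𝕂] A))

instance : Module 𝕂 (ProjTensor 𝕂 E A) :=
  inferInstanceAs (Module 𝕂 ((E ⊗[𝕂] E) ⊗[𝕂] A))

/-- The decomposable tensor `p ⊗ q ⊗ a`. -/
def ProjTensor.pure (p q : E) (a : A) : ProjTensor 𝕂 E A :=
  ((p ⊗ₜ[𝕂] q) ⊗ₜ[𝕂] a : (E ⊗[𝕂] E) ⊗[𝕂] A)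

/-- The locally convex vector space topologies on `E ⊗ E ⊗ A` for which `(p, q, a) ↦ p ⊗ q ⊗ a` is
continuous. -/
def ProjTensor.admissible : Set (TopologicalSpace (ProjTensor 𝕂 E A)) :=
  {t | @IsTopologicalAddGroup _ t _ ∧ @ContinuousSMul 𝕂 _ _ _ t ∧ @PolynormableSpace 𝕂 _ _ _ _ t ∧
    @Continuous (E × E × A) _ _ t fun z => ProjTensor.pure 𝕂 E A z.1 z.2.1 z.2.2}

/-- The projective topology: the finest locally convex topology for which
`(p, q, a) ↦ p ⊗ q ⊗ a` is continuous (in Mathlib's order on topologies, finer means smaller). -/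
@[reducible]
def ProjTensor.topology : TopologicalSpace (ProjTensor 𝕂 E A) :=
  sInf (ProjTensor.admissible 𝕂 E A)

theorem ProjTensor.isTopologicalAddGroup :
    @IsTopologicalAddGroup _ (ProjTensor.topology 𝕂 E A) _ :=
  topologicalAddGroup_sInf fun _ ht => ht.1

theorem ProjTensor.continuousSMul :
    @ContinuousSMul 𝕂 (ProjTensor 𝕂 E A) _ _ (ProjTensor.topology 𝕂 E A) :=
  continuousSMul_sInf fun _ ht => ht.2.1

instance : UniformSpace (ProjTensor 𝕂 E A) :=
  @IsTopologicalAddGroup.rightUniformSpace _ _ (ProjTensor.topology 𝕂 E A)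
    (ProjTensor.isTopologicalAddGroup 𝕂 E A)

instance : IsTopologicalAddGroup (ProjTensor 𝕂 E A) :=
  ProjTensor.isTopologicalAddGroup 𝕂 E A

instance : ContinuousSMul 𝕂 (ProjTensor 𝕂 E A) :=
  ProjTensor.continuousSMul 𝕂 E A

instance : IsUniformAddGroup (ProjTensor 𝕂 E A) :=
  @isUniformAddGroup_of_addCommGroup _ _ (ProjTensor.topology 𝕂 E A)
    (ProjTensor.isTopologicalAddGroup 𝕂 E A)

instance : UniformContinuousConstSMul 𝕂 (ProjTensor 𝕂 E A) :=
  uniformContinuousConstSMul_of_continuousConstSMul 𝕂 (ProjTensor 𝕂 E A)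

/-- The completed projective tensor product `E ⊗̂ E ⊗̂ A`. -/
abbrev Tensor3 : Type _ := UniformSpace.Completion (ProjTensor 𝕂 E A)

/-- The decomposable tensor `p ⊗ q ⊗ a` of `E ⊗̂ E ⊗̂ A`. -/
def Tensor3.pure (p q : E) (a : A) : Tensor3 𝕂 E A :=
  (ProjTensor.pure 𝕂 E A p q a : UniformSpace.Completion (ProjTensor 𝕂 E A))

variable {𝕂 E A} (ℰ : ℤ → Submodule 𝕂 E) (𝒜 : ℤ → Submodule 𝕂 A)

/-- A family of propagators: a tensor in `E ⊗̂ E ⊗̂ A` of total degree zero which is fixed by the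
continuous linear map `p ⊗ q ⊗ a ↦ (-1)^{|p||q|} q ⊗ p ⊗ a`. -/
structure IsPropagator (P : Tensor3 𝕂 E A) : Prop where
  degree_zero : P ∈ closure (Submodule.span 𝕂 {t : Tensor3 𝕂 E A | ∃ i j k : ℤ, i + j + k = 0 ∧
    ∃ p ∈ ℰ i, ∃ q ∈ ℰ j, ∃ a ∈ 𝒜 k, t = Tensor3.pure 𝕂 E A p q a} : Set (Tensor3 𝕂 E A))
  symmetric : ∃ τ : Tensor3 𝕂 E A →L[𝕂] Tensor3 𝕂 E A,
    (∀ i j : ℤ, ∀ p ∈ ℰ i, ∀ q ∈ ℰ j, ∀ a : A, τ (Tensor3.pure 𝕂 E A p q a) =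
      (if Odd i ∧ Odd j then (-1 : ℤ) else 1) • Tensor3.pure 𝕂 E A q p a) ∧ τ P = P

end Propagators

/-! ### Cyclic decompositions -/

section Cycles

variable {X : Type*}

/-- The number of cycles, fixed points included, of a permutation; equivalently, the number of
cycles of the corresponding cyclic decomposition. -/
def numCycles (σ : Equiv.Perm X) : ℕ := Nat.card (Quotient (Equiv.Perm.SameCycle.setoid σ))

variable [DecidableEq X]

/-- Remove `x` from its cycle `(… w x y …)`, giving `(… w y …)`; the point `x` becomes fixed. -/
def eraseFromCycle (c : Equiv.Perm X) (x : X) : Equiv.Perm X := Equiv.swap x (c x) * c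

/-- The effect on cyclic decompositions of contracting an edge with ends `x ≠ y`.  Two different
cycles `(x u …)` and `(y v …)` are joined and `x, y` are deleted; a cycle through both `x` and `y`
is cut into the two arcs between them and `x, y` are deleted.  The deleted points are kept
as fixed points of the permutation. -/
def contractEdge (c : Equiv.Perm X) (x y : X) : Equiv.Perm X :=
  eraseFromCycle (eraseFromCycle (c * Equiv.swap x y) x) y

theorem eraseFromCycle_self (c : Equiv.Perm X) (x : X) : eraseFromCycle c x x = x := by
  simp [eraseFromCycle]

theorem eraseFromCycle_fixed (c : Equiv.Perm X) (x z : X) (h : c z = z) :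
    eraseFromCycle c x z = z := by
  by_cases hz : z = x
  · subst hz; exact eraseFromCycle_self c z
  · have hc : z ≠ c x := fun hh => hz (c.injective (h.trans hh))
    simp [eraseFromCycle, h, Equiv.swap_apply_of_ne_of_ne hz hc]

theorem contractEdge_fixed (c : Equiv.Perm X) (x y z : X) (h : z = x ∨ z = y ∨ c z = z) :
    contractEdge c x y z = z := by
  unfold contractEdge
  by_cases hy : z = y
  · subst hy; exact eraseFromCycle_self _ _
  apply eraseFromCycle_fixed
  by_cases hx : z = x
  · subst hx; exact eraseFromCycle_self _ _
  apply eraseFromCycle_fixed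
  simpa [Equiv.swap_apply_of_ne_of_ne hx hy] using (h.resolve_left hx).resolve_left hy

end Cycles

/-! ### Stable ribbon graphs -/

/-- A ribbon graph with half-edges `Fin nH` and vertices `Fin nV` (every finite graph is isomorphic
to one of this form). -/
structure RibbonGraph where
  /-- number of half-edges -/
  nH : ℕ
  /-- number of vertices -/
  nV : ℕ
  /-- the vertex to which a half-edge is incident -/
  root : Fin nH → Fin nV
  /-- the involution; fixed points are legs, two-element orbits are edges -/
  inv : Equiv.Perm (Fin nH)
  inv_inv : ∀ h, inv (inv h) = h
  /-- the permutation whose cycles are the cycles of all the cyclic decompositions `C(v)` -/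
  cyc : Equiv.Perm (Fin nH)
  root_cyc : ∀ h, root (cyc h) = root h
  /-- the genus of a vertex -/
  genus : Fin nV → ℕ
  /-- the boundary of a vertex -/
  bdry : Fin nV → ℕ

namespace RibbonGraph

variable (Γ : RibbonGraph)

/-- The half-edges incident to the vertex `v`. -/
abbrev At (v : Fin Γ.nV) : Type := {h : Fin Γ.nH // Γ.root h = v}

/-- The cyclic decomposition `C(v)` of the half-edges incident to `v`. -/
def cycAt (v : Fin Γ.nV) : Equiv.Perm (Γ.At v) :=
  Γ.cyc.subtypePerm fun h => by rw [Γ.root_cyc]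

/-- The legs, that is the fixed points of the involution. -/
def legs : Finset (Fin Γ.nH) := Finset.univ.filter fun h => Γ.inv h = h

/-- The edges, each edge `{h, inv h}` being represented by the smaller of its two half-edges. -/
def edges : Finset (Fin Γ.nH) := Finset.univ.filter fun h => h < Γ.inv h

/-- The graph is connected (and not empty). -/
def Connected : Prop :=
  0 < Γ.nV ∧ ∀ v w : Fin Γ.nV,
    Relation.ReflTransGen (fun v w => ∃ h, Γ.root h = v ∧ Γ.root (Γ.inv h) = w) v w

/-- The cyclic structure left after contracting all the edges one after the other; half-edges that
are not legs have become fixed points. -/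
def contractAll : Equiv.Perm (Fin Γ.nH) :=
  (Γ.edges.sort (· ≤ ·)).foldl (fun c h => contractEdge c h (Γ.inv h)) Γ.cyc

theorem contractAll_fixed (h : Fin Γ.nH) (hh : h ∉ Γ.legs) : Γ.contractAll h = h := by
  have main : ∀ (L : List (Fin Γ.nH)) (c : Equiv.Perm (Fin Γ.nH)),
      (h ∈ L ∨ Γ.inv h ∈ L ∨ c h = h) →
      L.foldl (fun c h => contractEdge c h (Γ.inv h)) c h = h := by
    intro L
    induction L with
    | nil => intro c hc; simpa using hc
    | cons x L ih =>
      intro c hc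
      rw [List.foldl_cons]
      apply ih
      by_cases h1 : h ∈ L
      · exact Or.inl h1
      by_cases h2 : Γ.inv h ∈ L
      · exact Or.inr (Or.inl h2)
      refine Or.inr (Or.inr (contractEdge_fixed _ _ _ _ ?_))
      rcases hc with hc | hc | hc
      · exact Or.inl ((List.mem_cons.1 hc).resolve_right h1)
      · have := (List.mem_cons.1 hc).resolve_right h2
        exact Or.inr (Or.inl (by rw [← this, Γ.inv_inv]))
      · exact Or.inr (Or.inr hc)
  apply main
  have hne : Γ.inv h ≠ h := by simpa [legs] using hh
  rcases lt_or_gt_of_ne hne with h1 | h1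
  · right; left
    simpa [edges, Γ.inv_inv] using h1
  · left
    simpa [edges] using h1

/-- The canonical cyclic decomposition of the legs of a connected graph `Γ`, given by the cyclic
decomposition of the unique vertex of the graph `Γ/Γ` in which all edges are contracted. -/
def canonical : Equiv.Perm {h // h ∈ Γ.legs} :=
  Γ.contractAll.subtypePerm fun h => by
    constructor
    · intro h1
      by_contra h2
      rw [Γ.contractAll_fixed h h2] at h1
      exact h2 h1
    · intro h1
      by_contra h2
      have := Γ.contractAll.injective (Γ.contractAll_fixed _ h2)
      rw [this] at h2
      exact h2 h1

/-- The number of cycles of the boundary permutation, the composite of the cyclic structure with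
the involution. -/
def numBoundaryCycles : ℕ := numCycles (Γ.cyc * Γ.inv)

/-- The genus `1 - |V| + (|E| + |C| - β) / 2 + ∑ g(v)` of a connected graph. -/
def totalGenus : ℚ :=
  1 - (Γ.nV : ℚ) + ((Γ.edges.card : ℚ) + (numCycles Γ.cyc : ℚ) - (Γ.numBoundaryCycles : ℚ)) / 2
    + ∑ v, (Γ.genus v : ℚ)

/-- The number `b(Γ) = β + ∑ b(v) - |C(Γ/Γ)|`. -/
def totalBdry : ℤ :=
  (Γ.numBoundaryCycles : ℤ) + ∑ v, (Γ.bdry v : ℤ) - (numCycles Γ.canonical : ℤ)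

/-- An isomorphism of ribbon graphs. -/
structure Iso (Γ Γ' : RibbonGraph) where
  onH : Fin Γ.nH ≃ Fin Γ'.nH
  onV : Fin Γ.nV ≃ Fin Γ'.nV
  map_root : ∀ h, Γ'.root (onH h) = onV (Γ.root h)
  map_inv : ∀ h, Γ'.inv (onH h) = onH (Γ.inv h)
  map_cyc : ∀ h, Γ'.cyc (onH h) = onH (Γ.cyc h)
  map_genus : ∀ v, Γ'.genus (onV v) = Γ.genus v
  map_bdry : ∀ v, Γ'.bdry (onV v) = Γ.bdry v

end RibbonGraph

/-- A stable ribbon graph: at each vertex `|C(v)| + b(v) > 0` and `2 l(v) + |v| ≥ 3`, where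
`l(v) = 2 g(v) + b(v) + |C(v)| - 1` is the loop number. -/
structure StableRibbonGraph extends RibbonGraph where
  pos : ∀ v, 0 < numCycles (toRibbonGraph.cycAt v) + bdry v
  stable : ∀ v, (3 : ℤ) ≤
    2 * (2 * genus v + bdry v + numCycles (toRibbonGraph.cycAt v) - 1) +
      Fintype.card (toRibbonGraph.At v)

/-- Stable ribbon graphs up to isomorphism. -/
instance StableRibbonGraph.isoSetoid : Setoid StableRibbonGraph where
  r Γ Γ' := Nonempty (Γ.toRibbonGraph.Iso Γ'.toRibbonGraph)
  iseqv :=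
    { refl := fun Γ => ⟨⟨Equiv.refl _, Equiv.refl _, fun _ => rfl, fun _ => rfl, fun _ => rfl,
        fun _ => rfl, fun _ => rfl⟩⟩
      symm := by
        rintro Γ Γ' ⟨f⟩
        refine ⟨⟨f.onH.symm, f.onV.symm, ?_, ?_, ?_, ?_, ?_⟩⟩
        · intro h; rw [Equiv.eq_symm_apply, ← f.map_root, Equiv.apply_symm_apply]
        · intro h; rw [Equiv.eq_symm_apply, ← f.map_inv, Equiv.apply_symm_apply]
        · intro h; rw [Equiv.eq_symm_apply, ← f.map_cyc, Equiv.apply_symm_apply]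
        · intro v; rw [← f.map_genus, Equiv.apply_symm_apply]
        · intro v; rw [← f.map_bdry, Equiv.apply_symm_apply]
      trans := by
        rintro Γ Γ' Γ'' ⟨f⟩ ⟨f'⟩
        exact ⟨⟨f.onH.trans f'.onH, f.onV.trans f'.onV,
          fun h => by simp [f.map_root, f'.map_root], fun h => by simp [f.map_inv, f'.map_inv],
          fun h => by simp [f.map_cyc, f'.map_cyc], fun v => by simp [f.map_genus, f'.map_genus],
          fun v => by simp [f.map_bdry, f'.map_bdry]⟩⟩ }

/-- The isomorphism classes of stable ribbon graphs. -/
abbrev GraphClass : Type := Quotient StableRibbonGraph.isoSetoid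

/-- The order of the automorphism group. -/
def StableRibbonGraph.autOrder (Γ : StableRibbonGraph) : ℕ :=
  Nat.card (Γ.toRibbonGraph.Iso Γ.toRibbonGraph)

/-- The isomorphism classes of connected stable ribbon graphs `Γ` with `g(Γ) = i`, `b(Γ) = j`,
`|C(Γ/Γ)| = k` and `|L(Γ)| = l`. -/
def graphClasses (i j k l : ℕ) : Set GraphClass :=
  {γ | γ.out.Connected ∧ γ.out.totalGenus = i ∧ γ.out.totalBdry = j ∧
    numCycles γ.out.canonical = k ∧ γ.out.legs.card = l}

/-! ### Functionals on the fields -/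

section Functionals

variable {𝕂 E A : Type*} [RCLike 𝕂] [AddCommGroup E] [Module 𝕂 E] [TopologicalSpace E]
  [Ring A] [Algebra 𝕂 A] [TopologicalSpace A] [IsTopologicalRing A]
  [ContinuousConstSMul 𝕂 A]

variable (𝕂 E A) in
/-- Continuous linear maps from the `l`-th completed projective tensor power of `E` to `A`, presented
as continuous multilinear maps.  For nuclear Fréchet spaces this is the space
`Hom(E^{⊗̂ l}, A) = (E†)^{⊗̂ l} ⊗̂ A`. -/
abbrev Multi (l : ℕ) : Type _ := ContinuousMultilinearMap 𝕂 (fun _ : Fin l => E) A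

/-- The cyclic decompositions of `{1, …, l}` into `k` cycles. -/
abbrev CycDec (k l : ℕ) : Type := {σ : Equiv.Perm (Fin l) // numCycles σ = k}

instance (k l : ℕ) : Fintype (CycDec k l) := Fintype.ofFinite _

/-- `T'` is the image of `T` under the action of the permutation `ρ`, in which the slot `j` of `T`
becomes the slot `ρ j` of `T'`, with the Koszul sign. -/
def IsTransport (ℰ : ℤ → Submodule 𝕂 E) {l : ℕ} (ρ : Equiv.Perm (Fin l))
    (T T' : Multi 𝕂 E A l) : Prop :=
  ∀ (d : Fin l → ℤ) (x : ∀ i, ℰ (d i)),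
    T' (fun i => x i) = koszulSign id ρ.symm d • T (fun i => x (ρ i))

variable (A) in
/-- The relations identifying a functional attached to a cyclic decomposition `σ` with the permuted
functional attached to the permuted cyclic decomposition.  When `ρ` rotates a cycle of `σ` this is
the cyclic coinvariance, and when `ρ` exchanges cycles it is the symmetric coinvariance. -/
def relations (ℰ : ℤ → Submodule 𝕂 E) (k l : ℕ) :
    Submodule 𝕂 (CycDec k l → Multi 𝕂 E A l) :=
  Submodule.span 𝕂 {z | ∃ (σ σ' : CycDec k l) (ρ : Equiv.Perm (Fin l)) (T T' : Multi 𝕂 E A l),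
    σ'.1 = ρ * σ.1 * ρ⁻¹ ∧ IsTransport ℰ ρ T T' ∧ z = Pi.single σ T - Pi.single σ' T'}

variable (A) in
/-- The space of `A`-valued sums of products of `k` cyclic words of total length `l` in `E†`: the
part of order `l` of the `S_k`-coinvariants of the `k`-th tensor power of
`∏_{n ≥ 1} [(E†)^{⊗̂ n}]_{C_n}`, tensored with `A`. -/
abbrev CycWords (ℰ : ℤ → Submodule 𝕂 E) (k l : ℕ) : Type _ :=
  (CycDec k l → Multi 𝕂 E A l) ⧸ relations A ℰ k l

variable (A) in
/-- Power series `∑ γ^i ν^j I_{ijk l}` with `I_{ijkl}` a sum of products of `k` cyclic words of total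
length `l`. -/
abbrev Functional (ℰ : ℤ → Submodule 𝕂 E) : Type _ := ∀ _ _ k l : ℕ, CycWords A ℰ k l

/-- A family of interactions: a functional of total degree zero, with no terms `γ^i` that have
neither a factor `ν` nor a cyclic word, and satisfying the stability constraint. -/
structure IsInteraction (ℰ : ℤ → Submodule 𝕂 E) (𝒜 : ℤ → Submodule 𝕂 A)
    (I : Functional A ℰ) : Prop where
  degree_zero : ∀ i j k l, ∃ T : CycDec k l → Multi 𝕂 E A l,
    Submodule.Quotient.mk T = I i j k l ∧
      ∀ σ (d : Fin l → ℤ) (x : ∀ m, ℰ (d m)), T σ (fun m => x m) ∈ 𝒜 (∑ m, d m)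
  no_constant : ∀ i l, I i 0 0 l = 0
  stable : ∀ i j k l : ℕ, 2 * (2 * (i : ℤ) + j + k - 1) + l < 3 → I i j k l = 0

variable {ℰ : ℤ → Submodule 𝕂 E}

/-- The bijections from `Fin l` to `X` that carry the cyclic decomposition `σ` to `C`. -/
abbrev CycIso {X : Type*} {l : ℕ} (σ : Equiv.Perm (Fin l)) (C : Equiv.Perm X) : Type _ :=
  {φ : Fin l ≃ X // ∀ i, φ (σ i) = C (φ i)}

instance {X : Type*} [Finite X] {l : ℕ} (σ : Equiv.Perm (Fin l)) (C : Equiv.Perm X) :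
    Fintype (CycIso σ C) := Fintype.ofFinite _

/-- Relabelling the source of a bijection of cyclically decomposed sets. -/
def CycIso.relabel {X : Type*} {l : ℕ} {σ σ' : Equiv.Perm (Fin l)} (C : Equiv.Perm X)
    (ρ : Equiv.Perm (Fin l)) (hc : ∀ i, σ' (ρ i) = ρ (σ i)) : CycIso σ C ≃ CycIso σ' C where
  toFun φ := ⟨ρ.symm.trans φ.1, fun i => by
    have := hc (ρ.symm i)
    rw [Equiv.apply_symm_apply] at this
    simp [this, φ.2]⟩
  invFun φ := ⟨ρ.trans φ.1, fun i => by simp [← hc, φ.2]⟩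
  left_inv φ := by ext; simp
  right_inv φ := by ext; simp

variable (ℰ) in
/-- The map `attach` before passing to the quotient. -/
def attachPre {X : Type*} [Fintype X] [LinearOrder X] (C : Equiv.Perm X) (k l : ℕ)
    (d : X → ℤ) (x : ∀ h, ℰ (d h)) : (CycDec k l → Multi 𝕂 E A l) →ₗ[𝕂] A where
  toFun T := ∑ σ, ∑ φ : CycIso σ.1 C,
    koszulSign (id : X → X) φ.1.symm d • T σ (fun i => (x (φ.1 i) : E))
  map_add' T T' := by simp [Finset.sum_add_distrib]
  map_smul' r T := by
    simp only [Pi.smul_apply, _root_.smul_apply, RingHom.id_apply, Finset.smul_sum]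
    exact Finset.sum_congr rfl fun _ _ => Finset.sum_congr rfl fun _ _ => smul_comm _ _ _

theorem attachPre_single {X : Type*} [Fintype X] [LinearOrder X] (C : Equiv.Perm X) (k l : ℕ)
    (d : X → ℤ) (x : ∀ h, ℰ (d h)) (σ : CycDec k l) (T : Multi 𝕂 E A l) :
    attachPre ℰ C k l d x (Pi.single σ T) = ∑ φ : CycIso σ.1 C,
      koszulSign (id : X → X) φ.1.symm d • T (fun i => (x (φ.1 i) : E)) := by
  change ∑ τ : CycDec k l, ∑ φ : CycIso τ.1 C, koszulSign (id : X → X) φ.1.symm d •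
    (Pi.single σ T : CycDec k l → Multi 𝕂 E A l) τ (fun i => (x (φ.1 i) : E)) = _
  rw [Finset.sum_eq_single σ]
  · simp
  · intro τ _ hτ
    simp [Pi.single_eq_of_ne hτ]
  · simp

variable (ℰ) in
/-- Attaching a sum of products of `k` cyclic words to a set `X` with a cyclic decomposition `C`,
evaluated on homogeneous fields `x h`, for `h ∈ X`, placed in the order of `X`: the sum over all ways
to match the `k` words with the `k` cycles and to rotate each of them, with Koszul signs. -/
def attach {X : Type*} [Fintype X] [LinearOrder X] (C : Equiv.Perm X) (k l : ℕ)
    (d : X → ℤ) (x : ∀ h, ℰ (d h)) : CycWords A ℰ k l →ₗ[𝕂] A :=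
  (relations A ℰ k l).liftQ (attachPre ℰ C k l d x) <| by
    rw [relations, Submodule.span_le]
    rintro _ ⟨σ, σ', ρ, T, T', hσ, hT, rfl⟩
    simp only [SetLike.mem_coe, LinearMap.mem_ker, map_sub, attachPre_single, sub_eq_zero]
    have hc : ∀ i, σ'.1 (ρ i) = ρ (σ.1 i) := by intro i; simp [hσ]
    refine Fintype.sum_equiv (CycIso.relabel C ρ hc) _ _ fun φ => ?_
    have hφ : (CycIso.relabel C ρ hc φ).1 = ρ.symm.trans φ.1 := rfl
    rw [hφ, hT (fun i => d ((ρ.symm.trans φ.1) i)) (fun i => x ((ρ.symm.trans φ.1) i)), smul_smul]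
    have h1 : koszulSign (id : Fin l → Fin l) ρ.symm (fun i => d ((ρ.symm.trans φ.1) i)) =
        koszulSign (ρ.symm.trans φ.1).symm φ.1.symm d := by
      rw [← koszulSign_comp_equiv (ρ.symm.trans φ.1)]
      congr 1
      · funext i; simp
      · funext i; simp
    rw [h1, koszulSign_mul _ _ _ _ Function.injective_id (Equiv.injective _) (Equiv.injective _)]
    have h2 : ∀ i j, i = j → (x (φ.1 i) : E) = x (φ.1 j) := by rintro i _ rfl; rfl
    exact congrArg _ (congrArg T (funext fun i => h2 _ _ (by simp)))

end Functionals

/-! ### Feynman amplitudes, weights and the renormalization group flow -/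

section Flow

variable {𝕂 E A : Type*} [RCLike 𝕂] [AddCommGroup E] [Module 𝕂 E] [TopologicalSpace E]
  [Ring A] [Algebra 𝕂 A] [TopologicalSpace A] [IsTopologicalRing A]
  [ContinuousConstSMul 𝕂 A] {ℰ : ℤ → Submodule 𝕂 E}

namespace RibbonGraph

variable (Γ : RibbonGraph)

/-- The order of the factors before evaluation: first the fields on the legs, then, for each edge
`e`, the two `E`-factors and the `A`-factor of the propagator at `e`. -/
def keyIn : Fin Γ.nH ⊕ Γ.edges → ℕ ×ₗ ℕ ×ₗ ℕ
  | .inl h => if Γ.inv h = h then toLex (0, toLex (h, 0))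
      else toLex (1, toLex (min h (Γ.inv h), if h < Γ.inv h then 0 else 1))
  | .inr e => toLex (1, toLex (e, 2))

/-- The order of the factors at evaluation: first, for each vertex `v`, the fields on the
half-edges incident to `v`, and then the `A`-factors of the propagators. -/
def keyOut : Fin Γ.nH ⊕ Γ.edges → ℕ ×ₗ ℕ ×ₗ ℕ
  | .inl h => toLex (0, toLex (Γ.root h, h))
  | .inr e => toLex (1, toLex (e, 0))

/-- The value of `I(Γ)` on homogeneous fields `x h` on all the half-edges and elements `a e` of `A`
on all the edges, written in the order `keyIn`, with all resulting elements of `A` multiplied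
together: `± (∏_v I(v)(x|_v)) (∏_e a e)`. -/
def evaluate (I : Functional A ℰ) (𝒜 : ℤ → Submodule 𝕂 A) (d : Fin Γ.nH → ℤ)
    (x : ∀ h, ℰ (d h)) (d' : Γ.edges → ℤ) (a : ∀ e, 𝒜 (d' e)) : A :=
  koszulSign Γ.keyIn Γ.keyOut (Sum.elim d d') •
    (((List.finRange Γ.nV).map fun v =>
        attach ℰ (Γ.cycAt v) (numCycles (Γ.cycAt v)) (Fintype.card (Γ.At v))
          (fun h : Γ.At v => d h) (fun h => x h)
          (I (Γ.genus v) (Γ.bdry v) (numCycles (Γ.cycAt v)) (Fintype.card (Γ.At v)))).prod *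
      (((Γ.edges.sort (· ≤ ·)).attach.map fun e =>
        (a ⟨e.1, (Finset.mem_sort (· ≤ ·)).1 e.2⟩ : A)).prod))

variable {Γ} in
/-- `F` is the Feynman amplitude of `Γ` (with `l` legs): the evaluation of `I(Γ)` on
`⊗_e P(e)` and on fields on the legs.  The evaluation on tensors `⊗_e (p_e ⊗ q_e ⊗ a_e)` is
prescribed by `evaluate`, and it is extended to all propagators by linearity and continuity. -/
def IsAmplitude (𝒜 : ℤ → Submodule 𝕂 A) (I : Functional A ℰ) (P : Tensor3 𝕂 E A) {l : ℕ}
    (hl : Γ.legs.card = l) (F : Multi 𝕂 E A l) : Prop :=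
  ∃ Φ : MultilinearMap 𝕂 (fun _ : Fin l => E)
      (ContinuousMultilinearMap 𝕂 (fun _ : Γ.edges => Tensor3 𝕂 E A) A),
    (∀ (d : Fin Γ.nH → ℤ) (x : ∀ h, ℰ (d h)) (d' : Γ.edges → ℤ) (a : ∀ e, 𝒜 (d' e)),
      Φ (fun i => x (Γ.legs.orderIsoOfFin hl i).1)
          (fun e => Tensor3.pure 𝕂 E A (x e.1) (x (Γ.inv e.1)) (a e)) =
        Γ.evaluate I 𝒜 d x d' a) ∧
    ∀ y, F y = Φ y fun _ => P

open Classical in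
/-- The Feynman amplitude `F_Γ(I, P)`. -/
def amplitude (𝒜 : ℤ → Submodule 𝕂 A) (I : Functional A ℰ) (P : Tensor3 𝕂 E A) {l : ℕ}
    (hl : Γ.legs.card = l) : Multi 𝕂 E A l :=
  if h : ∃ F, Γ.IsAmplitude 𝒜 I P hl F then h.choose else 0

open Classical in
/-- The Feynman weight `w_Γ(I, P)` of a connected graph: the class of the amplitude, attached to the
canonical cyclic decomposition of the legs.  Its components in the wrong numbers of cyclic
words and letters are zero. -/
def weight (𝒜 : ℤ → Submodule 𝕂 A) (I : Functional A ℰ) (P : Tensor3 𝕂 E A) (k l : ℕ) :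
    CycWords A ℰ k l :=
  if hl : Γ.legs.card = l then
    if hk : numCycles ((Γ.legs.orderIsoOfFin hl).symm.toEquiv.permCongr Γ.canonical) = k then
      Submodule.Quotient.mk (Pi.single ⟨_, hk⟩ (Γ.amplitude 𝒜 I P hl))
    else 0
  else 0

end RibbonGraph

/-- The renormalization group flow: the coefficient of `γ^i ν^j` of
`∑_Γ γ^{g(Γ)} ν^{b(Γ)} w_Γ(I, P) / |Aut Γ|`, in the part with `k` cyclic words of total length `l`.
The sum is over isomorphism classes of connected stable ribbon graphs. -/
def rgFlow (𝒜 : ℤ → Submodule 𝕂 A) (I : Functional A ℰ) (P : Tensor3 𝕂 E A) : Functional A ℰ :=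
  fun i j k l => ∑ᶠ γ ∈ graphClasses i j k l,
    (γ.out.autOrder : 𝕂)⁻¹ • γ.out.weight 𝒜 I P k l

end Flow

end NCRG

end

set_option linter.unusedSectionVars false

noncomputable section

namespace NCRG

open Fin (castAdd natAdd addCases append append_left append_right castAdd_injective
  natAdd_injective)
open Equiv (Perm swap permCongr_apply swap_apply_of_ne_of_ne apply_symm_apply symm_apply_apply)
open Function (update update_of_ne Injective update_apply injective_id update_self)
open Prod.Lex (toLex_lt_toLex)
open Finset (sum_congr sum_eq_zero range mem_univ mem_sort mem_filter smul_sum univ sum_filter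
  mem_sigma sum_comm prod_congr mem_product sum_eq_single sum_add_distrib sum_const_zero sum_product
  mem_range sum_eq_single_of_mem sum_const prod_eq_one mem_union)


/-! ### Calculus of Koszul signs -/

theorem koszulSign_congr {ι K K' L L' : Type*} [LT K] [LT K'] [LT L] [LT L'] {u : ι → K}
    {w : ι → K'} {u' : ι → L} {w' : ι → L'} {d d' : ι → ℤ} (h : ∀ i j, (Odd (d i) ∧ Odd (d j) ∧ u i
    < u j ∧ w j < w i) ↔ (Odd (d' i) ∧ Odd (d' j) ∧ u' i < u' j ∧ w' j < w' i)) : koszulSign u w d =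
    koszulSign u' w' d' := by
  unfold koszulSign
  congr 1
  exact Nat.card_congr (Equiv.subtypeEquivRight fun p => h p.1 p.2)

theorem koszulSign_eq_one {ι K K' : Type*} [LT K] [LT K'] {u : ι → K} {w : ι → K'} {d : ι → ℤ}
    (h : ∀ i j, Odd (d i) → Odd (d j) → u i < u j → ¬ w j < w i) : koszulSign u w d = 1 := by
  have : IsEmpty {p : ι × ι // Odd (d p.1) ∧ Odd (d p.2) ∧ u p.1 < u p.2 ∧ w p.2 < w p.1} :=
    ⟨fun ⟨p, h1, h2, h3, h4⟩ => h _ _ h1 h2 h3 h4⟩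
  simp [koszulSign]

theorem koszulSign_symm {ι K K' : Type*} [LT K] [LT K'] (u : ι → K) (w : ι → K') (d : ι → ℤ) :
    koszulSign u w d = koszulSign w u d := by
  unfold koszulSign
  congr 1
  refine Nat.card_congr ((Equiv.prodComm ι ι).subtypeEquiv fun p => ?_)
  simp only [Equiv.prodComm_apply, Prod.fst_swap, Prod.snd_swap]
  tauto

theorem koszulSign_comp_injective {ι ι' K K' : Type*} [LT K] [LT K'] (f : ι' → ι)
    (hf : Injective f) (u : ι → K) (w : ι → K') (d : ι → ℤ)
    (hd : ∀ i j, Odd (d i) → Odd (d j) → u i < u j → w j < w i → ∃ i' j', f i' = i ∧ f j' = j) :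
    koszulSign u w d = koszulSign (u ∘ f) (w ∘ f) (d ∘ f) := by
  unfold koszulSign
  congr 1
  symm
  refine Nat.card_congr (Equiv.ofBijective (fun p => ⟨(f p.1.1, f p.1.2), p.2⟩) ⟨?_, ?_⟩)
  · rintro ⟨⟨a, b⟩, h⟩ ⟨⟨a', b'⟩, h'⟩ hh
    simp only [Subtype.mk.injEq, Prod.mk.injEq] at hh
    simp [hf hh.1, hf hh.2]
  · rintro ⟨⟨a, b⟩, h⟩
    obtain ⟨a', b', rfl, rfl⟩ := hd a b h.1 h.2.1 h.2.2.1 h.2.2.2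
    exact ⟨⟨(a', b'), h⟩, rfl⟩

theorem negOnePow_sum {ι : Type*} (s : Finset ι) (f : ι → ℤ) :
    (∑ i ∈ s, f i).negOnePow = ∏ i ∈ s, (f i).negOnePow := by
  classical
  induction s using Finset.induction_on with
  | empty => simp
  | insert a s ha ih => rw [Finset.sum_insert ha, Finset.prod_insert ha, Int.negOnePow_add, ih]

open Classical in
theorem koszulSign_eq_prod_negOnePow {ι K K' : Type*} [Fintype ι] [LT K] [LT K'] (u : ι → K)
    (w : ι → K') (d : ι → ℤ) : koszulSign u w d =
    ((∏ i, ∏ j, if u i < u j ∧ w j < w i then (d i * d j).negOnePow else 1 : ℤˣ) : ℤ) := by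
  rw [koszulSign_eq_prod, ← Fintype.prod_prod_type']
  rw [Units.coe_prod]
  refine prod_congr rfl fun p _ => ?_
  by_cases h : u p.1 < u p.2 ∧ w p.2 < w p.1
  · by_cases h1 : Odd (d p.1 * d p.2)
    · have h2 := Int.odd_mul.1 h1
      simp [h, h2, Int.negOnePow_odd _ h1]
    · have h2 : ¬ (Odd (d p.1) ∧ Odd (d p.2)) := fun hh => h1 (Int.odd_mul.2 hh)
      rw [if_neg (by tauto), if_pos h, Int.negOnePow_even _ (Int.not_odd_iff_even.1 h1)]
      rfl
  · rw [if_neg (by tauto), if_neg h]; rfl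

open Classical in
/-- Reordering objects that are grouped in blocks, when the order inside each block is kept. -/
theorem koszulSign_block {ι β K K' L L' : Type*} [Fintype ι] [Fintype β] [DecidableEq β] [LT K] [LT K']
    [Preorder L] [Preorder L'] (r : ι → β) {u : ι → K} {w : ι → K'} {u' : β → L} {w' : β → L'}
    {d : ι → ℤ} (hu : ∀ i j, r i ≠ r j → (u i < u j ↔ u' (r i) < u' (r j)))
    (hw : ∀ i j, r i ≠ r j → (w i < w j ↔ w' (r i) < w' (r j)))
    (hs : ∀ i j, r i = r j → u i < u j → ¬ w j < w i) :
    koszulSign u w d = koszulSign u' w' fun b => ∑ i with r i = b, d i := by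
  rw [koszulSign_eq_prod_negOnePow, koszulSign_eq_prod_negOnePow]
  congr 1
  have h1 : ∀ b b', (if u' b < u' b' ∧ w' b' < w' b then
      ((∑ i with r i = b, d i) * ∑ i with r i = b', d i).negOnePow else 1) =
      ∏ i with r i = b, ∏ j with r j = b',
        if u' (r i) < u' (r j) ∧ w' (r j) < w' (r i) then (d i * d j).negOnePow else 1 := by
    intro b b'
    have : ∀ i ∈ Finset.univ.filter (fun i => r i = b), ∀ j ∈ Finset.univ.filter (fun j => r j = b'),
      (if u' (r i) < u' (r j) ∧ w' (r j) < w' (r i) then (d i * d j).negOnePow else 1) =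
      if u' b < u' b' ∧ w' b' < w' b then (d i * d j).negOnePow else 1 := by
      intro i hi j hj
      rw [(mem_filter.1 hi).2, (mem_filter.1 hj).2]
    rw [prod_congr rfl fun i hi => prod_congr rfl (this i hi)]
    split_ifs
    · rw [Finset.sum_mul_sum, negOnePow_sum]
      exact prod_congr rfl fun i _ => negOnePow_sum _ _
    · simp
  simp_rw [h1]
  have h2 : ∀ b, ∏ b', ∏ i with r i = b, ∏ j with r j = b',
      (if u' (r i) < u' (r j) ∧ w' (r j) < w' (r i) then (d i * d j).negOnePow else 1) =
      ∏ i with r i = b, ∏ j,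
      (if u' (r i) < u' (r j) ∧ w' (r j) < w' (r i) then (d i * d j).negOnePow else 1) := by
    intro b
    rw [Finset.prod_comm]
    exact prod_congr rfl fun i _ => Finset.prod_fiberwise _ r _
  simp_rw [h2]
  refine Eq.trans ?_ (Finset.prod_fiberwise univ r _).symm
  refine prod_congr rfl fun i _ => prod_congr rfl fun j _ => ?_
  by_cases h : r i = r j
  · rw [if_neg (fun hh => hs i j h hh.1 hh.2), if_neg]
    rw [h]; exact fun hh => lt_irrefl _ hh.1
  · simp only [hu i j h, hw j i (Ne.symm h)]

open Classical in
/-- Reordering objects that are grouped in blocks, when the order of the blocks is kept. -/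
theorem koszulSign_fiber {ι β K K' : Type*} [Fintype ι] [Fintype β] [LT K] [LT K'] (r : ι → β)
    {u : ι → K} {w : ι → K'} {d : ι → ℤ} (h : ∀ i j, r i ≠ r j → u i < u j → ¬ w j < w i) :
    koszulSign u w d = ∏ b, koszulSign (fun i : {i // r i = b} => u i)
    (fun i : {i // r i = b} => w i) (fun i : {i // r i = b} => d i) := by
  simp_rw [koszulSign_eq_prod_negOnePow, ← Units.coe_prod]
  congr 1
  rw [← Finset.prod_fiberwise _ r]
  refine prod_congr rfl fun b _ => ?_
  rw [Finset.prod_subtype (p := fun i => r i = b) _ (by simp)]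
  refine prod_congr rfl fun i _ => ?_
  rw [← Finset.prod_fiberwise _ r, Finset.prod_eq_single b, Finset.prod_subtype
    (p := fun i => r i = b) _ (by simp)]
  · intro b' _ hb
    refine prod_eq_one fun j hj => if_neg fun hh => ?_
    have hj := (mem_filter.1 hj).2
    exact h i j (by rw [i.2, hj]; exact hb.symm) hh.1 hh.2
  · simp

theorem koszulSign_sum {ι ι' K K' : Type*} [Fintype ι] [Fintype ι'] [LT K] [LT K'] {u : ι ⊕ ι' → K}
    {w : ι ⊕ ι' → K'} {d : ι ⊕ ι' → ℤ} (h : ∀ i j, (u (.inl i) < u (.inr j) → ¬ w (.inr j) < w (.inl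
    i)) ∧ (u (.inr j) < u (.inl i) → ¬ w (.inl i) < w (.inr j))) : koszulSign u w d = koszulSign
    (u ∘ .inl) (w ∘ .inl) (d ∘ .inl) * koszulSign (u ∘ .inr) (w ∘ .inr) (d ∘ .inr) := by
  classical
  simp_rw [koszulSign_eq_prod_negOnePow, ← Units.val_mul]
  congr 1
  rw [Fintype.prod_sum_type]
  congr 1
  · refine prod_congr rfl fun i _ => ?_
    rw [Fintype.prod_sum_type, prod_eq_one (s := univ (α := ι')), mul_one]
    · rfl
    · exact fun j _ => if_neg fun hh => (h i j).1 hh.1 hh.2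
  · refine prod_congr rfl fun i _ => ?_
    rw [Fintype.prod_sum_type, prod_eq_one (s := univ (α := ι)), one_mul]
    · rfl
    · exact fun j _ => if_neg fun hh => (h j i).2 hh.1 hh.2

/-! ### Products of homogeneous elements in a graded commutative algebra -/

section GradedProducts

variable {𝕂 A : Type*} [CommRing 𝕂] [Ring A] [Algebra 𝕂 A] {𝒜 : ℤ → Submodule 𝕂 A}

theorem IsGradedCommutative.mul_comm (h : IsGradedCommutative 𝒜) {i j : ℤ} {a b : A}
    (ha : a ∈ 𝒜 i) (hb : b ∈ 𝒜 j) : a * b = ((i * j).negOnePow : ℤ) • (b * a) := by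
  rw [h i j a ha b hb]
  congr 1
  by_cases h1 : Odd (i * j)
  · rw [if_pos (Int.odd_mul.1 h1), Int.negOnePow_odd _ h1]; rfl
  · rw [if_neg fun h2 => h1 (Int.odd_mul.2 h2),
      Int.negOnePow_even _ (Int.not_odd_iff_even.1 h1)]; rfl

theorem exists_injective_sorted {S : Type*} [Fintype S] [DecidableEq S] (L : List S) (hL : L.Nodup)
    : ∃ v : S → ℕ ×ₗ Fin (Fintype.card S), Injective v ∧ L.Pairwise fun x y => v x < v y := by
  refine ⟨fun s => toLex (L.idxOf s, Fintype.equivFin S s), fun s s' h => ?_, ?_⟩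
  · simpa using congrArg (fun z => (ofLex z).2) h
  · rw [List.pairwise_iff_getElem]
    intro i j hi hj hij
    rw [toLex_lt_toLex]
    left
    simpa [hL.idxOf_getElem] using hij

open Classical in
/-- Reordering a product of homogeneous elements. -/
theorem IsGradedCommutative.list_prod_perm [SetLike.GradedMonoid 𝒜] (hc : IsGradedCommutative 𝒜)
    {S : Type*} [Fintype S] {L₁ L₂ : List S} (hp : L₁.Perm L₂) (hn : L₁.Nodup) (f : S → A)
    (d : S → ℤ) (hf : ∀ s, f s ∈ 𝒜 (d s)) : ∀ {K K' : Type} [LinearOrder K] [LinearOrder K']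
    (u : S → K) (w : S → K'), Injective u → Injective w → L₁.Pairwise (fun x y => u x < u y) →
    L₂.Pairwise (fun x y => w x < w y) → (L₁.map f).prod = koszulSign u w
    (fun s => if s ∈ L₁ then d s else 0) • (L₂.map f).prod := by
  induction hp with
  | nil => intro K K' _ _ u w _ _ _ _; simp [koszulSign_eq_one]
  | cons x hp ih =>
    rename_i l₁ l₂
    intro K K' _ _ u w hu hw h1 h2
    rw [List.pairwise_cons] at h1 h2
    rw [List.map_cons, List.prod_cons, List.map_cons, List.prod_cons,
      ih (List.nodup_cons.1 hn).2 u w hu hw h1.2 h2.2, mul_smul_comm]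
    congr 1
    refine koszulSign_congr fun i j => ?_
    have e : ∀ s, s ≠ x → (s ∈ x :: l₁ ↔ s ∈ l₁) := by intro s hs; simp [hs]
    have hx : x ∉ l₁ := (List.nodup_cons.1 hn).1
    by_cases hi : i = x
    · subst hi
      simp only [hx, if_false]
      constructor
      · rintro ⟨h, -⟩; simp at h
      · rintro ⟨h, h', h'', h'''⟩
        by_cases hj : j ∈ i :: l₁
        · rcases List.mem_cons.1 hj with rfl | hj
          · exact absurd h'' (lt_irrefl _)
          · exact absurd h''' (h2.1 _ (hp.subset hj)).asymm
        · rw [if_neg hj] at h'; simp at h'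
    · by_cases hj : j = x
      · subst hj
        simp only [hx, if_false]
        constructor
        · rintro ⟨-, h, -⟩; simp at h
        · rintro ⟨h, h', h'', h'''⟩
          simp only [e i hi] at h
          by_cases hi : i ∈ l₁
          · exact absurd h'' (h1.1 _ hi).asymm
          · rw [if_neg hi] at h; simp at h
      · simp only [e i hi, e j hj]
  | swap x y l =>
    intro K K' _ _ u w hu hw h1 h2
    simp only [List.map_cons, List.prod_cons]
    rw [← mul_assoc, ← mul_assoc, hc _ _ _ (hf y) _ (hf x), smul_mul_assoc]
    congr 1
    have hxy : y ≠ x := by rintro rfl; simp at hn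
    rw [List.pairwise_cons, List.pairwise_cons] at h1 h2
    have key : ∀ i j, i ∈ y :: x :: l → j ∈ y :: x :: l → u i < u j → w j < w i → i = y ∧ j = x := by
      intro i j hi hj hij hji
      simp only [List.mem_cons] at hi hj h1 h2
      have a1 := fun s (hs : s ∈ l) => h1.1 s (Or.inr hs)
      have a2 := fun s (hs : s ∈ l) => h1.2.1 s hs
      have a3 := fun s (hs : s ∈ l) => h2.1 s (Or.inr hs)
      have a4 := fun s (hs : s ∈ l) => h2.2.1 s hs
      have b := h1.1 x (Or.inl rfl)
      have c := h2.1 y (Or.inl rfl)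
      rcases hi with rfl | rfl | hi <;> rcases hj with rfl | rfl | hj
      · exact absurd hij (lt_irrefl _)
      · exact ⟨rfl, rfl⟩
      · exact absurd hji (a4 _ hj).asymm
      · exact absurd hij b.asymm
      · exact absurd hij (lt_irrefl _)
      · exact absurd hji (a3 _ hj).asymm
      · exact absurd hij (a1 _ hi).asymm
      · exact absurd hij (a2 _ hi).asymm
      · exfalso
        let R := fun s t => u s < u t → w s < w t
        exact (List.Pairwise.forall_of_forall_of_flip (R := R) (fun s _ h => absurd h (lt_irrefl _))
          (List.Pairwise.imp (S := R) (fun h _ => h) h2.2.2)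
          (List.Pairwise.imp (S := flip R) (fun h h' => absurd h' h.asymm) h1.2.2) hi hj hij).asymm hji
    unfold koszulSign
    by_cases ho : Odd (d y) ∧ Odd (d x)
    · rw [if_pos ho]
      have : Nat.card {p : S × S // Odd (if p.1 ∈ y :: x :: l then d p.1 else 0) ∧
          Odd (if p.2 ∈ y :: x :: l then d p.2 else 0) ∧ u p.1 < u p.2 ∧ w p.2 < w p.1} = 1 := by
        rw [Nat.card_eq_one_iff_unique]
        refine ⟨⟨fun ⟨p, hp⟩ ⟨q, hq⟩ => ?_⟩, ⟨⟨(y, x), ?_⟩⟩⟩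
        · have aux : ∀ p : S × S, Odd (if p.1 ∈ y :: x :: l then d p.1 else 0) ∧
            Odd (if p.2 ∈ y :: x :: l then d p.2 else 0) ∧ u p.1 < u p.2 ∧ w p.2 < w p.1 →
            p = (y, x) := by
            rintro p ⟨q1, q2, q3, q4⟩
            have m1 : p.1 ∈ y :: x :: l := by by_contra h; rw [if_neg h] at q1; simp at q1
            have m2 : p.2 ∈ y :: x :: l := by by_contra h; rw [if_neg h] at q2; simp at q2
            have := key _ _ m1 m2 q3 q4
            exact Prod.ext this.1 this.2
          exact Subtype.ext ((aux p hp).trans (aux q hq).symm)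
        · simp only [List.mem_cons, true_or, or_true, if_true]
          exact ⟨ho.1, ho.2, h1.1 x (by simp), h2.1 y (by simp)⟩
      rw [this]; simp
    · rw [if_neg ho]
      have : IsEmpty {p : S × S // Odd (if p.1 ∈ y :: x :: l then d p.1 else 0) ∧
          Odd (if p.2 ∈ y :: x :: l then d p.2 else 0) ∧ u p.1 < u p.2 ∧ w p.2 < w p.1} := by
        refine ⟨fun ⟨p, q1, q2, q3, q4⟩ => ho ?_⟩
        have m1 : p.1 ∈ y :: x :: l := by by_contra h; rw [if_neg h] at q1; simp at q1
        have m2 : p.2 ∈ y :: x :: l := by by_contra h; rw [if_neg h] at q2; simp at q2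
        have := key _ _ m1 m2 q3 q4
        rw [if_pos m1] at q1
        rw [if_pos m2] at q2
        exact ⟨this.1 ▸ q1, this.2 ▸ q2⟩
      rw [Nat.card_of_isEmpty, pow_zero]
  | trans hp hq ih1 ih2 =>
    rename_i l₁ l₂ l₃
    intro K K' _ _ u w hu hw h1 h2
    obtain ⟨v, hv, hv2⟩ := exists_injective_sorted l₂ (hp.nodup_iff.1 hn)
    rw [ih1 hn u v hu hv h1 hv2, ih2 (hp.nodup_iff.1 hn) v w hv hw hv2 h2, smul_smul]
    have : (fun s => if s ∈ l₂ then d s else 0) = fun s => if s ∈ l₁ then d s else 0 := by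
      funext s; simp only [hp.mem_iff]
    rw [this, koszulSign_mul _ _ _ _ hu hv hw]

theorem list_prod_mem_graded [SetLike.GradedMonoid 𝒜] {S : Type*} (L : List S) (f : S → A)
    (d : S → ℤ) (hf : ∀ s ∈ L, f s ∈ 𝒜 (d s)) : (L.map f).prod ∈ 𝒜 (L.map d).sum :=
  SetLike.list_prod_map_mem_graded L d f hf

end GradedProducts


/-! ### Projections onto homogeneous components -/

section Grading

variable {𝕂 V : Type*} [Ring 𝕂] [AddCommGroup V] [Module 𝕂 V] [TopologicalSpace V]
  {𝒱 : ℤ → Submodule 𝕂 V} [DirectSum.Decomposition 𝒱]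

/-- The continuous projection onto a homogeneous component. -/
def IsTopologicalGrading.proj (h : IsTopologicalGrading 𝒱) (i : ℤ) : V →L[𝕂] V where
  toFun x := (DirectSum.decompose 𝒱 x i : V)
  map_add' x y := by simp [DirectSum.decompose_add]
  map_smul' c x := by simp only [DirectSum.decompose_smul]; rfl
  cont := h.2 i

/-- The degrees of the nonzero homogeneous components. -/
def IsTopologicalGrading.degrees (h : IsTopologicalGrading 𝒱) : Finset ℤ := h.1.toFinset

variable (h : IsTopologicalGrading 𝒱)
include h

theorem IsTopologicalGrading.proj_mem (i : ℤ) (x : V) : h.proj i x ∈ 𝒱 i :=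
  (DirectSum.decompose 𝒱 x i).2

theorem IsTopologicalGrading.proj_same {i : ℤ} {x : V} (hx : x ∈ 𝒱 i) : h.proj i x = x :=
  DirectSum.decompose_of_mem_same 𝒱 hx

theorem IsTopologicalGrading.proj_ne {i j : ℤ} {x : V} (hx : x ∈ 𝒱 i) (hij : i ≠ j) :
    h.proj j x = 0 :=
  DirectSum.decompose_of_mem_ne 𝒱 hx hij

theorem IsTopologicalGrading.eq_zero_of_notMem {i : ℤ} {x : V} (hx : x ∈ 𝒱 i)
    (hi : i ∉ h.degrees) : x = 0 := by
  simp only [degrees, Set.Finite.mem_toFinset, Set.mem_ofPred_eq, not_not] at hi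
  simpa [hi] using hx

theorem IsTopologicalGrading.sum_proj (x : V) : ∑ i ∈ h.degrees, h.proj i x = x := by
  classical
  conv_rhs => rw [← DirectSum.sum_support_decompose 𝒱 x]
  symm
  refine Finset.sum_subset (fun i hi => ?_) fun i _ hi => ?_
  · by_contra hn
    have := h.eq_zero_of_notMem (h.proj_mem i x) hn
    rw [DFinsupp.mem_support_toFun] at hi
    exact hi (Subtype.ext this)
  · rw [DFinsupp.notMem_support_iff] at hi
    change ((DirectSum.decompose 𝒱 x i : 𝒱 i) : V) = 0
    rw [hi]; rfl

theorem IsTopologicalGrading.isClosed [T2Space V] (i : ℤ) : IsClosed (𝒱 i : Set V) := by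
  have : (𝒱 i : Set V) = {x | h.proj i x = x} := by
    ext x
    exact ⟨fun hx => h.proj_same hx, fun hx => by
      rw [Set.mem_ofPred_eq] at hx; rw [← hx]; exact h.proj_mem i x⟩
  rw [this]
  exact isClosed_eq (h.proj i).continuous continuous_id

/-- Summing over all degrees, only the actual degrees contribute. -/
theorem IsTopologicalGrading.sum_degrees {ι M : Type*} [Fintype ι] [DecidableEq ι]
    [AddCommMonoid M] {x : ι → V} {d : ι → ℤ} (hx : ∀ i, x i ∈ 𝒱 (d i)) (G : (ι → ℤ) → M)
    (hG : ∀ d', (∃ i, h.proj (d' i) (x i) = 0) → G d' = 0) :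
    ∑ d' ∈ Fintype.piFinset (fun _ : ι => h.degrees), G d' = G d := by
  refine sum_eq_single d (fun d' _ hd => ?_) fun hd => ?_
  · obtain ⟨i, hi⟩ := Function.ne_iff.1 hd
    exact hG d' ⟨i, h.proj_ne (hx i) (Ne.symm hi)⟩
  · rw [Fintype.mem_piFinset] at hd
    push Not at hd
    obtain ⟨i, hi⟩ := hd
    exact hG d ⟨i, by rw [h.proj_same (hx i)]; exact h.eq_zero_of_notMem (hx i) hi⟩

theorem IsTopologicalGrading.multilinear_ext {ι M : Type*} [Finite ι] [AddCommMonoid M]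
    [Module 𝕂 M] {f g : MultilinearMap 𝕂 (fun _ : ι => V) M}
    (H : ∀ (d : ι → ℤ) (x : ι → V), (∀ i, x i ∈ 𝒱 (d i)) → f x = g x) : f = g := by
  classical
  have := Fintype.ofFinite ι
  ext x
  have hx : x = fun i => ∑ j ∈ h.degrees, h.proj j (x i) := by funext i; rw [h.sum_proj]
  rw [hx, MultilinearMap.map_sum_finset, MultilinearMap.map_sum_finset]
  exact sum_congr rfl fun d _ => H d _ fun i => h.proj_mem _ _

end Grading

/-! ### Koszul transport of functionals -/

section Transport

variable {𝕂 E A : Type*} [RCLike 𝕂] [AddCommGroup E] [Module 𝕂 E] [TopologicalSpace E]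
  [Ring A] [Algebra 𝕂 A] [TopologicalSpace A] [IsTopologicalRing A] [ContinuousConstSMul 𝕂 A]
  {ℰ : ℤ → Submodule 𝕂 E} [DirectSum.Decomposition ℰ] (hℰ : IsTopologicalGrading ℰ)

include hℰ in
theorem multi_ext {l : ℕ} {T T' : Multi 𝕂 E A l}
    (H : ∀ (d : Fin l → ℤ) (x : Fin l → E), (∀ i, x i ∈ ℰ (d i)) → T x = T' x) : T = T' :=
  ContinuousMultilinearMap.toMultilinearMap_injective (hℰ.multilinear_ext H)

/-- The Koszul transport of a functional along a bijection `e` of the slots: the slot `i` becomes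
the slot `e i`. -/
def transport {a b : ℕ} (e : Fin a ≃ Fin b) : Multi 𝕂 E A a →ₗ[𝕂] Multi 𝕂 E A b where
  toFun T := ∑ d ∈ Fintype.piFinset fun _ : Fin b => hℰ.degrees,
    koszulSign (id : Fin b → Fin b) e.symm d •
      (T.compContinuousLinearMap fun i => hℰ.proj (d (e i))).domDomCongr e
  map_add' T T' := by
    rw [← sum_add_distrib]
    refine sum_congr rfl fun d _ => ?_
    ext x
    exact smul_add _ _ _
  map_smul' c T := by
    rw [RingHom.id_apply, smul_sum]
    refine sum_congr rfl fun d _ => ?_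
    ext x
    exact smul_comm _ _ _

theorem transport_apply {a b : ℕ} (e : Fin a ≃ Fin b) (T : Multi 𝕂 E A a) {d : Fin b → ℤ}
    {x : Fin b → E} (hx : ∀ i, x i ∈ ℰ (d i)) :
    transport hℰ e T x = koszulSign (id : Fin b → Fin b) e.symm d • T fun i => x (e i) := by
  change (∑ d ∈ Fintype.piFinset fun _ : Fin b => hℰ.degrees,
    koszulSign (id : Fin b → Fin b) e.symm d •
      (T.compContinuousLinearMap fun i => hℰ.proj (d (e i))).domDomCongr e) x = _
  rw [_root_.sum_apply, hℰ.sum_degrees hx]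
  · change koszulSign (id : Fin b → Fin b) e.symm d • T (fun i => hℰ.proj (d (e i)) (x (e i))) = _
    congr 2
    funext i
    exact hℰ.proj_same (hx _)
  · rintro d' ⟨i, hi⟩
    change koszulSign (id : Fin b → Fin b) e.symm d' •
      T (fun i => hℰ.proj (d' (e i)) (x (e i))) = _
    rw [T.map_coord_zero (e.symm i) (by simpa using hi), smul_zero]

theorem transport_trans {a b c : ℕ} (e : Fin a ≃ Fin b) (f : Fin b ≃ Fin c)
    (T : Multi 𝕂 E A a) : transport hℰ f (transport hℰ e T) = transport hℰ (e.trans f) T := by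
  refine multi_ext hℰ fun d x hx => ?_
  rw [transport_apply hℰ f _ hx, transport_apply hℰ e _ (d := fun i => d (f i))
    (fun i => hx _), transport_apply hℰ _ _ hx, smul_smul]
  congr 1
  rw [← koszulSign_mul id f.symm (e.trans f).symm d injective_id f.symm.injective
    (Equiv.injective _)]
  congr 1
  rw [← koszulSign_comp_equiv f f.symm (e.trans f).symm d]
  congr 1
  · funext i; simp
  · funext i; simp

theorem transport_refl {a : ℕ} (T : Multi 𝕂 E A a) : transport hℰ (Equiv.refl _) T = T := by
  refine multi_ext hℰ fun d x hx => ?_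
  rw [transport_apply hℰ _ _ hx, koszulSign_eq_one, one_smul]
  · rfl
  · intro i j _ _ h; exact h.asymm

theorem isTransport_iff {l : ℕ} (ρ : Perm (Fin l)) (T T' : Multi 𝕂 E A l) :
    IsTransport ℰ ρ T T' ↔ T' = transport hℰ ρ T := by
  constructor
  · intro h
    refine multi_ext hℰ fun d x hx => ?_
    rw [transport_apply hℰ _ _ hx]
    exact h d fun i => ⟨x i, hx i⟩
  · rintro rfl d x
    rw [transport_apply hℰ _ _ fun i => (x i).2]

end Transport


/-! ### Continuous trilinear maps and the completed projective tensor product -/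

section Analysis

open Filter Topology

/-- A map that is linear in each of its three arguments. -/
structure IsTrilinear (𝕂 : Type*) {E A B : Type*} [Semiring 𝕂] [AddCommMonoid E] [Module 𝕂 E]
    [AddCommMonoid A] [Module 𝕂 A] [AddCommMonoid B] [Module 𝕂 B] (f : E → E → A → B) :
    Prop where
  left : ∀ q a, IsLinearMap 𝕂 fun p => f p q a
  middle : ∀ p a, IsLinearMap 𝕂 fun q => f p q a
  right : ∀ p q, IsLinearMap 𝕂 fun a => f p q a

section Polynormable

variable {𝕂 V : Type*} [RCLike 𝕂] [AddCommGroup V] [Module 𝕂 V] [TopologicalSpace V]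
  [IsTopologicalAddGroup V] [ContinuousSMul 𝕂 V] [PolynormableSpace 𝕂 V]

variable (𝕂) in
theorem exists_seminorm_ball_subset {U : Set V} (hU : U ∈ 𝓝 (0 : V)) :
    ∃ p : Seminorm 𝕂 V, Continuous p ∧ ∀ x, p x < 1 → x ∈ U := by
  obtain ⟨⟨s, r⟩, hr, hs⟩ := (PolynormableSpace.withSeminorms 𝕂 V).hasBasis_zero_ball.mem_iff.1 hU
  have hr : 0 < r := hr
  let P : Seminorm 𝕂 V := s.sup fun p => p.1
  have hP : Continuous P := Seminorm.continuous_finsetSup fun p _ => p.2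
  refine ⟨Real.toNNReal r⁻¹ • P, hP.const_smul _, fun x hx => hs ?_⟩
  rw [Seminorm.mem_ball_zero]
  change (Real.toNNReal r⁻¹ : ℝ) * P x < 1 at hx
  rw [Real.coe_toNNReal _ (inv_nonneg.2 hr.le)] at hx
  rwa [inv_mul_lt_iff₀ hr, mul_one] at hx

variable (𝕂) in
theorem tendsto_iff_seminorm {X : Type*} {l : Filter X} {u : X → V} {v : V} :
    Tendsto u l (𝓝 v) ↔ ∀ p : Seminorm 𝕂 V, Continuous p → ∀ ε > 0, ∀ᶠ x in l, p (u x - v) < ε := by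
  rw [(PolynormableSpace.withSeminorms 𝕂 V).tendsto_nhds]
  exact ⟨fun h p hp => h ⟨p, hp⟩, fun h p => h p.1 p.2⟩

end Polynormable

variable {𝕂 E A : Type*} [RCLike 𝕂] [AddCommGroup E] [Module 𝕂 E] [TopologicalSpace E]
  [IsTopologicalAddGroup E] [ContinuousSMul 𝕂 E] [PolynormableSpace 𝕂 E]
  [AddCommGroup A] [Module 𝕂 A] [TopologicalSpace A]
  [IsTopologicalAddGroup A] [ContinuousSMul 𝕂 A] [PolynormableSpace 𝕂 A]

theorem ProjTensor.induction {C : ProjTensor 𝕂 E A → Prop} (h0 : C 0)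
    (hp : ∀ p q a, C (ProjTensor.pure 𝕂 E A p q a)) (ha : ∀ x y, C x → C y → C (x + y))
    (t : ProjTensor 𝕂 E A) : C t := by
  refine TensorProduct.induction_on (motive := C) t h0 (fun x a => ?_) ha
  refine TensorProduct.induction_on (motive := fun x => C (x ⊗ₜ[𝕂] a)) x ?_ (fun p q => hp p q a) ?_
  · rw [TensorProduct.zero_tmul]; exact h0
  · intro x y hx hy; rw [TensorProduct.add_tmul]; exact ha _ _ hx hy

theorem ProjTensor.continuous_pure : Continuous fun z : E × E × A =>
    ProjTensor.pure 𝕂 E A z.1 z.2.1 z.2.2 :=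
  continuous_sInf_rng.2 fun _ ht => ht.2.2.2

theorem ProjTensor.pure_trilinear :
    IsTrilinear 𝕂 (ProjTensor.pure 𝕂 E A) where
  left q a := ⟨fun x y => by simp only [ProjTensor.pure, TensorProduct.add_tmul]; rfl,
    fun c x => by simp only [ProjTensor.pure]; rfl⟩
  middle p a := ⟨fun x y => by
      simp only [ProjTensor.pure, TensorProduct.add_tmul, TensorProduct.tmul_add]; rfl,
    fun c x => by
      simp only [ProjTensor.pure, TensorProduct.tmul_smul]
      exact (TensorProduct.smul_tmul' c (p ⊗ₜ[𝕂] x) a).symm⟩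
  right p q := ⟨fun x y => by simp only [ProjTensor.pure, TensorProduct.tmul_add]; rfl,
    fun c x => by simp only [ProjTensor.pure, TensorProduct.tmul_smul]; rfl⟩

/-- A seminorm on `E ⊗ E ⊗ A` which is bounded on decomposable tensors by continuous seminorms is
continuous. -/
theorem ProjTensor.continuous_seminorm (π : Seminorm 𝕂 (ProjTensor 𝕂 E A)) (P Q : Seminorm 𝕂 E)
    (R : Seminorm 𝕂 A) (hP : Continuous P) (hQ : Continuous Q) (hR : Continuous R)
    (h : ∀ p q a, π (ProjTensor.pure 𝕂 E A p q a) ≤ P p * Q q * R a) : Continuous π := by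
  let fam : SeminormFamily 𝕂 (ProjTensor 𝕂 E A) Unit := fun _ => π
  let t : TopologicalSpace (ProjTensor 𝕂 E A) := fam.moduleFilterBasis.topology
  have hw : @WithSeminorms _ _ _ _ _ _ fam t := @WithSeminorms.mk _ _ _ _ _ _ fam t rfl
  have hadm : t ∈ ProjTensor.admissible 𝕂 E A := by
    refine ⟨@WithSeminorms.topologicalAddGroup _ _ _ _ _ _ t fam hw,
      @WithSeminorms.continuousSMul _ _ _ _ _ _ t fam hw,
      @WithSeminorms.toPolynormableSpace _ _ _ _ _ _ t fam hw, ?_⟩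
    rw [@continuous_iff_continuousAt]
    rintro ⟨p, q, a⟩
    unfold ContinuousAt
    rw [@WithSeminorms.tendsto_nhds _ _ _ _ _ _ _ t fam hw]
    rintro - ε hε
    have hb : ∀ z : E × E × A, π (ProjTensor.pure 𝕂 E A z.1 z.2.1 z.2.2 -
        ProjTensor.pure 𝕂 E A p q a) ≤
        P (z.1 - p) * Q z.2.1 * R z.2.2 + P p * Q (z.2.1 - q) * R z.2.2 +
          P p * Q q * R (z.2.2 - a) := by
      rintro ⟨p', q', a'⟩
      have e : ProjTensor.pure 𝕂 E A p' q' a' - ProjTensor.pure 𝕂 E A p q a =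
          ProjTensor.pure 𝕂 E A (p' - p) q' a' + ProjTensor.pure 𝕂 E A p (q' - q) a' +
          ProjTensor.pure 𝕂 E A p q (a' - a) := by
        rw [(ProjTensor.pure_trilinear.left q' a').map_sub, (ProjTensor.pure_trilinear.middle p
          a').map_sub, (ProjTensor.pure_trilinear.right p q).map_sub]
        abel
      rw [e]
      exact (map_add_le_add _ _ _).trans (add_le_add ((map_add_le_add _ _ _).trans
        (add_le_add (h _ _ _) (h _ _ _))) (h _ _ _))
    have hc : Tendsto (fun z : E × E × A => P (z.1 - p) * Q z.2.1 * R z.2.2 +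
        P p * Q (z.2.1 - q) * R z.2.2 + P p * Q q * R (z.2.2 - a)) (𝓝 (p, q, a)) (𝓝 0) := by
      have : Continuous (fun z : E × E × A => P (z.1 - p) * Q z.2.1 * R z.2.2 +
        P p * Q (z.2.1 - q) * R z.2.2 + P p * Q q * R (z.2.2 - a)) := by fun_prop
      convert this.tendsto (p, q, a) using 2
      simp
    filter_upwards [hc.eventually (gt_mem_nhds hε)] with z hz
    exact (hb z).trans_lt hz
  have h1 : @Continuous _ _ t _ π := @WithSeminorms.continuous_seminorm _ _ _ _ _ _ t fam hw ()
  exact continuous_le_dom (sInf_le hadm) h1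

end Analysis

section Extension

open Filter Topology

variable {𝕂 E A B : Type*} [RCLike 𝕂] [AddCommGroup E] [Module 𝕂 E] [TopologicalSpace E]
  [IsTopologicalAddGroup E] [ContinuousSMul 𝕂 E] [PolynormableSpace 𝕂 E]
  [AddCommGroup A] [Module 𝕂 A] [TopologicalSpace A]
  [IsTopologicalAddGroup A] [ContinuousSMul 𝕂 A] [PolynormableSpace 𝕂 A]
  [AddCommGroup B] [Module 𝕂 B] [UniformSpace B]
  [IsUniformAddGroup B] [ContinuousSMul 𝕂 B] [PolynormableSpace 𝕂 B]

/-- The linear map on `E ⊗ E ⊗ A` defined by a trilinear map. -/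
def IsTrilinear.lift {f : E → E → A → B} (h : IsTrilinear 𝕂 f) : ProjTensor 𝕂 E A →ₗ[𝕂] B :=
  TensorProduct.lift (TensorProduct.lift (LinearMap.mk₂ 𝕂
    (fun p q => (IsLinearMap.mk' (f p q) (h.right p q) : A →ₗ[𝕂] B))
    (fun p p' q => LinearMap.ext fun a => (h.left q a).map_add p p')
    (fun c p q => LinearMap.ext fun a => (h.left q a).map_smul c p)
    (fun p q q' => LinearMap.ext fun a => (h.middle p a).map_add q q')
    (fun c p q => LinearMap.ext fun a => (h.middle p a).map_smul c q)))

theorem IsTrilinear.lift_pure {f : E → E → A → B} (h : IsTrilinear 𝕂 f) (p q : E) (a : A) :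
    h.lift (ProjTensor.pure 𝕂 E A p q a) = f p q a := by
  rfl

theorem Tensor3.dense_coe : DenseRange ((↑) : ProjTensor 𝕂 E A → Tensor3 𝕂 E A) :=
  UniformSpace.Completion.denseRange_coe

variable [T2Space B]

theorem Tensor3.ext_of_pure {f g : Tensor3 𝕂 E A → B} (hf : IsLinearMap 𝕂 f)
    (hg : IsLinearMap 𝕂 g) (hfc : Continuous f) (hgc : Continuous g)
    (h : ∀ p q a, f (Tensor3.pure 𝕂 E A p q a) = g (Tensor3.pure 𝕂 E A p q a)) : f = g := by
  refine Tensor3.dense_coe.equalizer hfc hgc (funext fun t => ?_)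
  refine ProjTensor.induction (C := fun t => f (t : Tensor3 𝕂 E A) = g t) ?_ (fun p q a => h p q a)
    ?_ t
  · rw [UniformSpace.Completion.coe_zero, hf.map_zero, hg.map_zero]
  · intro x y hx hy
    rw [UniformSpace.Completion.coe_add, hf.map_add, hg.map_add, hx, hy]

/-- The inclusion of `E ⊗ E ⊗ A` in its completion. -/
def Tensor3.coeL : ProjTensor 𝕂 E A →L[𝕂] Tensor3 𝕂 E A where
  toFun := (↑)
  map_add' := UniformSpace.Completion.coe_add
  map_smul' c x := UniformSpace.Completion.coe_smul c x
  cont := UniformSpace.Completion.continuous_coe _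

theorem _root_.Seminorm.apply_inv_add_smul_lt_one {V : Type*} [AddCommGroup V] [Module 𝕂 V]
    (S : Seminorm 𝕂 V) (v : V) {ε : ℝ} (hε : 0 < ε) : S (((S v + ε : ℝ) : 𝕂)⁻¹ • v) < 1 := by
  have hp : 0 < S v + ε := add_pos_of_nonneg_of_pos (apply_nonneg S v) hε
  rw [map_smul_eq_mul, norm_inv, RCLike.norm_ofReal, abs_of_pos hp, inv_mul_lt_iff₀ hp]
  linarith

theorem exists_trilinear_bound {Z : Type*} [TopologicalSpace Z] {f : Z → E → E → A → B}
    (hf : ∀ z, IsTrilinear 𝕂 (f z))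
    (hc : Continuous fun w : Z × E × E × A => f w.1 w.2.1 w.2.2.1 w.2.2.2)
    (z₀ : Z) (s : Seminorm 𝕂 B) (hs : Continuous s) :
    ∃ U ∈ 𝓝 z₀, ∃ (P Q : Seminorm 𝕂 E) (R : Seminorm 𝕂 A), Continuous P ∧ Continuous Q ∧
      Continuous R ∧ ∀ z ∈ U, ∀ p q a, s (f z p q a) ≤ P p * Q q * R a := by
  have h0 : {w : Z × E × E × A | s (f w.1 w.2.1 w.2.2.1 w.2.2.2) < 1} ∈ 𝓝 (z₀, (0 : E), (0 : E), (0 : A)) := by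
    refine (hs.comp hc).continuousAt.eventually (gt_mem_nhds ?_)
    simp [(hf z₀).left 0 0 |>.map_zero]
  rw [nhds_prod_eq, nhds_prod_eq, nhds_prod_eq] at h0
  obtain ⟨U, hU, V', hV', h1⟩ := mem_prod_iff.1 h0
  obtain ⟨V, hV, W', hW', h2⟩ := mem_prod_iff.1 hV'
  obtain ⟨W, hW, X, hX, h3⟩ := mem_prod_iff.1 hW'
  obtain ⟨P, hP, hP'⟩ := exists_seminorm_ball_subset 𝕂 hV
  obtain ⟨Q, hQ, hQ'⟩ := exists_seminorm_ball_subset 𝕂 hW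
  obtain ⟨R, hR, hR'⟩ := exists_seminorm_ball_subset 𝕂 hX
  refine ⟨U, hU, P, Q, R, hP, hQ, hR, fun z hz p q a => ?_⟩
  have key : ∀ ε : ℝ, 0 < ε → s (f z p q a) ≤ (P p + ε) * (Q q + ε) * (R a + ε) := by
    intro ε hε
    have hp : 0 < P p + ε := add_pos_of_nonneg_of_pos (apply_nonneg P p) hε
    have hq : 0 < Q q + ε := add_pos_of_nonneg_of_pos (apply_nonneg Q q) hε
    have hr : 0 < R a + ε := add_pos_of_nonneg_of_pos (apply_nonneg R a) hε
    have h4 : s (f z (((P p + ε : ℝ) : 𝕂)⁻¹ • p) (((Q q + ε : ℝ) : 𝕂)⁻¹ • q)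
        (((R a + ε : ℝ) : 𝕂)⁻¹ • a)) < 1 :=
      h1 (Set.mk_mem_prod hz (h2 (Set.mk_mem_prod (hP' _ (P.apply_inv_add_smul_lt_one p hε))
        (h3 (Set.mk_mem_prod (hQ' _ (Q.apply_inv_add_smul_lt_one q hε)) (hR' _ (R.apply_inv_add_smul_lt_one a hε)))))))
    rw [((hf z).left _ _).map_smul, ((hf z).middle _ _).map_smul, ((hf z).right _ _).map_smul,
      map_smul_eq_mul, map_smul_eq_mul, map_smul_eq_mul, norm_inv, norm_inv, norm_inv,
      RCLike.norm_ofReal, RCLike.norm_ofReal, RCLike.norm_ofReal, abs_of_pos hp, abs_of_pos hq,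
      abs_of_pos hr, inv_mul_lt_iff₀ hp, inv_mul_lt_iff₀ hq, inv_mul_lt_iff₀ hr] at h4
    nlinarith [h4]
  have hlim : Tendsto (fun ε : ℝ => (P p + ε) * (Q q + ε) * (R a + ε)) (𝓝[>] 0)
      (𝓝 (P p * Q q * R a)) := by
    have : Continuous fun ε : ℝ => (P p + ε) * (Q q + ε) * (R a + ε) := by fun_prop
    have h5 := this.tendsto 0
    simp only [add_zero] at h5
    exact h5.mono_left nhdsWithin_le_nhds
  refine ge_of_tendsto hlim ?_
  filter_upwards [self_mem_nhdsWithin] with ε hε using key ε hε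

/-- A continuous family of trilinear maps is locally equicontinuous on `E ⊗ E ⊗ A`. -/
theorem exists_lift_bound {Z : Type*} [TopologicalSpace Z] {f : Z → E → E → A → B}
    (hf : ∀ z, IsTrilinear 𝕂 (f z))
    (hc : Continuous fun w : Z × E × E × A => f w.1 w.2.1 w.2.2.1 w.2.2.2) (z₀ : Z)
    (s : Seminorm 𝕂 B) (hs : Continuous s) : ∃ U ∈ 𝓝 z₀, ∃ π : Seminorm 𝕂 (ProjTensor 𝕂 E A),
    Continuous π ∧ ∀ z ∈ U, ∀ t, s ((hf z).lift t) ≤ π t := by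
  obtain ⟨U, hU, P, Q, R, hP, hQ, hR, hb⟩ := exists_trilinear_bound hf hc z₀ s hs
  let fam : U → Seminorm 𝕂 (ProjTensor 𝕂 E A) := fun z => s.comp (hf z).lift
  have hbdd : BddAbove (Set.range fam) := by
    rw [Seminorm.bddAbove_range_iff]
    intro t
    refine ProjTensor.induction (C := fun t => BddAbove (Set.range fun z => fam z t)) ?_ ?_ ?_ t
    · refine ⟨0, ?_⟩
      rintro _ ⟨z, rfl⟩
      simp
    · intro p q a
      refine ⟨P p * Q q * R a, ?_⟩
      rintro _ ⟨z, rfl⟩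
      change s ((hf z).lift _) ≤ _
      rw [(hf z).lift_pure]
      exact hb z z.2 p q a
    · rintro x y ⟨cx, hx⟩ ⟨cy, hy⟩
      refine ⟨cx + cy, ?_⟩
      rintro _ ⟨z, rfl⟩
      exact (map_add_le_add _ _ _).trans (add_le_add (hx ⟨z, rfl⟩) (hy ⟨z, rfl⟩))
  have hne : Nonempty U := ⟨⟨z₀, mem_of_mem_nhds hU⟩⟩
  have happ : ∀ z ∈ U, ∀ t, s ((hf z).lift t) ≤ (⨆ z, fam z) t := by
    intro z hz t
    rw [Seminorm.iSup_apply hbdd]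
    exact le_ciSup (Seminorm.bddAbove_range_iff.1 hbdd t) (⟨z, hz⟩ : U)
  refine ⟨U, hU, ⨆ z, fam z, ?_, happ⟩
  refine ProjTensor.continuous_seminorm _ P Q R hP hQ hR fun p q a => ?_
  rw [Seminorm.iSup_apply hbdd]
  refine ciSup_le fun z => ?_
  change s ((hf z).lift _) ≤ _
  rw [(hf z).lift_pure]
  exact hb z z.2 p q a

variable [CompleteSpace B]

/-- Universal property of `E ⊗̂ E ⊗̂ A` with parameters. -/
theorem exists_extension {Z : Type*} [TopologicalSpace Z] {f : Z → E → E → A → B}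
    (hf : ∀ z, IsTrilinear 𝕂 (f z))
    (hc : Continuous fun w : Z × E × E × A => f w.1 w.2.1 w.2.2.1 w.2.2.2) :
    ∃ C : Z → Tensor3 𝕂 E A →L[𝕂] B, (∀ z p q a, C z (Tensor3.pure 𝕂 E A p q a) = f z p q a) ∧
      Continuous fun w : Z × Tensor3 𝕂 E A => C w.1 w.2 := by
  have hcont : ∀ z, Continuous (hf z).lift := by
    intro z
    refine continuous_of_continuousAt_zero (hf z).lift ?_
    unfold ContinuousAt
    rw [map_zero, tendsto_iff_seminorm 𝕂]
    intro s hs ε hε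
    obtain ⟨U, hU, π, hπ, hb⟩ := exists_lift_bound hf hc z s hs
    have h1 : ∀ᶠ t in 𝓝 (0 : ProjTensor 𝕂 E A), π t < ε :=
      hπ.continuousAt.eventually (gt_mem_nhds (by simpa using hε))
    filter_upwards [h1] with t ht
    rw [sub_zero]
    exact (hb z (mem_of_mem_nhds hU) t).trans_lt ht
  let L : Z → ProjTensor 𝕂 E A →L[𝕂] B := fun z => ⟨(hf z).lift, hcont z⟩
  have hui : IsUniformInducing (Tensor3.coeL : ProjTensor 𝕂 E A →L[𝕂] Tensor3 𝕂 E A) :=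
    UniformSpace.Completion.isUniformInducing_coe _
  have hdr : DenseRange (Tensor3.coeL : ProjTensor 𝕂 E A →L[𝕂] Tensor3 𝕂 E A) := Tensor3.dense_coe
  let C : Z → Tensor3 𝕂 E A →L[𝕂] B := fun z => (L z).extend Tensor3.coeL
  have hC : ∀ z (t : ProjTensor 𝕂 E A), C z t = (hf z).lift t := fun z t =>
    (L z).extend_eq hdr hui t
  refine ⟨C, fun z p q a => (hC z _).trans ((hf z).lift_pure p q a), ?_⟩
  have hfin : ∀ t : ProjTensor 𝕂 E A, Continuous fun z => (hf z).lift t := by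
    intro t
    refine ProjTensor.induction (C := fun t => Continuous fun z => (hf z).lift t) ?_ ?_ ?_ t
    · simpa using continuous_const
    · intro p q a
      simp_rw [IsTrilinear.lift_pure]
      exact hc.comp (by fun_prop : Continuous fun z => (z, p, q, a))
    · intro x y hx hy
      simp_rw [map_add]
      exact hx.add hy
  rw [continuous_iff_continuousAt]
  rintro ⟨z₀, t₀⟩
  unfold ContinuousAt
  rw [tendsto_iff_seminorm 𝕂]
  intro s hs ε hε
  obtain ⟨U, hU, π, hπ, hb⟩ := exists_lift_bound hf hc z₀ s hs
  let O : Set (Tensor3 𝕂 E A) := (↑) '' {t : ProjTensor 𝕂 E A | π t < ε / 5}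
  have hO : closure O ∈
      𝓝 (0 : Tensor3 𝕂 E A) := by
    have := (hui.isDenseInducing hdr).closure_image_mem_nhds
      (s := {t : ProjTensor 𝕂 E A | π t < ε / 5}) (a := 0)
      (hπ.continuousAt.eventually (gt_mem_nhds (by simpa using (by linarith : 0 < ε / 5))))
    rwa [map_zero] at this
  have hO' : ∀ z ∈ U, ∀ t ∈ closure O, s (C z t) ≤ ε / 5 := by
    intro z hz t ht
    refine closure_minimal (s := O)
      (t := {t | s (C z t) ≤ ε / 5}) ?_ ?_ ht
    · rintro _ ⟨t, ht, rfl⟩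
      change s (C z t) ≤ _
      rw [hC]
      exact (hb z hz t).trans (le_of_lt ht)
    · exact isClosed_le (hs.comp (C z).continuous) continuous_const
  obtain ⟨t₁, ht₁⟩ : ∃ t₁ : ProjTensor 𝕂 E A, t₀ - t₁ ∈
      closure O := by
    have h1 : (fun x => t₀ - x) ⁻¹' closure O ∈ 𝓝 t₀ :=
      (continuous_const.sub continuous_id).continuousAt.preimage_mem_nhds (by simpa using hO)
    obtain ⟨x, hx⟩ := (Tensor3.dense_coe (𝕂 := 𝕂) (E := E) (A := A)).inter_nhds_nonempty h1
    obtain ⟨⟨t₁, rfl⟩, hx2⟩ := hx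
    exact ⟨t₁, hx2⟩
  have e1 : ∀ᶠ z in 𝓝 z₀, z ∈ U ∧ s ((hf z).lift t₁ - (hf z₀).lift t₁) < ε / 5 := by
    refine (eventually_mem_set.2 hU).and ?_
    exact (tendsto_iff_seminorm 𝕂).1 ((hfin t₁).tendsto z₀) s hs _ (by linarith)
  have e2 : ∀ᶠ t in 𝓝 t₀, t - t₀ ∈ closure O :=
    (continuous_id.sub continuous_const).continuousAt.preimage_mem_nhds (by simpa using hO)
  rw [nhds_prod_eq]
  filter_upwards [e1.prod_mk e2] with w hw
  obtain ⟨⟨hz, hz'⟩, ht⟩ := hw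
  have : C w.1 w.2 - C z₀ t₀ = C w.1 (w.2 - t₀) + C w.1 (t₀ - t₁) +
      ((hf w.1).lift t₁ - (hf z₀).lift t₁) - C z₀ (t₀ - t₁) := by
    rw [map_sub, map_sub, map_sub, hC, hC]; abel
  change s (C w.1 w.2 - C z₀ t₀) < ε
  rw [this]
  have a1 := map_sub_le_add s (C w.1 (w.2 - t₀) + C w.1 (t₀ - t₁) +
      ((hf w.1).lift t₁ - (hf z₀).lift t₁)) (C z₀ (t₀ - t₁))
  have a2 := map_add_le_add s (C w.1 (w.2 - t₀) + C w.1 (t₀ - t₁))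
    ((hf w.1).lift t₁ - (hf z₀).lift t₁)
  have a3 := map_add_le_add s (C w.1 (w.2 - t₀)) (C w.1 (t₀ - t₁))
  have a4 := hO' _ hz _ ht
  have a5 := hO' _ hz _ ht₁
  have a6 := hO' _ (mem_of_mem_nhds hU) _ ht₁
  linarith


/-! ### Extension of multilinear maps in several propagator slots -/

theorem Tensor3.clm_ext {f g : Tensor3 𝕂 E A →L[𝕂] B}
    (h : ∀ p q a, f (Tensor3.pure 𝕂 E A p q a) = g (Tensor3.pure 𝕂 E A p q a)) : f = g :=
  ContinuousLinearMap.ext fun t => congrFun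
    (Tensor3.ext_of_pure f.toLinearMap.isLinear g.toLinearMap.isLinear f.continuous g.continuous h) t

/-- Linearity in a parameter can be tested on decomposable tensors. -/
theorem isLinearMap_of_pure {X : Type*} [AddCommGroup X] [Module 𝕂 X]
    {D : X → Tensor3 𝕂 E A →L[𝕂] B}
    (h : ∀ p q a, IsLinearMap 𝕂 fun x => D x (Tensor3.pure 𝕂 E A p q a)) (t : Tensor3 𝕂 E A) :
    IsLinearMap 𝕂 fun x => D x t where
  map_add x y := by
    have : D (x + y) = D x + D y := Tensor3.clm_ext fun p q a => (h p q a).map_add x y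
    rw [this]; rfl
  map_smul c x := by
    have : D (c • x) = c • D x := Tensor3.clm_ext fun p q a => (h p q a).map_smul c x
    rw [this]; rfl

theorem exists_partial_extension {S Z : Type*} [DecidableEq S] [TopologicalSpace Z]
    {N : Z → (S → E × E × A) → B}
    (hN : ∀ z w s, IsTrilinear 𝕂 fun p q a => N z (update w s (p, q, a)))
    (hc : Continuous fun x : Z × (S → E × E × A) => N x.1 x.2) (R : Finset S) :
    ∃ G : Z → (S → E × E × A) → (S → Tensor3 𝕂 E A) → B,
      (Continuous fun x : Z × (S → E × E × A) × (S → Tensor3 𝕂 E A) => G x.1 x.2.1 x.2.2) ∧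
      (∀ z w t, ∀ s ∉ R, IsTrilinear 𝕂 fun p q a => G z (update w s (p, q, a)) t) ∧
      (∀ z w t, ∀ s ∈ R, IsLinearMap 𝕂 fun τ => G z w (update t s τ)) ∧
      (∀ z w t t', (∀ s ∈ R, t s = t' s) → G z w t = G z w t') ∧
      (∀ z w w' t, (∀ s ∉ R, w s = w' s) → G z w t = G z w' t) ∧
      (∀ z w t, (∀ s ∈ R, t s = Tensor3.pure 𝕂 E A (w s).1 (w s).2.1 (w s).2.2) →
        G z w t = N z w) := by
  induction R using Finset.induction_on with
  | empty =>
    refine ⟨fun z w _ => N z w, hc.comp (by fun_prop : Continuous fun x : Z × (S → E × E × A) ×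
      (S → Tensor3 𝕂 E A) => (x.1, x.2.1)), fun z w t s _ => hN z w s, by simp, by simp, ?_, by simp⟩
    intro z w w' t h
    simp only [Finset.notMem_empty, not_false_eq_true, forall_const] at h
    rw [funext h]
  | insert s₀ R hs₀ ih =>
    obtain ⟨G, h1, h2, h3, h4, h5, h6⟩ := ih
    obtain ⟨C, hC, hCc⟩ := exists_extension (𝕂 := 𝕂) (E := E) (A := A) (B := B)
      (Z := Z × (S → E × E × A) × (S → Tensor3 𝕂 E A))
      (f := fun x p q a => G x.1 (update x.2.1 s₀ (p, q, a)) x.2.2)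
      (fun x => h2 _ _ _ _ hs₀)
      (by
        refine h1.comp (f := fun w : (Z × (S → E × E × A) × (S → Tensor3 𝕂 E A)) × E × E × A =>
          (w.1.1, update w.1.2.1 s₀ (w.2.1, w.2.2.1, w.2.2.2), w.1.2.2)) ?_
        refine (continuous_fst.comp continuous_fst).prodMk (Continuous.prodMk ?_ (by fun_prop))
        exact (by fun_prop : Continuous fun w : (Z × (S → E × E × A) × (S → Tensor3 𝕂 E A)) ×
          E × E × A => w.1.2.1).update s₀ (by fun_prop))
    have hw : ∀ z w w' t, (∀ s ∉ insert s₀ R, w s = w' s) → C (z, w, t) = C (z, w', t) := by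
      intro z w w' t h
      refine Tensor3.clm_ext fun p q a => ?_
      rw [hC, hC]
      refine h5 _ _ _ _ fun s hs => ?_
      by_cases hss : s = s₀
      · subst hss; simp
      · rw [update_of_ne hss, update_of_ne hss]
        exact h s (by simp [hss, hs])
    have ht : ∀ z w t t', (∀ s ∈ R, t s = t' s) → C (z, w, t) = C (z, w, t') := by
      intro z w t t' h
      refine Tensor3.clm_ext fun p q a => ?_
      rw [hC, hC]
      exact h4 _ _ _ _ h
    refine ⟨fun z w t => C (z, w, t) (t s₀), ?_, ?_, ?_, ?_, ?_, ?_⟩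
    · exact hCc.comp (by fun_prop : Continuous fun x : Z × (S → E × E × A) ×
        (S → Tensor3 𝕂 E A) => ((x.1, x.2.1, x.2.2), x.2.2 s₀))
    · intro z w t s hs
      simp only [Finset.mem_insert, not_or] at hs
      refine ⟨fun q a => ?_, fun p a => ?_, fun p q => ?_⟩ <;>
        refine isLinearMap_of_pure (D := fun x => C (z, update w s _, t)) ?_ _ <;>
        intro p' q' a' <;> simp only [hC] <;> simp_rw [Function.update_comm hs.1]
      · exact (h2 z _ t s hs.2).left q a
      · exact (h2 z _ t s hs.2).middle p a
      · exact (h2 z _ t s hs.2).right p q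
    · intro z w t s hs
      by_cases hss : s = s₀
      · subst hss
        have : (fun τ => C (z, w, update t s τ) (update t s τ s)) =
            fun τ => C (z, w, t) τ := by
          funext τ
          rw [update_self, ht z w _ t]
          intro s' hs'
          rw [update_of_ne (by rintro rfl; exact hs₀ hs')]
        rw [this]
        exact (C (z, w, t)).toLinearMap.isLinear
      · simp_rw [update_of_ne (Ne.symm hss)]
        refine isLinearMap_of_pure (D := fun x => C (z, w, update t s x)) ?_ _
        intro p' q' a'
        simp only [hC]
        exact h3 _ _ _ _ (by simpa [hss] using hs)
    · intro z w t t' h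
      dsimp only
      rw [h s₀ (by simp), ht z w t t' fun s hs => h s (by simp [hs])]
    · intro z w w' t h
      dsimp only
      rw [hw z w w' t h]
    · intro z w t h
      dsimp only
      rw [h s₀ (by simp), hC]
      simp only [Prod.mk.eta, Function.update_eq_self]
      exact h6 z w t fun s hs => h s (by simp [hs])

theorem exists_multi_extension {S Z : Type*} [Fintype S] [TopologicalSpace Z]
    {N : Z → (S → E × E × A) → B}
    (hN : ∀ [DecidableEq S], ∀ z w s, IsTrilinear 𝕂 fun p q a => N z (update w s (p, q, a)))
    (hc : Continuous fun x : Z × (S → E × E × A) => N x.1 x.2) : ∃ Φ : Z → ContinuousMultilinearMap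
    𝕂 (fun _ : S => Tensor3 𝕂 E A) B, (Continuous fun x : Z × (S → Tensor3 𝕂 E A) => Φ x.1 x.2) ∧ ∀
    z w, Φ z (fun s => Tensor3.pure 𝕂 E A (w s).1 (w s).2.1 (w s).2.2) = N z w := by
  classical
  obtain ⟨G, h1, h2, h3, h4, h5, h6⟩ := exists_partial_extension hN hc univ
  refine ⟨fun z =>
    { toFun := fun t => G z 0 t
      map_update_add' := fun t s x y => ?_
      map_update_smul' := fun t s c x => ?_
      cont := h1.comp (f := fun t : S → Tensor3 𝕂 E A => (z, 0, t)) (by fun_prop) }, ?_, ?_⟩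
  · convert (h3 z 0 t s (mem_univ s)).map_add x y
  · convert (h3 z 0 t s (mem_univ s)).map_smul c x
  · exact h1.comp (f := fun x : Z × (S → Tensor3 𝕂 E A) => (x.1, (0 : S → E × E × A), x.2))
      (by fun_prop)
  · exact fun z w => (h5 z 0 w _ (by simp)).trans (h6 z w _ (fun _ _ => rfl))

end Extension

/-! ### Tensors of degree zero -/

section DegreeZero

variable {𝕂 E A B : Type*} [RCLike 𝕂] [AddCommGroup E] [Module 𝕂 E] [TopologicalSpace E]
  [IsTopologicalAddGroup E] [ContinuousSMul 𝕂 E] [PolynormableSpace 𝕂 E]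
  [AddCommGroup A] [Module 𝕂 A] [TopologicalSpace A]
  [IsTopologicalAddGroup A] [ContinuousSMul 𝕂 A] [PolynormableSpace 𝕂 A]
  (ℰ : ℤ → Submodule 𝕂 E) (𝒜 : ℤ → Submodule 𝕂 A)

/-- The decomposable homogeneous tensors of total degree zero. -/
def degreeZeroPure : Set (Tensor3 𝕂 E A) := {t | ∃ i j k : ℤ, i + j + k = 0 ∧
    ∃ p ∈ ℰ i, ∃ q ∈ ℰ j, ∃ a ∈ 𝒜 k, t = Tensor3.pure 𝕂 E A p q a}

/-- The closed space of tensors of total degree zero. -/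
def degreeZero : Set (Tensor3 𝕂 E A) :=
  closure (Submodule.span 𝕂 (degreeZeroPure ℰ 𝒜) : Set (Tensor3 𝕂 E A))

variable {ℰ 𝒜}

theorem degreeZero_induction [AddCommGroup B] [Module 𝕂 B] [TopologicalSpace B] {V : Submodule 𝕂 B}
    (hV : IsClosed (V : Set B)) {f : Tensor3 𝕂 E A → B} (hf : IsLinearMap 𝕂 f) (hfc : Continuous f)
    (h : ∀ t ∈ degreeZeroPure ℰ 𝒜, f t ∈ V) {t : Tensor3 𝕂 E A} (ht : t ∈ degreeZero ℰ 𝒜) :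
    f t ∈ V := by
  have h1 : closure (Submodule.span 𝕂 (degreeZeroPure ℰ 𝒜) : Set (Tensor3 𝕂 E A)) ⊆ f ⁻¹' V := by
    refine closure_minimal ?_ (hV.preimage hfc)
    intro x hx
    refine Submodule.span_induction (p := fun x _ => f x ∈ V) h ?_ ?_ ?_ hx
    · rw [hf.map_zero]; exact V.zero_mem
    · intro x y _ _ hx hy; rw [hf.map_add]; exact V.add_mem hx hy
    · intro c x _ hx; rw [hf.map_smul]; exact V.smul_mem _ hx
  exact h1 ht

theorem degreeZero_ext [AddCommGroup B] [Module 𝕂 B] [TopologicalSpace B] [T2Space B]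
    [IsTopologicalAddGroup B] {f g : Tensor3 𝕂 E A → B}
    (hf : IsLinearMap 𝕂 f) (hg : IsLinearMap 𝕂 g) (hfc : Continuous f) (hgc : Continuous g)
    (h : ∀ t ∈ degreeZeroPure ℰ 𝒜, f t = g t) {t : Tensor3 𝕂 E A} (ht : t ∈ degreeZero ℰ 𝒜) :
    f t = g t := by
  have := degreeZero_induction (ℰ := ℰ) (𝒜 := 𝒜) (V := (⊥ : Submodule 𝕂 B))
    (by simp)
    (f := fun t => f t - g t) ⟨fun x y => by rw [hf.map_add, hg.map_add]; abel,
      fun c x => by rw [hf.map_smul, hg.map_smul, smul_sub]⟩ (hfc.sub hgc)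
    (fun t ht => by simp [h t ht]) ht
  simpa [sub_eq_zero] using this

/-- Two functions of several tensors of degree zero, linear and continuous in each of them, agree
when they agree on decomposable homogeneous tensors of degree zero. -/
theorem degreeZero_multi_ext {S : Type*} [Fintype S] [DecidableEq S] [AddCommGroup B] [Module 𝕂 B]
    [TopologicalSpace B] [T2Space B] [IsTopologicalAddGroup B] {f g : (S → Tensor3 𝕂 E A) → B}
    (hf : ∀ t s, IsLinearMap 𝕂 fun τ => f (update t s τ))
    (hg : ∀ t s, IsLinearMap 𝕂 fun τ => g (update t s τ)) (hfc : Continuous f) (hgc : Continuous g)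
    (h : ∀ t : S → Tensor3 𝕂 E A, (∀ s, t s ∈ degreeZeroPure ℰ 𝒜) → f t = g t)
    {t : S → Tensor3 𝕂 E A} (ht : ∀ s, t s ∈ degreeZero ℰ 𝒜) : f t = g t := by
  have key : ∀ R : Finset S, ∀ t : S → Tensor3 𝕂 E A, (∀ s ∈ R, t s ∈ degreeZero ℰ 𝒜) →
      (∀ s ∉ R, t s ∈ degreeZeroPure ℰ 𝒜) → f t = g t := by
    intro R
    induction R using Finset.induction_on with
    | empty => exact fun t _ h1 => h t fun s => h1 s (by simp)
    | insert s R hs ih =>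
      intro t h1 h2
      have h3 := degreeZero_ext (ℰ := ℰ) (𝒜 := 𝒜) (hf t s) (hg t s)
        (hfc.comp (continuous_const.update s continuous_id))
        (hgc.comp (continuous_const.update s continuous_id)) (fun τ hτ => ?_)
        (h1 s (by simp))
      · simpa using h3
      · refine ih _ (fun s' hs' => ?_) fun s' hs' => ?_
        · rw [update_of_ne (by rintro rfl; exact hs hs')]
          exact h1 s' (by simp [hs'])
        · by_cases hss : s' = s
          · subst hss; simpa using hτ
          · rw [update_of_ne hss]
            exact h2 s' (by simp [hss, hs'])
  exact key univ t (fun s _ => ht s) (by simp)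

theorem zero_mem_degreeZero : (0 : Tensor3 𝕂 E A) ∈ degreeZero ℰ 𝒜 :=
  subset_closure (Submodule.zero_mem _)

theorem add_mem_degreeZero {P Q : Tensor3 𝕂 E A} (hP : P ∈ degreeZero ℰ 𝒜)
    (hQ : Q ∈ degreeZero ℰ 𝒜) : P + Q ∈ degreeZero ℰ 𝒜 :=
  (Submodule.span 𝕂 (degreeZeroPure ℰ 𝒜)).topologicalClosure.add_mem hP hQ

end DegreeZero


/-! ### Concatenated families of slots -/

section FinAdd

theorem append_update_left {X : Type*} {a b : ℕ} [DecidableEq (Fin a)] [DecidableEq (Fin (a + b))]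
    (y : Fin a → X) (v : Fin b → X) (i : Fin a) (x : X) :
    append (update y i x) v = update (append y v) (castAdd b i) x := by
  funext j
  refine addCases (fun j => ?_) (fun j => ?_) j
  · simp [update_apply, Fin.castAdd_inj]
  · have : natAdd a j ≠ castAdd b i := by
      intro h; have := congrArg Fin.val h; simp at this; omega
    simp [this]

theorem append_update_right {X : Type*} {a b : ℕ} [DecidableEq (Fin b)] [DecidableEq (Fin (a + b))]
    (y : Fin a → X) (v : Fin b → X) (i : Fin b) (x : X) :
    append y (update v i x) = update (append y v) (natAdd a i) x := by
  funext j
  refine addCases (fun j => ?_) (fun j => ?_) j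
  · have : castAdd b j ≠ natAdd a i := by
      intro h; have := congrArg Fin.val h; simp at this; omega
    simp [this]
  · simp [update_apply, Fin.natAdd_inj]

theorem append_mem {E : Type*} {S : ℤ → Set E} {a b : ℕ} {y : Fin a → E} {v : Fin b → E}
    {d : Fin a → ℤ} {d' : Fin b → ℤ} (hy : ∀ i, y i ∈ S (d i)) (hv : ∀ i, v i ∈ S (d' i))
    (i : Fin (a + b)) : append y v i ∈ S (append d d' i) := by
  refine addCases (fun i => ?_) (fun i => ?_) i
  · simpa using hy i
  · simpa using hv i

theorem continuous_append {Z X : Type*} [TopologicalSpace Z] [TopologicalSpace X] {a b : ℕ}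
    {f : Z → Fin a → X} {g : Z → Fin b → X} (hf : Continuous f) (hg : Continuous g) :
    Continuous fun z => append (f z) (g z) := by
  refine continuous_pi fun i => ?_
  refine addCases (fun i => ?_) (fun i => ?_) i
  · simp only [append_left]; exact (continuous_apply i).comp hf
  · simp only [append_right]; exact (continuous_apply i).comp hg

/-- The sum of two bijections of finite ordinals. -/
def finAddEquiv {a b c d : ℕ} (e : Fin a ≃ Fin b) (f : Fin c ≃ Fin d) : Fin (a + c) ≃ Fin (b + d) :=
  (finSumFinEquiv.symm.trans (e.sumCongr f)).trans finSumFinEquiv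

variable {a b c d : ℕ} (e : Fin a ≃ Fin b) (f : Fin c ≃ Fin d)

@[simp] theorem finAddEquiv_castAdd (i : Fin a) :
    finAddEquiv e f (castAdd c i) = castAdd d (e i) := by simp [finAddEquiv]

@[simp] theorem finAddEquiv_natAdd (i : Fin c) :
    finAddEquiv e f (natAdd a i) = natAdd b (f i) := by simp [finAddEquiv]

theorem finAddEquiv_symm : (finAddEquiv e f).symm = finAddEquiv e.symm f.symm := by
  ext i; simp [finAddEquiv]

theorem append_comp_finAddEquiv {X : Type*} (y : Fin b → X) (v : Fin d → X) :
    append y v ∘ finAddEquiv e f = append (y ∘ e) (v ∘ f) := by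
  funext i
  refine addCases (fun i => ?_) (fun i => ?_) i <;> simp

theorem koszulSign_finAdd {K K' : Type*} [LT K] [LT K'] {a b : ℕ} {u : Fin (a + b) → K}
    {w : Fin (a + b) → K'} {d : Fin (a + b) → ℤ} (h : ∀ i j, (u (castAdd b i) < u (natAdd a j) → ¬ w
    (natAdd a j) < w (castAdd b i)) ∧ (u (natAdd a j) < u (castAdd b i) → ¬ w (castAdd b i) < w
    (natAdd a j))) : koszulSign u w d = koszulSign (u ∘ castAdd b) (w ∘ castAdd b) (d ∘ castAdd b) *
    koszulSign (u ∘ natAdd a) (w ∘ natAdd a) (d ∘ natAdd a) := by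
  rw [← koszulSign_comp_equiv finSumFinEquiv, koszulSign_sum]
  · congr 1
  · simpa using h

theorem koszulSign_finAddEquiv (D : Fin (b + d) → ℤ) : koszulSign (id : Fin (b + d) → _)
    (finAddEquiv e f).symm D = koszulSign (id : Fin b → _) e.symm (D ∘ castAdd d) * koszulSign
    (id : Fin d → _) f.symm (D ∘ natAdd b) := by
  rw [finAddEquiv_symm, koszulSign_finAdd]
  · congr 1
    · refine koszulSign_congr fun i j => ?_
      simp only [Function.comp, finAddEquiv_castAdd, id, Fin.lt_def, Fin.val_castAdd]
    · refine koszulSign_congr fun i j => ?_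
      simp only [Function.comp, finAddEquiv_natAdd, id, Fin.lt_def, Fin.val_natAdd,
        add_lt_add_iff_left]
  · intro i j
    simp only [id, finAddEquiv_natAdd, finAddEquiv_castAdd, Fin.lt_def, Fin.val_natAdd,
      Fin.val_castAdd]
    omega

end FinAdd

/-! ### Contraction of the last two slots -/

section Flow

variable {𝕂 E A : Type*} [RCLike 𝕂] [AddCommGroup E] [Module 𝕂 E] [TopologicalSpace E]
  [IsTopologicalAddGroup E] [ContinuousSMul 𝕂 E] [PolynormableSpace 𝕂 E]
  [Ring A] [Algebra 𝕂 A] [UniformSpace A] [IsUniformAddGroup A] [IsTopologicalRing A]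
  [ContinuousSMul 𝕂 A] [PolynormableSpace 𝕂 A] [T2Space A] [CompleteSpace A]

theorem multi_append_trilinear {l : ℕ} (F : Multi 𝕂 E A (l + 2)) (z : Fin l → E) :
    IsTrilinear 𝕂 fun p q (a : A) => F (append z ![p, q]) * a where
  left q a := by
    have h : ∀ p, F (append z ![p, q]) =
        F (update (append z ![0, q]) (natAdd l 0) p) := by
      intro p; rw [← append_update_right]; congr 2; funext i; fin_cases i <;> rfl
    simp_rw [h]
    exact ⟨fun x y => by rw [F.map_update_add, add_mul], fun c x => by
      rw [F.map_update_smul, smul_mul_assoc]⟩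
  middle p a := by
    have h : ∀ q, F (append z ![p, q]) =
        F (update (append z ![p, 0]) (natAdd l 1) q) := by
      intro q; rw [← append_update_right]; congr 2; funext i; fin_cases i <;> rfl
    simp_rw [h]
    exact ⟨fun x y => by rw [F.map_update_add, add_mul], fun c x => by
      rw [F.map_update_smul, smul_mul_assoc]⟩
  right p q := ⟨fun x y => mul_add _ _ _, fun c x => mul_smul_comm _ _ _⟩

theorem exists_contraction {Z : Type*} [TopologicalSpace Z] {l : ℕ} (F : Z → Multi 𝕂 E A (l + 2))
    (hF : Continuous fun w : Z × (Fin (l + 2) → E) => F w.1 w.2) : ∃ C : Z × (Fin l → E) → Tensor3 𝕂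
    E A →L[𝕂] A, (∀ z p q a, C z (Tensor3.pure 𝕂 E A p q a) = F z.1 (append z.2 ![p, q]) * a) ∧
    Continuous fun w : (Z × (Fin l → E)) × Tensor3 𝕂 E A => C w.1 w.2 := by
  refine exists_extension (f := fun (z : Z × (Fin l → E)) p q a => F z.1 (append z.2 ![p, q]) * a)
    (fun z => multi_append_trilinear _ _) ?_
  refine Continuous.mul (hF.comp (Continuous.prodMk (by fun_prop) ?_)) (by fun_prop)
  refine continuous_append (by fun_prop) (continuous_pi fun i => ?_)
  fin_cases i <;> simp <;> fun_prop

/-- The contraction of the last two slots, as a function of the tensor. -/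
def contractFun {l : ℕ} (F : Multi 𝕂 E A (l + 2)) (z : Fin l → E) : Tensor3 𝕂 E A →L[𝕂] A :=
  (exists_contraction (fun _ : Unit => F) (F.cont.comp continuous_snd)).choose ((), z)

theorem contractFun_pure {l : ℕ} (F : Multi 𝕂 E A (l + 2)) (z : Fin l → E) (p q : E) (a : A) :
    contractFun F z (Tensor3.pure 𝕂 E A p q a) = F (append z ![p, q]) * a :=
  (exists_contraction (fun _ : Unit => F) (F.cont.comp continuous_snd)).choose_spec.1 _ p q a

theorem contractFun_continuous {Z : Type*} [TopologicalSpace Z] {l : ℕ}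
    {F : Z → Multi 𝕂 E A (l + 2)} (hF : Continuous fun w : Z × (Fin (l + 2) → E) => F w.1 w.2) :
    Continuous fun w : Z × (Fin l → E) × Tensor3 𝕂 E A => contractFun (F w.1) w.2.1 w.2.2 := by
  obtain ⟨C, hC, hc⟩ := exists_contraction F hF
  have : ∀ z y, contractFun (F z) y = C (z, y) := fun z y =>
    Tensor3.clm_ext fun p q a => by rw [contractFun_pure, hC]
  simp_rw [this]
  exact hc.comp (by fun_prop : Continuous fun w : Z × (Fin l → E) × Tensor3 𝕂 E A =>
    ((w.1, w.2.1), w.2.2))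

/-- The contraction of the last two slots of a functional with a tensor: on `p ⊗ q ⊗ a` it is
`y ↦ F (y, p, q) a`. -/
def contract (P : Tensor3 𝕂 E A) {l : ℕ} : Multi 𝕂 E A (l + 2) →ₗ[𝕂] Multi 𝕂 E A l where
  toFun F :=
    { toFun := fun z => contractFun F z P
      map_update_add' := fun z i x y => (isLinearMap_of_pure
        (D := fun x => contractFun F (update z i x)) (fun p q a => by
          simp_rw [contractFun_pure, append_update_left]
          exact ⟨fun x y => by rw [F.map_update_add, add_mul], fun c x => by
            rw [F.map_update_smul, smul_mul_assoc]⟩) P).map_add x y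
      map_update_smul' := fun z i c x => (isLinearMap_of_pure
        (D := fun x => contractFun F (update z i x)) (fun p q a => by
          simp_rw [contractFun_pure, append_update_left]
          exact ⟨fun x y => by rw [F.map_update_add, add_mul], fun c x => by
            rw [F.map_update_smul, smul_mul_assoc]⟩) P).map_smul c x
      cont := (contractFun_continuous (F := fun _ : Unit => F) (F.cont.comp continuous_snd)).comp
        (by fun_prop : Continuous fun z : Fin l → E => ((), z, P)) }
  map_add' F G := by
    ext z
    exact (isLinearMap_of_pure (D := fun F : Multi 𝕂 E A (l + 2) => contractFun F z)
      (fun p q a => by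
        simp_rw [contractFun_pure]
        exact ⟨fun x y => add_mul _ _ _, fun c x => smul_mul_assoc _ _ _⟩) P).map_add F G
  map_smul' c F := by
    ext z
    exact (isLinearMap_of_pure (D := fun F : Multi 𝕂 E A (l + 2) => contractFun F z)
      (fun p q a => by
        simp_rw [contractFun_pure]
        exact ⟨fun x y => add_mul _ _ _, fun c x => smul_mul_assoc _ _ _⟩) P).map_smul c F

theorem contract_apply (P : Tensor3 𝕂 E A) {l : ℕ} (F : Multi 𝕂 E A (l + 2)) (z : Fin l → E) :
    contract P F z = contractFun F z P := rfl

variable {ℰ : ℤ → Submodule 𝕂 E} {𝒜 : ℤ → Submodule 𝕂 A}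

/-- Test an identity between functions of a tensor of degree zero, one of which is a contraction. -/
theorem contract_eq_of_pure {l : ℕ} (F : Multi 𝕂 E A (l + 2)) (z : Fin l → E)
    {g : Tensor3 𝕂 E A → A} (hg : IsLinearMap 𝕂 g) (hgc : Continuous g) (h : ∀ i j k, i + j + k = 0
    → ∀ p ∈ ℰ i, ∀ q ∈ ℰ j, ∀ a ∈ 𝒜 k, F (append z ![p, q]) * a = g (Tensor3.pure 𝕂 E A p q a))
    {P : Tensor3 𝕂 E A} (hP : P ∈ degreeZero ℰ 𝒜) : contract P F z = g P := by
  refine degreeZero_ext (f := fun P => contractFun F z P) (contractFun F z).toLinearMap.isLinear hg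
    (contractFun F z).continuous hgc ?_ hP
  rintro _ ⟨i, j, k, hijk, p, hp, q, hq, a, ha, rfl⟩
  rw [contractFun_pure]
  exact h i j k hijk p hp q hq a ha

variable [DirectSum.Decomposition ℰ] (hℰ : IsTopologicalGrading ℰ)

theorem pair_mem {i j : ℤ} {p q : E} (hp : p ∈ ℰ i) (hq : q ∈ ℰ j) (m : Fin 2) :
    (![p, q] : Fin 2 → E) m ∈ ℰ ((![i, j] : Fin 2 → ℤ) m) := by
  fin_cases m
  · exact hp
  · exact hq

theorem contract_transport {a b : ℕ} (e : Fin a ≃ Fin b) (F : Multi 𝕂 E A (a + 2))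
    {P : Tensor3 𝕂 E A} (hP : P ∈ degreeZero ℰ 𝒜) : contract P
    (transport hℰ (finAddEquiv e (Equiv.refl (Fin 2))) F) = transport hℰ e (contract P F) := by
  refine multi_ext hℰ fun d x hx => ?_
  rw [transport_apply hℰ e _ hx]
  refine contract_eq_of_pure (ℰ := ℰ) (𝒜 := 𝒜) _ x
    (g := ⇑(koszulSign id e.symm d • contractFun F (fun i => x (e i))))
    (LinearMap.isLinear _) (ContinuousLinearMap.continuous _) ?_ hP
  intro i j k _ p hp q hq α _
  have hmem := append_mem (S := fun i => (ℰ i : Set E)) hx (pair_mem hp hq)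
  rw [transport_apply hℰ _ _ hmem]
  change _ = koszulSign id e.symm d • contractFun F (fun i => x (e i)) _
  rw [contractFun_pure, smul_mul_assoc, koszulSign_finAddEquiv, koszulSign_eq_one (ι := Fin 2),
    mul_one]
  · have h1 : (append d ![i, j] : Fin (b + 2) → ℤ) ∘ castAdd 2 = d := by
      funext i; simp
    rw [h1]
    have := append_comp_finAddEquiv e (Equiv.refl (Fin 2)) x ![p, q]
    exact congrArg (fun z => koszulSign id e.symm d • (F z * α)) this
  · intro i j _ _ h; exact h.asymm

/-- Exchanging the last two slots. -/
theorem contract_swap {l : ℕ} (F : Multi 𝕂 E A (l + 2)) {P : Tensor3 𝕂 E A}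
    (hP : IsPropagator ℰ 𝒜 P) : contract P
    (transport hℰ (finAddEquiv (Equiv.refl (Fin l)) (swap 0 1)) F) = contract P F := by
  obtain ⟨hP, τ, hτ, hτP⟩ := hP
  refine multi_ext hℰ fun d x hx => ?_
  rw [contract_apply _ F, ← hτP]
  conv_lhs => rw [hτP]
  refine contract_eq_of_pure (ℰ := ℰ) (𝒜 := 𝒜) _ x (g := ⇑((contractFun F x).comp τ))
    (LinearMap.isLinear _) (ContinuousLinearMap.continuous _) ?_ hP
  intro i j k _ p hp q hq α _
  have hmem := append_mem (S := fun i => (ℰ i : Set E)) hx (pair_mem hp hq)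
  rw [transport_apply hℰ _ _ hmem, ContinuousLinearMap.comp_apply, hτ i j p hp q hq, map_zsmul,
    contractFun_pure, smul_mul_assoc]
  have h2 := append_comp_finAddEquiv (Equiv.refl (Fin l)) (swap (0 : Fin 2) 1) x ![p, q]
  have h3 : (![p, q] : Fin 2 → E) ∘ swap (0 : Fin 2) 1 = ![q, p] := by
    funext m; fin_cases m <;> simp
  rw [h3] at h2
  have h4 : F (fun m => append x ![p, q] (finAddEquiv (Equiv.refl (Fin l))
      (swap (0 : Fin 2) 1) m)) = F (append x ![q, p]) := congrArg F h2
  rw [h4]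
  congr 1
  rw [koszulSign_finAddEquiv, koszulSign_eq_one (ι := Fin l), one_mul]
  · have h5 : (append d ![i, j] : Fin (l + 2) → ℤ) ∘ natAdd l = ![i, j] := by
      funext m; simp
    rw [h5, koszulSign_eq_prod]
    simp only [Fintype.prod_prod_type, Fin.prod_univ_two]
    simp
  · intro i j _ _ h; exact h.asymm

/-! ### Products of functionals -/

theorem castAdd_ne_natAdd {a b : ℕ} (i : Fin a) (j : Fin b) : castAdd b i ≠ natAdd a j := fun h => by
  have := congrArg Fin.val h
  simp at this; omega

section Update

variable {V : Type*} {a b : ℕ} [DecidableEq (Fin (a + b))] (m : Fin (a + b) → V)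

theorem update_castAdd (i : Fin a) (x : V) : (fun j => update m (castAdd b i) x (castAdd b j)) =
    update (fun j => m (castAdd b j)) i x :=
  Function.update_comp_eq_of_injective' m (castAdd_injective a b) i x

theorem update_natAdd (i : Fin b) (x : V) : (fun j => update m (natAdd a i) x (natAdd a j)) =
    update (fun j => m (natAdd a j)) i x :=
  Function.update_comp_eq_of_injective' m (natAdd_injective b a) i x

theorem update_castAdd_natAdd (i : Fin a) (x : V) :
    (fun j => update m (castAdd b i) x (natAdd a j)) = fun j => m (natAdd a j) :=
  Function.update_comp_eq_of_forall_ne' m x fun j => (castAdd_ne_natAdd i j).symm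

theorem update_natAdd_castAdd (i : Fin b) (x : V) :
    (fun j => update m (natAdd a i) x (castAdd b j)) = fun j => m (castAdd b j) :=
  Function.update_comp_eq_of_forall_ne' m x fun j => castAdd_ne_natAdd j i

end Update

/-- The product of two functionals, the slots of the first preceding those of the second. -/
def tensor {a b : ℕ} (F : Multi 𝕂 E A a) (G : Multi 𝕂 E A b) : Multi 𝕂 E A (a + b) where
  toFun x := F (fun i => x (castAdd b i)) * G (fun i => x (natAdd a i))
  map_update_add' := by
    intro _ m i x y
    refine addCases (fun i => ?_) (fun i => ?_) i
    · simp only [update_castAdd, update_castAdd_natAdd, F.map_update_add, add_mul]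
    · simp only [update_natAdd, update_natAdd_castAdd, G.map_update_add, mul_add]
  map_update_smul' := by
    intro _ m i c x
    refine addCases (fun i => ?_) (fun i => ?_) i
    · simp only [update_castAdd, update_castAdd_natAdd, F.map_update_smul, smul_mul_assoc]
    · simp only [update_natAdd, update_natAdd_castAdd, G.map_update_smul, mul_smul_comm]
  cont := (F.cont.comp (by fun_prop)).mul (G.cont.comp (by fun_prop))

theorem tensor_apply {a b : ℕ} (F : Multi 𝕂 E A a) (G : Multi 𝕂 E A b) (x : Fin (a + b) → E) :
    tensor F G x = F (fun i => x (castAdd b i)) * G (fun i => x (natAdd a i)) := rfl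

theorem transport_tensor {a b c d : ℕ} (e : Fin a ≃ Fin b) (f : Fin c ≃ Fin d)
    (F : Multi 𝕂 E A a) (G : Multi 𝕂 E A c) :
    transport hℰ (finAddEquiv e f) (tensor F G) = tensor (transport hℰ e F) (transport hℰ f G) := by
  refine multi_ext hℰ fun D x hx => ?_
  rw [transport_apply hℰ _ _ hx, tensor_apply, tensor_apply, transport_apply hℰ e F (d := D ∘
    castAdd d) fun i => hx _, transport_apply hℰ f G (d := D ∘ natAdd b) fun i => hx _,
    smul_mul_smul_comm, koszulSign_finAddEquiv]
  simp

theorem transport_finCongr {a b : ℕ} (h : a = b) (F : Multi 𝕂 E A a) (x : Fin b → E) :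
    transport hℰ (finCongr h) F x = F fun i => x (Fin.cast h i) := by
  subst h
  exact congrArg (fun T : Multi 𝕂 E A a => T x) (transport_refl hℰ F)

theorem contract_tensor_right {a b : ℕ} (F : Multi 𝕂 E A a) (G : Multi 𝕂 E A (b + 2))
    {P : Tensor3 𝕂 E A} (hP : P ∈ degreeZero ℰ 𝒜) :
    contract P (transport hℰ (finCongr (Nat.add_assoc a b 2).symm) (tensor F G)) =
      tensor F (contract P G) := by
  ext x
  rw [tensor_apply]
  refine contract_eq_of_pure (ℰ := ℰ) (𝒜 := 𝒜) _ x
    (g := fun P => F (fun i => x (castAdd b i)) * contractFun G (fun i => x (natAdd a i)) P)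
    ⟨fun P Q => by rw [map_add, mul_add], fun c P => by rw [map_smul, mul_smul_comm]⟩
    (continuous_const.mul (ContinuousLinearMap.continuous _)) ?_ hP
  intro i j k _ p _ q _ α _
  rw [contractFun_pure, transport_finCongr, tensor_apply, ← mul_assoc]
  congr 3
  · funext i
    have : Fin.cast (Nat.add_assoc a b 2).symm (castAdd (b + 2) i) =
      castAdd 2 (castAdd b i) := Fin.ext rfl
    rw [this, append_left]
  · funext i
    refine addCases (fun i => ?_) (fun i => ?_) i
    · have : Fin.cast (Nat.add_assoc a b 2).symm (natAdd a (castAdd 2 i)) =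
        castAdd 2 (natAdd a i) := Fin.ext rfl
      rw [this, append_left, append_left]
    · have : Fin.cast (Nat.add_assoc a b 2).symm (natAdd a (natAdd b i)) =
        natAdd (a + b) i := Fin.ext (by simp [Nat.add_assoc])
      rw [this, append_right, append_right]

/-- The bijection of slots that moves the two last slots of the first factor to the end. -/
def moveLast (a b : ℕ) : Fin (a + 2 + b) ≃ Fin (a + b + 2) :=
  (finCongr (Nat.add_assoc a 2 b)).trans
    ((finAddEquiv (Equiv.refl (Fin a)) finAddFlip).trans (finCongr (Nat.add_assoc a b 2).symm))

theorem moveLast_left {a b : ℕ} (i : Fin a) :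
    moveLast a b (castAdd b (castAdd 2 i)) = castAdd 2 (castAdd b i) := by
  have : finCongr (Nat.add_assoc a 2 b) (castAdd b (castAdd 2 i)) =
    castAdd (2 + b) i := Fin.ext rfl
  simp only [moveLast, Equiv.trans_apply]
  rw [this, finAddEquiv_castAdd]
  exact Fin.ext rfl

theorem moveLast_middle {a b : ℕ} (i : Fin 2) :
    moveLast a b (castAdd b (natAdd a i)) = natAdd (a + b) i := by
  have : finCongr (Nat.add_assoc a 2 b) (castAdd b (natAdd a i)) =
    natAdd a (castAdd b i) := Fin.ext rfl
  simp only [moveLast, Equiv.trans_apply]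
  rw [this, finAddEquiv_natAdd, finAddFlip_apply_castAdd]
  exact Fin.ext (by simp [Nat.add_assoc])

theorem moveLast_right {a b : ℕ} (i : Fin b) :
    moveLast a b (natAdd (a + 2) i) = castAdd 2 (natAdd a i) := by
  have : finCongr (Nat.add_assoc a 2 b) (natAdd (a + 2) i) =
    natAdd a (natAdd 2 i) := Fin.ext (by simp [Nat.add_assoc])
  simp only [moveLast, Equiv.trans_apply]
  rw [this, finAddEquiv_natAdd, finAddFlip_apply_natAdd]
  exact Fin.ext rfl

theorem koszulSign_moveLast {a b : ℕ} (d : Fin (a + b) → ℤ) (i j : ℤ) :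
    koszulSign (id : Fin (a + b + 2) → _) (moveLast a b).symm (append d ![i, j]) =
      (((i + j) * ∑ m, d (natAdd a m)).negOnePow : ℤ) := by
  let r : Fin (a + b + 2) → Fin 3 := fun m => if (m : ℕ) < a then 0 else
    if (m : ℕ) < a + b then 1 else 2
  have hm : ∀ m : Fin (a + b + 2), (((moveLast a b).symm m : Fin (a + 2 + b)) : ℕ) =
      if (m : ℕ) < a then (m : ℕ) else if (m : ℕ) < a + b then m + 2 else m - b := by
    intro m
    obtain ⟨n, rfl⟩ := (moveLast a b).surjective m
    rw [symm_apply_apply]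
    refine addCases (fun n => ?_) (fun n => ?_) n
    · refine addCases (fun n => ?_) (fun n => ?_) n
      · rw [moveLast_left]; simp
      · rw [moveLast_middle]
        simp only [Fin.val_castAdd, Fin.val_natAdd]
        rw [if_neg (by omega), if_neg (by omega)]; omega
    · rw [moveLast_right]
      have := n.2
      simp only [Fin.val_castAdd, Fin.val_natAdd]
      rw [if_neg (by omega), if_pos (by omega)]; omega
  have h0 : ¬ (a + b + 1 < a) := by omega
  rw [koszulSign_block r (u' := (id : Fin 3 → Fin 3)) (w' := (![0, 2, 1] : Fin 3 → ℕ))]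
  · have e1 : (∑ m with r m = 1, (append d ![i, j] : Fin (a + b + 2) → ℤ) m) =
        ∑ m, d (natAdd a m) := by
      rw [sum_filter, Fin.sum_univ_add, Fin.sum_univ_add]
      simp [r, h0]
    have e2 : (∑ m with r m = 2, (append d ![i, j] : Fin (a + b + 2) → ℤ) m) = i + j := by
      rw [sum_filter, Fin.sum_univ_add, Fin.sum_univ_add]
      simp [r, h0]
    rw [koszulSign_eq_prod_negOnePow]
    simp only [Fin.prod_univ_three]
    simp [e1, e2, mul_comm]
  · intro m n hmn
    simp only [id, Fin.lt_def, r] at *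
    split_ifs at * <;> simp at * <;> omega
  · intro m n hmn
    rw [Fin.lt_def, hm, hm]
    simp only [r] at *
    split_ifs at * <;> simp at * <;> omega
  · intro m n hmn h
    rw [Fin.lt_def, hm, hm]
    simp only [r, id, Fin.lt_def] at *
    split_ifs at * <;> simp at * <;> omega

theorem contract_tensor_left (hc : IsGradedCommutative 𝒜) {a b : ℕ} (F : Multi 𝕂 E A (a + 2))
    (G : Multi 𝕂 E A b)
    (hG : ∀ (d : Fin b → ℤ) (x : Fin b → E), (∀ i, x i ∈ ℰ (d i)) → G x ∈ 𝒜 (∑ i, d i))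
    {P : Tensor3 𝕂 E A} (hP : P ∈ degreeZero ℰ 𝒜) :
    contract P (transport hℰ (moveLast a b) (tensor F G)) = tensor (contract P F) G := by
  refine multi_ext hℰ fun d x hx => ?_
  rw [tensor_apply]
  refine contract_eq_of_pure (ℰ := ℰ) (𝒜 := 𝒜) _ x
    (g := fun P => contractFun F (fun i => x (castAdd b i)) P * G (fun i => x (natAdd a i)))
    ⟨fun P Q => by rw [map_add, add_mul], fun c P => by rw [map_smul, smul_mul_assoc]⟩
    ((ContinuousLinearMap.continuous _).mul continuous_const) ?_ hP
  intro i j k hijk p hp q hq α hα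
  have hmem := append_mem (S := fun i => (ℰ i : Set E)) hx (pair_mem hp hq)
  have hGx := hG (fun i => d (natAdd a i)) _ fun i => hx (natAdd a i)
  rw [contractFun_pure, transport_apply hℰ _ _ hmem, tensor_apply, koszulSign_moveLast]
  have e1 : (fun m => (append x ![p, q] : Fin (a + b + 2) → E)
      (moveLast a b (castAdd b m))) =
      append (fun i => x (castAdd b i)) ![p, q] := by
    funext m
    refine addCases (fun m => ?_) (fun m => ?_) m
    · rw [moveLast_left, append_left, append_left]
    · rw [moveLast_middle, append_right, append_right]
  have e2 : (fun m => (append x ![p, q] : Fin (a + b + 2) → E)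
      (moveLast a b (natAdd (a + 2) m))) = fun i => x (natAdd a i) := by
    funext m
    rw [moveLast_right, append_left]
  rw [e1, e2, smul_mul_assoc, mul_assoc, hc.mul_comm hGx hα, mul_smul_comm, smul_smul, ← mul_assoc,
    ← Units.val_mul, ← Int.negOnePow_add]
  have : (i + j) * ∑ m, d (natAdd a m) + (∑ m, d (natAdd a m)) * k = 0 := by
    have : k = -(i + j) := by linarith
    rw [this]; ring
  rw [this]; simp


/-! ### Existence and uniqueness of the amplitudes -/

theorem isLinearMap_list_prod {𝕂 A V X : Type*} [CommSemiring 𝕂] [Semiring A] [Algebra 𝕂 A]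
    [AddCommMonoid X] [Module 𝕂 X] {L : List V} (hL : L.Nodup) {v : V} (hv : v ∈ L) {F : V → X → A}
    (h1 : IsLinearMap 𝕂 (F v)) (h2 : ∀ w ≠ v, ∀ x y, F w x = F w y) :
    IsLinearMap 𝕂 fun x => (L.map fun w => F w x).prod := by
  obtain ⟨L1, L2, rfl⟩ := List.append_of_mem hv
  have a1 : v ∉ L1 := fun h => (List.nodup_append.1 hL).2.2 v h v (by simp) rfl
  have a2 : v ∉ L2 := (List.nodup_cons.1 (List.nodup_append.1 hL).2.1).1
  have b : ∀ M : List V, v ∉ M → ∀ x, (M.map fun w => F w x) = M.map fun w => F w 0 := by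
    exact fun M hM x => List.map_congr_left fun w hw => h2 w (by rintro rfl; exact hM hw) _ _
  have : ∀ x, ((L1 ++ v :: L2).map fun w => F w x).prod =
      (L1.map fun w => F w 0).prod * (F v x * (L2.map fun w => F w 0).prod) := by
    intro x
    rw [List.map_append, List.map_cons, b L1 a1, b L2 a2]; simp
  simp_rw [this]
  exact ⟨fun x y => by rw [h1.map_add, add_mul, mul_add], fun c x => by
    rw [h1.map_smul, smul_mul_assoc, mul_smul_comm]⟩

/-- The functional attached to a cyclically decomposed set, as a continuous multilinear function of
the components of degrees `d` of the fields. -/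
def attachFun {X : Type*} [Fintype X] [LinearOrder X] (C : Perm X) {k l : ℕ}
    (d : X → ℤ) (J : CycWords A ℰ k l) : ContinuousMultilinearMap 𝕂 (fun _ : X => E) A :=
  ∑ σ, ∑ φ : CycIso σ.1 C, koszulSign (id : X → X) φ.1.symm d •
    ((Quotient.out J σ).compContinuousLinearMap fun i => hℰ.proj (d (φ.1 i))).domDomCongr φ.1

theorem attachFun_apply {X : Type*} [Fintype X] [LinearOrder X] (C : Perm X) {k l : ℕ}
    (d : X → ℤ) (J : CycWords A ℰ k l) (x : X → E) : attachFun hℰ C d J x =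
      attach ℰ C k l d (fun h => ⟨hℰ.proj (d h) (x h), hℰ.proj_mem _ _⟩) J := by
  have h : attach ℰ C k l d (fun h => ⟨hℰ.proj (d h) (x h), hℰ.proj_mem _ _⟩) J =
      attachPre ℰ C k l d (fun h => ⟨hℰ.proj (d h) (x h), hℰ.proj_mem _ _⟩) (Quotient.out J) := by
    conv_lhs => rw [← Quotient.out_eq J]
    rfl
  rw [h]
  unfold attachFun
  rw [_root_.sum_apply]
  refine sum_congr rfl fun σ _ => ?_
  rw [_root_.sum_apply]
  rfl

namespace RibbonGraph

variable (Γ : RibbonGraph) (I : Functional A ℰ)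

theorem not_leg_of_mem_edges {h : Fin Γ.nH} (hh : h ∈ Γ.edges) : Γ.inv h ≠ h := by
  have := (mem_filter.1 hh).2
  exact this.ne'

theorem inv_notMem_edges {h : Fin Γ.nH} (hh : h ∈ Γ.edges) : Γ.inv h ∉ Γ.edges := by
  have h1 := (mem_filter.1 hh).2
  intro h2
  have h3 := (mem_filter.1 h2).2
  rw [Γ.inv_inv] at h3
  exact h3.asymm h1

theorem mem_edges {h : Fin Γ.nH} : h ∈ Γ.edges ↔ h < Γ.inv h := by simp [edges]

theorem inv_mem_edges {h : Fin Γ.nH} (h1 : Γ.inv h ≠ h) (h2 : h ∉ Γ.edges) : Γ.inv h ∈ Γ.edges := by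
  rw [mem_edges] at *
  rw [Γ.inv_inv]
  exact lt_of_le_of_ne (not_lt.1 h2) h1

/-- The product over the vertices of the functionals attached to them. -/
def vertexProd (d : Fin Γ.nH → ℤ) (x : Fin Γ.nH → E) : A :=
  ((List.finRange Γ.nV).map fun v => attachFun hℰ (Γ.cycAt v) (fun h : Γ.At v => d h)
    (I (Γ.genus v) (Γ.bdry v) (numCycles (Γ.cycAt v)) (Fintype.card (Γ.At v)))
    fun h : Γ.At v => x h).prod

theorem vertexProd_linear (d : Fin Γ.nH → ℤ) (x : Fin Γ.nH → E) (h : Fin Γ.nH) :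
    IsLinearMap 𝕂 fun p => Γ.vertexProd hℰ I d (update x h p) := by
  refine isLinearMap_list_prod (List.nodup_finRange _) (List.mem_finRange (Γ.root h)) ?_ ?_
  · have : ∀ p, (fun h' : Γ.At (Γ.root h) => update x h p h') =
        update (fun h' : Γ.At (Γ.root h) => x h') ⟨h, rfl⟩ p := by
      intro p
      funext h'
      by_cases hh : h' = ⟨h, rfl⟩
      · rw [hh]; simp
      · rw [update_of_ne hh, update_of_ne (fun h2 => hh (Subtype.ext h2))]
    simp_rw [this]
    exact ⟨fun a b => ContinuousMultilinearMap.map_update_add _ _ _ _ _,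
      fun c a => ContinuousMultilinearMap.map_update_smul _ _ _ _ _⟩
  · intro w hw p q
    congr 1
    funext h'
    have : (h' : Fin Γ.nH) ≠ h := by rintro rfl; exact hw h'.2.symm
    rw [update_of_ne this, update_of_ne this]

theorem vertexProd_continuous (d : Fin Γ.nH → ℤ) : Continuous (Γ.vertexProd hℰ I d) :=
  continuous_list_prod _ fun _ _ => (ContinuousMultilinearMap.cont _).comp
    (continuous_pi fun _ => continuous_apply _)

theorem vertexProd_eq_zero {d : Fin Γ.nH → ℤ} {x : Fin Γ.nH → E} {h : Fin Γ.nH}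
    (hx : hℰ.proj (d h) (x h) = 0) : Γ.vertexProd hℰ I d x = 0 := by
  have h1 : Γ.vertexProd hℰ I d x = Γ.vertexProd hℰ I d (update x h 0) := by
    unfold vertexProd
    congr 2
    funext v
    rw [attachFun_apply, attachFun_apply]
    congr 2
    funext h'
    refine Subtype.ext ?_
    by_cases hh : (h' : Fin Γ.nH) = h
    · simp only
      rw [hh, hx]; simp
    · simp only
      rw [update_of_ne hh]
  rw [h1]
  exact (Γ.vertexProd_linear hℰ I d x h).map_zero

theorem vertexProd_eq (d : Fin Γ.nH → ℤ) (x : ∀ h, ℰ (d h)) : Γ.vertexProd hℰ I d (fun h => x h) =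
    ((List.finRange Γ.nV).map fun v => attach ℰ (Γ.cycAt v) (numCycles (Γ.cycAt v)) (Fintype.card
    (Γ.At v)) (fun h : Γ.At v => d h) (fun h => x h) (I (Γ.genus v) (Γ.bdry v) (numCycles (Γ.cycAt
    v)) (Fintype.card (Γ.At v)))).prod := by
  unfold vertexProd
  congr 2
  funext v
  rw [attachFun_apply]
  congr 2
  funext h
  exact Subtype.ext (hℰ.proj_same (x h).2)

variable [GradedAlgebra 𝒜] (h𝒜 : IsTopologicalGrading 𝒜)

/-- The product over the edges of elements of `A`, projected to given degrees. -/
def edgeProd (d : Γ.edges → ℤ) (a : Γ.edges → A) : A :=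
  ((Γ.edges.sort (· ≤ ·)).attach.map fun e => h𝒜.proj (d ⟨e.1, (mem_sort (· ≤ ·)).1 e.2⟩)
    (a ⟨e.1, (mem_sort (· ≤ ·)).1 e.2⟩)).prod

theorem edgeProd_linear [DecidableEq Γ.edges] (d : Γ.edges → ℤ) (a : Γ.edges → A) (e : Γ.edges) :
    IsLinearMap 𝕂 fun p => Γ.edgeProd h𝒜 d (update a e p) := by
  refine isLinearMap_list_prod (v := ⟨e.1, (mem_sort (· ≤ ·)).2 e.2⟩) ?_ (by simp) ?_ ?_
  · exact List.nodup_attach.2 (Finset.sort_nodup _ _)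
  · simp only [Subtype.coe_eta, update_self]
    exact (h𝒜.proj _).toLinearMap.isLinear
  · intro w hw p q
    have : (⟨w.1, (mem_sort (· ≤ ·)).1 w.2⟩ : Γ.edges) ≠ e := by rintro rfl; exact hw rfl
    rw [update_of_ne this, update_of_ne this]

theorem edgeProd_continuous (d : Γ.edges → ℤ) : Continuous (Γ.edgeProd h𝒜 d) :=
  continuous_list_prod _ fun _ _ => (h𝒜.proj _).continuous.comp (continuous_apply _)

theorem edgeProd_eq_zero {d : Γ.edges → ℤ} {a : Γ.edges → A} {e : Γ.edges}
    (hx : h𝒜.proj (d e) (a e) = 0) : Γ.edgeProd h𝒜 d a = 0 := by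
  have h1 : Γ.edgeProd h𝒜 d a = Γ.edgeProd h𝒜 d (update a e 0) := by
    unfold edgeProd
    congr 2
    funext e'
    by_cases hh : (⟨e'.1, (mem_sort (· ≤ ·)).1 e'.2⟩ : Γ.edges) = e
    · rw [hh, hx]; simp
    · rw [update_of_ne hh]
  rw [h1]
  exact (Γ.edgeProd_linear h𝒜 d a e).map_zero

theorem edgeProd_eq (d : Γ.edges → ℤ) (a : ∀ e, 𝒜 (d e)) : Γ.edgeProd h𝒜 d (fun e => a e) =
    ((Γ.edges.sort (· ≤ ·)).attach.map fun e => (a ⟨e.1, (mem_sort (· ≤ ·)).1 e.2⟩ : A)).prod := by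
  unfold edgeProd
  congr 2
  funext e
  exact h𝒜.proj_same (a _).2

/-- The evaluation of the functionals at all the vertices on fields at all the half-edges and
elements of `A` at all the edges, taken in the order `K`. -/
def evalKey {κ : Type*} [LT κ] (K : Fin Γ.nH ⊕ Γ.edges → κ) (x : Fin Γ.nH → E) (a : Γ.edges → A) : A :=
  ∑ d ∈ Fintype.piFinset fun _ : Fin Γ.nH => hℰ.degrees,
    ∑ d' ∈ Fintype.piFinset fun _ : Γ.edges => h𝒜.degrees,
      koszulSign K Γ.keyOut (Sum.elim d d') • (Γ.vertexProd hℰ I d x * Γ.edgeProd h𝒜 d' a)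

variable {κ : Type*} [LT κ] (K : Fin Γ.nH ⊕ Γ.edges → κ)

theorem evalKey_apply {d : Fin Γ.nH → ℤ} {x : Fin Γ.nH → E} (hx : ∀ h, x h ∈ ℰ (d h))
    {d' : Γ.edges → ℤ} {a : Γ.edges → A} (ha : ∀ e, a e ∈ 𝒜 (d' e)) : Γ.evalKey hℰ I h𝒜 K x a =
    koszulSign K Γ.keyOut (Sum.elim d d') • (Γ.vertexProd hℰ I d x * Γ.edgeProd h𝒜 d' a) := by
  unfold evalKey
  rw [hℰ.sum_degrees hx, h𝒜.sum_degrees ha]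
  · rintro d' ⟨e, he⟩
    rw [Γ.edgeProd_eq_zero h𝒜 he, mul_zero, smul_zero]
  · rintro d ⟨e, he⟩
    refine sum_eq_zero fun d' _ => ?_
    rw [Γ.vertexProd_eq_zero hℰ I he, zero_mul, smul_zero]

theorem evalKey_linear (x : Fin Γ.nH → E) (a : Γ.edges → A) (h : Fin Γ.nH) :
    IsLinearMap 𝕂 fun p => Γ.evalKey hℰ I h𝒜 K (update x h p) a where
  map_add p q := by
    simp only [evalKey, (Γ.vertexProd_linear hℰ I _ x h).map_add, add_mul, smul_add,
      sum_add_distrib]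
  map_smul c p := by
    simp only [evalKey, (Γ.vertexProd_linear hℰ I _ x h).map_smul, smul_mul_assoc, smul_sum]
    simp only [smul_comm c]

theorem evalKey_linear_edge [DecidableEq Γ.edges] (x : Fin Γ.nH → E) (a : Γ.edges → A) (e : Γ.edges) :
    IsLinearMap 𝕂 fun p => Γ.evalKey hℰ I h𝒜 K x (update a e p) where
  map_add p q := by
    simp only [evalKey, (Γ.edgeProd_linear h𝒜 _ a e).map_add, mul_add, smul_add, sum_add_distrib]
  map_smul c p := by
    simp only [evalKey, (Γ.edgeProd_linear h𝒜 _ a e).map_smul, mul_smul_comm, smul_sum]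
    simp only [smul_comm c]

theorem evalKey_continuous :
    Continuous fun z : (Fin Γ.nH → E) × (Γ.edges → A) => Γ.evalKey hℰ I h𝒜 K z.1 z.2 :=
  continuous_finsetSum _ fun d _ => continuous_finsetSum _ fun d' _ =>
    (((Γ.vertexProd_continuous hℰ I d).comp continuous_fst).mul
      ((Γ.edgeProd_continuous h𝒜 d').comp continuous_snd)).zsmul _

/-- An enumeration of the legs. -/
structure LegEnum (l : ℕ) where
  toFun : Fin l → Fin Γ.nH
  injective : Injective toFun
  range : ∀ h, (∃ i, toFun i = h) ↔ Γ.inv h = h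

variable {Γ} {l : ℕ} (ψ : Γ.LegEnum l)

/-- The fields on all the half-edges, given by fields on the legs and tensors at the edges. -/
def LegEnum.field (y : Fin l → E) (w : Γ.edges → E × E × A) : Fin Γ.nH → E :=
  Function.extend ψ.toFun y fun h => if hh : h ∈ Γ.edges then (w ⟨h, hh⟩).1 else
    if hh : Γ.inv h ∈ Γ.edges then (w ⟨Γ.inv h, hh⟩).2.1 else 0

/-- The order in which the fields on the legs, as enumerated, precede the tensors at the edges. -/
def LegEnum.key : Fin Γ.nH ⊕ Γ.edges → ℕ ×ₗ ℕ ×ₗ ℕ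
  | .inl h => Function.extend ψ.toFun (fun i : Fin l => toLex (0, toLex ((i : ℕ), 0)))
      (fun h => toLex (1, toLex (((min h (Γ.inv h) : Fin Γ.nH) : ℕ), if h < Γ.inv h then 0 else 1))) h
  | .inr e => toLex (1, toLex ((e : ℕ), 2))

theorem LegEnum.field_leg (y : Fin l → E) (w : Γ.edges → E × E × A) (i : Fin l) :
    ψ.field y w (ψ.toFun i) = y i := ψ.injective.extend_apply _ _ _

theorem LegEnum.field_of_ne (y : Fin l → E) (w : Γ.edges → E × E × A) {h : Fin Γ.nH}
    (hh : Γ.inv h ≠ h) : ψ.field y w h = if hh : h ∈ Γ.edges then (w ⟨h, hh⟩).1 else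
    if hh : Γ.inv h ∈ Γ.edges then (w ⟨Γ.inv h, hh⟩).2.1 else 0 :=
  Function.extend_apply' _ _ _ fun h1 => hh ((ψ.range h).1 h1)

theorem LegEnum.field_fst (y : Fin l → E) (w : Γ.edges → E × E × A) (e : Γ.edges) :
    ψ.field y w e = (w e).1 := by
  rw [ψ.field_of_ne y w (Γ.not_leg_of_mem_edges e.2), dif_pos e.2]

theorem LegEnum.field_snd (y : Fin l → E) (w : Γ.edges → E × E × A) (e : Γ.edges) :
    ψ.field y w (Γ.inv e) = (w e).2.1 := by
  have h1 : Γ.inv (Γ.inv e) ≠ Γ.inv e := by rw [Γ.inv_inv]; exact (Γ.not_leg_of_mem_edges e.2).symm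
  rw [ψ.field_of_ne y w h1, dif_neg (Γ.inv_notMem_edges e.2), dif_pos (by rw [Γ.inv_inv]; exact e.2)]
  have : (⟨Γ.inv (Γ.inv e), by rw [Γ.inv_inv]; exact e.2⟩ : Γ.edges) = e :=
    Subtype.ext (Γ.inv_inv _)
  rw [this]

/-- To prove a property of all half-edges, it suffices to treat legs and both ends of edges. -/
theorem LegEnum.cases {C : Fin Γ.nH → Prop} (h1 : ∀ i, C (ψ.toFun i)) (h2 : ∀ e ∈ Γ.edges, C e)
    (h3 : ∀ e ∈ Γ.edges, C (Γ.inv e)) (h : Fin Γ.nH) : C h := by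
  by_cases hh : Γ.inv h = h
  · obtain ⟨i, rfl⟩ := (ψ.range h).2 hh
    exact h1 i
  · by_cases he : h ∈ Γ.edges
    · exact h2 h he
    · have := h3 _ (Γ.inv_mem_edges hh he)
      rwa [Γ.inv_inv] at this

theorem LegEnum.ne_edge (i : Fin l) {e : Fin Γ.nH} (he : e ∈ Γ.edges) : ψ.toFun i ≠ e := by
  rintro rfl
  exact Γ.not_leg_of_mem_edges he ((ψ.range _).1 ⟨i, rfl⟩)

theorem LegEnum.ne_inv (i : Fin l) {e : Fin Γ.nH} (he : e ∈ Γ.edges) : ψ.toFun i ≠ Γ.inv e := by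
  intro h
  have := (ψ.range _).1 ⟨i, h⟩
  rw [Γ.inv_inv] at this
  exact Γ.not_leg_of_mem_edges he this.symm

theorem LegEnum.field_update [DecidableEq Γ.edges] (y : Fin l → E) (w : Γ.edges → E × E × A) (s : Γ.edges)
    (p q : E) (a : A) : ψ.field y (update w s (p, q, a)) =
      update (update (ψ.field y w) s p) (Γ.inv s) q := by
  have hs := Γ.not_leg_of_mem_edges s.2
  funext h
  refine ψ.cases (C := fun h => ψ.field y (update w s (p, q, a)) h =
      update (update (ψ.field y w) s p) (Γ.inv s) q h) ?_ ?_ ?_ h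
  · intro i
    rw [update_of_ne (ψ.ne_inv i s.2), update_of_ne (ψ.ne_edge i s.2), ψ.field_leg, ψ.field_leg]
  · intro e he
    have h1 : e ≠ Γ.inv s := by rintro rfl; exact Γ.inv_notMem_edges s.2 he
    rw [update_of_ne h1, ψ.field_fst y _ ⟨e, he⟩]
    by_cases h2 : e = s
    · subst h2; simp
    · rw [update_of_ne h2, update_of_ne (fun h => h2 (congrArg Subtype.val h)),
        ψ.field_fst y _ ⟨e, he⟩]
  · intro e he
    have h1 : Γ.inv e ≠ s := by intro h; exact Γ.inv_notMem_edges he (h ▸ s.2)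
    rw [ψ.field_snd y _ ⟨e, he⟩]
    by_cases h2 : e = s
    · subst h2; simp
    · rw [update_of_ne (fun h => h2 (Γ.inv.injective h)), update_of_ne h1,
        update_of_ne (fun h => h2 (congrArg Subtype.val h)), ψ.field_snd y _ ⟨e, he⟩]

theorem LegEnum.field_update_leg [DecidableEq (Fin l)] (y : Fin l → E) (w : Γ.edges → E × E × A) (i : Fin l) (p : E) :
    ψ.field (update y i p) w = update (ψ.field y w) (ψ.toFun i) p := by
  funext h
  refine ψ.cases (C := fun h => ψ.field (update y i p) w h =
    update (ψ.field y w) (ψ.toFun i) p h) ?_ ?_ ?_ h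
  · intro j
    rw [ψ.field_leg]
    by_cases hj : j = i
    · subst hj; simp
    · rw [update_of_ne hj, update_of_ne (fun h => hj (ψ.injective h)), ψ.field_leg]
  · intro e he
    rw [update_of_ne (ψ.ne_edge i he).symm, ψ.field_fst y _ ⟨e, he⟩, ψ.field_fst _ _ ⟨e, he⟩]
  · intro e he
    rw [update_of_ne (ψ.ne_inv i he).symm, ψ.field_snd y _ ⟨e, he⟩, ψ.field_snd _ _ ⟨e, he⟩]

theorem LegEnum.field_continuous :
    Continuous fun z : (Fin l → E) × (Γ.edges → E × E × A) => ψ.field z.1 z.2 := by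
  refine continuous_pi fun h => ?_
  refine ψ.cases (C := fun h => Continuous fun z : (Fin l → E) × (Γ.edges → E × E × A) =>
    ψ.field z.1 z.2 h) ?_ ?_ ?_ h
  · intro i; simp_rw [ψ.field_leg]; fun_prop
  · intro e he; simp_rw [ψ.field_fst _ _ ⟨e, he⟩]; fun_prop
  · intro e he; simp_rw [ψ.field_snd _ _ ⟨e, he⟩]; fun_prop

theorem exists_amplitudeFun : ∃ Φ : (Fin l → E) →
    ContinuousMultilinearMap 𝕂 (fun _ : Γ.edges => Tensor3 𝕂 E A) A,
      (Continuous fun x : (Fin l → E) × (Γ.edges → Tensor3 𝕂 E A) => Φ x.1 x.2) ∧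
      ∀ y w, Φ y (fun e => Tensor3.pure 𝕂 E A (w e).1 (w e).2.1 (w e).2.2) =
        Γ.evalKey hℰ I h𝒜 ψ.key (ψ.field y w) fun e => (w e).2.2 := by
  refine exists_multi_extension (N := fun y w => Γ.evalKey hℰ I h𝒜 ψ.key (ψ.field y w)
    fun e => (w e).2.2) ?_ ?_
  · intro _ y w s
    have h1 : ∀ p q a, (fun e => (update w s (p, q, a) e).2.2) =
        update (fun e => (w e).2.2) s a := by
      intro p q a
      funext e
      by_cases he : e = s
      · subst he; simp
      · rw [update_of_ne he, update_of_ne he]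
    simp_rw [h1, ψ.field_update]
    refine ⟨fun q a => ?_, fun p a => ?_, fun p q => ?_⟩
    · simp_rw [Function.update_comm (Γ.not_leg_of_mem_edges s.2).symm]
      exact Γ.evalKey_linear hℰ I h𝒜 _ _ _ _
    · exact Γ.evalKey_linear hℰ I h𝒜 _ _ _ _
    · exact Γ.evalKey_linear_edge hℰ I h𝒜 ψ.key _ _ _
  · have h1 : Continuous fun z : (Fin l → E) × (Γ.edges → E × E × A) =>
        (ψ.field z.1 z.2, fun e => (z.2 e).2.2) :=
      ψ.field_continuous.prodMk (by fun_prop)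
    have h2 := (Γ.evalKey_continuous hℰ I h𝒜 ψ.key).comp h1
    simp only [Function.comp_def] at h2
    exact h2

/-- The amplitude as a function of the fields on the legs and the tensors at the edges. -/
def amplitudeFun (y : Fin l → E) : ContinuousMultilinearMap 𝕂 (fun _ : Γ.edges => Tensor3 𝕂 E A) A :=
  (exists_amplitudeFun hℰ I h𝒜 ψ).choose y

theorem amplitudeFun_continuous : Continuous fun x : (Fin l → E) × (Γ.edges → Tensor3 𝕂 E A) =>
    amplitudeFun hℰ I h𝒜 ψ x.1 x.2 := (exists_amplitudeFun hℰ I h𝒜 ψ).choose_spec.1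

theorem amplitudeFun_pure (y : Fin l → E) (w : Γ.edges → E × E × A) :
    amplitudeFun hℰ I h𝒜 ψ y (fun e => Tensor3.pure 𝕂 E A (w e).1 (w e).2.1 (w e).2.2) =
        Γ.evalKey hℰ I h𝒜 ψ.key (ψ.field y w) fun e => (w e).2.2 :=
  (exists_amplitudeFun hℰ I h𝒜 ψ).choose_spec.2 y w

include hℰ h𝒜 in
theorem Tensor3.ext_of_homogeneous {f g : Tensor3 𝕂 E A → A} (hf : IsLinearMap 𝕂 f)
    (hg : IsLinearMap 𝕂 g) (hfc : Continuous f) (hgc : Continuous g) (h : ∀ i j k, ∀ p ∈ ℰ i, ∀ q ∈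
    ℰ j, ∀ a ∈ 𝒜 k, f (Tensor3.pure 𝕂 E A p q a) = g (Tensor3.pure 𝕂 E A p q a)) : f = g := by
  have T := ProjTensor.pure_trilinear (𝕂 := 𝕂) (E := E) (A := A)
  have key : ∀ (D : ProjTensor 𝕂 E A →ₗ[𝕂] A) p q a, D (ProjTensor.pure 𝕂 E A p q a) =
      ∑ i ∈ hℰ.degrees, ∑ j ∈ hℰ.degrees, ∑ k ∈ h𝒜.degrees,
        D (ProjTensor.pure 𝕂 E A (hℰ.proj i p) (hℰ.proj j q) (h𝒜.proj k a)) := by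
    intro D p q a
    have e1 : ∀ q a, ProjTensor.pure 𝕂 E A p q a =
        ∑ i ∈ hℰ.degrees, ProjTensor.pure 𝕂 E A (hℰ.proj i p) q a := by
      intro q a
      conv_lhs => rw [← hℰ.sum_proj p]
      exact map_sum (IsLinearMap.mk' _ (T.left q a)) _ _
    have e2 : ∀ p a, ProjTensor.pure 𝕂 E A p q a =
        ∑ i ∈ hℰ.degrees, ProjTensor.pure 𝕂 E A p (hℰ.proj i q) a := by
      intro p a
      conv_lhs => rw [← hℰ.sum_proj q]
      exact map_sum (IsLinearMap.mk' _ (T.middle p a)) _ _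
    have e3 : ∀ p q, ProjTensor.pure 𝕂 E A p q a =
        ∑ i ∈ h𝒜.degrees, ProjTensor.pure 𝕂 E A p q (h𝒜.proj i a) := by
      intro p q
      conv_lhs => rw [← h𝒜.sum_proj a]
      exact map_sum (IsLinearMap.mk' _ (T.right p q)) _ _
    rw [e1, map_sum]
    refine sum_congr rfl fun i _ => ?_
    rw [e2, map_sum]
    refine sum_congr rfl fun j _ => ?_
    rw [e3, map_sum]
  refine Tensor3.ext_of_pure hf hg hfc hgc fun p q a => ?_
  have e1 := key ((IsLinearMap.mk' f hf).comp (Tensor3.coeL (𝕂 := 𝕂) (E := E) (A := A)).toLinearMap) p q a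
  have e2 := key ((IsLinearMap.mk' g hg).comp (Tensor3.coeL (𝕂 := 𝕂) (E := E) (A := A)).toLinearMap) p q a
  refine e1.trans (Eq.trans ?_ e2.symm)
  refine sum_congr rfl fun i _ => sum_congr rfl fun j _ => sum_congr rfl fun k _ => ?_
  exact h i j k _ (hℰ.proj_mem _ _) _ (hℰ.proj_mem _ _) _ (h𝒜.proj_mem _ _)

include hℰ h𝒜 in
theorem cmm_ext_homogeneous {S : Type*} [Fintype S]
    {f g : ContinuousMultilinearMap 𝕂 (fun _ : S => Tensor3 𝕂 E A) A}
    (h : ∀ w : S → E × E × A, (∀ s, ∃ i j k, (w s).1 ∈ ℰ i ∧ (w s).2.1 ∈ ℰ j ∧ (w s).2.2 ∈ 𝒜 k) →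
      f (fun e => Tensor3.pure 𝕂 E A (w e).1 (w e).2.1 (w e).2.2) =
      g (fun e => Tensor3.pure 𝕂 E A (w e).1 (w e).2.1 (w e).2.2)) : f = g := by
  classical
  have key : ∀ R : Finset S, ∀ t : S → Tensor3 𝕂 E A,
      (∀ s ∉ R, ∃ w : E × E × A, (∃ i j k, w.1 ∈ ℰ i ∧ w.2.1 ∈ ℰ j ∧ w.2.2 ∈ 𝒜 k) ∧
        t s = Tensor3.pure 𝕂 E A w.1 w.2.1 w.2.2) → f t = g t := by
    intro R
    induction R using Finset.induction_on with
    | empty =>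
      intro t ht
      choose w hw hh using fun s => ht s (by simp)
      rw [show t = fun s => _ from funext hh]
      exact h w hw
    | insert s R hs ih =>
      intro t ht
      have : (fun τ => f (update t s τ)) = fun τ => g (update t s τ) := by
        refine Tensor3.ext_of_homogeneous hℰ h𝒜 (f.toMultilinearMap.toLinearMap t s).isLinear
          (g.toMultilinearMap.toLinearMap t s).isLinear
          (f.cont.comp (continuous_const.update s continuous_id))
          (g.cont.comp (continuous_const.update s continuous_id)) fun i j k p hp q hq a ha => ?_
        refine ih _ fun s' hs' => ?_
        by_cases hss : s' = s
        · subst hss; exact ⟨(p, q, a), ⟨i, j, k, hp, hq, ha⟩, by simp⟩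
        · rw [update_of_ne hss]; exact ht s' (by simp [hss, hs'])
      simpa using congrFun this (t s)
  exact ContinuousMultilinearMap.ext fun t => key univ t (by simp)

theorem amplitudeFun_linear [DecidableEq (Fin l)] (y : Fin l → E) (i : Fin l) :
    IsLinearMap 𝕂 fun p => amplitudeFun hℰ I h𝒜 ψ (update y i p) where
  map_add p q := cmm_ext_homogeneous hℰ h𝒜 fun w _ => by
    rw [_root_.add_apply]
    simp_rw [amplitudeFun_pure, ψ.field_update_leg]
    exact (Γ.evalKey_linear hℰ I h𝒜 _ _ _ _).map_add _ _
  map_smul c p := cmm_ext_homogeneous hℰ h𝒜 fun w _ => by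
    rw [_root_.smul_apply]
    simp_rw [amplitudeFun_pure, ψ.field_update_leg]
    exact (Γ.evalKey_linear hℰ I h𝒜 _ _ _ _).map_smul _ _

/-- The amplitude with given enumeration of the legs and tensors at the edges, the tensor at an edge
being assigned to the smaller one of its half-edges. -/
def ampl (t : Fin Γ.nH → Tensor3 𝕂 E A) : Multi 𝕂 E A l where
  toFun y := amplitudeFun hℰ I h𝒜 ψ y fun e => t e
  map_update_add' y i p q := by
    exact congrArg (fun f => f fun e : Γ.edges => t e) ((amplitudeFun_linear hℰ I h𝒜 ψ y i).map_add p q)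
  map_update_smul' y i c p := by
    exact congrArg (fun f => f fun e : Γ.edges => t e) ((amplitudeFun_linear hℰ I h𝒜 ψ y i).map_smul c p)
  cont := (amplitudeFun_continuous hℰ I h𝒜 ψ).comp
    (by fun_prop : Continuous fun y : Fin l → E => (y, fun e : Γ.edges => t e))

theorem ampl_continuous : Continuous fun x : (Fin Γ.nH → Tensor3 𝕂 E A) × (Fin l → E) =>
    ampl hℰ I h𝒜 ψ x.1 x.2 :=
  (amplitudeFun_continuous hℰ I h𝒜 ψ).comp
    (by fun_prop : Continuous fun x : (Fin Γ.nH → Tensor3 𝕂 E A) × (Fin l → E) =>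
      (x.2, fun e : Γ.edges => x.1 e))

theorem ampl_apply {d : Fin Γ.nH → ℤ} {x : Fin Γ.nH → E} (hx : ∀ h, x h ∈ ℰ (d h))
    {d' : Γ.edges → ℤ} {a : Γ.edges → A} (ha : ∀ e, a e ∈ 𝒜 (d' e)) {t : Fin Γ.nH → Tensor3 𝕂 E A}
    (ht : ∀ e : Γ.edges, t e = Tensor3.pure 𝕂 E A (x e) (x (Γ.inv e)) (a e)) :
    ampl hℰ I h𝒜 ψ t (fun i => x (ψ.toFun i)) = koszulSign ψ.key Γ.keyOut (Sum.elim d d') •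
      (Γ.vertexProd hℰ I d x * Γ.edgeProd h𝒜 d' a) := by
  change amplitudeFun hℰ I h𝒜 ψ (fun i => x (ψ.toFun i)) (fun e => t e) = _
  rw [show (fun e : Γ.edges => t e) = fun e : Γ.edges => Tensor3.pure 𝕂 E A
    (x e, x (Γ.inv e), a e).1 (x e, x (Γ.inv e), a e).2.1 (x e, x (Γ.inv e), a e).2.2 from funext ht,
    amplitudeFun_pure (w := fun e : Γ.edges => (x e, x (Γ.inv e), a e))]
  have : ψ.field (fun i => x (ψ.toFun i)) (fun e : Γ.edges => (x e, x (Γ.inv e), a e)) = x := by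
    funext h
    refine ψ.cases (C := fun h => ψ.field (fun i => x (ψ.toFun i))
      (fun e : Γ.edges => (x e, x (Γ.inv e), a e)) h = x h) ?_ ?_ ?_ h
    · intro i; rw [ψ.field_leg]
    · intro e he; rw [ψ.field_fst _ _ ⟨e, he⟩]
    · intro e he; rw [ψ.field_snd _ _ ⟨e, he⟩]
  rw [this]
  exact Γ.evalKey_apply hℰ I h𝒜 _ hx ha

variable (Γ) in
/-- The increasing enumeration of the legs. -/
def sortedLegs (hl : Γ.legs.card = l) : Γ.LegEnum l where
  toFun i := (Γ.legs.orderIsoOfFin hl i).1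
  injective i j h := (Γ.legs.orderIsoOfFin hl).injective (Subtype.ext h)
  range h := by
    constructor
    · rintro ⟨i, rfl⟩
      exact (mem_filter.1 (Γ.legs.orderIsoOfFin hl i).2).2
    · exact fun hh => ⟨(Γ.legs.orderIsoOfFin hl).symm ⟨h, by simpa [legs] using hh⟩, by simp⟩

theorem sortedLegs_key (hl : Γ.legs.card = l) (i j : Fin Γ.nH ⊕ Γ.edges) :
    (Γ.sortedLegs hl).key i < (Γ.sortedLegs hl).key j ↔ Γ.keyIn i < Γ.keyIn j := by
  have h1 : ∀ i, (Γ.sortedLegs hl).key (.inl ((Γ.sortedLegs hl).toFun i)) =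
      toLex (0, toLex ((i : ℕ), 0)) := fun i => by
    simp only [LegEnum.key]
    exact (Γ.sortedLegs hl).injective.extend_apply _ _ _
  have h2 : ∀ i, Γ.keyIn (.inl ((Γ.sortedLegs hl).toFun i)) =
      toLex (0, toLex (((Γ.sortedLegs hl).toFun i : ℕ), 0)) := fun i => by
    have := ((Γ.sortedLegs hl).range _).1 ⟨i, rfl⟩
    simp [keyIn, this]
  have h3 : ∀ h, Γ.inv h ≠ h → (Γ.sortedLegs hl).key (.inl h) = Γ.keyIn (.inl h) := fun h hh => by
    simp only [LegEnum.key, keyIn, if_neg hh]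
    rw [Function.extend_apply' _ _ _ fun h1 => hh (((Γ.sortedLegs hl).range h).1 h1)]
    rfl
  have h4 : ∀ e, (Γ.sortedLegs hl).key (.inr e) = Γ.keyIn (.inr e) := fun e => rfl
  have h5 : ∀ i, ((Γ.sortedLegs hl).key i = Γ.keyIn i ∧ ∃ z, Γ.keyIn i = toLex (1, z)) ∨
      ∃ j, i = .inl ((Γ.sortedLegs hl).toFun j) := by
    rintro (h | e)
    · by_cases hh : Γ.inv h = h
      · obtain ⟨i, rfl⟩ := ((Γ.sortedLegs hl).range h).2 hh
        exact Or.inr ⟨i, rfl⟩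
      · exact Or.inl ⟨h3 h hh, ⟨_, by simp only [keyIn, if_neg hh]; rfl⟩⟩
    · exact Or.inl ⟨h4 e, ⟨_, rfl⟩⟩
  rcases h5 i with ⟨hi, zi, hi'⟩ | ⟨i, rfl⟩ <;> rcases h5 j with ⟨hj, zj, hj'⟩ | ⟨j, rfl⟩
  · rw [hi, hj]
  · rw [hi, h1, h2, hi']; simp [toLex_lt_toLex]
  · rw [hj, h1, h2, hj']; simp [toLex_lt_toLex]
  · rw [h1, h1, h2, h2]
    simp only [toLex_lt_toLex, lt_self_iff_false, false_or, true_and, and_false, or_false]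
    exact ((Γ.legs.orderIsoOfFin hl).lt_iff_lt (x := i) (y := j)).symm

theorem isAmplitude_ampl (hl : Γ.legs.card = l) (P : Tensor3 𝕂 E A) :
    Γ.IsAmplitude 𝒜 I P hl (ampl hℰ I h𝒜 (Γ.sortedLegs hl) fun _ => P) := by
  refine ⟨{ toFun := amplitudeFun hℰ I h𝒜 (Γ.sortedLegs hl)
            map_update_add' := fun y i p q => ?_
            map_update_smul' := fun y i c p => ?_ }, ?_, fun y => rfl⟩
  · exact (amplitudeFun_linear hℰ I h𝒜 (Γ.sortedLegs hl) y i).map_add p q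
  · exact (amplitudeFun_linear hℰ I h𝒜 (Γ.sortedLegs hl) y i).map_smul c p
  · intro d x d' a
    have h1 := ampl_apply hℰ I h𝒜 (Γ.sortedLegs hl) (fun h => (x h).2) (fun e => (a e).2)
      (t := fun h => if hh : h ∈ Γ.edges then Tensor3.pure 𝕂 E A (x h) (x (Γ.inv h)) (a ⟨h, hh⟩)
        else 0) (fun e => by simp)
    refine Eq.trans ?_ (h1.trans ?_)
    · change _ = amplitudeFun hℰ I h𝒜 (Γ.sortedLegs hl) _ _
      refine congrArg (amplitudeFun hℰ I h𝒜 (Γ.sortedLegs hl) _) (funext fun e => ?_)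
      simp
    · rw [vertexProd_eq, edgeProd_eq, evaluate]
      congr 1
      refine koszulSign_congr fun i j => ?_
      rw [sortedLegs_key]

include hℰ h𝒜 in
theorem IsAmplitude.eq {P : Tensor3 𝕂 E A} {hl : Γ.legs.card = l} {F : Multi 𝕂 E A l}
    (hF : Γ.IsAmplitude 𝒜 I P hl F) : F = ampl hℰ I h𝒜 (Γ.sortedLegs hl) fun _ => P := by
  obtain ⟨Φ, h1, h2⟩ := hF
  refine multi_ext hℰ fun d y hy => ?_
  rw [h2]
  change _ = amplitudeFun hℰ I h𝒜 (Γ.sortedLegs hl) y fun _ => P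
  congr 1
  refine cmm_ext_homogeneous hℰ h𝒜 fun w hw => ?_
  have h3 : ∀ h, ∃ n, (Γ.sortedLegs hl).field y w h ∈ ℰ n := by
    refine (Γ.sortedLegs hl).cases ?_ ?_ ?_
    · intro i; rw [LegEnum.field_leg]; exact ⟨_, hy i⟩
    · intro e he
      obtain ⟨i, -, -, hi, -, -⟩ := hw ⟨e, he⟩
      rw [LegEnum.field_fst _ _ _ ⟨e, he⟩]; exact ⟨i, hi⟩
    · intro e he
      obtain ⟨-, i, -, -, hi, -⟩ := hw ⟨e, he⟩
      rw [LegEnum.field_snd _ _ _ ⟨e, he⟩]; exact ⟨i, hi⟩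
  choose dH hdH using h3
  choose _ _ dA _ _ hdA using hw
  have h4 := h1 dH (fun h => ⟨_, hdH h⟩) dA (fun e => ⟨_, hdA e⟩)
  rw [amplitudeFun_pure, Γ.evalKey_apply hℰ I h𝒜 _ hdH hdA]
  have h7 : (fun i => (Γ.sortedLegs hl).field y w (Γ.legs.orderIsoOfFin hl i).1) = y :=
    funext fun i => (Γ.sortedLegs hl).field_leg y w i
  simp only [h7] at h4
  have h8 : ∀ e : Γ.edges, (Γ.sortedLegs hl).field y w e = (w e).1 :=
    fun e => LegEnum.field_fst _ y w e
  have h9 : ∀ e : Γ.edges, (Γ.sortedLegs hl).field y w (Γ.inv e) = (w e).2.1 :=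
    fun e => LegEnum.field_snd _ y w e
  simp only [h8, h9] at h4
  rw [h4, evaluate]
  have h10 := Γ.vertexProd_eq hℰ I dH fun h => ⟨_, hdH h⟩
  have h11 := Γ.edgeProd_eq h𝒜 dA fun h => ⟨_, hdA h⟩
  simp only at h10 h11
  rw [h10, h11]
  congr 1
  refine koszulSign_congr fun i j => ?_
  rw [sortedLegs_key]

include hℰ h𝒜 in
theorem existsUnique_isAmplitude (hl : Γ.legs.card = l) (P : Tensor3 𝕂 E A) :
    ∃! F, Γ.IsAmplitude 𝒜 I P hl F :=
  ⟨_, isAmplitude_ampl hℰ I h𝒜 hl P, fun _ hF => hF.eq hℰ I h𝒜⟩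

theorem amplitude_eq (hl : Γ.legs.card = l) (P : Tensor3 𝕂 E A) :
    Γ.amplitude 𝒜 I P hl = ampl hℰ I h𝒜 (Γ.sortedLegs hl) fun _ => P := by
  have h : ∃ F, Γ.IsAmplitude 𝒜 I P hl F := ⟨_, isAmplitude_ampl hℰ I h𝒜 hl P⟩
  rw [amplitude, dif_pos h]
  exact h.choose_spec.eq hℰ I h𝒜

end RibbonGraph


/-! ### Cutting an edge -/

section PullSign

variable {ε : Type*} [Fintype ε] [DecidableEq ε] {l : ℕ}

/-- Legs, followed by triples of objects indexed by edges. -/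
def tripleKey (v : ε → ℕ) : Fin l ⊕ ε × Fin 3 → ℕ ×ₗ ℕ ×ₗ ℕ
  | .inl i => toLex (0, toLex ((i : ℕ), 0))
  | .inr (e, s) => toLex (1, toLex (v e, (s : ℕ)))

/-- The same order, with the triple at `a` broken up: its first two members are put behind the legs,
and its third member is put last. -/
def pulledKey (v : ε → ℕ) (a : ε) : Fin l ⊕ ε × Fin 3 → ℕ ×ₗ ℕ ×ₗ ℕ
  | .inl i => toLex (0, toLex ((i : ℕ), 0))
  | .inr (e, s) => if e = a then (if s = 2 then toLex (2, toLex (0, 0)) else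
      toLex (0, toLex (l + (s : ℕ), 0))) else toLex (1, toLex (v e, (s : ℕ)))

theorem koszulSign_pulledKey {v : ε → ℕ} (hv : Injective v) (a : ε) (D : Fin l → ℤ)
    (D3 : ε → Fin 3 → ℤ) (h : ∀ e, ∑ s, D3 e s = 0) :
    koszulSign (tripleKey v) (pulledKey v a) (Sum.elim D fun z => D3 z.1 z.2) = 1 := by
  let r : Fin l ⊕ ε × Fin 3 → Fin l ⊕ ε × Fin 3 := Sum.elim .inl fun z =>
    if z.1 = a then .inr z else .inr (z.1, 2)
  rw [koszulSign_block r (u' := tripleKey v) (w' := pulledKey v a)]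
  · refine koszulSign_eq_one ?_
    have h0 : ∀ z : ε × Fin 3, z.1 ≠ a → ¬ Odd (∑ i with r i = .inr z,
        (Sum.elim D fun z => D3 z.1 z.2 : Fin l ⊕ ε × Fin 3 → ℤ) i) := by
      rintro ⟨e, s⟩ he
      simp only at he
      rw [sum_filter, Fintype.sum_sum_type]
      simp only [r, Sum.elim_inl, reduceCtorEq, if_false, sum_const_zero, zero_add, Sum.elim_inr]
      rw [Fintype.sum_prod_type, sum_eq_single e]
      · simp only [he, if_false, Sum.inr.injEq, Prod.mk.injEq, true_and]
        split_ifs with hs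
        · rw [h]; simp
        · simp
      · intro e' _ he'
        refine sum_eq_zero fun s' _ => if_neg ?_
        split_ifs
        · simp [he']
        · simp [he']
      · simp
    rintro (i | ⟨e, s⟩) (j | ⟨e', s'⟩) hi hj hij
    · simpa [pulledKey, tripleKey] using hij.le
    · by_cases he' : e' = a
      · subst he'
        fin_cases s' <;> simp [pulledKey, toLex_lt_toLex] <;> omega
      · exact absurd hj (h0 (e', s') he')
    · simp [tripleKey, toLex_lt_toLex] at hij
    · by_cases he' : e' = a
      · by_cases he : e = a
        · subst he; subst he'
          fin_cases s <;> fin_cases s' <;> simp [pulledKey, tripleKey, toLex_lt_toLex] at hij ⊢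
        · exact absurd hi (h0 (e, s) he)
      · exact absurd hj (h0 (e', s') he')
  · rintro (i | ⟨e, s⟩) (j | ⟨e', s'⟩) hij
    · rfl
    · by_cases he' : e' = a <;> simp [r, he', tripleKey, toLex_lt_toLex]
    · by_cases he : e = a <;> simp [r, he, tripleKey, toLex_lt_toLex]
    · by_cases hee : e = e'
      · subst hee
        by_cases he : e = a
        · simp [r, he]
        · simp [r, he] at hij
      · have := hv.ne hee
        by_cases he : e = a <;> by_cases he' : e' = a <;>
          simp [r, he, he', tripleKey, toLex_lt_toLex] <;> grind
  · rintro (i | ⟨e, s⟩) (j | ⟨e', s'⟩) hij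
    · rfl
    · by_cases he' : e' = a <;> simp [r, he', pulledKey, toLex_lt_toLex]
    · by_cases he : e = a <;> simp [r, he, pulledKey, toLex_lt_toLex]
    · by_cases hee : e = e'
      · subst hee
        by_cases he : e = a
        · simp [r, he]
        · simp [r, he] at hij
      · have := hv.ne hee
        by_cases he : e = a
        · subst he
          have he' : ¬ e' = e := fun h => hee h.symm
          simp only [r, Sum.elim_inr, if_true, he', if_false, pulledKey]
          split_ifs <;> simp [toLex_lt_toLex]
        · by_cases he' : e' = a
          · subst he'
            simp only [r, Sum.elim_inr, if_true, he, if_false, pulledKey]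
            split_ifs <;> simp [toLex_lt_toLex]
          · simp [r, he, he', pulledKey, toLex_lt_toLex]
            grind
  · rintro (i | ⟨e, s⟩) (j | ⟨e', s'⟩) hij hlt
    · simpa [pulledKey, tripleKey] using hlt.le
    · by_cases he' : e' = a <;> simp [r, he'] at hij
    · by_cases he : e = a <;> simp [r, he] at hij
    · by_cases he : e = a <;> by_cases he' : e' = a
      · simp [r, he, he'] at hij
        subst he; subst he'; simp [hij] at hlt
      · simp [r, he, he'] at hij; exact absurd hij.1.symm he'
      · simp [r, he, he'] at hij
      · simp [r, he, he'] at hij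
        subst hij
        simp [pulledKey, tripleKey, he, toLex_lt_toLex] at hlt ⊢
        exact hlt.le

end PullSign

variable [GradedAlgebra 𝒜] (h𝒜 : IsTopologicalGrading 𝒜)

section Cut

namespace RibbonGraph

variable (Γ : RibbonGraph) (I : Functional A ℰ)

/-- Cutting the edge through `a` into two legs. -/
@[reducible]
def cut (a : Fin Γ.nH) : RibbonGraph where
  nH := Γ.nH
  nV := Γ.nV
  root := Γ.root
  inv := Γ.inv * swap a (Γ.inv a)
  inv_inv h := by
    simp only [Equiv.Perm.mul_apply]
    by_cases h1 : h = a
    · subst h1; simp [Γ.inv_inv]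
    · by_cases h2 : h = Γ.inv a
      · subst h2; simp
      · rw [swap_apply_of_ne_of_ne h1 h2, swap_apply_of_ne_of_ne, Γ.inv_inv]
        · rintro h3; apply h2; rw [← h3, Γ.inv_inv]
        · exact fun h3 => h1 (Γ.inv.injective h3)
  cyc := Γ.cyc
  root_cyc := Γ.root_cyc
  genus := Γ.genus
  bdry := Γ.bdry

theorem cut_inv (a h : Fin Γ.nH) : (Γ.cut a).inv h = if h = a ∨ h = Γ.inv a then h else Γ.inv h := by
  change Γ.inv (swap a (Γ.inv a) h) = _
  by_cases h1 : h = a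
  · subst h1; simp [Γ.inv_inv]
  · by_cases h2 : h = Γ.inv a
    · subst h2; simp
    · rw [swap_apply_of_ne_of_ne h1 h2, if_neg (by tauto)]

theorem cut_edges (a : Fin Γ.nH) (h : Fin Γ.nH) :
    h ∈ (Γ.cut a).edges ↔ h ∈ Γ.edges ∧ h ≠ a ∧ h ≠ Γ.inv a := by
  have h1 : h ∈ (Γ.cut a).edges ↔ h < (Γ.cut a).inv h := mem_edges _
  rw [h1, mem_edges, cut_inv]
  by_cases hh : h = a ∨ h = Γ.inv a
  · rw [if_pos hh]; simp; tauto
  · rw [if_neg hh]; tauto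

variable {Γ} {l : ℕ} (ψ : Γ.LegEnum l)

/-- The enumeration of the legs after cutting an edge, the new legs being put last. -/
def LegEnum.cut (a : Fin Γ.nH) (ha : Γ.inv a ≠ a) : (Γ.cut a).LegEnum (l + 2) where
  toFun := append ψ.toFun ![a, Γ.inv a]
  injective := by
    have h1 : ∀ i, ψ.toFun i ≠ a := by rintro i rfl; exact ha ((ψ.range _).1 ⟨i, rfl⟩)
    have h2 : ∀ i, ψ.toFun i ≠ Γ.inv a := by
      intro i h
      have := (ψ.range _).1 ⟨i, h⟩
      rw [Γ.inv_inv] at this; exact ha this.symm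
    refine Fin.append_injective_iff.2 ⟨ψ.injective, ?_, ?_⟩
    · intro i j h
      fin_cases i <;> fin_cases j <;> simp at h ⊢
      · exact ha h.symm
      · exact ha h
    · intro i j
      fin_cases j
      · exact h1 i
      · exact h2 i
  range h := by
    rw [show (Γ.cut a).inv h = _ from Γ.cut_inv a h]
    constructor
    · rintro ⟨i, rfl⟩
      refine addCases (fun i => ?_) (fun i => ?_) i
      · rw [append_left]
        have := (ψ.range _).1 ⟨i, rfl⟩
        rw [this]; simp
      · rw [append_right]
        fin_cases i <;> simp
    · intro hh
      split_ifs at hh with h1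
      · rcases h1 with h1 | h1
        · exact ⟨natAdd l 0, by rw [append_right, h1]; rfl⟩
        · exact ⟨natAdd l 1, by rw [append_right, h1]; rfl⟩
      · obtain ⟨i, rfl⟩ := (ψ.range h).2 hh
        exact ⟨castAdd 2 i, by rw [append_left]⟩

/-- The legs and the two half-edges and the coefficient at each edge. -/
def LegEnum.pos : Fin l ⊕ Γ.edges × Fin 3 → Fin Γ.nH ⊕ Γ.edges
  | .inl i => .inl (ψ.toFun i)
  | .inr (e, s) => if s = 0 then .inl e else if s = 1 then .inl (Γ.inv e) else .inr e

theorem LegEnum.pos_bijective : Function.Bijective ψ.pos := by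
  constructor
  · rintro (i | ⟨e, s⟩) (j | ⟨e', s'⟩) h
    · simp only [LegEnum.pos, Sum.inl.injEq] at h
      rw [ψ.injective h]
    · have h1 := ψ.ne_edge i e'.2
      have h2 := ψ.ne_inv i e'.2
      fin_cases s' <;> simp [pos, h1, h2] at h
    · have h1 := (ψ.ne_edge j e.2).symm
      have h2 := (ψ.ne_inv j e.2).symm
      fin_cases s <;> simp [pos, h1, h2] at h
    · have h1 : (e : Fin Γ.nH) ≠ Γ.inv e' := by
        intro h; exact Γ.inv_notMem_edges e'.2 (h ▸ e.2)
      have h2 : Γ.inv e ≠ e' := by intro h; exact Γ.inv_notMem_edges e.2 (h ▸ e'.2)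
      fin_cases s <;> fin_cases s' <;> simp [pos, h1, h2] at h ⊢ <;> exact h
  · rintro (h | e)
    · refine ψ.cases (C := fun h => ∃ z, ψ.pos z = .inl h) ?_ ?_ ?_ h
      · intro i; exact ⟨.inl i, rfl⟩
      · intro e he; exact ⟨.inr (⟨e, he⟩, 0), by simp [pos]⟩
      · intro e he; exact ⟨.inr (⟨e, he⟩, 1), by simp [pos]⟩
    · exact ⟨.inr (e, 2), by simp [pos]⟩

theorem LegEnum.key_leg (i : Fin l) : ψ.key (.inl (ψ.toFun i)) = toLex (0, toLex ((i : ℕ), 0)) := by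
  simp only [LegEnum.key]
  exact ψ.injective.extend_apply _ _ _

theorem LegEnum.key_of_ne {h : Fin Γ.nH} (hh : Γ.inv h ≠ h) : ψ.key (.inl h) =
    toLex (1, toLex (((min h (Γ.inv h) : Fin Γ.nH) : ℕ), if h < Γ.inv h then 0 else 1)) := by
  simp only [LegEnum.key]
  exact Function.extend_apply' _ _ _ fun h1 => hh ((ψ.range h).1 h1)

theorem LegEnum.key_edge {e : Fin Γ.nH} (he : e ∈ Γ.edges) :
    ψ.key (.inl e) = toLex (1, toLex ((e : ℕ), 0)) := by
  rw [ψ.key_of_ne (Γ.not_leg_of_mem_edges he)]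
  rw [mem_edges] at he
  rw [min_eq_left he.le, if_pos he]

theorem LegEnum.key_inv {e : Fin Γ.nH} (he : e ∈ Γ.edges) :
    ψ.key (.inl (Γ.inv e)) = toLex (1, toLex ((e : ℕ), 1)) := by
  rw [ψ.key_of_ne (by rw [Γ.inv_inv]; exact (Γ.not_leg_of_mem_edges he).symm), Γ.inv_inv]
  rw [mem_edges] at he
  rw [min_eq_right he.le, if_neg he.asymm]

theorem LegEnum.key_pos (z : Fin l ⊕ Γ.edges × Fin 3) :
    ψ.key (ψ.pos z) = tripleKey (fun e : Γ.edges => ((e : Fin Γ.nH) : ℕ)) z := by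
  rcases z with i | ⟨e, s⟩
  · exact ψ.key_leg i
  · fin_cases s
    · simpa [pos, tripleKey] using ψ.key_edge e.2
    · simpa [pos, tripleKey] using ψ.key_inv e.2
    · simp [pos, tripleKey, key]

theorem LegEnum.key_injective : Injective ψ.key := by
  have h : Injective (ψ.key ∘ ψ.pos) := by
    have : ψ.key ∘ ψ.pos = tripleKey fun e : Γ.edges => ((e : Fin Γ.nH) : ℕ) := funext ψ.key_pos
    rw [this]
    rintro (i | ⟨e, s⟩) (j | ⟨e', s'⟩) h
    · simpa [tripleKey, Fin.ext_iff] using h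
    · simp [tripleKey] at h
    · simp [tripleKey] at h
    · simp [tripleKey, Fin.val_inj] at h
      rw [h.1, h.2]
  exact Function.Injective.of_comp_right h ψ.pos_bijective.2

theorem keyOut_injective : Injective Γ.keyOut := by
  rintro (h | e) (h' | e') hh
  · simp [keyOut, Fin.val_inj] at hh; rw [hh.2]
  · simp [keyOut] at hh
  · simp [keyOut] at hh
  · simp [keyOut, Fin.val_inj] at hh; rw [hh]

/-- The order of evaluation, with the coefficient at the edge `a` put last. -/
def keyOutLast (a : Γ.edges) : Fin Γ.nH ⊕ Γ.edges → ℕ ×ₗ ℕ ×ₗ ℕ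
  | .inl h => Γ.keyOut (.inl h)
  | .inr e => if e = a then toLex (1, toLex (Γ.nH, 0)) else Γ.keyOut (.inr e)

theorem keyOutLast_injective (a : Γ.edges) : Injective (keyOutLast a) := by
  have h1 : ∀ e : Γ.edges, ((e : Fin Γ.nH) : ℕ) ≠ Γ.nH := fun e => (e : Fin Γ.nH).2.ne
  rintro (h | e) (h' | e') hh
  · exact keyOut_injective hh
  · simp only [keyOutLast] at hh
    split_ifs at hh <;> simp [keyOut] at hh
  · simp only [keyOutLast] at hh
    split_ifs at hh <;> simp [keyOut] at hh
  · simp only [keyOutLast] at hh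
    split_ifs at hh with h2 h3 h3
    · rw [h2, h3]
    · simp [keyOut] at hh; exact absurd hh.symm (h1 e')
    · simp [keyOut] at hh; exact absurd hh (h1 e)
    · exact keyOut_injective hh

theorem edgeProd_eq_map (d : Γ.edges → ℤ) (a : Γ.edges → A) : Γ.edgeProd h𝒜 d a = ((Γ.edges.sort (·
    ≤ ·)).map fun h => if hh : h ∈ Γ.edges then h𝒜.proj (d ⟨h, hh⟩) (a ⟨h, hh⟩) else 0).prod := by
  unfold edgeProd
  conv_rhs => rw [← List.attach_map_subtype_val (Γ.edges.sort (· ≤ ·)), List.map_map]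
  congr 2
  funext e
  simp [(mem_sort (· ≤ ·)).1 e.2]

variable (hc : IsGradedCommutative 𝒜)

include hc in
theorem edgeProd_last (a : Γ.edges) (d : Γ.edges → ℤ) (dH : Fin Γ.nH → ℤ) (α : Γ.edges → A) :
    Γ.edgeProd h𝒜 d α = koszulSign Γ.keyOut (keyOutLast a) (Sum.elim dH d) •
      ((Γ.cut a).edgeProd h𝒜 (fun e => d ⟨e.1, ((Γ.cut_edges a e.1).1 e.2).1⟩)
        (fun e => α ⟨e.1, ((Γ.cut_edges a e.1).1 e.2).1⟩) * h𝒜.proj (d a) (α a)) := by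
  let f : Fin Γ.nH → A := fun h => if hh : h ∈ Γ.edges then h𝒜.proj (d ⟨h, hh⟩) (α ⟨h, hh⟩) else 0
  let D : Fin Γ.nH → ℤ := fun h => if hh : h ∈ Γ.edges then d ⟨h, hh⟩ else 0
  let L₂ : List (Fin Γ.nH) := (Γ.cut a).edges.sort (· ≤ ·) ++ [a.1]
  let w : Fin Γ.nH → ℕ := fun h => if h = a then Γ.nH else h
  have hmem : ∀ h : Fin Γ.nH, h ∈ (Γ.cut a).edges ↔ h ∈ Γ.edges ∧ h ≠ a := by
    intro h
    rw [cut_edges]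
    refine ⟨fun hh => ⟨hh.1, hh.2.1⟩, fun hh => ⟨hh.1, hh.2, ?_⟩⟩
    rintro rfl
    exact Γ.inv_notMem_edges a.2 hh.1
  have hn : (Γ.edges.sort (· ≤ ·)).Nodup := Finset.sort_nodup _ _
  have hn2 : ((Γ.cut a).edges.sort (· ≤ ·)).Nodup := Finset.sort_nodup _ _
  have hm2 : ∀ h : Fin Γ.nH, h ∈ (Γ.cut a).edges.sort (· ≤ ·) ↔ h ∈ Γ.edges ∧ h ≠ a := fun h => by
    rw [← hmem]; exact mem_sort _
  have hp : (Γ.edges.sort (· ≤ ·)).Perm L₂ := by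
    refine (List.perm_ext_iff_of_nodup hn ?_).2 fun h => ?_
    · refine List.nodup_append.2 ⟨hn2, by simp, ?_⟩
      intro x hx y hy
      simp only [List.mem_singleton] at hy
      rw [hy]; exact ((hm2 x).1 hx).2
    · rw [mem_sort, List.mem_append, hm2, List.mem_singleton]
      by_cases h1 : h = a
      · simp [h1]
      · simp [h1]
  have h1 := hc.list_prod_perm hp hn f D (fun h => by
    by_cases hh : h ∈ Γ.edges
    · simp only [f, D, dif_pos hh]; exact h𝒜.proj_mem _ _
    · simp only [f, D, dif_neg hh]; exact Submodule.zero_mem _) (id : Fin Γ.nH → Fin Γ.nH) w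
    injective_id (by
      intro x y hxy
      simp only [w] at hxy
      have := x.2
      have := y.2
      split_ifs at hxy with h1 h2 h2
      · rw [h1, h2]
      · omega
      · omega
      · exact Fin.ext hxy)
    (Finset.sortedLT_sort Γ.edges).pairwise (by
      refine List.pairwise_append.2 ⟨?_, by simp, ?_⟩
      · have h3 : ((Γ.cut a).edges.sort (· ≤ ·)).Pairwise (· < ·) :=
          (Finset.sortedLT_sort (Γ.cut a).edges).pairwise
        refine List.Pairwise.imp_of_mem (fun {x y} hx hy hxy => ?_) h3
        simp only [w]
        rw [if_neg ((hm2 x).1 hx).2, if_neg ((hm2 y).1 hy).2]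
        exact hxy
      · intro x hx y hy
        simp only [List.mem_singleton] at hy
        simp only [w]
        rw [if_neg ((hm2 x).1 hx).2, if_pos hy]
        exact x.2)
  rw [edgeProd_eq_map, edgeProd_eq_map]
  refine h1.trans ?_
  congr 1
  · rw [koszulSign_sum, koszulSign_eq_one (u := Γ.keyOut ∘ Sum.inl), one_mul,
      koszulSign_comp_injective (Subtype.val : Γ.edges → Fin Γ.nH) Subtype.val_injective]
    · refine koszulSign_congr fun i j => ?_
      have hi := i.1.2
      have hj := j.1.2
      simp only [Function.comp, id, mem_sort, i.2, j.2, if_true, D, dif_pos, Sum.elim_inr,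
        keyOut, keyOutLast, w, Subtype.ext_iff, Fin.lt_def]
      refine and_congr_right fun _ => and_congr_right fun _ => and_congr ?_ ?_
      · simp [toLex_lt_toLex]
      · split_ifs <;> simp [toLex_lt_toLex]
    · intro i j hi hj _ _
      simp only [mem_sort] at hi hj
      refine ⟨⟨i, ?_⟩, ⟨j, ?_⟩, rfl, rfl⟩
      · by_contra h; rw [if_neg h] at hi; simp at hi
      · by_contra h; rw [if_neg h] at hj; simp at hj
    · intro i j _ _ h
      simpa [keyOutLast] using h.asymm
    · intro i j
      constructor
      · intro _
        simp only [keyOutLast]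
        split_ifs <;> simp [keyOut, toLex_lt_toLex]
      · intro h
        simp [keyOut, toLex_lt_toLex] at h
  · rw [List.map_append, List.prod_append]
    congr 1
    · congr 1
      refine List.map_congr_left fun h hh => ?_
      have h2 := (hm2 h).1 hh
      simp only [f]
      rw [dif_pos h2.1]
      rw [dif_pos ((hmem h).2 h2)]
    · simp [f, a.2]

theorem LegEnum.cut_key_pos (a : Γ.edges) (z : Fin l ⊕ Γ.edges × Fin 3) (hz : z ≠ .inr (a, 2)) :
    ∃ z' : Fin Γ.nH ⊕ (Γ.cut a).edges, Sum.map id (fun e => ⟨e.1, ((Γ.cut_edges a e.1).1 e.2).1⟩) z' =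
      ψ.pos z ∧ (ψ.cut a (Γ.not_leg_of_mem_edges a.2)).key z' =
      pulledKey (fun e : Γ.edges => ((e : Fin Γ.nH) : ℕ)) a z := by
  have ha := Γ.not_leg_of_mem_edges a.2
  have hmem : ∀ e : Γ.edges, e ≠ a → (e : Fin Γ.nH) ∈ (Γ.cut a).edges := by
    intro e he
    rw [cut_edges]
    refine ⟨e.2, fun h => he (Subtype.ext h), fun h => Γ.inv_notMem_edges a.2 (h ▸ e.2)⟩
  have hinv : ∀ e : Γ.edges, e ≠ a → (Γ.cut a).inv e.1 = Γ.inv e := by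
    intro e he
    rw [cut_inv, if_neg]
    rintro (h | h)
    · exact he (Subtype.ext h)
    · exact Γ.inv_notMem_edges a.2 (h ▸ e.2)
  rcases z with i | ⟨e, s⟩
  · refine ⟨.inl (ψ.toFun i), rfl, ?_⟩
    have h1 := (ψ.cut a ha).key_leg (castAdd 2 i)
    have h2 : (ψ.cut a ha).toFun (castAdd 2 i) = ψ.toFun i := append_left _ _ _
    rw [h2] at h1
    exact h1
  · by_cases he : e = a
    · subst he
      have h1 := (ψ.cut e ha).key_leg (natAdd l 0)
      have h1' := (ψ.cut e ha).key_leg (natAdd l 1)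
      have h2 : (ψ.cut e ha).toFun (natAdd l 0) = e := append_right _ _ _
      have h2' : (ψ.cut e ha).toFun (natAdd l 1) = Γ.inv e := append_right _ _ _
      rw [h2] at h1
      rw [h2'] at h1'
      fin_cases s
      · exact ⟨.inl e, by simp [pos], by simpa [pulledKey] using h1⟩
      · exact ⟨.inl (Γ.inv e), by simp [pos], by simpa [pulledKey] using h1'⟩
      · exact absurd rfl hz
    · fin_cases s
      · refine ⟨.inl e, by simp [pos], ?_⟩
        rw [(ψ.cut a ha).key_edge (hmem e he)]
        simp [pulledKey, he]
      · refine ⟨.inl (Γ.inv e), by simp [pos], ?_⟩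
        have := (ψ.cut a ha).key_inv (hmem e he)
        rw [hinv e he] at this
        simpa [pulledKey, he] using this
      · exact ⟨.inr ⟨e, hmem e he⟩, by simp [pos], by simp [pulledKey, he, key]⟩

theorem pulledKey_injective (a : Γ.edges) :
    Injective (pulledKey (l := l) (fun e : Γ.edges => ((e : Fin Γ.nH) : ℕ)) a) := by
  rintro (i | ⟨e, s⟩) (j | ⟨e', s'⟩) h
  · simpa [pulledKey, Fin.ext_iff] using h
  · simp only [pulledKey] at h
    split_ifs at h <;> simp at h <;> omega
  · simp only [pulledKey] at h
    split_ifs at h <;> simp at h <;> omega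
  · simp only [pulledKey] at h
    split_ifs at h <;> simp at h
    · simp_all
    · simp_all [Fin.ext_iff]
    · rw [Subtype.ext (Fin.ext h.1), Fin.ext h.2]

theorem LegEnum.koszulSign_cut (a : Γ.edges) (d : Fin Γ.nH → ℤ) (d' : Γ.edges → ℤ)
    (hd : ∀ e : Γ.edges, d e + d (Γ.inv e) + d' e = 0) : koszulSign ψ.key (keyOutLast a)
    (Sum.elim d d') = koszulSign (ψ.cut a (Γ.not_leg_of_mem_edges a.2)).key (Γ.cut a).keyOut
    (Sum.elim d fun e => d' ⟨e.1, ((Γ.cut_edges a e.1).1 e.2).1⟩) := by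
  let f := Equiv.ofBijective ψ.pos ψ.pos_bijective
  let D := Sum.elim d d'
  have h1 : koszulSign ψ.key (keyOutLast a) D =
      koszulSign (pulledKey (fun e : Γ.edges => ((e : Fin Γ.nH) : ℕ)) a) (keyOutLast a ∘ f) (D ∘ f) := by
    rw [← koszulSign_comp_equiv f, ← koszulSign_mul (ψ.key ∘ f) (pulledKey (fun e : Γ.edges => ((e :
      Fin Γ.nH) : ℕ)) a) (keyOutLast a ∘ f) (D ∘ f) (ψ.key_injective.comp f.injective)
      (pulledKey_injective a) ((keyOutLast_injective a).comp f.injective)]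
    have h2 : ψ.key ∘ f = tripleKey (fun e : Γ.edges => ((e : Fin Γ.nH) : ℕ)) := funext ψ.key_pos
    have h3 : D ∘ f = Sum.elim (fun i => d (ψ.toFun i)) fun z : Γ.edges × Fin 3 =>
        ![d z.1, d (Γ.inv z.1), d' z.1] z.2 := by
      funext z
      rcases z with i | ⟨e, s⟩
      · rfl
      · fin_cases s <;> simp [D, f, LegEnum.pos]
    rw [h2, h3, koszulSign_pulledKey (D3 := fun e : Γ.edges => ![d e, d (Γ.inv e), d' e]), one_mul]
    · exact Fin.val_injective.comp Subtype.val_injective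
    · intro e
      simpa [Fin.sum_univ_three] using hd e
  let g : Fin Γ.nH ⊕ (Γ.cut a).edges → Fin Γ.nH ⊕ Γ.edges :=
    Sum.map id (fun e => ⟨e.1, ((Γ.cut_edges a e.1).1 e.2).1⟩)
  have hg : Injective g :=
    Sum.map_injective.2 ⟨injective_id, fun e e' h => Subtype.ext (congrArg (fun z : Γ.edges => z.1) h)⟩
  have hlast : f (.inr (a, 2)) = .inr a := by simp [f, LegEnum.pos]
  refine h1.trans ?_
  rw [koszulSign_comp_injective (f.symm ∘ g) (f.symm.injective.comp hg)]
  · have h4 : ∀ z', f.symm (g z') ≠ .inr (a, 2) := by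
      intro z' h
      rw [Equiv.symm_apply_eq, hlast] at h
      rcases z' with h' | e
      · simp [g] at h
      · simp only [g, Sum.map_inr, Sum.inr.injEq] at h
        exact ((Γ.cut_edges a e.1).1 e.2).2.1 (congrArg Subtype.val h)
    congr 1
    · funext z'
      obtain ⟨z'', h5, h6⟩ := ψ.cut_key_pos a _ (h4 z')
      have h7 : g z'' = g z' := h5.trans (f.apply_symm_apply _)
      rw [hg h7] at h6
      exact h6.symm
    · funext z'
      simp only [Function.comp, apply_symm_apply]
      rcases z' with h' | e
      · rfl
      · simp only [g, Sum.map_inr, keyOutLast]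
        rw [if_neg]
        · rfl
        · exact fun h => ((Γ.cut_edges a e.1).1 e.2).2.1 (congrArg Subtype.val h)
    · funext z'
      simp only [Function.comp, apply_symm_apply, D]
      rcases z' with h' | e <;> rfl
  · have h8 : ∀ z : Fin l ⊕ Γ.edges × Fin 3, z ≠ .inr (a, 2) → ∃ z', (f.symm ∘ g) z' = z := by
      intro z hz
      obtain ⟨z', h5, -⟩ := ψ.cut_key_pos a z hz
      exact ⟨z', (Equiv.symm_apply_eq f).2 h5⟩
    have h9 : ∀ z : Fin l ⊕ Γ.edges × Fin 3, z ≠ .inr (a, 2) →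
        pulledKey (fun e : Γ.edges => ((e : Fin Γ.nH) : ℕ)) a z < toLex (2, toLex (0, 0)) := by
      rintro (i | ⟨e, s⟩) hz
      · simp [pulledKey, toLex_lt_toLex]
      · simp only [pulledKey]
        split_ifs with h1 h2
        · subst h1; subst h2; exact absurd rfl hz
        · simp [toLex_lt_toLex]
        · simp [toLex_lt_toLex]
    have h10 : ∀ z : Fin l ⊕ Γ.edges × Fin 3, z ≠ .inr (a, 2) →
        (keyOutLast a ∘ f) z < (keyOutLast a ∘ f) (.inr (a, 2)) := by
      intro z hz
      simp only [Function.comp, hlast]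
      have : f z ≠ .inr a := fun h => hz (f.injective (h.trans hlast.symm))
      rcases hh : f z with h' | e
      · simp [keyOutLast, keyOut, toLex_lt_toLex]
      · have he : e ≠ a := by rintro rfl; exact this hh
        simp [keyOutLast, he, keyOut, toLex_lt_toLex]
    intro z z' _ _ hu hw
    by_cases hz : z = .inr (a, 2)
    · by_cases hz' : z' = .inr (a, 2)
      · rw [hz, hz'] at hu; exact absurd hu (lt_irrefl _)
      · rw [hz] at hu
        have := h9 z' hz'
        simp only [pulledKey, if_true] at hu
        exact absurd hu this.asymm
    · by_cases hz' : z' = .inr (a, 2)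
      · rw [hz'] at hw
        exact absurd hw (h10 z hz).asymm
      · obtain ⟨i, hi⟩ := h8 z hz
        obtain ⟨j, hj⟩ := h8 z' hz'
        exact ⟨i, j, hi, hj⟩

theorem ampl_congr {t t' : Fin Γ.nH → Tensor3 𝕂 E A} (h : ∀ e ∈ Γ.edges, t e = t' e) :
    ampl hℰ I h𝒜 ψ t = ampl hℰ I h𝒜 ψ t' := by
  ext y
  exact congrArg (amplitudeFun hℰ I h𝒜 ψ y) (funext fun e => h e e.2)

theorem ampl_linear (t : Fin Γ.nH → Tensor3 𝕂 E A) {e : Fin Γ.nH} (he : e ∈ Γ.edges) :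
    IsLinearMap 𝕂 fun P => ampl hℰ I h𝒜 ψ (update t e P) := by
  have h : ∀ P y, ampl hℰ I h𝒜 ψ (update t e P) y =
      amplitudeFun hℰ I h𝒜 ψ y (update (fun e : Γ.edges => t e) ⟨e, he⟩ P) := by
    intro P y
    refine congrArg (amplitudeFun hℰ I h𝒜 ψ y) (funext fun e' => ?_)
    by_cases hh : e' = ⟨e, he⟩
    · subst hh; simp
    · rw [update_of_ne hh, update_of_ne fun h => hh (Subtype.ext h)]
  constructor
  · intro P Q
    ext y
    rw [_root_.add_apply, h, h, h, ContinuousMultilinearMap.map_update_add]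
  · intro c P
    ext y
    rw [_root_.smul_apply, h, h, ContinuousMultilinearMap.map_update_smul]

include hc in
/-- Cutting an edge, read from its smaller half-edge. -/
theorem ampl_cut_edge (a : Γ.edges) {t : Fin Γ.nH → Tensor3 𝕂 E A}
    (ht : ∀ e ∈ Γ.edges, t e ∈ degreeZero ℰ 𝒜) : ampl hℰ I h𝒜 ψ t =
      contract (t a) (ampl hℰ I h𝒜 (ψ.cut a (Γ.not_leg_of_mem_edges a.2)) t) := by
  refine multi_ext hℰ fun d y hy => ?_
  let tot : (Γ.edges → Tensor3 𝕂 E A) → Fin Γ.nH → Tensor3 𝕂 E A :=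
    fun τ h => if hh : h ∈ Γ.edges then τ ⟨h, hh⟩ else 0
  have htot : ∀ τ (e : Γ.edges), tot τ e = τ e := fun τ e => dif_pos e.2
  have hupd : ∀ τ (e : Γ.edges) P, tot (update τ e P) = update (tot τ) e P := by
    intro τ e P
    funext h
    by_cases hh : h = e
    · subst hh; simp [tot]
    · rw [update_of_ne hh]
      simp only [tot]
      split_ifs with h1
      · rw [update_of_ne fun h2 => hh (congrArg Subtype.val h2)]
      · rfl
  have htc : Continuous tot := continuous_pi fun h => by
    by_cases hh : h ∈ Γ.edges
    · simp only [tot, dif_pos hh]; fun_prop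
    · simp only [tot, dif_neg hh]; fun_prop
  let ψ' := ψ.cut a (Γ.not_leg_of_mem_edges a.2)
  have hcut : ∀ e : Γ.edges, e ≠ a → (e : Fin Γ.nH) ∈ (Γ.cut a).edges := by
    intro e he
    rw [cut_edges]
    exact ⟨e.2, fun h => he (Subtype.ext h), fun h => Γ.inv_notMem_edges a.2 (h ▸ e.2)⟩
  have h1 := degreeZero_multi_ext (ℰ := ℰ) (𝒜 := 𝒜) (S := Γ.edges)
    (f := fun τ => ampl hℰ I h𝒜 ψ (tot τ) y)
    (g := fun τ => contract (τ a) (ampl hℰ I h𝒜 ψ' (tot τ)) y) ?_ ?_ ?_ ?_ ?_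
    (t := fun e => t e) fun e => ht e e.2
  · rw [ampl_congr hℰ h𝒜 I ψ (t' := t) fun e he => htot (fun e => t e) ⟨e, he⟩,
      ampl_congr hℰ h𝒜 I ψ' (t' := t) fun e he => htot (fun e => t e) ⟨e, ((Γ.cut_edges a e).1 he).1⟩] at h1
    exact h1
  · intro τ e
    simp_rw [hupd]
    have := ampl_linear hℰ h𝒜 I ψ (tot τ) e.2
    exact ⟨fun P Q => by rw [this.map_add]; rfl, fun c P => by rw [this.map_smul]; rfl⟩
  · intro τ e
    simp_rw [hupd]
    by_cases he : e = a
    · subst he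
      have h2 : ∀ P, ampl hℰ I h𝒜 ψ' (update (tot τ) e P) = ampl hℰ I h𝒜 ψ' (tot τ) := by
        intro P
        refine ampl_congr hℰ h𝒜 I ψ' fun h hh => update_of_ne ?_ _ _
        exact ((Γ.cut_edges e h).1 hh).2.1
      simp only [h2, update_self, contract_apply]
      exact (contractFun _ y).toLinearMap.isLinear
    · have := ampl_linear hℰ h𝒜 I ψ' (tot τ) (hcut e he)
      simp only [update_of_ne (Ne.symm he)]
      exact ⟨fun P Q => by rw [this.map_add, map_add]; rfl,
        fun c P => by rw [this.map_smul, map_smul]; rfl⟩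
  · exact (ampl_continuous hℰ I h𝒜 ψ).comp (htc.prodMk continuous_const)
  · exact (contractFun_continuous (F := ampl hℰ I h𝒜 ψ') (ampl_continuous hℰ I h𝒜 ψ')).comp
      (htc.prodMk (continuous_const.prodMk (continuous_apply a)))
  · intro τ hτ
    choose i j k hijk p hp q hq α hα hτ using hτ
    let w : Γ.edges → E × E × A := fun e => (p e, q e, α e)
    let x := ψ.field y w
    let D : Fin Γ.nH → ℤ := ψ.field d fun e => (i e, j e, (0 : A))
    have hx : ∀ h, x h ∈ ℰ (D h) := by
      refine ψ.cases ?_ ?_ ?_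
      · intro m; simp only [x, D, ψ.field_leg]; exact hy m
      · intro e he
        have e1 := ψ.field_fst y w ⟨e, he⟩
        have e2 := ψ.field_fst d (fun e => (i e, j e, (0 : A))) ⟨e, he⟩
        simp only at e1 e2
        simp only [x, D]
        rw [e1, e2]; exact hp _
      · intro e he
        have e1 := ψ.field_snd y w ⟨e, he⟩
        have e2 := ψ.field_snd d (fun e => (i e, j e, (0 : A))) ⟨e, he⟩
        simp only at e1 e2
        simp only [x, D]
        rw [e1, e2]; exact hq _
    have hD : ∀ e : Γ.edges, D e + D (Γ.inv e) + k e = 0 := by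
      intro e
      simp only [D]
      rw [ψ.field_fst, ψ.field_snd]
      exact hijk e
    have hy' : y = fun i => x (ψ.toFun i) := funext fun i => (ψ.field_leg y w i).symm
    have hpure : ∀ e : Γ.edges, tot τ e = Tensor3.pure 𝕂 E A (x e) (x (Γ.inv e)) (α e) := by
      intro e
      rw [htot, hτ e]
      simp only [x]
      rw [ψ.field_fst, ψ.field_snd]
    have h2 := ampl_apply hℰ I h𝒜 ψ hx hα hpure
    have h3 := ampl_apply hℰ I h𝒜 ψ' (x := x) hx
      (a := fun e => α ⟨e.1, ((Γ.cut_edges a e.1).1 e.2).1⟩) (fun e => hα _) (t := tot τ) (by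
        intro e
        have e1 : (Γ.cut a).inv e.1 = Γ.inv e.1 := by
          rw [cut_inv, if_neg]
          have := ((Γ.cut_edges a e.1).1 e.2).2
          tauto
        rw [e1]
        exact hpure ⟨e.1, ((Γ.cut_edges a e.1).1 e.2).1⟩)
    have h4 : (append y ![p a, q a] : Fin (l + 2) → E) = fun i => x (ψ'.toFun i) := by
      funext m
      refine addCases (fun m => ?_) (fun m => ?_) m
      · rw [append_left]
        have : ψ'.toFun (castAdd 2 m) = ψ.toFun m := append_left _ _ _
        rw [this]; exact (ψ.field_leg y w m).symm
      · rw [append_right]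
        have : ψ'.toFun (natAdd l m) = (![(a : Fin Γ.nH), Γ.inv a] : Fin 2 → Fin Γ.nH) m :=
          append_right _ _ _
        rw [this]
        fin_cases m
        · exact (ψ.field_fst y w a).symm
        · exact (ψ.field_snd y w a).symm
    rw [contract_apply, hτ a, contractFun_pure, h4, h3]
    conv_lhs => rw [hy']
    rw [h2, Γ.edgeProd_last h𝒜 hc a k D α, mul_smul_comm, smul_smul,
      koszulSign_mul _ _ _ _ ψ.key_injective keyOut_injective (keyOutLast_injective a),
      ψ.koszulSign_cut a D k hD, h𝒜.proj_same (hα a), smul_mul_assoc, mul_assoc]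
    rfl

end RibbonGraph

end Cut


/-! ### Invariance of the amplitudes under isomorphisms -/

theorem numCycles_congr {X X' : Type*} {C : Perm X} {C' : Perm X'} (f : X ≃ X')
    (h : ∀ x, C' (f x) = f (C x)) : numCycles C' = numCycles C := by
  unfold numCycles
  symm
  refine Nat.card_congr (Quotient.congr f fun x y => ?_)
  have hC : C' = (f.symm.trans C).trans f := by ext x; have := h (f.symm x); simpa using this
  have hz : ∀ (n : ℤ) x, (C' ^ n) (f x) = f ((C ^ n) x) := by
    intro n x
    have h2 : C' = f.permCongr C := by rw [hC]; rfl
    have h3 : C' ^ n = f.permCongr (C ^ n) := by rw [h2]; exact (map_zpow f.permCongrHom C n).symm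
    rw [h3]; simp [permCongr_apply]
  change C.SameCycle x y ↔ C'.SameCycle (f x) (f y)
  unfold Equiv.Perm.SameCycle
  simp only [hz, f.injective.eq_iff]

section Invariance

variable (hc : IsGradedCommutative 𝒜) (I : Functional A ℰ)

theorem attachFun_eq_sum {Y : Type*} [Fintype Y] [LinearOrder Y] (D : Perm Y) {k l : ℕ}
    (J : CycWords A ℰ k l) (d : Y → ℤ) (x : Y → E) :
    attachFun hℰ D d J x = ∑ σ, ∑ φ : CycIso σ.1 D, koszulSign (id : Y → Y) φ.1.symm d •
      Quotient.out J σ fun i => hℰ.proj (d (φ.1 i)) (x (φ.1 i)) := by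
  unfold attachFun
  rw [_root_.sum_apply]
  refine sum_congr rfl fun σ _ => ?_
  rw [_root_.sum_apply]
  rfl

theorem attachFun_iso {X X' : Type*} [Fintype X] [LinearOrder X] [Fintype X'] [LinearOrder X']
    {C : Perm X} {C' : Perm X'} (f : X ≃ X') (h : ∀ x, C' (f x) = f (C x)) {k l : ℕ}
    (J : CycWords A ℰ k l) (d : X' → ℤ) (x : X' → E) : attachFun hℰ C' d J x =
      koszulSign (id : X → X) f (d ∘ f) • attachFun hℰ C (d ∘ f) J (x ∘ f) := by
  rw [attachFun_eq_sum, attachFun_eq_sum, smul_sum]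
  refine sum_congr rfl fun σ _ => ?_
  rw [smul_sum]
  symm
  have hs : ∀ x, f.symm (C' x) = C (f.symm x) := by
    intro x; rw [Equiv.symm_apply_eq, ← h, f.apply_symm_apply]
  let F : CycIso σ.1 C ≃ CycIso σ.1 C' :=
    { toFun := fun φ => ⟨φ.1.trans f, fun i => by simp [φ.2, h]⟩
      invFun := fun φ => ⟨φ.1.trans f.symm, fun i => by simp [φ.2, hs]⟩
      left_inv := fun φ => by ext; simp
      right_inv := fun φ => by ext; simp }
  refine Fintype.sum_equiv F _ _ fun φ => ?_
  rw [smul_smul]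
  congr 1
  rw [← koszulSign_comp_equiv f id, koszulSign_symm id f, show ((id : X' → X') ∘ f) = f from rfl]
  have : ((φ.1.trans f).symm : X' → Fin l) ∘ f = φ.1.symm := by funext x; simp
  change _ = koszulSign f ((φ.1.trans f).symm ∘ f) (d ∘ f)
  rw [this]
  exact koszulSign_mul _ _ _ _ f.injective injective_id φ.1.symm.injective

/-- The functional of a vertex on a cyclically decomposed set of half-edges. -/
def vertexFun {X : Type*} [Fintype X] [LinearOrder X] (C : Perm X) (g b : ℕ) (d : X → ℤ)
    (x : X → E) : A :=
  attachFun hℰ C d (I g b (numCycles C) (Fintype.card X)) x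

theorem vertexFun_iso {X X' : Type*} [Fintype X] [LinearOrder X] [Fintype X'] [LinearOrder X']
    {C : Perm X} {C' : Perm X'} (f : X ≃ X') (h : ∀ x, C' (f x) = f (C x)) (g b : ℕ)
    (d : X' → ℤ) (x : X' → E) : vertexFun hℰ I C' g b d x =
      koszulSign (id : X → X) f (d ∘ f) • vertexFun hℰ I C g b (d ∘ f) (x ∘ f) := by
  unfold vertexFun
  rw [numCycles_congr f h, Fintype.card_congr f.symm]
  exact attachFun_iso hℰ f h _ d x

variable {I} (hI : IsInteraction ℰ 𝒜 I)

theorem attachPre_mem {X : Type*} [Fintype X] [LinearOrder X] (C : Perm X) {k l : ℕ}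
    {T : CycDec k l → Multi 𝕂 E A l}
    (hT : ∀ σ (d : Fin l → ℤ) (x : ∀ m, ℰ (d m)), T σ (fun m => x m) ∈ 𝒜 (∑ m, d m))
    (d : X → ℤ) (x : ∀ h, ℰ (d h)) : attachPre ℰ C k l d x T ∈ 𝒜 (∑ h, d h) := by
  refine Submodule.sum_mem _ fun σ _ => Submodule.sum_mem _ fun φ _ => zsmul_mem ?_ _
  have := hT σ (fun i => d (φ.1 i)) fun i => x (φ.1 i)
  rwa [φ.1.sum_comp] at this

theorem attach_mk {X : Type*} [Fintype X] [LinearOrder X] (C : Perm X) {k l : ℕ}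
    (T : CycDec k l → Multi 𝕂 E A l) (d : X → ℤ) (x : ∀ h, ℰ (d h)) :
    attach ℰ C k l d x (Submodule.Quotient.mk T) = attachPre ℰ C k l d x T := rfl

include hI in
theorem vertexFun_mem {X : Type*} [Fintype X] [LinearOrder X] (C : Perm X) (g b : ℕ)
    (d : X → ℤ) (x : X → E) : vertexFun hℰ I C g b d x ∈ 𝒜 (∑ h, d h) := by
  have h1 := attachFun_apply hℰ C d (I g b (numCycles C) (Fintype.card X)) x
  obtain ⟨T, hT, hT2⟩ := hI.degree_zero g b (numCycles C) (Fintype.card X)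
  rw [← hT, attach_mk] at h1
  unfold vertexFun
  rw [← hT, h1]
  exact attachPre_mem C hT2 d _

namespace RibbonGraph

theorem vertexProd_eq_vertexFun (Γ : RibbonGraph) (d : Fin Γ.nH → ℤ) (x : Fin Γ.nH → E) :
    Γ.vertexProd hℰ I d x = ((List.finRange Γ.nV).map fun v => vertexFun hℰ I (Γ.cycAt v)
      (Γ.genus v) (Γ.bdry v) (fun h : Γ.At v => d h) fun h : Γ.At v => x h).prod := rfl

include hI in
theorem vertexProd_mem (Γ : RibbonGraph) (d : Fin Γ.nH → ℤ) (x : Fin Γ.nH → E) :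
    Γ.vertexProd hℰ I d x ∈ 𝒜 (∑ h, d h) := by
  rw [vertexProd_eq_vertexFun, ← Finset.sum_fiberwise univ Γ.root d]
  have := list_prod_mem_graded (𝒜 := 𝒜) (List.finRange Γ.nV) (fun v => vertexFun hℰ I (Γ.cycAt v)
      (Γ.genus v) (Γ.bdry v) (fun h : Γ.At v => d h) fun h : Γ.At v => x h)
    (fun v => ∑ h with Γ.root h = v, d h) fun v _ => by
      rw [← Finset.sum_subtype_eq_sum_filter] 
      have := vertexFun_mem hℰ hI (Γ.cycAt v) (Γ.genus v) (Γ.bdry v) (fun h : Γ.At v => d h)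
        fun h : Γ.At v => x h
      simpa using this
  rwa [← Fin.sum_univ_def] at this

/-- The order by vertices. -/
def rootKey (Γ : RibbonGraph) (h : Fin Γ.nH) : ℕ ×ₗ ℕ := toLex ((Γ.root h : ℕ), (h : ℕ))

theorem rootKey_injective (Γ : RibbonGraph) : Injective Γ.rootKey := by
  intro h h' hh
  simp [rootKey, Fin.val_inj] at hh
  exact hh.2

/-- The effect of an isomorphism on the half-edges at a vertex. -/
def Iso.at {Γ Γ' : RibbonGraph} (f : Γ.Iso Γ') (v : Fin Γ.nV) : Γ.At v ≃ Γ'.At (f.onV v) :=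
  f.onH.subtypeEquiv fun h => by rw [f.map_root, f.onV.injective.eq_iff]

include hc hI in
theorem vertexProd_iso {Γ Γ' : RibbonGraph} (f : Γ.Iso Γ') (d : Fin Γ'.nH → ℤ) (x : Fin Γ'.nH → E) :
    Γ'.vertexProd hℰ I d x = koszulSign Γ.rootKey (Γ'.rootKey ∘ f.onH) (d ∘ f.onH) •
      Γ.vertexProd hℰ I (d ∘ f.onH) (x ∘ f.onH) := by
  rw [vertexProd_eq_vertexFun, vertexProd_eq_vertexFun]
  set F : Fin Γ'.nV → A := fun v => vertexFun hℰ I (Γ'.cycAt v)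
      (Γ'.genus v) (Γ'.bdry v) (fun h : Γ'.At v => d h) fun h : Γ'.At v => x h with hF
  set G : Fin Γ.nV → A := fun v => vertexFun hℰ I (Γ.cycAt v)
      (Γ.genus v) (Γ.bdry v) (fun h : Γ.At v => d (f.onH h)) fun h : Γ.At v => x (f.onH h) with hG
  have h1 : ∀ v, F (f.onV v) = koszulSign (id : Γ.At v → Γ.At v) (f.at v) (fun h => d (f.onH h)) •
      G v := by
    intro v
    simp only [hF, hG]
    rw [f.map_genus, f.map_bdry]
    exact vertexFun_iso hℰ I (f.at v) (fun h => Subtype.ext (f.map_cyc h)) _ _ _ _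
  have h2 := hc.list_prod_perm (L₁ := List.finRange Γ'.nV) (L₂ := (List.finRange Γ.nV).map f.onV)
    ((List.perm_ext_iff_of_nodup (List.nodup_finRange _)
      ((List.nodup_finRange _).map f.onV.injective)).2 fun v => by
        simp only [List.mem_finRange, List.mem_map, true_and, true_iff]
        exact f.onV.surjective v) (List.nodup_finRange _) F (fun v => ∑ h with Γ'.root h = v, d h)
    (fun v => by
      rw [← Finset.sum_subtype_eq_sum_filter]
      have := vertexFun_mem hℰ hI (Γ'.cycAt v) (Γ'.genus v) (Γ'.bdry v) (fun h : Γ'.At v => d h)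
        fun h : Γ'.At v => x h
      simpa using this) (id : Fin Γ'.nV → _) f.onV.symm injective_id f.onV.symm.injective
    (by simpa using List.pairwise_lt_finRange _)
    (by rw [List.pairwise_map]; simpa using List.pairwise_lt_finRange _)
  rw [h2, List.map_map]
  have h3 : ∀ L : List (Fin Γ.nV), (L.map (F ∘ f.onV)).prod =
      (L.map fun v => koszulSign (id : Γ.At v → Γ.At v) (f.at v) (fun h => d (f.onH h))).prod •
        (L.map G).prod := by
    intro L
    induction L with
    | nil => simp
    | cons v L ih =>
      simp only [List.map_cons, List.prod_cons, ih, Function.comp, h1]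
      rw [smul_mul_smul_comm]
  rw [h3, smul_smul]
  change _ = _ • (List.map G _).prod
  congr 1
  rw [← Fin.prod_univ_def]
  let z : Fin Γ.nH → ℕ ×ₗ ℕ := fun h => toLex ((f.onV (Γ.root h) : ℕ), (h : ℕ))
  have hz : Injective z := by
    intro h h' hh
    simp [z, Fin.val_inj] at hh
    exact hh.2
  rw [← koszulSign_mul Γ.rootKey z (Γ'.rootKey ∘ f.onH) _ Γ.rootKey_injective hz
    (Γ'.rootKey_injective.comp f.onH.injective)]
  congr 1
  · rw [koszulSign_block Γ.root (u' := (id : Fin Γ.nV → Fin Γ.nV)) (w' := f.onV),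
      ← koszulSign_comp_equiv f.onV, koszulSign_symm]
    · refine koszulSign_congr fun v w => ?_
      simp only [Function.comp, symm_apply_apply, List.mem_finRange, if_true, id]
      have : ∀ v, ∑ h with Γ'.root h = f.onV v, d h = ∑ h with Γ.root h = v, d (f.onH h) := by
        intro v
        rw [sum_filter, sum_filter, ← f.onH.sum_comp]
        simp [f.map_root]
      rw [this, this]
    · intro i j hij
      have := Fin.val_ne_of_ne hij
      simp [rootKey, toLex_lt_toLex, this]
    · intro i j hij
      have := Fin.val_ne_of_ne (f.onV.injective.ne hij)
      simp [z, toLex_lt_toLex, this]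
    · intro i j hij h
      simp [rootKey, z, toLex_lt_toLex, hij] at h ⊢
      exact h.le
  · rw [koszulSign_fiber Γ.root]
    · refine prod_congr rfl fun v _ => koszulSign_congr fun i j => ?_
      have hi := i.2
      have hj := j.2
      simp only [z, Function.comp, rootKey, f.map_root, hi, hj, toLex_lt_toLex, lt_self_iff_false, false_or,
        true_and, id, Fin.val_fin_lt, Subtype.coe_lt_coe]
      rfl
    · intro i j hij h
      have := Fin.val_ne_of_ne (f.onV.injective.ne hij)
      simp [rootKey, f.map_root, z, toLex_lt_toLex, this, this.symm] at h ⊢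
      exact h.le

variable {Γ Γ' : RibbonGraph} {l l' : ℕ}

/-- The amplitude of a graph without edges. -/
theorem ampl_of_edges_eq_empty (h0 : Γ.edges = ∅) (ψ : Γ.LegEnum l) (t : Fin Γ.nH → Tensor3 𝕂 E A)
    {d : Fin Γ.nH → ℤ} {x : Fin Γ.nH → E} (hx : ∀ h, x h ∈ ℰ (d h)) :
    ampl hℰ I h𝒜 ψ t (fun i => x (ψ.toFun i)) =
      koszulSign (fun h => ψ.key (.inl h)) Γ.rootKey d • Γ.vertexProd hℰ I d x := by
  have he : IsEmpty Γ.edges := by rw [h0]; infer_instance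
  rw [ampl_apply hℰ I h𝒜 ψ hx (d' := fun _ => 0) (a := fun _ => 0) (fun e => he.elim e)
    fun e => he.elim e]
  have h1 : Γ.edgeProd h𝒜 (fun _ => 0) (fun _ => 0) = 1 := by rw [edgeProd_eq_map, h0]; simp
  rw [h1, mul_one]
  congr 1
  rw [← koszulSign_comp_equiv (Equiv.sumEmpty (Fin Γ.nH) Γ.edges).symm]
  refine koszulSign_congr fun i j => ?_
  simp [keyOut, rootKey, toLex_lt_toLex]

theorem Iso.legs_iff (f : Γ.Iso Γ') (h : Fin Γ.nH) : Γ'.inv (f.onH h) = f.onH h ↔ Γ.inv h = h := by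
  rw [f.map_inv, f.onH.injective.eq_iff]

theorem inv_eq_self_of_edges_eq_empty (h0 : Γ.edges = ∅) (h : Fin Γ.nH) : Γ.inv h = h := by
  by_contra hh
  by_cases h1 : h ∈ Γ.edges
  · rw [h0] at h1; simp at h1
  · have := Γ.inv_mem_edges hh h1
    rw [h0] at this; simp at this

include hc hI in
theorem ampl_iso_of_edges_eq_empty (h0 : Γ.edges = ∅) (f : Γ.Iso Γ') (ψ : Γ.LegEnum l)
    (ψ' : Γ'.LegEnum l') (e : Fin l ≃ Fin l') (he : ∀ i, ψ'.toFun (e i) = f.onH (ψ.toFun i))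
    (t : Fin Γ.nH → Tensor3 𝕂 E A) (t' : Fin Γ'.nH → Tensor3 𝕂 E A) :
    ampl hℰ I h𝒜 ψ' t' = transport hℰ e (ampl hℰ I h𝒜 ψ t) := by
  have hleg := inv_eq_self_of_edges_eq_empty h0
  have h0' : Γ'.edges = ∅ := by
    ext h
    obtain ⟨h, rfl⟩ := f.onH.surjective h
    rw [mem_edges, f.map_inv, hleg]; simp
  refine multi_ext hℰ fun d y hy => ?_
  have hsurj : ∀ h, ∃ i, ψ'.toFun i = h := by
    intro h
    rw [ψ'.range]
    obtain ⟨h, rfl⟩ := f.onH.surjective h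
    rw [f.legs_iff, hleg]
  let F : Fin l' ≃ Fin Γ'.nH := Equiv.ofBijective ψ'.toFun ⟨ψ'.injective, hsurj⟩
  have hF : ∀ i, F.symm (ψ'.toFun i) = i := fun i => F.symm_apply_apply i
  let x : Fin Γ'.nH → E := y ∘ F.symm
  let D : Fin Γ'.nH → ℤ := d ∘ F.symm
  have hx : ∀ h, x h ∈ ℰ (D h) := fun h => hy _
  have e1 : y = fun i => x (ψ'.toFun i) := funext fun i => by simp [x, hF]
  have e2 : (fun i => y (e i)) = fun i => (x ∘ f.onH) (ψ.toFun i) := funext fun i => by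
    simp [x, ← he, hF]
  have e4 := ampl_of_edges_eq_empty (I := I) hℰ h𝒜 h0 ψ t (x := x ∘ f.onH) (d := D ∘ f.onH)
    fun h => hx _
  rw [transport_apply hℰ _ _ hy, e2, e4]
  conv_lhs => rw [e1]
  rw [ampl_of_edges_eq_empty hℰ h𝒜 h0' ψ' t' hx, vertexProd_iso hℰ hc hI f, smul_smul, smul_smul]
  congr 1
  rw [← koszulSign_comp_equiv f.onH]
  have e3 : koszulSign (id : Fin l' → Fin l') e.symm d =
      koszulSign (fun h => ψ'.key (.inl (f.onH h))) (fun h => ψ.key (.inl h)) (D ∘ f.onH) := by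
    rw [← koszulSign_comp_equiv (F.trans f.onH.symm)]
    refine koszulSign_congr fun i j => ?_
    have a1 : ∀ i, f.onH ((F.trans f.onH.symm) i) = ψ'.toFun i := fun i => by simp [F]; rfl
    have a2 : ∀ i, (F.trans f.onH.symm) i = ψ.toFun (e.symm i) := fun i => by
      rw [← f.onH.injective.eq_iff, a1, ← he, e.apply_symm_apply]
    simp only [Function.comp, a1, D, hF]
    simp only [a2, LegEnum.key_leg]
    simp [toLex_lt_toLex]
  rw [e3]
  have i1 : Injective fun h => ψ.key (.inl h) := ψ.key_injective.comp Sum.inl_injective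
  have i2 : Injective fun h => ψ'.key (.inl (f.onH h)) :=
    ψ'.key_injective.comp (Sum.inl_injective.comp f.onH.injective)
  have i3 := Γ'.rootKey_injective.comp f.onH.injective
  rw [koszulSign_mul _ _ _ _ i2 i1 Γ.rootKey_injective]
  rw [koszulSign_symm Γ.rootKey]
  exact koszulSign_mul _ _ _ _ i2 i3 Γ.rootKey_injective

end RibbonGraph

end Invariance


variable (hc : IsGradedCommutative 𝒜) {I : Functional A ℰ} (hI : IsInteraction ℰ 𝒜 I)

namespace RibbonGraph

variable {Γ Γ' : RibbonGraph} {l l' : ℕ}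

/-- The isomorphism obtained by cutting corresponding edges. -/
def Iso.cut (f : Γ.Iso Γ') {a : Fin Γ.nH} {a' : Fin Γ'.nH}
    (h : f.onH a = a' ∨ f.onH a = Γ'.inv a') : (Γ.cut a).Iso (Γ'.cut a') where
  onH := f.onH
  onV := f.onV
  map_root := f.map_root
  map_inv h' := by
    have h1 := Γ.cut_inv a h'
    have h2 := Γ'.cut_inv a' (f.onH h')
    refine h2.trans (Eq.trans ?_ (congrArg f.onH h1.symm))
    have h3 : (f.onH h' = a' ∨ f.onH h' = Γ'.inv a') ↔ (h' = a ∨ h' = Γ.inv a) := by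
      rw [← f.onH.injective.eq_iff, ← f.onH.injective.eq_iff (a := h') (b := Γ.inv a), ← f.map_inv]
      rcases h with h | h
      · rw [h]
      · rw [h, Γ'.inv_inv, or_comm]
    by_cases h4 : h' = a ∨ h' = Γ.inv a
    · rw [if_pos (h3.2 h4), if_pos h4]
    · rw [if_neg (fun h5 => h4 (h3.1 h5)), if_neg h4, f.map_inv]
  map_cyc := f.map_cyc
  map_genus := f.map_genus
  map_bdry := f.map_bdry

theorem cut_edges_card_lt (a : Γ.edges) : (Γ.cut a).edges.card < Γ.edges.card := by
  refine Finset.card_lt_card ⟨fun h hh => ((Γ.cut_edges a h).1 hh).1, fun hh => ?_⟩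
  exact ((Γ.cut_edges a a).1 (hh a.2)).2.1 rfl

theorem LegEnum.cut_castAdd (ψ : Γ.LegEnum l) (a : Fin Γ.nH) (ha : Γ.inv a ≠ a) (i : Fin l) :
    (ψ.cut a ha).toFun (castAdd 2 i) = ψ.toFun i := append_left _ _ _

theorem LegEnum.cut_natAdd (ψ : Γ.LegEnum l) (a : Fin Γ.nH) (ha : Γ.inv a ≠ a) (i : Fin 2) :
    (ψ.cut a ha).toFun (natAdd l i) = (![a, Γ.inv a] : Fin 2 → Fin Γ.nH) i :=
  append_right _ _ _

/-- A symmetric assignment of propagators to the edges. -/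
structure EdgeLabel (ℰ : ℤ → Submodule 𝕂 E) (𝒜 : ℤ → Submodule 𝕂 A) (Γ : RibbonGraph)
    (t : Fin Γ.nH → Tensor3 𝕂 E A) : Prop where
  propagator : ∀ h, IsPropagator ℰ 𝒜 (t h)
  symm : ∀ h, t (Γ.inv h) = t h

theorem EdgeLabel.cut {t : Fin Γ.nH → Tensor3 𝕂 E A} (ht : EdgeLabel ℰ 𝒜 Γ t) (a : Fin Γ.nH) :
    EdgeLabel ℰ 𝒜 (Γ.cut a) t where
  propagator := ht.propagator
  symm h := by
    rw [show (Γ.cut a).inv h = _ from Γ.cut_inv a h]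
    split_ifs
    · rfl
    · exact ht.symm h

include hc hI in
theorem ampl_iso (f : Γ.Iso Γ') (ψ : Γ.LegEnum l) (ψ' : Γ'.LegEnum l') (e : Fin l ≃ Fin l')
    (he : ∀ i, ψ'.toFun (e i) = f.onH (ψ.toFun i)) {t : Fin Γ.nH → Tensor3 𝕂 E A}
    {t' : Fin Γ'.nH → Tensor3 𝕂 E A} (ht : EdgeLabel ℰ 𝒜 Γ t) (ht' : ∀ h, t' (f.onH h) = t h) : ampl
    hℰ I h𝒜 ψ' t' = transport hℰ e (ampl hℰ I h𝒜 ψ t) := by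
  induction hn : Γ.edges.card using Nat.strong_induction_on generalizing Γ Γ' l l' with
  | _ n ih =>
  rcases Γ.edges.eq_empty_or_nonempty with h0 | ⟨a, ha⟩
  · exact ampl_iso_of_edges_eq_empty hℰ h𝒜 hc hI h0 f ψ ψ' e he t t'
  have hlt : (Γ.cut a).edges.card < n := hn ▸ cut_edges_card_lt ⟨a, ha⟩
  have hd : ∀ h, t h ∈ degreeZero ℰ 𝒜 := fun h => (ht.propagator h).degree_zero
  have hd' : ∀ h, t' h ∈ degreeZero ℰ 𝒜 := fun h => by
    obtain ⟨h, rfl⟩ := f.onH.surjective h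
    rw [ht']; exact hd h
  have e1 := ampl_cut_edge hℰ h𝒜 I ψ hc ⟨a, ha⟩ (t := t) fun e _ => hd e
  have hfa : Γ'.inv (f.onH a) ≠ f.onH a := by rw [Ne, f.legs_iff]; exact Γ.not_leg_of_mem_edges ha
  by_cases h1 : f.onH a ∈ Γ'.edges
  · have e2 := ampl_cut_edge hℰ h𝒜 I ψ' hc ⟨_, h1⟩ (t := t') fun e _ => hd' e
    have e3 := ih _ hlt (f.cut (a := a) (Or.inl rfl)) (ψ.cut a (Γ.not_leg_of_mem_edges ha))
      (ψ'.cut (f.onH a) hfa) (finAddEquiv e (Equiv.refl (Fin 2))) ?_ (t := t) (t' := t') (ht.cut a) ht' rfl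
    · rw [e2, e1]
      simp only [ht']
      rw [← contract_transport hℰ e _ (hd a)]
      exact congrArg _ e3
    · intro i
      refine addCases (fun i => ?_) (fun i => ?_) i
      · rw [finAddEquiv_castAdd, LegEnum.cut_castAdd, LegEnum.cut_castAdd]
        exact he i
      · rw [finAddEquiv_natAdd, LegEnum.cut_natAdd, LegEnum.cut_natAdd]
        fin_cases i
        · rfl
        · exact f.map_inv a
  · have h2 : Γ'.inv (f.onH a) ∈ Γ'.edges := Γ'.inv_mem_edges hfa h1
    have e2 := ampl_cut_edge hℰ h𝒜 I ψ' hc ⟨_, h2⟩ (t := t') fun e _ => hd' e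
    have e3 := ih _ hlt (f.cut (a := a) (a' := Γ'.inv (f.onH a)) (Or.inr (Γ'.inv_inv _).symm))
      (ψ.cut a (Γ.not_leg_of_mem_edges ha))
      (ψ'.cut (Γ'.inv (f.onH a)) (Γ'.not_leg_of_mem_edges h2)) (finAddEquiv e (swap 0 1)) ?_
      (t := t) (t' := t') (ht.cut a) ht' rfl
    · have e4 : t' (Γ'.inv (f.onH a)) = t a := by rw [f.map_inv, ht', ht.symm]
      have e5 : finAddEquiv e (swap (0 : Fin 2) 1) =
          (finAddEquiv e (Equiv.refl (Fin 2))).trans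
            (finAddEquiv (Equiv.refl (Fin l')) (swap 0 1)) := by
        ext i
        refine addCases (fun i => ?_) (fun i => ?_) i <;> simp
      rw [e2, e1]
      simp only [e4]
      rw [← contract_transport hℰ e _ (hd a)]
      refine Eq.trans ?_ (contract_swap hℰ _ (ht.propagator a))
      rw [transport_trans, ← e5]
      exact congrArg _ e3
    · intro i
      refine addCases (fun i => ?_) (fun i => ?_) i
      · rw [finAddEquiv_castAdd, LegEnum.cut_castAdd, LegEnum.cut_castAdd]
        exact he i
      · rw [finAddEquiv_natAdd, LegEnum.cut_natAdd, LegEnum.cut_natAdd]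
        fin_cases i
        · exact Γ'.inv_inv _
        · exact f.map_inv a

/-- The identity isomorphism. -/
def Iso.refl (Γ : RibbonGraph) : Γ.Iso Γ :=
  ⟨Equiv.refl _, Equiv.refl _, fun _ => rfl, fun _ => rfl, fun _ => rfl, fun _ => rfl, fun _ => rfl⟩

include hc hI in
/-- Cutting an edge. -/
theorem ampl_cut (ψ : Γ.LegEnum l) (a : Fin Γ.nH) (ha : Γ.inv a ≠ a) {t : Fin Γ.nH → Tensor3 𝕂 E A}
    (ht : EdgeLabel ℰ 𝒜 Γ t) : ampl hℰ I h𝒜 ψ t = contract (t a) (ampl hℰ I h𝒜 (ψ.cut a ha) t) := by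
  have hd : ∀ h, t h ∈ degreeZero ℰ 𝒜 := fun h => (ht.propagator h).degree_zero
  by_cases h1 : a ∈ Γ.edges
  · exact ampl_cut_edge hℰ h𝒜 I ψ hc ⟨a, h1⟩ fun e _ => hd e
  · have h2 := Γ.inv_mem_edges ha h1
    rw [ampl_cut_edge hℰ h𝒜 I ψ hc ⟨_, h2⟩ (t := t) fun e _ => hd e]
    have e3 := ampl_iso hℰ h𝒜 hc hI ((Iso.refl Γ).cut (a := Γ.inv a) (a' := a) (Or.inr rfl))
      (ψ.cut (Γ.inv a) (Γ.not_leg_of_mem_edges h2)) (ψ.cut a ha)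
      (finAddEquiv (Equiv.refl (Fin l)) (swap 0 1)) ?_ (t := t) (t' := t) (ht.cut _)
      fun _ => rfl
    · rw [e3]
      simp only [ht.symm]
      rw [contract_swap hℰ _ (ht.propagator a)]
    · intro i
      refine addCases (fun i => ?_) (fun i => ?_) i
      · rw [finAddEquiv_castAdd, LegEnum.cut_castAdd, LegEnum.cut_castAdd]
        rfl
      · rw [finAddEquiv_natAdd, LegEnum.cut_natAdd, LegEnum.cut_natAdd]
        fin_cases i
        · rfl
        · exact (Γ.inv_inv a).symm

end RibbonGraph

include h𝒜 in
theorem contract_mem {l : ℕ} {F : Multi 𝕂 E A (l + 2)}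
    (hF : ∀ (d : Fin (l + 2) → ℤ) (x : Fin (l + 2) → E), (∀ i, x i ∈ ℰ (d i)) → F x ∈ 𝒜 (∑ i, d i))
    {P : Tensor3 𝕂 E A} (hP : P ∈ degreeZero ℰ 𝒜) (d : Fin l → ℤ) (x : Fin l → E)
    (hx : ∀ i, x i ∈ ℰ (d i)) : contract P F x ∈ 𝒜 (∑ i, d i) := by
  rw [contract_apply]
  refine degreeZero_induction (ℰ := ℰ) (𝒜 := 𝒜) (h𝒜.isClosed _)
    (contractFun F x).toLinearMap.isLinear (contractFun F x).continuous ?_ hP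
  rintro _ ⟨i, j, k, hijk, p, hp, q, hq, a, ha, rfl⟩
  have h1 := hF _ _ (append_mem (S := fun i => (ℰ i : Set E)) hx (pair_mem hp hq))
  have h2 := SetLike.mul_mem_graded h1 ha
  rw [Fin.sum_univ_add] at h2
  simp only [append_left, append_right, Fin.sum_univ_two] at h2
  change contractFun F x _ ∈ _
  rw [contractFun_pure]
  have h3 : ∑ m, d m + (![i, j] 0 + ![i, j] 1) + k = ∑ m, d m := by simp; linarith
  rwa [h3] at h2

namespace RibbonGraph

variable {Γ : RibbonGraph} {l : ℕ}

include hI hc in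
theorem ampl_mem (ψ : Γ.LegEnum l) {t : Fin Γ.nH → Tensor3 𝕂 E A}
    (ht : ∀ e ∈ Γ.edges, t e ∈ degreeZero ℰ 𝒜) (d : Fin l → ℤ) (x : Fin l → E)
    (hx : ∀ i, x i ∈ ℰ (d i)) : ampl hℰ I h𝒜 ψ t x ∈ 𝒜 (∑ i, d i) := by
  induction hn : Γ.edges.card using Nat.strong_induction_on generalizing Γ l with
  | _ n ih =>
  rcases Γ.edges.eq_empty_or_nonempty with h0 | ⟨a, ha⟩
  · have hsurj : ∀ h, ∃ i, ψ.toFun i = h := fun h =>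
      (ψ.range h).2 (inv_eq_self_of_edges_eq_empty h0 h)
    let F : Fin l ≃ Fin Γ.nH := Equiv.ofBijective ψ.toFun ⟨ψ.injective, hsurj⟩
    have e1 : x = fun i => (x ∘ F.symm) (ψ.toFun i) :=
      funext fun i => by simp [show ψ.toFun i = F i from rfl]
    have e2 := ampl_of_edges_eq_empty (I := I) hℰ h𝒜 h0 ψ t (x := x ∘ F.symm) (d := d ∘ F.symm)
      fun h => hx _
    rw [e1, e2]
    have := vertexProd_mem hℰ hI Γ (d ∘ F.symm) (x ∘ F.symm)
    rw [show ∑ h, (d ∘ F.symm) h = ∑ i, d i from F.symm.sum_comp d] at this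
    exact zsmul_mem this _
  · rw [ampl_cut_edge hℰ h𝒜 I ψ hc ⟨a, ha⟩ ht]
    refine contract_mem h𝒜 (fun d x hx => ?_) (ht a ha) d x hx
    have hlt : (Γ.cut a).edges.card < n := hn ▸ cut_edges_card_lt ⟨a, ha⟩
    exact ih _ hlt (ψ.cut a (Γ.not_leg_of_mem_edges ha))
      (fun e he => ht e ((Γ.cut_edges a e).1 he).1) d x hx rfl

/-! ### Disjoint unions -/

/-- The disjoint union of two graphs. -/
@[reducible]
def glue (Γ₁ Γ₂ : RibbonGraph) : RibbonGraph where
  nH := Γ₁.nH + Γ₂.nH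
  nV := Γ₁.nV + Γ₂.nV
  root := append (castAdd Γ₂.nV ∘ Γ₁.root) (natAdd Γ₁.nV ∘ Γ₂.root)
  inv := finAddEquiv Γ₁.inv Γ₂.inv
  inv_inv := addCases (fun h => by simp [Γ₁.inv_inv]) (fun h => by simp [Γ₂.inv_inv])
  cyc := finAddEquiv Γ₁.cyc Γ₂.cyc
  root_cyc := addCases (fun h => by simp [Γ₁.root_cyc]) (fun h => by simp [Γ₂.root_cyc])
  genus := append Γ₁.genus Γ₂.genus
  bdry := append Γ₁.bdry Γ₂.bdry

variable {Γ₁ Γ₂ : RibbonGraph} {l₁ l₂ : ℕ}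

/-- The enumeration of the legs of a disjoint union. -/
def LegEnum.glue (ψ₁ : Γ₁.LegEnum l₁) (ψ₂ : Γ₂.LegEnum l₂) : (Γ₁.glue Γ₂).LegEnum (l₁ + l₂) where
  toFun := append (castAdd Γ₂.nH ∘ ψ₁.toFun) (natAdd Γ₁.nH ∘ ψ₂.toFun)
  injective := by
    refine Fin.append_injective_iff.2 ⟨(castAdd_injective _ _).comp ψ₁.injective,
      (natAdd_injective _ _).comp ψ₂.injective, ?_⟩
    intro i j h
    have := congrArg Fin.val h
    simp at this
    omega
  range := by
    refine addCases (fun h => ?_) (fun h => ?_)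
    · simp only [finAddEquiv_castAdd, Fin.castAdd_inj]
      rw [← ψ₁.range h]
      constructor
      · rintro ⟨i, hi⟩
        refine addCases (fun i hi => ?_) (fun i hi => ?_) i hi
        · rw [append_left] at hi
          exact ⟨i, castAdd_injective _ _ hi⟩
        · rw [append_right] at hi
          have := congrArg Fin.val hi
          simp at this; omega
      · rintro ⟨i, rfl⟩
        exact ⟨castAdd _ i, by rw [append_left]; rfl⟩
    · simp only [finAddEquiv_natAdd, Fin.natAdd_inj]
      rw [← ψ₂.range h]
      constructor
      · rintro ⟨i, hi⟩
        refine addCases (fun i hi => ?_) (fun i hi => ?_) i hi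
        · rw [append_left] at hi
          have := congrArg Fin.val hi
          simp at this; omega
        · rw [append_right] at hi
          exact ⟨i, natAdd_injective _ _ hi⟩
      · rintro ⟨i, rfl⟩
        exact ⟨natAdd _ i, by rw [append_right]; rfl⟩

theorem LegEnum.glue_castAdd (ψ₁ : Γ₁.LegEnum l₁) (ψ₂ : Γ₂.LegEnum l₂) (i : Fin l₁) :
    (ψ₁.glue ψ₂).toFun (castAdd l₂ i) = castAdd Γ₂.nH (ψ₁.toFun i) := append_left _ _ _

theorem LegEnum.glue_natAdd (ψ₁ : Γ₁.LegEnum l₁) (ψ₂ : Γ₂.LegEnum l₂) (i : Fin l₂) :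
    (ψ₁.glue ψ₂).toFun (natAdd l₁ i) = natAdd Γ₁.nH (ψ₂.toFun i) := append_right _ _ _

theorem glue_root_castAdd (h : Fin Γ₁.nH) :
    (Γ₁.glue Γ₂).root (castAdd Γ₂.nH h) = castAdd Γ₂.nV (Γ₁.root h) := append_left _ _ _

theorem glue_root_natAdd (h : Fin Γ₂.nH) :
    (Γ₁.glue Γ₂).root (natAdd Γ₁.nH h) = natAdd Γ₁.nV (Γ₂.root h) := append_right _ _ _

/-- The half-edges at a vertex of the first graph. -/
def glueAtLeft (v : Fin Γ₁.nV) : Γ₁.At v ≃ (Γ₁.glue Γ₂).At (castAdd Γ₂.nV v) :=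
  Equiv.ofBijective (fun h => ⟨castAdd _ h.1, by rw [glue_root_castAdd, h.2]⟩) ⟨fun h h' hh =>
    Subtype.ext (castAdd_injective _ _ (congrArg Subtype.val hh)), by
    rintro ⟨h, hh⟩
    revert hh
    refine addCases (fun h hh => ?_) (fun h hh => ?_) h
    · rw [glue_root_castAdd] at hh
      exact ⟨⟨h, castAdd_injective _ _ hh⟩, rfl⟩
    · rw [glue_root_natAdd] at hh
      have := congrArg Fin.val hh
      simp at this; omega⟩

/-- The half-edges at a vertex of the second graph. -/
def glueAtRight (v : Fin Γ₂.nV) : Γ₂.At v ≃ (Γ₁.glue Γ₂).At (natAdd Γ₁.nV v) :=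
  Equiv.ofBijective (fun h => ⟨natAdd _ h.1, by rw [glue_root_natAdd, h.2]⟩) ⟨fun h h' hh =>
    Subtype.ext (natAdd_injective _ _ (congrArg Subtype.val hh)), by
    rintro ⟨h, hh⟩
    revert hh
    refine addCases (fun h hh => ?_) (fun h hh => ?_) h
    · rw [glue_root_castAdd] at hh
      have := congrArg Fin.val hh
      simp at this; omega
    · rw [glue_root_natAdd] at hh
      exact ⟨⟨h, natAdd_injective _ _ hh⟩, rfl⟩⟩

theorem vertexProd_glue (d : Fin (Γ₁.nH + Γ₂.nH) → ℤ) (x : Fin (Γ₁.nH + Γ₂.nH) → E) :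
    (Γ₁.glue Γ₂).vertexProd hℰ I d x = Γ₁.vertexProd hℰ I (d ∘ castAdd Γ₂.nH) (x ∘ castAdd Γ₂.nH) *
    Γ₂.vertexProd hℰ I (d ∘ natAdd Γ₁.nH) (x ∘ natAdd Γ₁.nH) := by
  simp only [vertexProd_eq_vertexFun]
  rw [← List.ofFn_eq_map, ← List.ofFn_eq_map, ← List.ofFn_eq_map, ← List.prod_append,
    ← List.ofFn_fin_append]
  congr 2
  funext v
  refine addCases (fun v => ?_) (fun v => ?_) v
  · rw [append_left, append_left, append_left]
    rw [vertexFun_iso hℰ I (glueAtLeft v) (C := Γ₁.cycAt v)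
      (C' := (Γ₁.glue Γ₂).cycAt (castAdd Γ₂.nV v))
      (fun h => Subtype.ext (finAddEquiv_castAdd Γ₁.cyc Γ₂.cyc h.1)), koszulSign_eq_one, one_smul]
    · rfl
    · exact fun i j _ _ h => (show i < j from h).asymm
  · rw [append_right, append_right, append_right]
    rw [vertexFun_iso hℰ I (glueAtRight v) (C := Γ₂.cycAt v)
      (C' := (Γ₁.glue Γ₂).cycAt (natAdd Γ₁.nV v))
      (fun h => Subtype.ext (finAddEquiv_natAdd Γ₁.cyc Γ₂.cyc h.1)), koszulSign_eq_one, one_smul]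
    · rfl
    · intro i j _ _ h h2
      have h2' : natAdd Γ₁.nH j.1 < natAdd Γ₁.nH i.1 := h2
      have h3 : i.1 < j.1 := h
      rw [Fin.natAdd_lt_natAdd_iff] at h2'
      exact h3.asymm h2'

theorem mem_edges_glue_left (h : Fin Γ₁.nH) :
    castAdd Γ₂.nH h ∈ (Γ₁.glue Γ₂).edges ↔ h ∈ Γ₁.edges := by
  rw [mem_edges, mem_edges]
  simp only [finAddEquiv_castAdd]
  rfl

theorem mem_edges_glue_right (h : Fin Γ₂.nH) :
    natAdd Γ₁.nH h ∈ (Γ₁.glue Γ₂).edges ↔ h ∈ Γ₂.edges := by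
  rw [mem_edges, mem_edges]
  simp only [finAddEquiv_natAdd, Fin.natAdd_lt_natAdd_iff]

end RibbonGraph


namespace RibbonGraph

variable {Γ Γ₁ Γ₂ : RibbonGraph} {l l₁ l₂ : ℕ}

/-- In a graph without edges an enumeration of the legs is one of the half-edges. -/
def LegEnum.equiv (ψ : Γ.LegEnum l) (h0 : Γ.edges = ∅) : Fin l ≃ Fin Γ.nH :=
  Equiv.ofBijective ψ.toFun
    ⟨ψ.injective, fun h => (ψ.range h).2 (inv_eq_self_of_edges_eq_empty h0 h)⟩

theorem LegEnum.equiv_apply (ψ : Γ.LegEnum l) (h0 : Γ.edges = ∅) (i : Fin l) :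
    ψ.equiv h0 i = ψ.toFun i := rfl

theorem glue_edges_eq_empty (h1 : Γ₁.edges = ∅) (h2 : Γ₂.edges = ∅) : (Γ₁.glue Γ₂).edges = ∅ := by
  rw [Finset.eq_empty_iff_forall_notMem]
  refine addCases (fun h => ?_) (fun h => ?_)
  · rw [mem_edges_glue_left, h1]; simp
  · rw [mem_edges_glue_right, h2]; simp

theorem ampl_glue_of_edges_eq_empty (h1 : Γ₁.edges = ∅) (h2 : Γ₂.edges = ∅) (ψ₁ : Γ₁.LegEnum l₁)
    (ψ₂ : Γ₂.LegEnum l₂) (t : Fin (Γ₁.glue Γ₂).nH → Tensor3 𝕂 E A) : ampl hℰ I h𝒜 (ψ₁.glue ψ₂) t =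
    tensor (ampl hℰ I h𝒜 ψ₁ (t ∘ castAdd Γ₂.nH)) (ampl hℰ I h𝒜 ψ₂ (t ∘ natAdd Γ₁.nH)) := by
  refine multi_ext hℰ fun d y hy => ?_
  let F := (ψ₁.glue ψ₂).equiv (glue_edges_eq_empty h1 h2)
  let x : Fin (Γ₁.nH + Γ₂.nH) → E := y ∘ F.symm
  let D : Fin (Γ₁.nH + Γ₂.nH) → ℤ := d ∘ F.symm
  have hx : ∀ h, x h ∈ ℰ (D h) := fun h => hy _
  have hF : ∀ i, F.symm ((ψ₁.glue ψ₂).toFun i) = i := fun i => F.symm_apply_apply i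
  have e1 : y = fun i => x ((ψ₁.glue ψ₂).toFun i) := funext fun i => by simp [x, hF]
  have e2 : (fun i => y (castAdd l₂ i)) = fun i => (x ∘ castAdd Γ₂.nH) (ψ₁.toFun i) :=
    funext fun i => by simp only [x, Function.comp, ← LegEnum.glue_castAdd ψ₁ ψ₂, hF]
  have e3 : (fun i => y (natAdd l₁ i)) = fun i => (x ∘ natAdd Γ₁.nH) (ψ₂.toFun i) :=
    funext fun i => by simp only [x, Function.comp, ← LegEnum.glue_natAdd ψ₁ ψ₂, hF]
  rw [tensor_apply, e2, e3, ampl_of_edges_eq_empty (I := I) hℰ h𝒜 h1 ψ₁ _ (x := x ∘ castAdd Γ₂.nH)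
    (d := D ∘ castAdd Γ₂.nH) fun h => hx _, ampl_of_edges_eq_empty (I := I) hℰ h𝒜 h2 ψ₂ _
    (x := x ∘ natAdd Γ₁.nH) (d := D ∘ natAdd Γ₁.nH) fun h => hx _]
  conv_lhs => rw [e1]
  rw [ampl_of_edges_eq_empty hℰ h𝒜 (glue_edges_eq_empty h1 h2) (ψ₁.glue ψ₂) t hx, vertexProd_glue,
    smul_mul_smul_comm]
  congr 1
  have s1 := ψ₁.equiv h1
  have k1 : ∀ i, (ψ₁.glue ψ₂).key (.inl (castAdd Γ₂.nH (ψ₁.toFun i))) =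
      toLex (0, toLex ((i : ℕ), 0)) := fun i => by
    rw [← LegEnum.glue_castAdd ψ₁ ψ₂, LegEnum.key_leg]; rfl
  have k2 : ∀ i, (ψ₁.glue ψ₂).key (.inl (natAdd Γ₁.nH (ψ₂.toFun i))) =
      toLex (0, toLex (l₁ + (i : ℕ), 0)) := fun i => by
    rw [← LegEnum.glue_natAdd ψ₁ ψ₂, LegEnum.key_leg]; rfl
  have r1 : ∀ h, (Γ₁.glue Γ₂).rootKey (castAdd Γ₂.nH h) =
      toLex ((Γ₁.root h : ℕ), (h : ℕ)) := fun h => by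
    rw [rootKey, glue_root_castAdd]; rfl
  have r2 : ∀ h, (Γ₁.glue Γ₂).rootKey (natAdd Γ₁.nH h) =
      toLex (Γ₁.nV + (Γ₂.root h : ℕ), Γ₁.nH + (h : ℕ)) := fun h => by
    rw [rootKey, glue_root_natAdd]; rfl
  rw [koszulSign_finAdd]
  · congr 1
    · refine koszulSign_congr fun i j => ?_
      obtain ⟨i, rfl⟩ := (ψ₁.equiv h1).surjective i
      obtain ⟨j, rfl⟩ := (ψ₁.equiv h1).surjective j
      simp only [Function.comp, LegEnum.equiv_apply, r1, k1, LegEnum.key_leg]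
      rfl
    · refine koszulSign_congr fun i j => ?_
      obtain ⟨i, rfl⟩ := (ψ₂.equiv h2).surjective i
      obtain ⟨j, rfl⟩ := (ψ₂.equiv h2).surjective j
      simp only [Function.comp, LegEnum.equiv_apply, r2, k2, LegEnum.key_leg]
      simp [rootKey, toLex_lt_toLex]
  · intro i j
    obtain ⟨i, rfl⟩ := (ψ₁.equiv h1).surjective i
    obtain ⟨j, rfl⟩ := (ψ₂.equiv h2).surjective j
    simp only [LegEnum.equiv_apply, r1, r2, k1, k2]
    have a1 := (Γ₁.root (ψ₁.toFun i)).2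
    have a2 := i.2
    have b1 : (toLex (0, toLex ((i : ℕ), 0)) : ℕ ×ₗ ℕ ×ₗ ℕ) < toLex (0, toLex (l₁ + (j : ℕ), 0)) :=
      toLex_lt_toLex.2 (Or.inr ⟨rfl, toLex_lt_toLex.2 (Or.inl (by dsimp; omega))⟩)
    have b2 : (toLex ((Γ₁.root (ψ₁.toFun i) : ℕ), (ψ₁.toFun i : ℕ)) : ℕ ×ₗ ℕ) <
        toLex (Γ₁.nV + (Γ₂.root (ψ₂.toFun j) : ℕ), Γ₁.nH + (ψ₂.toFun j : ℕ)) := by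
      simp only [toLex_lt_toLex]; omega
    exact ⟨fun _ => b2.asymm, fun h => absurd h b1.asymm⟩

/-- Cutting an edge of the second graph. -/
def glueCutRight (Γ₁ Γ₂ : RibbonGraph) (a : Fin Γ₂.nH) :
    (Γ₁.glue (Γ₂.cut a)).Iso ((Γ₁.glue Γ₂).cut (natAdd Γ₁.nH a)) where
  onH := Equiv.refl _
  onV := Equiv.refl _
  map_root _ := rfl
  map_inv := by
    refine addCases (fun h => ?_) (fun h => ?_)
    · refine ((Γ₁.glue Γ₂).cut_inv (natAdd Γ₁.nH a) (castAdd Γ₂.nH h)).trans ?_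
      rw [if_neg]
      · simp
      · simp only [finAddEquiv_natAdd, Fin.ext_iff, Fin.val_castAdd, Fin.val_natAdd]; omega
    · refine ((Γ₁.glue Γ₂).cut_inv (natAdd Γ₁.nH a) (natAdd Γ₁.nH h)).trans ?_
      have h1 := finAddEquiv_natAdd Γ₁.inv (Γ₂.cut a).inv h
      refine Eq.trans ?_ h1.symm
      rw [cut_inv]
      simp only [finAddEquiv_natAdd, Fin.natAdd_inj]
      split_ifs <;> rfl
  map_cyc _ := rfl
  map_genus _ := rfl
  map_bdry _ := rfl

/-- Cutting an edge of the first graph. -/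
def glueCutLeft (Γ₁ Γ₂ : RibbonGraph) (a : Fin Γ₁.nH) :
    ((Γ₁.cut a).glue Γ₂).Iso ((Γ₁.glue Γ₂).cut (castAdd Γ₂.nH a)) where
  onH := Equiv.refl _
  onV := Equiv.refl _
  map_root _ := rfl
  map_inv := by
    refine addCases (fun h => ?_) (fun h => ?_)
    · refine ((Γ₁.glue Γ₂).cut_inv (castAdd Γ₂.nH a) (castAdd Γ₂.nH h)).trans ?_
      have h1 := finAddEquiv_castAdd (Γ₁.cut a).inv Γ₂.inv h
      refine Eq.trans ?_ h1.symm
      rw [cut_inv]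
      simp only [finAddEquiv_castAdd, Fin.castAdd_inj]
      split_ifs <;> rfl
    · refine ((Γ₁.glue Γ₂).cut_inv (castAdd Γ₂.nH a) (natAdd Γ₁.nH h)).trans ?_
      rw [if_neg]
      · simp
      · simp only [finAddEquiv_castAdd, Fin.ext_iff, Fin.val_castAdd, Fin.val_natAdd]
        have := (Γ₁.inv a).2
        omega
  map_cyc _ := rfl
  map_genus _ := rfl
  map_bdry _ := rfl

theorem EdgeLabel.left {t : Fin (Γ₁.nH + Γ₂.nH) → Tensor3 𝕂 E A}
    (ht : EdgeLabel ℰ 𝒜 (Γ₁.glue Γ₂) t) : EdgeLabel ℰ 𝒜 Γ₁ (t ∘ castAdd Γ₂.nH) where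
  propagator h := ht.propagator _
  symm h := by
    have := ht.symm (castAdd Γ₂.nH h)
    rwa [finAddEquiv_castAdd] at this

theorem EdgeLabel.right {t : Fin (Γ₁.nH + Γ₂.nH) → Tensor3 𝕂 E A}
    (ht : EdgeLabel ℰ 𝒜 (Γ₁.glue Γ₂) t) : EdgeLabel ℰ 𝒜 Γ₂ (t ∘ natAdd Γ₁.nH) where
  propagator h := ht.propagator _
  symm h := by
    have := ht.symm (natAdd Γ₁.nH h)
    rwa [finAddEquiv_natAdd] at this

include hc hI in
/-- The amplitude of a disjoint union is the tensor product of the amplitudes. -/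
theorem ampl_glue (ψ₁ : Γ₁.LegEnum l₁) (ψ₂ : Γ₂.LegEnum l₂)
    {t : Fin (Γ₁.nH + Γ₂.nH) → Tensor3 𝕂 E A} (ht : EdgeLabel ℰ 𝒜 (Γ₁.glue Γ₂) t) :
    ampl hℰ I h𝒜 (ψ₁.glue ψ₂) t = tensor (ampl hℰ I h𝒜 ψ₁ (t ∘ castAdd Γ₂.nH))
      (ampl hℰ I h𝒜 ψ₂ (t ∘ natAdd Γ₁.nH)) := by
  induction hn : Γ₁.edges.card + Γ₂.edges.card using Nat.strong_induction_on
    generalizing Γ₁ Γ₂ l₁ l₂ with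
  | _ n ih =>
  rcases Γ₂.edges.eq_empty_or_nonempty with h2 | ⟨a, ha⟩
  · rcases Γ₁.edges.eq_empty_or_nonempty with h1 | ⟨a, ha⟩
    · exact ampl_glue_of_edges_eq_empty hℰ h𝒜 h1 h2 ψ₁ ψ₂ t
    · have hlt : (Γ₁.cut a).edges.card < Γ₁.edges.card := cut_edges_card_lt ⟨a, ha⟩
      have ha' := Γ₁.not_leg_of_mem_edges ha
      have hb : (Γ₁.glue Γ₂).inv (castAdd Γ₂.nH a) ≠ castAdd Γ₂.nH a := by
        rw [finAddEquiv_castAdd]; exact fun h => ha' (castAdd_injective _ _ h)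
      have ht' : EdgeLabel ℰ 𝒜 ((Γ₁.cut a).glue Γ₂) t := ⟨ht.propagator, fun h => by
        have := (ht.cut (castAdd Γ₂.nH a)).symm h
        rwa [show ((Γ₁.glue Γ₂).cut (castAdd Γ₂.nH a)).inv h = _ from
          (glueCutLeft Γ₁ Γ₂ a).map_inv h] at this⟩
      have e1 := ih _ (by omega) (ψ₁.cut a ha') ψ₂ ht' rfl
      have e2 := ampl_iso hℰ h𝒜 hc hI (glueCutLeft Γ₁ Γ₂ a) ((ψ₁.cut a ha').glue ψ₂)
        ((ψ₁.glue ψ₂).cut _ hb) (moveLast l₁ l₂) ?_ ht' (t' := t) fun _ => rfl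
      · rw [ampl_cut hℰ h𝒜 hc hI _ _ hb ht, e2, e1]
        have e3 := contract_tensor_left hℰ hc (ampl hℰ I h𝒜 (ψ₁.cut a ha') (t ∘ castAdd Γ₂.nH))
          (ampl hℰ I h𝒜 ψ₂ (t ∘ natAdd Γ₁.nH))
          (ampl_mem hℰ h𝒜 hc hI _ fun e _ => (ht.propagator _).degree_zero)
          (ht.propagator (castAdd Γ₂.nH a)).degree_zero
        refine e3.trans ?_
        congr 1
        exact (ampl_cut hℰ h𝒜 hc hI ψ₁ a ha' ht.left).symm
      · refine addCases (fun i => ?_) (fun i => ?_)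
        · revert i
          refine addCases (fun i => ?_) (fun i => ?_)
          · rw [moveLast_left, LegEnum.cut_castAdd, LegEnum.glue_castAdd, LegEnum.glue_castAdd,
              LegEnum.cut_castAdd]
            rfl
          · rw [moveLast_middle, LegEnum.cut_natAdd, LegEnum.glue_castAdd, LegEnum.cut_natAdd]
            fin_cases i
            · rfl
            · exact finAddEquiv_castAdd _ _ _
        · rw [moveLast_right, LegEnum.cut_castAdd, LegEnum.glue_natAdd, LegEnum.glue_natAdd]
          rfl
  · have hlt : (Γ₂.cut a).edges.card < Γ₂.edges.card := cut_edges_card_lt ⟨a, ha⟩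
    have ha' := Γ₂.not_leg_of_mem_edges ha
    have hb : (Γ₁.glue Γ₂).inv (natAdd Γ₁.nH a) ≠ natAdd Γ₁.nH a := by
      rw [finAddEquiv_natAdd]; exact fun h => ha' (natAdd_injective _ _ h)
    have ht' : EdgeLabel ℰ 𝒜 (Γ₁.glue (Γ₂.cut a)) t := ⟨ht.propagator, fun h => by
      have := (ht.cut (natAdd Γ₁.nH a)).symm h
      rwa [show ((Γ₁.glue Γ₂).cut (natAdd Γ₁.nH a)).inv h = _ from
        (glueCutRight Γ₁ Γ₂ a).map_inv h] at this⟩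
    have e1 := ih _ (by omega) ψ₁ (ψ₂.cut a ha') ht' rfl
    have e2 := ampl_iso hℰ h𝒜 hc hI (glueCutRight Γ₁ Γ₂ a) (ψ₁.glue (ψ₂.cut a ha'))
      ((ψ₁.glue ψ₂).cut _ hb) (finCongr (Nat.add_assoc l₁ l₂ 2).symm) ?_ ht' (t' := t) fun _ => rfl
    · rw [ampl_cut hℰ h𝒜 hc hI _ _ hb ht, e2, e1]
      have e3 := contract_tensor_right hℰ (ampl hℰ I h𝒜 ψ₁ (t ∘ castAdd Γ₂.nH))
        (ampl hℰ I h𝒜 (ψ₂.cut a ha') (t ∘ natAdd Γ₁.nH))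
        (ht.propagator (natAdd Γ₁.nH a)).degree_zero
      refine e3.trans ?_
      congr 1
      exact (ampl_cut hℰ h𝒜 hc hI ψ₂ a ha' ht.right).symm
    · refine addCases (fun i => ?_) (fun i => ?_)
      · rw [show finCongr (Nat.add_assoc l₁ l₂ 2).symm (castAdd (l₂ + 2) i) = castAdd 2 (castAdd l₂
          i) from rfl, LegEnum.cut_castAdd, LegEnum.glue_castAdd, LegEnum.glue_castAdd]
        rfl
      · revert i
        refine addCases (fun i => ?_) (fun i => ?_)
        · rw [show finCongr (Nat.add_assoc l₁ l₂ 2).symm (natAdd l₁ (castAdd 2 i)) =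
            castAdd 2 (natAdd l₁ i) from rfl, LegEnum.cut_castAdd, LegEnum.glue_natAdd,
            LegEnum.glue_natAdd, LegEnum.cut_castAdd]
          rfl
        · rw [show finCongr (Nat.add_assoc l₁ l₂ 2).symm (natAdd l₁ (natAdd l₂ i)) =
            natAdd (l₁ + l₂) i from Fin.ext (by simp [Nat.add_assoc]), LegEnum.cut_natAdd,
            LegEnum.glue_natAdd, LegEnum.cut_natAdd]
          fin_cases i
          · rfl
          · exact finAddEquiv_natAdd _ _ _

end RibbonGraph



section Erase

variable {X Y : Type*} [DecidableEq X] [DecidableEq Y]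

theorem eraseFromCycle_apply (c : Perm X) (x z : X) :
    eraseFromCycle c x z = if z = x then x else if c z = x then c x else c z := by
  unfold eraseFromCycle
  rw [Equiv.Perm.mul_apply, Equiv.swap_apply_def]
  by_cases h : z = x
  · subst h; simp
  · have : c z ≠ c x := fun h1 => h (c.injective h1)
    simp [h, this]

theorem eraseFromCycle_comm (c : Perm X) (x y : X) :
    eraseFromCycle (eraseFromCycle c x) y = eraseFromCycle (eraseFromCycle c y) x := by
  ext z
  have hc : ∀ u v, c u = c v → u = v := fun u v => fun h => c.injective h
  simp only [eraseFromCycle_apply]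
  grind

theorem eraseFromCycle_mul_swap (c : Perm X) {x y z : X} (hx : z ≠ x) (hy : z ≠ y) :
    eraseFromCycle (c * swap x y) z = eraseFromCycle c z * swap x y := by
  unfold eraseFromCycle
  rw [Equiv.Perm.mul_apply, swap_apply_of_ne_of_ne hx hy, mul_assoc]

theorem contractEdge_symm (c : Perm X) (x y : X) : contractEdge c x y = contractEdge c y x := by
  unfold contractEdge
  rw [eraseFromCycle_comm, Equiv.swap_comm]

theorem contractEdge_mul_swap (c : Perm X) {x y z w : X} (h1 : x ≠ z) (h2 : x ≠ w)
    (h3 : y ≠ z) (h4 : y ≠ w) : contractEdge c x y * swap z w =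
      eraseFromCycle (eraseFromCycle (c * swap x y * swap z w) x) y := by
  unfold contractEdge
  rw [← eraseFromCycle_mul_swap _ h3 h4, ← eraseFromCycle_mul_swap _ h1 h2]

theorem contractEdge_comm (c : Perm X) {x y z w : X} (h1 : x ≠ z) (h2 : x ≠ w)
    (h3 : y ≠ z) (h4 : y ≠ w) :
    contractEdge (contractEdge c x y) z w = contractEdge (contractEdge c z w) x y := by
  have e : swap x y * swap z w = swap z w * swap x y := by
    rw [Equiv.mul_swap_eq_swap_mul, swap_apply_of_ne_of_ne h1.symm h3.symm,
      swap_apply_of_ne_of_ne h2.symm h4.symm]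
  rw [contractEdge, contractEdge_mul_swap c h1 h2 h3 h4, contractEdge,
    contractEdge_mul_swap c h1.symm h3.symm h2.symm h4.symm, mul_assoc, e, ← mul_assoc]
  rw [eraseFromCycle_comm _ y z, eraseFromCycle_comm _ x z, eraseFromCycle_comm _ y w,
    eraseFromCycle_comm _ x w]

theorem eraseFromCycle_conj {e : X → Y} (he : Injective e) {c : Perm X} {c' : Perm Y}
    (h : ∀ z, c' (e z) = e (c z)) (x z : X) :
    eraseFromCycle c' (e x) (e z) = e (eraseFromCycle c x z) := by
  simp only [eraseFromCycle_apply, h, he.eq_iff]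
  split_ifs <;> rfl

theorem contractEdge_conj {e : X → Y} (he : Injective e) {c : Perm X} {c' : Perm Y}
    (h : ∀ z, c' (e z) = e (c z)) (x y z : X) :
    contractEdge c' (e x) (e y) (e z) = e (contractEdge c x y z) := by
  refine eraseFromCycle_conj he (fun z => eraseFromCycle_conj he (fun z => ?_) x z) y z
  rw [Equiv.Perm.mul_apply, Equiv.Perm.mul_apply, ← h, Equiv.swap_apply_def, Equiv.swap_apply_def]
  simp only [he.eq_iff]
  split_ifs <;> rfl

theorem contractEdge_of_ne (c : Perm X) {x y z : X} (h1 : z ≠ x) (h2 : z ≠ y) (h3 : c z ≠ x)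
    (h4 : c z ≠ y) : contractEdge c x y z = c z := by
  have h5 : (c * swap x y) z = c z := by rw [Equiv.Perm.mul_apply, swap_apply_of_ne_of_ne h1 h2]
  have h6 : eraseFromCycle (c * swap x y) x z = c z := by
    rw [eraseFromCycle_apply, if_neg h1, h5, if_neg h3]
  rw [contractEdge, eraseFromCycle_apply, if_neg h2, h6, if_neg h4]

variable [Finite X]

theorem sameCycle_eraseFromCycle (c : Perm X) {x y z : X} (hy : y ≠ x) (hz : z ≠ x) :
    (eraseFromCycle c x).SameCycle y z ↔ c.SameCycle y z := by
  constructor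
  · intro h
    obtain ⟨n, -, hn⟩ := h.exists_pow_eq''
    clear h
    obtain ⟨-, hn⟩ := hn
    induction n generalizing y with
    | zero => rw [pow_zero] at hn; exact hn ▸ Equiv.Perm.SameCycle.refl _ _
    | succ n ih =>
      rw [pow_succ, Equiv.Perm.mul_apply] at hn
      have h1 : eraseFromCycle c x y ≠ x := fun h => hy
        ((eraseFromCycle c x).injective (h.trans (eraseFromCycle_self c x).symm))
      refine Equiv.Perm.SameCycle.trans ?_ (ih h1 hn)
      rw [eraseFromCycle_apply, if_neg hy]
      split_ifs with h2
      · rw [← h2]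
        exact Equiv.Perm.sameCycle_apply_right.2 (Equiv.Perm.sameCycle_apply_right.2
          (Equiv.Perm.SameCycle.refl _ _))
      · exact Equiv.Perm.sameCycle_apply_right.2 (Equiv.Perm.SameCycle.refl _ _)
  · intro h
    obtain ⟨n, -, -, hn⟩ := h.exists_pow_eq''
    clear h
    induction n using Nat.strong_induction_on generalizing y with
    | _ n ih =>
    rcases n with _ | n
    · rw [pow_zero] at hn; exact hn ▸ Equiv.Perm.SameCycle.refl _ _
    rw [pow_succ, Equiv.Perm.mul_apply] at hn
    have h0 : (eraseFromCycle c x).SameCycle y (eraseFromCycle c x y) :=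
      Equiv.Perm.sameCycle_apply_right.2 (Equiv.Perm.SameCycle.refl _ _)
    rw [eraseFromCycle_apply, if_neg hy] at h0
    split_ifs at h0 with h2
    · rcases n with _ | n
      · exact absurd (hn.symm.trans h2) hz
      rw [pow_succ, Equiv.Perm.mul_apply, h2] at hn
      refine h0.trans (ih n (by omega) (fun h => hy ?_) hn)
      exact c.injective (h2.trans h.symm)
    · exact h0.trans (ih n (by omega) h2 hn)

theorem not_sameCycle_mul_swap {c : Perm X} {a b : X} (hab : a ≠ b) (h : c.SameCycle a b) :
    ¬ (c * swap a b).SameCycle a b := by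
  classical
  obtain ⟨n0, -, -, hn0⟩ := h.exists_pow_eq''
  have hex : ∃ n : ℕ, (c ^ n) a = b := ⟨n0, hn0⟩
  obtain ⟨n, hn, hmin⟩ : ∃ n : ℕ, (c ^ n) a = b ∧ ∀ m < n, (c ^ m) a ≠ b :=
    ⟨Nat.find hex, Nat.find_spec hex, fun m hm => Nat.find_min hex hm⟩
  have hne : ∀ j, 0 < j → j ≤ n → (c ^ j) a ≠ a := by
    intro j hj hjn h1
    refine hmin (n - j) (by omega) ?_
    rw [← hn, ← Nat.sub_add_cancel hjn, pow_add, Equiv.Perm.mul_apply, h1]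
    simp
  have hpos : 0 < n := by
    rcases Nat.eq_zero_or_pos n with h1 | h1
    · rw [h1] at hn; exact absurd hn hab
    · exact h1
  intro h2
  obtain ⟨m, -, -, hm⟩ := h2.symm.exists_pow_eq''
  have key : ∀ m, ∃ j, 0 < j ∧ j ≤ n ∧ ((c * swap a b) ^ m) b = (c ^ j) a := by
    intro m
    induction m with
    | zero => exact ⟨n, hpos, le_rfl, hn.symm⟩
    | succ m ih =>
      obtain ⟨j, hj, hjn, h3⟩ := ih
      rw [pow_succ', Equiv.Perm.mul_apply, h3, Equiv.Perm.mul_apply]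
      rcases eq_or_lt_of_le hjn with h4 | h4
      · refine ⟨1, one_pos, hpos, ?_⟩
        rw [h4, hn]; simp
      · refine ⟨j + 1, by omega, by omega, ?_⟩
        rw [swap_apply_of_ne_of_ne (hne j hj hjn) (hmin j h4), pow_succ', Equiv.Perm.mul_apply]
  obtain ⟨j, hj, hjn, h3⟩ := key m
  exact hne j hj hjn (h3.symm.trans hm)

theorem sameCycle_mul_swap {c : Perm X} {a b : X} (h : ¬ c.SameCycle a b) :
    (c * swap a b).SameCycle a b := by
  by_contra h1
  have key : ∀ k : ℕ, (c * swap a b).SameCycle a ((c ^ (k + 1)) b) := by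
    intro k
    induction k with
    | zero =>
      have : (c ^ (0 + 1)) b = (c * swap a b) a := by simp
      rw [this]
      exact Equiv.Perm.sameCycle_apply_right.2 (Equiv.Perm.SameCycle.refl _ _)
    | succ k ih =>
      have h2 : (c ^ (k + 1)) b ≠ a := fun h2 => h (h2 ▸
        (Equiv.Perm.sameCycle_pow_right.2 (Equiv.Perm.SameCycle.refl c b)).symm)
      have h3 : (c ^ (k + 1)) b ≠ b := fun h3 => h1 (by rwa [h3] at ih)
      have h4 : (c ^ (k + 1 + 1)) b = (c * swap a b) ((c ^ (k + 1)) b) := by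
        rw [Equiv.Perm.mul_apply, swap_apply_of_ne_of_ne h2 h3, ← Equiv.Perm.mul_apply, ← pow_succ']
      rw [h4]
      exact Equiv.Perm.sameCycle_apply_right.2 ih
  obtain ⟨n, hn, -, h2⟩ := (Equiv.Perm.SameCycle.refl c b).exists_pow_eq''
  have := key (n - 1)
  rw [Nat.sub_add_cancel hn, h2] at this
  exact h1 this

theorem sameCycle_of_forall_apply {c : Perm X} {r : X → X → Prop} (hr : Equivalence r)
    (h : ∀ x, r x (c x)) {x y : X} (hxy : c.SameCycle x y) : r x y := by
  obtain ⟨n, -, -, rfl⟩ := hxy.exists_pow_eq''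
  clear hxy
  induction n with
  | zero => exact hr.refl _
  | succ n ih =>
    rw [pow_succ', Equiv.Perm.mul_apply]
    exact hr.trans ih (h _)

theorem sameCycle_mul_swap_iff {c : Perm X} {a b : X} (h : ¬ c.SameCycle a b) (x y : X) :
    (c * swap a b).SameCycle x y ↔ c.SameCycle x y ∨
      ((c.SameCycle x a ∨ c.SameCycle x b) ∧ (c.SameCycle y a ∨ c.SameCycle y b)) := by
  have hself : ∀ (c : Perm X) z, c.SameCycle z (c z) := fun c z =>
    Equiv.Perm.sameCycle_apply_right.2 (Equiv.Perm.SameCycle.refl _ _)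
  have hab := sameCycle_mul_swap h
  have h1 : ∀ x y, c.SameCycle x y → (c * swap a b).SameCycle x y := by
    intro x y
    refine sameCycle_of_forall_apply (Equiv.Perm.SameCycle.equivalence _) fun z => ?_
    have := hself (c * swap a b) (swap a b z)
    rw [Equiv.Perm.mul_apply, Equiv.swap_apply_self] at this
    refine Equiv.Perm.SameCycle.trans ?_ this
    rw [Equiv.swap_apply_def]
    split_ifs with h2 h3
    · rw [h2]; exact hab
    · rw [h3]; exact hab.symm
    · exact Equiv.Perm.SameCycle.refl _ _
  constructor
  · refine sameCycle_of_forall_apply (r := fun x y => c.SameCycle x y ∨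
      ((c.SameCycle x a ∨ c.SameCycle x b) ∧ (c.SameCycle y a ∨ c.SameCycle y b))) ⟨fun x => Or.inl (Equiv.Perm.SameCycle.refl _ _), ?_, ?_⟩ ?_
    · rintro x y (h2 | h2)
      · exact Or.inl h2.symm
      · exact Or.inr h2.symm
    · have ht : ∀ x y, c.SameCycle x y → (c.SameCycle x a ∨ c.SameCycle x b) →
          (c.SameCycle y a ∨ c.SameCycle y b) := fun x y h2 h3 =>
        h3.imp h2.symm.trans h2.symm.trans
      rintro x y z (h2 | ⟨h2, h3⟩) (h4 | ⟨h4, h5⟩)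
      · exact Or.inl (h2.trans h4)
      · exact Or.inr ⟨ht _ _ h2.symm h4, h5⟩
      · exact Or.inr ⟨h2, ht _ _ h4 h3⟩
      · exact Or.inr ⟨h2, h5⟩
    · intro z
      rw [Equiv.Perm.mul_apply, Equiv.swap_apply_def]
      split_ifs with h2 h3
      · exact Or.inr ⟨Or.inl (h2 ▸ Equiv.Perm.SameCycle.refl _ _), Or.inr (hself c b).symm⟩
      · exact Or.inr ⟨Or.inr (h3 ▸ Equiv.Perm.SameCycle.refl _ _), Or.inl (hself c a).symm⟩
      · exact Or.inl (hself c z)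
  · rintro (h2 | ⟨h2, h3⟩)
    · exact h1 _ _ h2
    · have h4 : ∀ z, (c.SameCycle z a ∨ c.SameCycle z b) → (c * swap a b).SameCycle z a := by
        rintro z (h5 | h5)
        · exact h1 _ _ h5
        · exact (h1 _ _ h5).trans hab.symm
      exact (h4 _ h2).trans (h4 _ h3).symm

theorem numCycles_mul_swap_of_not {c : Perm X} {a b : X} (h : ¬ c.SameCycle a b) :
    numCycles (c * swap a b) + 1 = numCycles c := by
  classical
  unfold numCycles
  let b' : Quotient (Equiv.Perm.SameCycle.setoid c) := Quotient.mk _ b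
  have h1 := Nat.card_congr (Equiv.optionSubtypeNe b').symm
  rw [Finite.card_option] at h1
  rw [h1]
  congr 1
  let f : Quotient (Equiv.Perm.SameCycle.setoid c) →
      Quotient (Equiv.Perm.SameCycle.setoid (c * swap a b)) :=
    Quotient.map id fun x y hxy => (sameCycle_mul_swap_iff h x y).2 (Or.inl hxy)
  refine (Nat.card_congr (Equiv.ofBijective (fun q : {q // q ≠ b'} => f q) ⟨?_, ?_⟩)).symm
  · rintro ⟨q, hq⟩ ⟨q', hq'⟩ hqq
    induction q using Quotient.inductionOn with | _ x => ?_
    induction q' using Quotient.inductionOn with | _ y => ?_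
    have hx : ¬ c.SameCycle x b := fun h2 => hq (Quotient.sound h2)
    have hy : ¬ c.SameCycle y b := fun h2 => hq' (Quotient.sound h2)
    have h3 := (sameCycle_mul_swap_iff h x y).1 (Quotient.exact hqq)
    refine Subtype.ext (Quotient.sound ?_)
    rcases h3 with h3 | ⟨h3, h4⟩
    · exact h3
    · exact (h3.resolve_right hx).trans (h4.resolve_right hy).symm
  · intro q
    induction q using Quotient.inductionOn with | _ x => ?_
    by_cases hx : c.SameCycle x b
    · refine ⟨⟨Quotient.mk _ a, fun h2 => h (Quotient.exact h2)⟩, Quotient.sound ?_⟩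
      exact (sameCycle_mul_swap_iff h a x).2 (Or.inr ⟨Or.inl (Equiv.Perm.SameCycle.refl _ _),
        Or.inr hx⟩)
    · exact ⟨⟨Quotient.mk _ x, fun h2 => hx (Quotient.exact h2)⟩, rfl⟩

theorem numCycles_mul_swap_of_sameCycle {c : Perm X} {a b : X} (hab : a ≠ b)
    (h : c.SameCycle a b) : numCycles (c * swap a b) = numCycles c + 1 := by
  have := numCycles_mul_swap_of_not (not_sameCycle_mul_swap hab h)
  rw [mul_assoc, Equiv.swap_mul_self, mul_one] at this
  exact this.symm

end Erase


section Lists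

variable {X : Type*} [DecidableEq X]

/-- The pairs `{h, i h}`, for `h` in a list, are disjoint. -/
def DisjointPairs (i : X → X) (L : List X) : Prop :=
  L.Pairwise fun x z => x ≠ z ∧ x ≠ i z ∧ i x ≠ z ∧ i x ≠ i z

theorem eraseFromCycle_mul_prod_swap (i : X → X) (L : List X) (c : Perm X) {z : X}
    (hz : ∀ h ∈ L, z ≠ h ∧ z ≠ i h) : eraseFromCycle c z * (L.map fun h => swap h (i h)).prod =
    eraseFromCycle (c * (L.map fun h => swap h (i h)).prod) z := by
  induction L generalizing c with
  | nil => simp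
  | cons x L ih =>
    rw [List.map_cons, List.prod_cons, ← mul_assoc, ← mul_assoc,
      ← eraseFromCycle_mul_swap _ (hz x (by simp)).1 (hz x (by simp)).2]
    exact ih _ fun h hh => hz h (by simp [hh])

theorem sameCycle_foldl_contractEdge [Finite X] (i : X → X) (L : List X) (hL : DisjointPairs i L)
    (c : Perm X) {y z : X} (hy : ∀ h ∈ L, y ≠ h ∧ y ≠ i h) (hz : ∀ h ∈ L, z ≠ h ∧ z ≠ i h) :
    (L.foldl (fun c h => contractEdge c h (i h)) c).SameCycle y z ↔
      (c * (L.map fun h => swap h (i h)).prod).SameCycle y z := by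
  induction L generalizing c with
  | nil => simp
  | cons x L ih =>
    have h1 := List.pairwise_cons.1 hL
    rw [List.foldl_cons, ih h1.2 _ (fun h hh => hy h (by simp [hh])) fun h hh => hz h (by simp [hh]),
      contractEdge, eraseFromCycle_mul_prod_swap, eraseFromCycle_mul_prod_swap, List.map_cons,
      List.prod_cons, ← mul_assoc, sameCycle_eraseFromCycle _ (hy x (by simp)).2 (hz x (by simp)).2,
      sameCycle_eraseFromCycle _ (hy x (by simp)).1 (hz x (by simp)).1]
    · exact fun h hh => ⟨(h1.1 h hh).1, (h1.1 h hh).2.1⟩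
    · exact fun h hh => ⟨(h1.1 h hh).2.2.1, (h1.1 h hh).2.2.2⟩

theorem prod_swap_apply_of_notMem (i : X → X) (L : List X) {z : X} (hz : ∀ h ∈ L, z ≠ h ∧ z ≠ i h) :
    (L.map fun h => swap h (i h)).prod z = z := by
  induction L with
  | nil => simp
  | cons x L ih =>
    rw [List.map_cons, List.prod_cons, Equiv.Perm.mul_apply, ih fun h hh => hz h (by simp [hh]),
      swap_apply_of_ne_of_ne (hz x (by simp)).1 (hz x (by simp)).2]

theorem prod_swap_apply (i : X → X) (L : List X) (hL : DisjointPairs i L) {x : X} (hx : x ∈ L) :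
    (L.map fun h => swap h (i h)).prod x = i x ∧ (L.map fun h => swap h (i h)).prod (i x) = x := by
  induction L with
  | nil => simp at hx
  | cons y L ih =>
    have h1 := List.pairwise_cons.1 hL
    simp only [List.map_cons, List.prod_cons, Equiv.Perm.mul_apply]
    rcases List.mem_cons.1 hx with rfl | hx
    · rw [prod_swap_apply_of_notMem i L fun h hh => ⟨(h1.1 h hh).1, (h1.1 h hh).2.1⟩,
        prod_swap_apply_of_notMem i L fun h hh => ⟨(h1.1 h hh).2.2.1, (h1.1 h hh).2.2.2⟩]
      simp
    · obtain ⟨h2, h3⟩ := ih h1.2 hx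
      obtain ⟨a1, a2, a3, a4⟩ := h1.1 x hx
      rw [h2, h3, swap_apply_of_ne_of_ne a2.symm a4.symm, swap_apply_of_ne_of_ne a1.symm a3.symm]
      simp

end Lists

namespace RibbonGraph

variable {Γ Γ' : RibbonGraph} {l : ℕ}

theorem edges_disjoint {x z : Fin Γ.nH} (hx : x ∈ Γ.edges) (hz : z ∈ Γ.edges) (h : x ≠ z) :
    x ≠ z ∧ x ≠ Γ.inv z ∧ Γ.inv x ≠ z ∧ Γ.inv x ≠ Γ.inv z := by
  rw [mem_edges] at hx hz
  refine ⟨h, ?_, ?_, fun h1 => h (Γ.inv.injective h1)⟩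
  · rintro rfl
    rw [Γ.inv_inv] at hx
    exact hx.asymm hz
  · rintro rfl
    rw [Γ.inv_inv] at hz
    exact hx.asymm hz

theorem disjointPairs_sort_edges (Γ : RibbonGraph) : DisjointPairs Γ.inv (Γ.edges.sort (· ≤ ·)) :=
  (Γ.edges.sort_nodup (· ≤ ·)).imp_of_mem fun hx hz h =>
    edges_disjoint ((mem_sort _).1 hx) ((mem_sort _).1 hz) h

theorem prod_swap_edges (Γ : RibbonGraph) :
    ((Γ.edges.sort (· ≤ ·)).map fun h => swap h (Γ.inv h)).prod = Γ.inv := by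
  ext1 h
  by_cases h1 : h ∈ Γ.edges
  · exact (prod_swap_apply _ _ Γ.disjointPairs_sort_edges ((mem_sort _).2 h1)).1
  by_cases h2 : Γ.inv h ∈ Γ.edges
  · have := (prod_swap_apply _ _ Γ.disjointPairs_sort_edges ((mem_sort (· ≤ ·)).2 h2)).2
    rwa [Γ.inv_inv] at this
  · have h3 : Γ.inv h = h := by
      by_contra h3
      exact h2 (Γ.inv_mem_edges h3 h1)
    rw [h3]
    refine prod_swap_apply_of_notMem _ _ fun e he => ?_
    rw [mem_sort] at he
    constructor
    · rintro rfl; exact h1 he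
    · rintro rfl
      rw [Γ.inv_inv] at h3
      rw [← h3] at h1; exact h1 he

theorem sameCycle_contractAll {y z : Fin Γ.nH} (hy : Γ.inv y = y) (hz : Γ.inv z = z) :
    Γ.contractAll.SameCycle y z ↔ (Γ.cyc * Γ.inv).SameCycle y z := by
  have key : ∀ y, Γ.inv y = y → ∀ h ∈ Γ.edges.sort (· ≤ ·), y ≠ h ∧ y ≠ Γ.inv h := by
    intro y hy h hh
    have h1 := Γ.not_leg_of_mem_edges ((mem_sort _).1 hh)
    constructor
    · rintro rfl; exact h1 hy
    · rintro rfl; rw [Γ.inv_inv] at hy; exact h1 hy.symm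
  unfold contractAll
  rw [sameCycle_foldl_contractEdge Γ.inv _ Γ.disjointPairs_sort_edges _ (key y hy) (key z hz),
    prod_swap_edges]

/-- The canonical cyclic decomposition is obtained by contracting any given edge last. -/
theorem contractAll_cut (a : Fin Γ.nH) (ha : Γ.inv a ≠ a) :
    Γ.contractAll = contractEdge (Γ.cut a).contractAll a (Γ.inv a) := by
  obtain ⟨e, he, hea⟩ : ∃ e ∈ Γ.edges, e = a ∨ e = Γ.inv a := by
    by_cases h : a ∈ Γ.edges
    · exact ⟨a, h, Or.inl rfl⟩
    · exact ⟨_, Γ.inv_mem_edges ha h, Or.inr rfl⟩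
  have hmem : ∀ h, h ∈ (Γ.cut a).edges ↔ h ∈ Γ.edges ∧ h ≠ e := by
    intro h
    rw [Γ.cut_edges a h]
    constructor
    · rintro ⟨h1, h2, h3⟩
      exact ⟨h1, by rcases hea with rfl | rfl <;> assumption⟩
    · rintro ⟨h1, h2⟩
      have h3 := edges_disjoint h1 he h2
      rcases hea with rfl | rfl
      · exact ⟨h1, h3.1, h3.2.1⟩
      · rw [Γ.inv_inv] at h3
        exact ⟨h1, h3.2.1, h3.1⟩
  have hp : (Γ.edges.sort (· ≤ ·)).Perm ((Γ.cut a).edges.sort (· ≤ ·) ++ [e]) := by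
    refine (List.perm_ext_iff_of_nodup (Finset.sort_nodup _ _) ?_).2 fun h => ?_
    · rw [List.nodup_append]
      refine ⟨Finset.sort_nodup _ _, by simp, fun x hx y hy => ?_⟩
      rw [List.mem_singleton.1 hy]
      exact ((hmem x).1 ((mem_sort _).1 hx)).2
    · rw [List.mem_append, mem_sort, List.mem_singleton]
      have := hmem h
      rw [← mem_sort (· ≤ ·) (s := (Γ.cut a).edges)] at this
      rw [this]
      by_cases h1 : h = e
      · subst h1; simp [he]
      · simp [h1]
  have h1 : Γ.contractAll = (Γ.edges.sort (· ≤ ·)).foldl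
      (fun c h => contractEdge c h (Γ.inv h)) Γ.cyc := rfl
  have h2 : (Γ.cut a).contractAll = ((Γ.cut a).edges.sort (· ≤ ·)).foldl
      (fun c h => contractEdge c h (Γ.inv h)) Γ.cyc := by
    refine List.foldl_ext _ _ _ fun c h hh => ?_
    have h3 := (Γ.cut_edges a h).1 ((mem_sort _).1 hh)
    rw [show (Γ.cut a).inv h = Γ.inv h by rw [Γ.cut_inv a h, if_neg (by tauto)]]
  rw [h1, hp.foldl_eq', List.foldl_append, ← h2]
  · rcases hea with rfl | rfl
    · rfl
    · simp only [List.foldl_cons, List.foldl_nil, Γ.inv_inv]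
      exact contractEdge_symm _ _ _
  · intro x hx y hy c
    rw [mem_sort] at hx hy
    by_cases hxy : y = x
    · rw [hxy]
    · obtain ⟨a1, a2, a3, a4⟩ := edges_disjoint hx hy (Ne.symm hxy)
      exact contractEdge_comm _ a1 a2 a3 a4

theorem contractAll_of_edges_eq_empty (h : Γ.edges = ∅) : Γ.contractAll = Γ.cyc := by
  unfold contractAll
  rw [h]
  simp

theorem contractAll_iso (f : Γ.Iso Γ') (h : Fin Γ.nH) :
    Γ'.contractAll (f.onH h) = f.onH (Γ.contractAll h) := by
  induction hn : Γ.edges.card using Nat.strong_induction_on generalizing Γ Γ' with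
  | _ n ih =>
  rcases Γ.edges.eq_empty_or_nonempty with h0 | ⟨a, ha⟩
  · have h0' : Γ'.edges = ∅ := by
      rw [Finset.eq_empty_iff_forall_notMem]
      intro h'
      obtain ⟨h', rfl⟩ := f.onH.surjective h'
      rw [mem_edges, f.map_inv, inv_eq_self_of_edges_eq_empty h0]
      exact lt_irrefl _
    rw [contractAll_of_edges_eq_empty h0, contractAll_of_edges_eq_empty h0', f.map_cyc]
  · have ha' := Γ.not_leg_of_mem_edges ha
    have hlt : (Γ.cut a).edges.card < n := hn ▸ cut_edges_card_lt ⟨a, ha⟩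
    have hfa : Γ'.inv (f.onH a) ≠ f.onH a := by rwa [Ne, f.legs_iff]
    have e1 := ih _ hlt (f.cut (a := a) (a' := f.onH a) (Or.inl rfl))
    rw [contractAll_cut a ha', contractAll_cut _ hfa, f.map_inv]
    exact contractEdge_conj f.onH.injective (fun z => e1 z rfl) _ _ _

/-! ### The canonical cyclic decomposition on an enumeration of the legs -/

theorem mem_legs (h : Fin Γ.nH) : h ∈ Γ.legs ↔ Γ.inv h = h := by simp [legs]

/-- An enumeration of the legs as a bijection. -/
def LegEnum.legEquiv (ψ : Γ.LegEnum l) : Fin l ≃ {h // h ∈ Γ.legs} :=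
  Equiv.ofBijective (fun i => ⟨ψ.toFun i, (mem_legs _).2 ((ψ.range _).1 ⟨i, rfl⟩)⟩)
    ⟨fun i j h => ψ.injective (congrArg Subtype.val h), fun h => by
      obtain ⟨i, hi⟩ := (ψ.range h.1).2 ((mem_legs _).1 h.2)
      exact ⟨i, Subtype.ext hi⟩⟩

theorem LegEnum.card_legs (ψ : Γ.LegEnum l) : Γ.legs.card = l := by
  have := Fintype.card_congr ψ.legEquiv
  rw [Fintype.card_fin, Fintype.card_coe] at this
  exact this.symm

/-- The canonical cyclic decomposition of the legs. -/
def LegEnum.perm (ψ : Γ.LegEnum l) : Perm (Fin l) := ψ.legEquiv.symm.permCongr Γ.canonical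

theorem LegEnum.perm_spec (ψ : Γ.LegEnum l) (i : Fin l) :
    ψ.toFun (ψ.perm i) = Γ.contractAll (ψ.toFun i) := by
  have : ψ.legEquiv (ψ.perm i) = Γ.canonical (ψ.legEquiv i) := by
    simp [LegEnum.perm, permCongr_apply]
  exact congrArg Subtype.val this

theorem LegEnum.perm_eq {ψ : Γ.LegEnum l} {σ : Perm (Fin l)}
    (h : ∀ i, ψ.toFun (σ i) = Γ.contractAll (ψ.toFun i)) : ψ.perm = σ := by
  ext1 i
  exact ψ.injective ((ψ.perm_spec i).trans (h i).symm)

theorem LegEnum.numCycles_perm (ψ : Γ.LegEnum l) : numCycles ψ.perm = numCycles Γ.canonical :=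
  numCycles_congr ψ.legEquiv.symm fun x => by simp [LegEnum.perm, permCongr_apply]

theorem LegEnum.sameCycle_perm (ψ : Γ.LegEnum l) (i j : Fin l) :
    ψ.perm.SameCycle i j ↔ (Γ.cyc * Γ.inv).SameCycle (ψ.toFun i) (ψ.toFun j) := by
  rw [← sameCycle_contractAll ((ψ.range _).1 ⟨i, rfl⟩) ((ψ.range _).1 ⟨j, rfl⟩)]
  have hp : ∀ n : ℕ, ψ.toFun ((ψ.perm ^ n) i) = (Γ.contractAll ^ n) (ψ.toFun i) := by
    intro n
    induction n with
    | zero => rfl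
    | succ n ih => rw [pow_succ', pow_succ', Equiv.Perm.mul_apply, Equiv.Perm.mul_apply, ← ih,
        ψ.perm_spec]
  constructor
  · intro h
    obtain ⟨n, hn⟩ := h.exists_nat_pow_eq
    exact ⟨n, by rw [zpow_natCast, ← hp, hn]⟩
  · intro h
    obtain ⟨n, hn⟩ := h.exists_nat_pow_eq
    exact ⟨n, by rw [zpow_natCast]; exact ψ.injective ((hp n).trans hn)⟩

theorem numCycles_canonical_le (Γ : RibbonGraph) : numCycles Γ.canonical ≤ Γ.numBoundaryCycles := by
  let f : Quotient (Equiv.Perm.SameCycle.setoid Γ.canonical) →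
      Quotient (Equiv.Perm.SameCycle.setoid (Γ.cyc * Γ.inv)) :=
    Quotient.map Subtype.val fun x y hxy => (sameCycle_contractAll ((mem_legs _).1 x.2)
      ((mem_legs _).1 y.2)).1 (Equiv.Perm.sameCycle_subtypePerm.1 hxy)
  refine Nat.card_le_card_of_injective f ?_
  intro q q' h
  induction q using Quotient.inductionOn with | _ x => ?_
  induction q' using Quotient.inductionOn with | _ y => ?_
  exact Quotient.sound (Equiv.Perm.sameCycle_subtypePerm.2 ((sameCycle_contractAll
    ((mem_legs _).1 x.2) ((mem_legs _).1 y.2)).2 (Quotient.exact h)))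

end RibbonGraph


section CutLast

variable {l : ℕ}

/-- The first and the second of the last two elements of `Fin (l + 2)`. -/
abbrev last₁ (l : ℕ) : Fin (l + 2) := natAdd l 0
abbrev last₂ (l : ℕ) : Fin (l + 2) := natAdd l 1

theorem castAdd_or_last (i : Fin (l + 2)) : (∃ j, i = castAdd 2 j) ∨ i = last₁ l ∨ i = last₂ l := by
  refine addCases (fun i => Or.inl ⟨i, rfl⟩) (fun i => ?_) i
  fin_cases i
  · exact Or.inr (Or.inl rfl)
  · exact Or.inr (Or.inr rfl)

theorem castAdd_ne_last (j : Fin l) : castAdd 2 j ≠ last₁ l ∧ castAdd 2 j ≠ last₂ l := by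
  have := j.2
  constructor <;> (intro h; have := congrArg Fin.val h; simp at this; omega)

theorem last_ne : last₁ l ≠ last₂ l := by intro h; simpa using congrArg Fin.val h

theorem exists_contractEdge_last (σ : Perm (Fin (l + 2))) (i : Fin l) :
    ∃ j, contractEdge σ (last₁ l) (last₂ l) (castAdd 2 i) = castAdd 2 j := by
  rcases castAdd_or_last (contractEdge σ (last₁ l) (last₂ l) (castAdd 2 i)) with h | h | h
  · exact h
  · have h1 := contractEdge_fixed σ (last₁ l) (last₂ l) (last₁ l) (Or.inl rfl)
    exact absurd ((contractEdge σ _ _).injective (h.trans h1.symm)) (castAdd_ne_last i).1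
  · have h1 := contractEdge_fixed σ (last₁ l) (last₂ l) (last₂ l) (Or.inr (Or.inl rfl))
    exact absurd ((contractEdge σ _ _).injective (h.trans h1.symm)) (castAdd_ne_last i).2

/-- The effect on a cyclic decomposition of joining the last two elements by an edge and
contracting it. -/
def cutLast (σ : Perm (Fin (l + 2))) : Perm (Fin l) :=
  Equiv.ofBijective (fun i => (exists_contractEdge_last σ i).choose)
    (Finite.injective_iff_bijective.1 fun i j h => by
      have h1 := (exists_contractEdge_last σ i).choose_spec
      have h2 := (exists_contractEdge_last σ j).choose_spec
      rw [show (exists_contractEdge_last σ i).choose = (exists_contractEdge_last σ j).choose from h,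
        ← h2] at h1
      exact castAdd_injective _ _ ((contractEdge σ _ _).injective h1))

theorem castAdd_cutLast (σ : Perm (Fin (l + 2))) (i : Fin l) :
    castAdd 2 (cutLast σ i) = contractEdge σ (last₁ l) (last₂ l) (castAdd 2 i) :=
  (exists_contractEdge_last σ i).choose_spec.symm

end CutLast

theorem finAddEquiv_pow {a b : ℕ} (σ : Perm (Fin a)) (τ : Perm (Fin b)) (n : ℕ) :
    (finAddEquiv σ τ : Perm (Fin (a + b))) ^ n = finAddEquiv (σ ^ n) (τ ^ n) := by
  ext1 i
  induction n generalizing i with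
  | zero => refine addCases (fun i => ?_) (fun i => ?_) i <;> simp
  | succ n ih =>
    simp only [pow_succ', Equiv.Perm.mul_apply, ih]
    refine addCases (fun i => ?_) (fun i => ?_) i <;> simp

theorem numCycles_finAddEquiv {a b : ℕ} (σ : Perm (Fin a)) (τ : Perm (Fin b)) :
    numCycles (finAddEquiv σ τ : Perm (Fin (a + b))) = numCycles σ + numCycles τ := by
  unfold numCycles
  rw [← Nat.card_sum]
  have h1 : ∀ i j, σ.SameCycle i j →
      Equiv.Perm.SameCycle (finAddEquiv σ τ) (castAdd b i) (castAdd b j) := by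
    intro i j h
    obtain ⟨n, rfl⟩ := h.exists_nat_pow_eq
    exact ⟨n, by rw [zpow_natCast, finAddEquiv_pow, finAddEquiv_castAdd]⟩
  have h2 : ∀ i j, τ.SameCycle i j →
      Equiv.Perm.SameCycle (finAddEquiv σ τ) (natAdd a i) (natAdd a j) := by
    intro i j h
    obtain ⟨n, rfl⟩ := h.exists_nat_pow_eq
    exact ⟨n, by rw [zpow_natCast, finAddEquiv_pow, finAddEquiv_natAdd]⟩
  have hv : ∀ (i : Fin a) (j : Fin b), castAdd b i ≠ natAdd a j := fun i j h => by
    have := congrArg Fin.val h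
    simp at this; omega
  let f : Quotient (Equiv.Perm.SameCycle.setoid σ) ⊕ Quotient (Equiv.Perm.SameCycle.setoid τ) →
      Quotient (Equiv.Perm.SameCycle.setoid (finAddEquiv σ τ : Perm (Fin (a + b)))) :=
    Sum.elim (Quotient.map (castAdd b) h1) (Quotient.map (natAdd a) h2)
  refine (Nat.card_congr (Equiv.ofBijective f ⟨?_, ?_⟩)).symm
  · rintro (q | q) (q' | q') h <;> induction q using Quotient.inductionOn with | _ i => ?_ <;>
      induction q' using Quotient.inductionOn with | _ j => ?_ <;>
      obtain ⟨n, hn⟩ := (show Equiv.Perm.SameCycle (finAddEquiv σ τ) _ _ from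
        Quotient.exact h).exists_nat_pow_eq <;>
      rw [finAddEquiv_pow] at hn
    · rw [finAddEquiv_castAdd] at hn
      exact congrArg Sum.inl (Quotient.sound ⟨n, castAdd_injective _ _ hn⟩)
    · rw [finAddEquiv_castAdd] at hn
      exact absurd hn (hv _ _)
    · rw [finAddEquiv_natAdd] at hn
      exact absurd hn.symm (hv _ _)
    · rw [finAddEquiv_natAdd] at hn
      exact congrArg Sum.inr (Quotient.sound ⟨n, natAdd_injective _ _ hn⟩)
  · intro q
    induction q using Quotient.inductionOn with | _ i => ?_
    refine addCases (fun i => ?_) (fun i => ?_) i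
    · exact ⟨.inl (Quotient.mk _ i), rfl⟩
    · exact ⟨.inr (Quotient.mk _ i), rfl⟩

theorem not_sameCycle_finAddEquiv {a b : ℕ} (σ : Perm (Fin a)) (τ : Perm (Fin b)) (i : Fin a)
    (j : Fin b) : ¬ Equiv.Perm.SameCycle (finAddEquiv σ τ) (castAdd b i) (natAdd a j) := by
  intro h
  obtain ⟨n, hn⟩ := h.exists_nat_pow_eq
  rw [finAddEquiv_pow, finAddEquiv_castAdd] at hn
  have := congrArg Fin.val hn
  simp at this; omega

namespace RibbonGraph

variable {Γ Γ' Γ₁ Γ₂ : RibbonGraph} {l l₁ l₂ : ℕ}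

/-! ### Joining two legs by an edge -/

/-- The graph in which the legs `a` and `b` are joined by an edge. -/
@[reducible]
def join (Γ : RibbonGraph) (a b : Fin Γ.nH) : RibbonGraph where
  nH := Γ.nH
  nV := Γ.nV
  root := Γ.root
  inv := if Γ.inv a = a ∧ Γ.inv b = b then Γ.inv * swap a b else Γ.inv
  inv_inv h := by
    split_ifs with hh
    · rw [Equiv.Perm.mul_apply, Equiv.Perm.mul_apply]
      by_cases h1 : h = a
      · subst h1; simp [hh]
      by_cases h2 : h = b
      · subst h2; simp [hh]
      have h3 : Γ.inv h ≠ a := fun h3 => h1 (Γ.inv.injective (h3.trans hh.1.symm))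
      have h4 : Γ.inv h ≠ b := fun h4 => h2 (Γ.inv.injective (h4.trans hh.2.symm))
      rw [swap_apply_of_ne_of_ne h1 h2, swap_apply_of_ne_of_ne h3 h4, Γ.inv_inv]
    · exact Γ.inv_inv h
  cyc := Γ.cyc
  root_cyc := Γ.root_cyc
  genus := Γ.genus
  bdry := Γ.bdry

variable {a b : Fin Γ.nH}

theorem join_inv (ha : Γ.inv a = a) (hb : Γ.inv b = b) :
    (Γ.join a b).inv = Γ.inv * swap a b := if_pos ⟨ha, hb⟩

theorem join_inv_left (ha : Γ.inv a = a) (hb : Γ.inv b = b) : (Γ.join a b).inv a = b := by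
  rw [join_inv ha hb]; simp [hb]

theorem join_inv_right (ha : Γ.inv a = a) (hb : Γ.inv b = b) : (Γ.join a b).inv b = a := by
  rw [join_inv ha hb]; simp [ha]

theorem join_inv_of_ne (ha : Γ.inv a = a) (hb : Γ.inv b = b) {h : Fin Γ.nH} (h1 : h ≠ a)
    (h2 : h ≠ b) : (Γ.join a b).inv h = Γ.inv h := by
  rw [join_inv ha hb, Equiv.Perm.mul_apply, swap_apply_of_ne_of_ne h1 h2]

/-- Cutting the edge that joins two legs. -/
def joinCut (ha : Γ.inv a = a) (hb : Γ.inv b = b) : Γ.Iso ((Γ.join a b).cut a) where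
  onH := Equiv.refl _
  onV := Equiv.refl _
  map_root _ := rfl
  map_inv h := by
    refine ((Γ.join a b).cut_inv a h).trans ?_
    rw [join_inv_left ha hb]
    split_ifs with h1
    · rcases h1 with rfl | rfl
      · exact ha.symm
      · exact hb.symm
    · exact join_inv_of_ne ha hb (fun h2 => h1 (Or.inl h2)) fun h2 => h1 (Or.inr h2)
  map_cyc _ := rfl
  map_genus _ := rfl
  map_bdry _ := rfl

theorem contractAll_join (ha : Γ.inv a = a) (hb : Γ.inv b = b) (hab : a ≠ b) :
    (Γ.join a b).contractAll = contractEdge Γ.contractAll a b := by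
  rw [contractAll_cut (Γ := Γ.join a b) a (by rw [join_inv_left ha hb]; exact hab.symm),
    join_inv_left ha hb]
  congr 1
  ext1 h
  exact contractAll_iso (joinCut ha hb) h

/-- The legs left after joining the last two legs of an enumeration. -/
def LegEnum.join (ψ : Γ.LegEnum (l + 2)) :
    (Γ.join (ψ.toFun (last₁ l)) (ψ.toFun (last₂ l))).LegEnum l where
  toFun i := ψ.toFun (castAdd 2 i)
  injective i j h := castAdd_injective _ _ (ψ.injective h)
  range h := by
    have h1 : Γ.inv (ψ.toFun (last₁ l)) = ψ.toFun (last₁ l) := (ψ.range _).1 ⟨_, rfl⟩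
    have h2 : Γ.inv (ψ.toFun (last₂ l)) = ψ.toFun (last₂ l) := (ψ.range _).1 ⟨_, rfl⟩
    have h0 : ψ.toFun (last₁ l) ≠ ψ.toFun (last₂ l) := fun h => last_ne (ψ.injective h)
    by_cases h3 : h = ψ.toFun (last₁ l)
    · subst h3
      rw [join_inv_left h1 h2]
      exact iff_of_false (fun ⟨i, hi⟩ => (castAdd_ne_last i).1 (ψ.injective hi)) h0.symm
    by_cases h4 : h = ψ.toFun (last₂ l)
    · subst h4
      rw [join_inv_right h1 h2]
      exact iff_of_false (fun ⟨i, hi⟩ => (castAdd_ne_last i).2 (ψ.injective hi)) h0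
    rw [join_inv_of_ne h1 h2 h3 h4, ← ψ.range]
    constructor
    · rintro ⟨i, hi⟩; exact ⟨_, hi⟩
    · rintro ⟨i, rfl⟩
      rcases castAdd_or_last i with ⟨j, rfl⟩ | rfl | rfl
      · exact ⟨j, rfl⟩
      · exact absurd rfl h3
      · exact absurd rfl h4

theorem LegEnum.leg (ψ : Γ.LegEnum l) (i : Fin l) : Γ.inv (ψ.toFun i) = ψ.toFun i :=
  (ψ.range _).1 ⟨_, rfl⟩

theorem LegEnum.perm_join (ψ : Γ.LegEnum (l + 2)) : ψ.join.perm = cutLast ψ.perm := by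
  refine LegEnum.perm_eq fun i => ?_
  have h0 : ψ.toFun (last₁ l) ≠ ψ.toFun (last₂ l) := fun h => last_ne (ψ.injective h)
  have h1 := contractEdge_conj ψ.injective (fun z => (ψ.perm_spec z).symm) (last₁ l) (last₂ l)
    (castAdd 2 i)
  rw [contractAll_join (ψ.leg _) (ψ.leg _) h0]
  refine Eq.trans ?_ h1.symm
  rw [← castAdd_cutLast]
  rfl

/-- Reordering an enumeration of the legs. -/
def LegEnum.reindex (ψ : Γ.LegEnum l) (e : Fin l ≃ Fin l₁) : Γ.LegEnum l₁ where
  toFun i := ψ.toFun (e.symm i)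
  injective i j h := e.symm.injective (ψ.injective h)
  range h := by
    rw [← ψ.range]
    exact ⟨fun ⟨i, hi⟩ => ⟨_, hi⟩, fun ⟨i, hi⟩ => ⟨e i, by simpa using hi⟩⟩

theorem LegEnum.perm_reindex (ψ : Γ.LegEnum l) (e : Fin l ≃ Fin l₁) :
    (ψ.reindex e).perm = e.permCongr ψ.perm :=
  LegEnum.perm_eq fun i => by simp [LegEnum.reindex, permCongr_apply, ψ.perm_spec]

/-- The image of an enumeration of the legs under an isomorphism. -/
def LegEnum.map (ψ : Γ.LegEnum l) (f : Γ.Iso Γ') : Γ'.LegEnum l where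
  toFun i := f.onH (ψ.toFun i)
  injective i j h := ψ.injective (f.onH.injective h)
  range h := by
    obtain ⟨h, rfl⟩ := f.onH.surjective h
    rw [f.legs_iff, ← ψ.range]
    simp

theorem contractAll_glue (Γ₁ Γ₂ : RibbonGraph) :
    (Γ₁.glue Γ₂).contractAll = finAddEquiv Γ₁.contractAll Γ₂.contractAll := by
  induction hn : Γ₁.edges.card + Γ₂.edges.card using Nat.strong_induction_on
    generalizing Γ₁ Γ₂ with
  | _ n ih =>
  have hv : ∀ (i : Fin Γ₁.nH) (j : Fin Γ₂.nH), castAdd Γ₂.nH i ≠ natAdd Γ₁.nH j :=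
    fun i j h => by
      have := congrArg Fin.val h
      simp at this; omega
  rcases Γ₂.edges.eq_empty_or_nonempty with h2 | ⟨a, ha⟩
  · rcases Γ₁.edges.eq_empty_or_nonempty with h1 | ⟨a, ha⟩
    · rw [contractAll_of_edges_eq_empty h1, contractAll_of_edges_eq_empty h2,
        contractAll_of_edges_eq_empty (glue_edges_eq_empty h1 h2)]
    · have hlt : (Γ₁.cut a).edges.card < Γ₁.edges.card := cut_edges_card_lt ⟨a, ha⟩
      have ha' := Γ₁.not_leg_of_mem_edges ha
      have hb : (Γ₁.glue Γ₂).inv (castAdd Γ₂.nH a) ≠ castAdd Γ₂.nH a := by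
        rw [finAddEquiv_castAdd]; exact fun h => ha' (castAdd_injective _ _ h)
      have e1 := ih _ (by omega) (Γ₁.cut a) Γ₂ rfl
      have e2 : ((Γ₁.glue Γ₂).cut (castAdd Γ₂.nH a)).contractAll =
          finAddEquiv (Γ₁.cut a).contractAll Γ₂.contractAll := by
        rw [← e1]; ext1 h; exact contractAll_iso (glueCutLeft Γ₁ Γ₂ a) h
      rw [contractAll_cut _ hb, e2, contractAll_cut a ha']
      ext1 h
      refine addCases (fun h => ?_) (fun h => ?_) h
      · rw [finAddEquiv_castAdd, finAddEquiv_castAdd]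
        exact contractEdge_conj (castAdd_injective _ _) (fun z => finAddEquiv_castAdd _ _ _) _ _ _
      · rw [contractEdge_of_ne, finAddEquiv_natAdd, finAddEquiv_natAdd] <;>
          simp only [finAddEquiv_natAdd, finAddEquiv_castAdd] <;> exact (hv _ _).symm
  · have hlt : (Γ₂.cut a).edges.card < Γ₂.edges.card := cut_edges_card_lt ⟨a, ha⟩
    have ha' := Γ₂.not_leg_of_mem_edges ha
    have hb : (Γ₁.glue Γ₂).inv (natAdd Γ₁.nH a) ≠ natAdd Γ₁.nH a := by
      rw [finAddEquiv_natAdd]; exact fun h => ha' (natAdd_injective _ _ h)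
    have e1 := ih _ (by omega) Γ₁ (Γ₂.cut a) rfl
    have e2 : ((Γ₁.glue Γ₂).cut (natAdd Γ₁.nH a)).contractAll =
        finAddEquiv Γ₁.contractAll (Γ₂.cut a).contractAll := by
      rw [← e1]; ext1 h; exact contractAll_iso (glueCutRight Γ₁ Γ₂ a) h
    rw [contractAll_cut _ hb, e2, contractAll_cut a ha']
    ext1 h
    refine addCases (fun h => ?_) (fun h => ?_) h
    · rw [contractEdge_of_ne, finAddEquiv_castAdd, finAddEquiv_castAdd] <;>
        simp only [finAddEquiv_natAdd, finAddEquiv_castAdd] <;> exact hv _ _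
    · rw [finAddEquiv_natAdd, finAddEquiv_natAdd]
      exact contractEdge_conj (natAdd_injective _ _) (fun z => finAddEquiv_natAdd _ _ _) _ _ _

theorem LegEnum.perm_glue (ψ₁ : Γ₁.LegEnum l₁) (ψ₂ : Γ₂.LegEnum l₂) :
    (ψ₁.glue ψ₂).perm = finAddEquiv ψ₁.perm ψ₂.perm := by
  refine LegEnum.perm_eq ?_
  refine addCases (fun i => ?_) (fun i => ?_)
  · rw [finAddEquiv_castAdd, LegEnum.glue_castAdd, LegEnum.glue_castAdd, contractAll_glue,
      finAddEquiv_castAdd, ψ₁.perm_spec]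
  · rw [finAddEquiv_natAdd, LegEnum.glue_natAdd, LegEnum.glue_natAdd, contractAll_glue,
      finAddEquiv_natAdd, ψ₂.perm_spec]

/-! ### The number of boundary components and the genus -/

theorem nH_eq (Γ : RibbonGraph) : 2 * Γ.edges.card + Γ.legs.card = Γ.nH := by
  have h1 : Γ.edges.card = (Finset.univ.filter fun h => Γ.inv h < h).card := by
    refine Finset.card_bij' (fun h _ => Γ.inv h) (fun h _ => Γ.inv h) ?_ ?_ ?_ ?_
    · intro h hh; simpa [mem_edges, Γ.inv_inv] using hh
    · intro h hh; simpa [mem_edges, Γ.inv_inv] using hh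
    · intro h _; exact Γ.inv_inv h
    · intro h _; exact Γ.inv_inv h
  have h2 : (univ : Finset (Fin Γ.nH)).card = Γ.nH := by simp
  rw [two_mul]
  conv_rhs => rw [← h2]
  conv_lhs => enter [1, 2]; rw [h1]
  rw [← Finset.card_union_of_disjoint, ← Finset.card_union_of_disjoint]
  · congr 1
    ext h
    simp only [mem_union, mem_edges, mem_legs, mem_filter, mem_univ, true_and, iff_true]
    rcases lt_trichotomy h (Γ.inv h) with h1 | h1 | h1
    · exact Or.inl (Or.inl h1)
    · exact Or.inr h1.symm
    · exact Or.inl (Or.inr h1)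
  · rw [Finset.disjoint_left]
    intro h hh
    simp only [mem_union, mem_edges, mem_legs, mem_filter, mem_univ, true_and] at hh ⊢
    rcases hh with hh | hh
    · exact hh.ne'
    · exact hh.ne
  · rw [Finset.disjoint_left]
    intro h hh
    simp only [mem_edges, mem_filter, mem_univ, true_and] at hh ⊢
    exact hh.asymm

/-- The number of all boundary components, including the empty ones and those with legs. -/
def bnd (Γ : RibbonGraph) : ℕ := Γ.numBoundaryCycles + ∑ v, Γ.bdry v

theorem totalBdry_eq (Γ : RibbonGraph) : Γ.totalBdry = Γ.bnd - numCycles Γ.canonical := by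
  simp [totalBdry, bnd]

theorem numCycles_canonical_le_bnd (Γ : RibbonGraph) : numCycles Γ.canonical ≤ Γ.bnd :=
  Γ.numCycles_canonical_le.trans (Nat.le_add_right _ _)

theorem numCycles_cyc_iso (f : Γ.Iso Γ') : numCycles Γ'.cyc = numCycles Γ.cyc :=
  numCycles_congr f.onH f.map_cyc

theorem numBoundaryCycles_iso (f : Γ.Iso Γ') : Γ'.numBoundaryCycles = Γ.numBoundaryCycles :=
  numCycles_congr f.onH fun h => by
    rw [Equiv.Perm.mul_apply, Equiv.Perm.mul_apply, f.map_inv, f.map_cyc]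

theorem bnd_iso (f : Γ.Iso Γ') : Γ'.bnd = Γ.bnd := by
  unfold bnd
  rw [numBoundaryCycles_iso f, ← Equiv.sum_comp f.onV]
  simp only [f.map_bdry]

theorem nH_iso (f : Γ.Iso Γ') : Γ'.nH = Γ.nH := by simpa using (Fintype.card_congr f.onH).symm

theorem nV_iso (f : Γ.Iso Γ') : Γ'.nV = Γ.nV := by simpa using (Fintype.card_congr f.onV).symm

theorem card_legs_iso (f : Γ.Iso Γ') : Γ'.legs.card = Γ.legs.card :=
  ((Γ.sortedLegs rfl).map f).card_legs

theorem totalGenus_iso (f : Γ.Iso Γ') : Γ'.totalGenus = Γ.totalGenus := by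
  have h1 : Γ'.edges.card = Γ.edges.card := by
    have := nH_eq Γ; have := nH_eq Γ'; have := nH_iso f; have := card_legs_iso f; omega
  unfold totalGenus
  rw [← Equiv.sum_comp f.onV]
  simp only [f.map_genus]
  rw [numBoundaryCycles_iso f, numCycles_cyc_iso f, nV_iso f, h1]

theorem card_legs_join (ha : Γ.inv a = a) (hb : Γ.inv b = b) (hab : a ≠ b) :
    (Γ.join a b).legs.card + 2 = Γ.legs.card := by
  have h1 : (Γ.join a b).legs = (Γ.legs.erase a).erase b := by
    ext h
    rw [Finset.mem_erase, Finset.mem_erase, mem_legs, mem_legs]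
    by_cases h1 : h = a
    · rw [h1, join_inv_left ha hb]; simp [hab.symm]
    by_cases h2 : h = b
    · rw [h2, join_inv_right ha hb]; simp [hab]
    rw [join_inv_of_ne ha hb h1 h2]
    simp [h1, h2]
  have h2 := Finset.card_erase_add_one ((mem_legs _).2 ha)
  have h3 := Finset.card_erase_add_one (s := Γ.legs.erase a) (a := b)
    (Finset.mem_erase.2 ⟨hab.symm, (mem_legs _).2 hb⟩)
  rw [h1]
  omega

theorem card_edges_join (ha : Γ.inv a = a) (hb : Γ.inv b = b) (hab : a ≠ b) :
    (Γ.join a b).edges.card = Γ.edges.card + 1 := by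
  have h1 := nH_eq Γ
  have h2 : 2 * (Γ.join a b).edges.card + (Γ.join a b).legs.card = Γ.nH := nH_eq _
  have := card_legs_join ha hb hab
  omega

theorem bnd_totalGenus_join_of_sameCycle (ha : Γ.inv a = a) (hb : Γ.inv b = b) (hab : a ≠ b)
    (h : (Γ.cyc * Γ.inv).SameCycle a b) :
    (Γ.join a b).bnd = Γ.bnd + 1 ∧ (Γ.join a b).totalGenus = Γ.totalGenus := by
  have h1 : (Γ.join a b).numBoundaryCycles = Γ.numBoundaryCycles + 1 := by
    unfold numBoundaryCycles
    rw [join_inv ha hb, ← mul_assoc]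
    exact numCycles_mul_swap_of_sameCycle hab h
  constructor
  · unfold bnd; rw [h1]; ring
  · unfold totalGenus
    rw [h1, card_edges_join ha hb hab]
    push_cast; ring

theorem bnd_totalGenus_join_of_not (ha : Γ.inv a = a) (hb : Γ.inv b = b)
    (h : ¬ (Γ.cyc * Γ.inv).SameCycle a b) :
    (Γ.join a b).bnd + 1 = Γ.bnd ∧ (Γ.join a b).totalGenus = Γ.totalGenus + 1 := by
  have hab : a ≠ b := fun hab => h (hab ▸ Equiv.Perm.SameCycle.refl _ _)
  have h1 : (Γ.join a b).numBoundaryCycles + 1 = Γ.numBoundaryCycles := by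
    unfold numBoundaryCycles
    rw [join_inv ha hb, ← mul_assoc]
    exact numCycles_mul_swap_of_not h
  constructor
  · unfold bnd; rw [← h1]; ring
  · unfold totalGenus
    rw [← h1, card_edges_join ha hb hab]
    push_cast; ring

theorem card_legs_glue : (Γ₁.glue Γ₂).legs.card = Γ₁.legs.card + Γ₂.legs.card :=
  ((Γ₁.sortedLegs rfl).glue (Γ₂.sortedLegs rfl)).card_legs

theorem glue_cyc_mul_inv : (Γ₁.glue Γ₂).cyc * (Γ₁.glue Γ₂).inv =
    finAddEquiv (Γ₁.cyc * Γ₁.inv) (Γ₂.cyc * Γ₂.inv) := by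
  ext1 h
  refine addCases (fun h => ?_) (fun h => ?_) h <;> simp

theorem numBoundaryCycles_glue : (Γ₁.glue Γ₂).numBoundaryCycles =
    Γ₁.numBoundaryCycles + Γ₂.numBoundaryCycles := by
  unfold numBoundaryCycles
  rw [glue_cyc_mul_inv]
  exact numCycles_finAddEquiv _ _

theorem bnd_glue : (Γ₁.glue Γ₂).bnd = Γ₁.bnd + Γ₂.bnd := by
  unfold bnd
  rw [numBoundaryCycles_glue, Fin.sum_univ_add]
  simp only [append_left, append_right]
  ring

theorem totalGenus_glue : (Γ₁.glue Γ₂).totalGenus = Γ₁.totalGenus + Γ₂.totalGenus - 1 := by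
  have h1 : (Γ₁.glue Γ₂).edges.card = Γ₁.edges.card + Γ₂.edges.card := by
    have := nH_eq Γ₁; have := nH_eq Γ₂
    have h3 : 2 * (Γ₁.glue Γ₂).edges.card + (Γ₁.glue Γ₂).legs.card = Γ₁.nH + Γ₂.nH := nH_eq _
    have := card_legs_glue (Γ₁ := Γ₁) (Γ₂ := Γ₂)
    omega
  have h2 : numCycles (Γ₁.glue Γ₂).cyc = numCycles Γ₁.cyc + numCycles Γ₂.cyc :=
    numCycles_finAddEquiv _ _
  unfold totalGenus
  rw [h1, h2, numBoundaryCycles_glue, Fin.sum_univ_add]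
  simp only [append_left, append_right]
  push_cast
  ring

end RibbonGraph


namespace RibbonGraph

variable {Γ Γ' Γ₁ Γ₂ : RibbonGraph}

/-! ### Connectivity -/

/-- Two vertices are connected by a path of edges. -/
def Reach (Γ : RibbonGraph) : Fin Γ.nV → Fin Γ.nV → Prop :=
  Relation.ReflTransGen fun v w => ∃ h, Γ.root h = v ∧ Γ.root (Γ.inv h) = w

theorem Reach.symm {v w : Fin Γ.nV} (h : Γ.Reach v w) : Γ.Reach w v := by
  have : Std.Symm fun v w => ∃ h, Γ.root h = v ∧ Γ.root (Γ.inv h) = w :=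
    ⟨fun v w ⟨h, h1, h2⟩ => ⟨Γ.inv h, h2, by rw [Γ.inv_inv, h1]⟩⟩
  exact Relation.ReflTransGen.stdSymm.symm _ _ h

theorem Reach.trans {u v w : Fin Γ.nV} (h : Γ.Reach u v) (h' : Γ.Reach v w) : Γ.Reach u w :=
  Relation.ReflTransGen.trans h h'

theorem reach_refl (v : Fin Γ.nV) : Γ.Reach v v := Relation.ReflTransGen.refl

theorem reach_inv (h : Fin Γ.nH) : Γ.Reach (Γ.root h) (Γ.root (Γ.inv h)) :=
  Relation.ReflTransGen.single ⟨h, rfl, rfl⟩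

theorem Reach.of_closed {v w : Fin Γ.nV} (h : Γ.Reach v w) (p : Fin Γ.nV → Prop) (hv : p v)
    (hp : ∀ x, p (Γ.root x) → p (Γ.root (Γ.inv x))) : p w := by
  induction h with
  | refl => exact hv
  | tail _ h ih =>
    obtain ⟨x, rfl, rfl⟩ := h
    exact hp x ih

theorem connected_of_reach (v : Fin Γ.nV) (h : ∀ w, Γ.Reach v w) : Γ.Connected :=
  ⟨v.pos, fun u w => (h u).symm.trans (h w)⟩

theorem Connected.reach (h : Γ.Connected) (v w : Fin Γ.nV) : Γ.Reach v w := h.2 v w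

theorem Reach.iso (f : Γ.Iso Γ') {v w : Fin Γ.nV} (h : Γ.Reach v w) :
    Γ'.Reach (f.onV v) (f.onV w) := by
  refine h.of_closed (fun w => Γ'.Reach (f.onV v) (f.onV w)) (reach_refl _) fun x hx => hx.trans ?_
  rw [← f.map_root, ← f.map_root, ← f.map_inv]
  exact reach_inv _

theorem Connected.iso (f : Γ.Iso Γ') (h : Γ.Connected) : Γ'.Connected := by
  refine connected_of_reach (f.onV ⟨0, h.1⟩) fun w => ?_
  obtain ⟨w, rfl⟩ := f.onV.surjective w
  exact (h.reach _ w).iso f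

/-- The inverse of an isomorphism. -/
def Iso.symm (f : Γ.Iso Γ') : Γ'.Iso Γ where
  onH := f.onH.symm
  onV := f.onV.symm
  map_root h := by rw [Equiv.eq_symm_apply, ← f.map_root, apply_symm_apply]
  map_inv h := by rw [Equiv.eq_symm_apply, ← f.map_inv, apply_symm_apply]
  map_cyc h := by rw [Equiv.eq_symm_apply, ← f.map_cyc, apply_symm_apply]
  map_genus v := by rw [← f.map_genus, apply_symm_apply]
  map_bdry v := by rw [← f.map_bdry, apply_symm_apply]

/-- The composite of two isomorphisms. -/
def Iso.trans {Γ'' : RibbonGraph} (f : Γ.Iso Γ') (f' : Γ'.Iso Γ'') : Γ.Iso Γ'' where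
  onH := f.onH.trans f'.onH
  onV := f.onV.trans f'.onV
  map_root h := by simp [f.map_root, f'.map_root]
  map_inv h := by simp [f.map_inv, f'.map_inv]
  map_cyc h := by simp [f.map_cyc, f'.map_cyc]
  map_genus v := by simp [f.map_genus, f'.map_genus]
  map_bdry v := by simp [f.map_bdry, f'.map_bdry]

theorem connected_iso (f : Γ.Iso Γ') : Γ'.Connected ↔ Γ.Connected :=
  ⟨fun h => h.iso f.symm, fun h => h.iso f⟩

theorem reach_of_sameCycle {x y : Fin Γ.nH} (h : (Γ.cyc * Γ.inv).SameCycle x y) :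
    Γ.Reach (Γ.root x) (Γ.root y) := by
  refine sameCycle_of_forall_apply (r := fun x y => Γ.Reach (Γ.root x) (Γ.root y))
    ⟨fun _ => reach_refl _, fun h => h.symm, fun h h' => h.trans h'⟩ (fun x => ?_) h
  rw [Equiv.Perm.mul_apply, Γ.root_cyc]
  exact reach_inv x

variable {a b : Fin Γ.nH}

theorem Reach.join (ha : Γ.inv a = a) (hb : Γ.inv b = b) {v w : Fin Γ.nV} (h : Γ.Reach v w) :
    (Γ.join a b).Reach v w := by
  refine h.of_closed (fun w => (Γ.join a b).Reach v w) (reach_refl (Γ := Γ.join a b) _) fun x hx => ?_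
  by_cases h1 : x = a
  · subst h1; rwa [ha]
  by_cases h2 : x = b
  · subst h2; rwa [hb]
  · rw [← join_inv_of_ne ha hb h1 h2]
    exact hx.trans (reach_inv (Γ := Γ.join a b) x)

theorem Connected.join (ha : Γ.inv a = a) (hb : Γ.inv b = b) (h : Γ.Connected) :
    (Γ.join a b).Connected := ⟨h.1, fun v w => (h.reach v w).join ha hb⟩

theorem reach_or_reach (ha : Γ.inv a = a) (hb : Γ.inv b = b) (h : (Γ.join a b).Connected)
    (v : Fin Γ.nV) : Γ.Reach (Γ.root a) v ∨ Γ.Reach (Γ.root b) v := by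
  refine (h.reach (Γ.root a) v).of_closed
    (fun v : Fin Γ.nV => Γ.Reach (Γ.root a) v ∨ Γ.Reach (Γ.root b) v) (Or.inl (reach_refl _)) ?_
  intro x hx
  by_cases h1 : x = a
  · rw [h1, join_inv_left ha hb]; exact Or.inr (reach_refl _)
  by_cases h2 : x = b
  · rw [h2, join_inv_right ha hb]; exact Or.inl (reach_refl _)
  rw [join_inv_of_ne ha hb h1 h2]
  have h3 := reach_inv (Γ := Γ) x
  exact hx.imp (fun h => h.trans h3) fun h => h.trans h3

theorem connected_join_of_reach_or (ha : Γ.inv a = a) (hb : Γ.inv b = b)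
    (h : ∀ v, Γ.Reach (Γ.root a) v ∨ Γ.Reach (Γ.root b) v) : (Γ.join a b).Connected := by
  refine connected_of_reach (Γ := Γ.join a b) (Γ.root a) fun v => ?_
  rcases h v with h1 | h1
  · exact h1.join ha hb
  · have := reach_inv (Γ := Γ.join a b) a
    rw [join_inv_left ha hb] at this
    exact this.trans (h1.join ha hb)

theorem not_reach_of_not_connected (h : ¬ Γ.Connected)
    (h' : ∀ v, Γ.Reach (Γ.root a) v ∨ Γ.Reach (Γ.root b) v) : ¬ Γ.Reach (Γ.root a) (Γ.root b) :=
  fun h1 => h (connected_of_reach (Γ.root a) fun v => (h' v).elim id h1.trans)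

theorem reach_glue_castAdd {v : Fin Γ₁.nV} {w : Fin (Γ₁.nV + Γ₂.nV)} :
    (Γ₁.glue Γ₂).Reach (castAdd Γ₂.nV v) w ↔ ∃ w', w = castAdd Γ₂.nV w' ∧ Γ₁.Reach v w' := by
  constructor
  · intro h
    refine h.of_closed (fun w : Fin (Γ₁.nV + Γ₂.nV) => ∃ w', w = castAdd Γ₂.nV w' ∧ Γ₁.Reach v w')
      ⟨v, rfl, reach_refl v⟩ ?_
    refine addCases (fun x => ?_) (fun x => ?_)
    · rintro ⟨w', h1, h2⟩
      rw [glue_root_castAdd] at h1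
      rw [← castAdd_injective _ _ h1] at h2
      exact ⟨_, by rw [finAddEquiv_castAdd, glue_root_castAdd], h2.trans (reach_inv x)⟩
    · rintro ⟨w', h1, h2⟩
      rw [glue_root_natAdd] at h1
      have := congrArg Fin.val h1
      simp at this; omega
  · rintro ⟨w', rfl, h⟩
    refine h.of_closed (fun w => (Γ₁.glue Γ₂).Reach (castAdd Γ₂.nV v) (castAdd Γ₂.nV w))
      (reach_refl (Γ := Γ₁.glue Γ₂) _) fun x hx => hx.trans ?_
    have := reach_inv (Γ := Γ₁.glue Γ₂) (castAdd Γ₂.nH x)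
    rwa [finAddEquiv_castAdd, glue_root_castAdd, glue_root_castAdd] at this

theorem reach_glue_natAdd {v : Fin Γ₂.nV} {w : Fin (Γ₁.nV + Γ₂.nV)} :
    (Γ₁.glue Γ₂).Reach (natAdd Γ₁.nV v) w ↔ ∃ w', w = natAdd Γ₁.nV w' ∧ Γ₂.Reach v w' := by
  constructor
  · intro h
    refine h.of_closed (fun w : Fin (Γ₁.nV + Γ₂.nV) => ∃ w', w = natAdd Γ₁.nV w' ∧ Γ₂.Reach v w')
      ⟨v, rfl, reach_refl v⟩ ?_
    refine addCases (fun x => ?_) (fun x => ?_)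
    · rintro ⟨w', h1, h2⟩
      rw [glue_root_castAdd] at h1
      have := congrArg Fin.val h1
      simp at this; omega
    · rintro ⟨w', h1, h2⟩
      rw [glue_root_natAdd] at h1
      rw [← natAdd_injective _ _ h1] at h2
      exact ⟨_, by rw [finAddEquiv_natAdd, glue_root_natAdd], h2.trans (reach_inv x)⟩
  · rintro ⟨w', rfl, h⟩
    refine h.of_closed (fun w => (Γ₁.glue Γ₂).Reach (natAdd Γ₁.nV v) (natAdd Γ₁.nV w))
      (reach_refl (Γ := Γ₁.glue Γ₂) _) fun x hx => hx.trans ?_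
    have := reach_inv (Γ := Γ₁.glue Γ₂) (natAdd Γ₁.nH x)
    rwa [finAddEquiv_natAdd, glue_root_natAdd, glue_root_natAdd] at this

theorem reach_glue_or (h₁ : Γ₁.Connected) (h₂ : Γ₂.Connected) (a : Fin Γ₁.nH) (b : Fin Γ₂.nH)
    (v : Fin (Γ₁.nV + Γ₂.nV)) : (Γ₁.glue Γ₂).Reach ((Γ₁.glue Γ₂).root (castAdd Γ₂.nH a)) v ∨
    (Γ₁.glue Γ₂).Reach ((Γ₁.glue Γ₂).root (natAdd Γ₁.nH b)) v := by
  rw [glue_root_castAdd, glue_root_natAdd]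
  refine addCases (fun v => Or.inl ?_) (fun v => Or.inr ?_) v
  · exact reach_glue_castAdd.2 ⟨v, rfl, h₁.reach _ _⟩
  · exact reach_glue_natAdd.2 ⟨v, rfl, h₂.reach _ _⟩

theorem not_connected_glue (h₁ : Γ₁.Connected) (h₂ : Γ₂.Connected) : ¬ (Γ₁.glue Γ₂).Connected := by
  intro h
  obtain ⟨w, hw, -⟩ := reach_glue_castAdd.1 (h.reach (castAdd Γ₂.nV ⟨0, h₁.1⟩)
    (natAdd Γ₁.nV ⟨0, h₂.1⟩))
  have := congrArg Fin.val hw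
  simp at this; omega

end RibbonGraph

/-! ### Labelled graphs -/

/-- A ribbon graph with half-edges `Fin n` and vertices `Fin m`, some of whose edges are marked. -/
@[ext]
structure LG (n m : ℕ) where
  root : Fin n → Fin m
  inv : Perm (Fin n)
  cyc : Perm (Fin n)
  genus : Fin m → ℕ
  bdry : Fin m → ℕ
  mark : Fin n → Bool
  inv_inv : ∀ h, inv (inv h) = h
  root_cyc : ∀ h, root (cyc h) = root h
  mark_inv : ∀ h, mark (inv h) = mark h
  mark_leg : ∀ h, inv h = h → mark h = false

namespace LG

variable {n m n' m' n₁ n₂ m₁ m₂ : ℕ}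

/-- The underlying ribbon graph. -/
@[reducible]
def graph (Γ : LG n m) : RibbonGraph where
  nH := n
  nV := m
  root := Γ.root
  inv := Γ.inv
  inv_inv := Γ.inv_inv
  cyc := Γ.cyc
  root_cyc := Γ.root_cyc
  genus := Γ.genus
  bdry := Γ.bdry

/-- Relabelling a labelled graph. -/
@[reducible]
def map (e : Fin n ≃ Fin n') (e' : Fin m ≃ Fin m') (Γ : LG n m) : LG n' m' where
  root h := e' (Γ.root (e.symm h))
  inv := e.permCongr Γ.inv
  cyc := e.permCongr Γ.cyc
  genus v := Γ.genus (e'.symm v)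
  bdry v := Γ.bdry (e'.symm v)
  mark h := Γ.mark (e.symm h)
  inv_inv h := by simp [permCongr_apply, Γ.inv_inv]
  root_cyc h := by simp [permCongr_apply, Γ.root_cyc]
  mark_inv h := by simp [permCongr_apply, Γ.mark_inv]
  mark_leg h hh := Γ.mark_leg _ (by simpa [permCongr_apply, Equiv.eq_symm_apply] using hh)

theorem map_map_symm (e : Fin n ≃ Fin n') (e' : Fin m ≃ Fin m') (Γ : LG n' m') :
    (Γ.map e.symm e'.symm).map e e' = Γ := by
  ext <;> simp [permCongr_apply]

theorem map_symm_map (e : Fin n ≃ Fin n') (e' : Fin m ≃ Fin m') (Γ : LG n m) :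
    (Γ.map e e').map e.symm e'.symm = Γ := by
  ext <;> simp [permCongr_apply]

/-- The isomorphism from a labelled graph to a relabelling. -/
def mapIso (e : Fin n ≃ Fin n') (e' : Fin m ≃ Fin m') (Γ : LG n m) :
    Γ.graph.Iso (Γ.map e e').graph where
  onH := e
  onV := e'
  map_root h := by simp
  map_inv h := by simp [permCongr_apply]
  map_cyc h := by simp [permCongr_apply]
  map_genus v := by simp
  map_bdry v := by simp

/-- The disjoint union of two labelled graphs. -/
@[reducible]
def glue (Γ₁ : LG n₁ m₁) (Γ₂ : LG n₂ m₂) : LG (n₁ + n₂) (m₁ + m₂) where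
  root := (Γ₁.graph.glue Γ₂.graph).root
  inv := (Γ₁.graph.glue Γ₂.graph).inv
  cyc := (Γ₁.graph.glue Γ₂.graph).cyc
  genus := (Γ₁.graph.glue Γ₂.graph).genus
  bdry := (Γ₁.graph.glue Γ₂.graph).bdry
  mark := append Γ₁.mark Γ₂.mark
  inv_inv := (Γ₁.graph.glue Γ₂.graph).inv_inv
  root_cyc := (Γ₁.graph.glue Γ₂.graph).root_cyc
  mark_inv := addCases (fun h => by simp [Γ₁.mark_inv]) (fun h => by simp [Γ₂.mark_inv])
  mark_leg := addCases (fun h hh => by simpa using Γ₁.mark_leg h (by simpa using hh))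
    (fun h hh => by simpa using Γ₂.mark_leg h (by simpa using hh))

theorem exists_finAddEquiv {a b : ℕ} (σ : Perm (Fin (a + b)))
    (h : ∀ i, ∃ j, σ (castAdd b i) = castAdd b j) : ∃ σ₁ σ₂, σ = finAddEquiv σ₁ σ₂ := by
  have h1 := Equiv.Perm.mem_sumCongrHom_range_of_perm_mapsTo_inl
    (σ := finSumFinEquiv.symm.permCongr σ) (by
      rintro _ ⟨i, rfl⟩
      obtain ⟨j, hj⟩ := h i
      exact ⟨j, by simp [permCongr_apply, hj]⟩)
  obtain ⟨⟨σ₁, σ₂⟩, hs⟩ := h1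
  refine ⟨σ₁, σ₂, ?_⟩
  have h2 : σ = finSumFinEquiv.permCongr (finSumFinEquiv.symm.permCongr σ) := by
    ext1 i; simp [permCongr_apply]
  rw [h2, ← hs]
  ext1 i
  refine addCases (fun i => ?_) (fun i => ?_) i <;> simp [permCongr_apply]

theorem glue_injective {Γ₁ Γ₁' : LG n₁ m₁} {Γ₂ Γ₂' : LG n₂ m₂} (h : Γ₁.glue Γ₂ = Γ₁'.glue Γ₂') :
    Γ₁ = Γ₁' ∧ Γ₂ = Γ₂' := by
  have hr := fun x => congrFun (congrArg LG.root h) x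
  have hi := fun x => DFunLike.congr_fun (congrArg LG.inv h) x
  have hc := fun x => DFunLike.congr_fun (congrArg LG.cyc h) x
  have hg := fun x => congrFun (congrArg LG.genus h) x
  have hb := fun x => congrFun (congrArg LG.bdry h) x
  have hm := fun x => congrFun (congrArg LG.mark h) x
  constructor
  · ext x
    · simpa using congrArg Fin.val (hr (castAdd _ x))
    · simpa using congrArg Fin.val (hi (castAdd _ x))
    · simpa using congrArg Fin.val (hc (castAdd _ x))
    · simpa using hg (castAdd _ x)
    · simpa using hb (castAdd _ x)
    · simpa using hm (castAdd _ x)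
  · ext x
    · simpa using congrArg Fin.val (hr (natAdd _ x))
    · simpa using congrArg Fin.val (hi (natAdd _ x))
    · simpa using congrArg Fin.val (hc (natAdd _ x))
    · simpa using hg (natAdd _ x)
    · simpa using hb (natAdd _ x)
    · simpa using hm (natAdd _ x)

/-- A graph is a disjoint union if a set of half-edges and vertices is closed. -/
theorem exists_eq_glue (Γ : LG (n₁ + n₂) (m₁ + m₂))
    (h1 : ∀ h, ∃ v, Γ.root (castAdd n₂ h) = castAdd m₂ v)
    (h2 : ∀ h, ∃ v, Γ.root (natAdd n₁ h) = natAdd m₁ v)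
    (h3 : ∀ h, ∃ h', Γ.inv (castAdd n₂ h) = castAdd n₂ h') :
    ∃ (Γ₁ : LG n₁ m₁) (Γ₂ : LG n₂ m₂), Γ = Γ₁.glue Γ₂ := by
  have hv : ∀ {p q : ℕ} (i : Fin p) (j : Fin q), castAdd q i ≠ natAdd p j := fun i j h => by
    have := congrArg Fin.val h
    simp at this; omega
  have h4 : ∀ h, ∃ h', Γ.cyc (castAdd n₂ h) = castAdd n₂ h' := by
    intro h
    obtain ⟨v, hvv⟩ := h1 h
    rw [← Γ.root_cyc] at hvv
    generalize Γ.cyc (castAdd n₂ h) = x at hvv ⊢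
    revert hvv
    refine addCases (fun x _ => ⟨x, rfl⟩) (fun x hx => ?_) x
    obtain ⟨w, hw⟩ := h2 x
    exact absurd (hx.symm.trans hw) (hv _ _)
  choose r1 hr1 using h1
  choose r2 hr2 using h2
  obtain ⟨i1, i2, hi⟩ := exists_finAddEquiv Γ.inv h3
  obtain ⟨c1, c2, hc⟩ := exists_finAddEquiv Γ.cyc h4
  have hi1 : ∀ h, Γ.inv (castAdd n₂ h) = castAdd n₂ (i1 h) := fun h => by rw [hi]; simp
  have hi2 : ∀ h, Γ.inv (natAdd n₁ h) = natAdd n₁ (i2 h) := fun h => by rw [hi]; simp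
  have hc1 : ∀ h, Γ.cyc (castAdd n₂ h) = castAdd n₂ (c1 h) := fun h => by rw [hc]; simp
  have hc2 : ∀ h, Γ.cyc (natAdd n₁ h) = natAdd n₁ (c2 h) := fun h => by rw [hc]; simp
  refine ⟨⟨r1, i1, c1, Γ.genus ∘ castAdd m₂, Γ.bdry ∘ castAdd m₂, Γ.mark ∘ castAdd n₂,
    fun h => ?_, fun h => ?_, fun h => ?_, fun h hh => ?_⟩, ⟨r2, i2, c2, Γ.genus ∘ natAdd m₁,
    Γ.bdry ∘ natAdd m₁, Γ.mark ∘ natAdd n₁, fun h => ?_, fun h => ?_, fun h => ?_,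
    fun h hh => ?_⟩, ?_⟩
  · have := Γ.inv_inv (castAdd n₂ h)
    rw [hi1, hi1] at this
    exact castAdd_injective _ _ this
  · have := Γ.root_cyc (castAdd n₂ h)
    rw [hc1, hr1, hr1] at this
    exact castAdd_injective _ _ this
  · have := Γ.mark_inv (castAdd n₂ h)
    rwa [hi1] at this
  · exact Γ.mark_leg _ (by rw [hi1, hh])
  · have := Γ.inv_inv (natAdd n₁ h)
    rw [hi2, hi2] at this
    exact natAdd_injective _ _ this
  · have := Γ.root_cyc (natAdd n₁ h)
    rw [hc2, hr2, hr2] at this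
    exact natAdd_injective _ _ this
  · have := Γ.mark_inv (natAdd n₁ h)
    rwa [hi2] at this
  · exact Γ.mark_leg _ (by rw [hi2, hh])
  · refine LG.ext ?_ hi hc ?_ ?_ ?_
    · funext x; refine addCases (fun x => ?_) (fun x => ?_) x <;> simp [hr1, hr2]
    · funext x; refine addCases (fun x => ?_) (fun x => ?_) x <;> simp
    · funext x; refine addCases (fun x => ?_) (fun x => ?_) x <;> simp
    · funext x; refine addCases (fun x => ?_) (fun x => ?_) x <;> simp

end LG


theorem exists_block {n : ℕ} (A : Finset (Fin n)) : ∃ e : Fin (A.card + (n - A.card)) ≃ Fin n,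
    (∀ i, e (castAdd _ i) ∈ A) ∧ ∀ j, e (natAdd _ j) ∉ A := by
  classical
  have h1 : Fintype.card {x // x ∈ A} = A.card := Fintype.card_coe A
  have h2 : Fintype.card {x // x ∉ A} = n - A.card := by
    rw [Fintype.card_subtype_compl, Fintype.card_fin, h1]
  refine ⟨(finSumFinEquiv.symm.trans ((Fintype.equivFinOfCardEq h1).symm.sumCongr
    (Fintype.equivFinOfCardEq h2).symm)).trans (Equiv.sumCompl _), fun i => ?_, fun j => ?_⟩
  · simp
  · simp only [Equiv.trans_apply, finSumFinEquiv_symm_apply_natAdd]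
    exact ((Fintype.equivFinOfCardEq h2).symm j).2

namespace LG

open RibbonGraph

variable {n m n' m' n₁ n₂ m₁ m₂ : ℕ}

theorem glue_root_left (Γ₁ : LG n₁ m₁) (Γ₂ : LG n₂ m₂) (h : Fin n₁) :
    (Γ₁.glue Γ₂).root (castAdd n₂ h) = castAdd m₂ (Γ₁.root h) := append_left _ _ _

theorem glue_root_right (Γ₁ : LG n₁ m₁) (Γ₂ : LG n₂ m₂) (h : Fin n₂) :
    (Γ₁.glue Γ₂).root (natAdd n₁ h) = natAdd m₁ (Γ₂.root h) := append_right _ _ _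

/-- The legs `a` and `b` lie in the two components of a disconnected graph. -/
structure IsSplit (Γ : LG n m) (a b : Fin n) : Prop where
  not_connected : ¬ Γ.graph.Connected
  left : Γ.inv a = a
  right : Γ.inv b = b
  reach : ∀ v, Γ.graph.Reach (Γ.root a) v ∨ Γ.graph.Reach (Γ.root b) v

open Classical in
/-- The vertices of the component of a half-edge. -/
def compV (Γ : LG n m) (a : Fin n) : Finset (Fin m) :=
  Finset.univ.filter fun v => Γ.graph.Reach (Γ.root a) v

/-- The half-edges of the component of a half-edge. -/
def compH (Γ : LG n m) (a : Fin n) : Finset (Fin n) :=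
  Finset.univ.filter fun h => Γ.root h ∈ Γ.compV a

theorem mem_compV {Γ : LG n m} {a : Fin n} {v : Fin m} :
    v ∈ Γ.compV a ↔ Γ.graph.Reach (Γ.root a) v := by simp [compV]

theorem mem_compH {Γ : LG n m} {a h : Fin n} : h ∈ Γ.compH a ↔ Γ.root h ∈ Γ.compV a := by
  simp [compH]

theorem IsSplit.not_reach {Γ : LG n m} {a b : Fin n} (h : Γ.IsSplit a b) :
    ¬ Γ.graph.Reach (Γ.root a) (Γ.root b) :=
  not_reach_of_not_connected (Γ := Γ.graph) h.not_connected h.reach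

/-- `e` carries the left block to `A` and the right block to its complement. -/
def IsBlock (e : Fin (n₁ + n₂) ≃ Fin n) (A : Finset (Fin n)) : Prop :=
  (∀ i, e (castAdd _ i) ∈ A) ∧ ∀ j, e (natAdd _ j) ∉ A

theorem IsBlock.left {e : Fin (n₁ + n₂) ≃ Fin n} {A : Finset (Fin n)} (h : IsBlock e A) {x : Fin n}
    (hx : x ∈ A) : ∃ i, e.symm x = castAdd n₂ i := by
  obtain ⟨i, rfl⟩ := e.surjective x
  revert hx
  refine addCases (fun i _ => ⟨i, by simp⟩) (fun i hx => absurd hx (h.2 i)) i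

theorem IsBlock.right {e : Fin (n₁ + n₂) ≃ Fin n} {A : Finset (Fin n)} (h : IsBlock e A) {x : Fin n}
    (hx : x ∉ A) : ∃ i, e.symm x = natAdd n₁ i := by
  obtain ⟨i, rfl⟩ := e.surjective x
  revert hx
  refine addCases (fun i hx => absurd (h.1 i) hx) (fun i _ => ⟨i, by simp⟩) i

theorem IsSplit.exists_glue {Γ : LG n m} {a b : Fin n} (h : Γ.IsSplit a b)
    {e : Fin (n₁ + n₂) ≃ Fin n} {e' : Fin (m₁ + m₂) ≃ Fin m} (he : IsBlock e (Γ.compH a))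
    (he' : IsBlock e' (Γ.compV a)) : ∃ (Γ₁ : LG n₁ m₁) (Γ₂ : LG n₂ m₂) (a₁ : Fin n₁) (b₂ : Fin n₂),
    Γ₁.graph.Connected ∧ Γ₂.graph.Connected ∧ Γ₁.inv a₁ = a₁ ∧ Γ₂.inv b₂ = b₂ ∧ (Γ₁.glue Γ₂).map e
    e' = Γ ∧ e (castAdd n₂ a₁) = a ∧ e (natAdd n₁ b₂) = b := by
  obtain ⟨Γ₁, Γ₂, hΓ⟩ := exists_eq_glue (Γ.map e.symm e'.symm)
    (fun x => he'.left (mem_compH.1 (he.1 x))) (fun x => he'.right fun h1 => he.2 x (mem_compH.2 h1))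
    (fun x => by
      simp only [permCongr_apply, Equiv.symm_symm]
      refine he.left (mem_compH.2 (mem_compV.2 ?_))
      exact (mem_compV.1 (mem_compH.1 (he.1 x))).trans (reach_inv (Γ := Γ.graph) _))
  have hΓ' : (Γ₁.glue Γ₂).map e e' = Γ := by rw [← hΓ, map_map_symm]
  obtain ⟨a₁, ha₁⟩ := he.left (mem_compH.2 (mem_compV.2 (reach_refl (Γ := Γ.graph) (Γ.root a))))
  obtain ⟨b₂, hb₂⟩ := he.right (x := b) fun h1 => h.not_reach (mem_compV.1 (mem_compH.1 h1))
  have hf : ∀ v w, Γ.graph.Reach v w →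
      (Γ₁.graph.glue Γ₂.graph).Reach (e'.symm v) (e'.symm w) := by
    intro v w hvw
    have h1 : (Γ.map e.symm e'.symm).graph.Reach (e'.symm v) (e'.symm w) :=
      hvw.iso (mapIso e.symm e'.symm Γ)
    rw [hΓ] at h1
    exact h1
  have hroot : ∀ x, (Γ₁.graph.glue Γ₂.graph).root (e.symm x) = e'.symm (Γ.root x) := by
    intro x
    have := congrFun (congrArg LG.root hΓ) (e.symm x)
    simpa using this.symm
  have hinv : ∀ x, (Γ₁.graph.glue Γ₂.graph).inv (e.symm x) = e.symm (Γ.inv x) := by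
    intro x
    have := DFunLike.congr_fun (congrArg LG.inv hΓ) (e.symm x)
    simpa [permCongr_apply] using this.symm
  refine ⟨Γ₁, Γ₂, a₁, b₂, ?_, ?_, ?_, ?_, hΓ', ?_, ?_⟩
  · refine connected_of_reach (Γ := Γ₁.graph) (Γ₁.root a₁) fun w => ?_
    have h1 := hf _ _ (mem_compV.1 (he'.1 w))
    rw [← hroot, ha₁, glue_root_castAdd, symm_apply_apply] at h1
    obtain ⟨w', h2, h3⟩ := reach_glue_castAdd.1 h1
    rwa [← castAdd_injective _ _ h2] at h3
  · refine connected_of_reach (Γ := Γ₂.graph) (Γ₂.root b₂) fun w => ?_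
    have h1 := hf _ _ ((h.reach (e' (natAdd m₁ w))).resolve_left fun h1 => he'.2 w (mem_compV.2 h1))
    rw [← hroot, hb₂, glue_root_natAdd, symm_apply_apply] at h1
    obtain ⟨w', h2, h3⟩ := reach_glue_natAdd.1 h1
    rwa [← natAdd_injective _ _ h2] at h3
  · have := hinv a
    rw [h.left, ha₁, finAddEquiv_castAdd] at this
    exact castAdd_injective _ _ this
  · have := hinv b
    rw [h.right, hb₂, finAddEquiv_natAdd] at this
    exact natAdd_injective _ _ this
  · rw [← ha₁, apply_symm_apply]
  · rw [← hb₂, apply_symm_apply]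

theorem isSplit_map_glue {Γ₁ : LG n₁ m₁} {Γ₂ : LG n₂ m₂} (h₁ : Γ₁.graph.Connected)
    (h₂ : Γ₂.graph.Connected) {a : Fin n₁} {b : Fin n₂} (ha : Γ₁.inv a = a) (hb : Γ₂.inv b = b)
    {e : Fin (n₁ + n₂) ≃ Fin n} {e' : Fin (m₁ + m₂) ≃ Fin m} {A : Finset (Fin n)}
    {V : Finset (Fin m)} (he : IsBlock e A) (he' : IsBlock e' V) : ((Γ₁.glue Γ₂).map e e').IsSplit
    (e (castAdd n₂ a)) (e (natAdd n₁ b)) ∧ ((Γ₁.glue Γ₂).map e e').compH (e (castAdd n₂ a)) = A ∧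
    ((Γ₁.glue Γ₂).map e e').compV (e (castAdd n₂ a)) = V := by
  have hroot : ∀ x, ((Γ₁.glue Γ₂).map e e').root (e x) = e' ((Γ₁.glue Γ₂).root x) := fun x => by simp
  have hr : ∀ v w, ((Γ₁.glue Γ₂).map e e').graph.Reach (e' v) (e' w) ↔
      (Γ₁.graph.glue Γ₂.graph).Reach v w := by
    intro v w
    constructor
    · intro h
      have := h.iso (mapIso e e' (Γ₁.glue Γ₂)).symm
      simpa [RibbonGraph.Iso.symm, mapIso] using this
    · exact fun h => h.iso (Γ := (Γ₁.glue Γ₂).graph) (mapIso e e' (Γ₁.glue Γ₂))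
  have hV : ((Γ₁.glue Γ₂).map e e').compV (e (castAdd n₂ a)) = V := by
    ext v
    obtain ⟨v, rfl⟩ := e'.surjective v
    rw [mem_compV, hroot, hr, glue_root_left, reach_glue_castAdd]
    refine addCases (fun v => ?_) (fun v => ?_) v
    · exact iff_of_true ⟨v, rfl, h₁.reach _ _⟩ (he'.1 v)
    · refine iff_of_false ?_ (he'.2 v)
      rintro ⟨w, h, -⟩
      have := congrArg Fin.val h
      simp at this; omega
  refine ⟨⟨?_, ?_, ?_, ?_⟩, ?_, hV⟩
  · exact fun h => not_connected_glue h₁ h₂ (h.iso (mapIso e e' (Γ₁.glue Γ₂)).symm)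
  · simp [permCongr_apply, ha]
  · simp [permCongr_apply, hb]
  · intro v
    obtain ⟨v, rfl⟩ := e'.surjective v
    rw [hroot, hroot, hr, hr]
    exact reach_glue_or h₁ h₂ a b v
  · ext x
    obtain ⟨x, rfl⟩ := e.surjective x
    rw [mem_compH, hV, hroot]
    refine addCases (fun x => ?_) (fun x => ?_) x
    · rw [glue_root_left]
      exact iff_of_true (he'.1 _) (he.1 _)
    · rw [glue_root_right]
      exact iff_of_false (he'.2 _) (he.2 _)

/-- A ribbon graph as a labelled graph without marks. -/
@[reducible]
def ofGraph (Γ : RibbonGraph) : LG Γ.nH Γ.nV :=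
  ⟨Γ.root, Γ.inv, Γ.cyc, Γ.genus, Γ.bdry, fun _ => false, Γ.inv_inv, Γ.root_cyc, fun _ => rfl,
    fun _ _ => rfl⟩

end LG

namespace RibbonGraph

variable {Γ Γ' Γ₁ Γ₂ : RibbonGraph}

/-- Joining the ends of an edge that has been cut. -/
def cutJoin (a : Fin Γ.nH) : ((Γ.cut a).join a (Γ.inv a)).Iso Γ where
  onH := Equiv.refl _
  onV := Equiv.refl _
  map_root _ := rfl
  map_inv h := by
    have h1 : (Γ.cut a).inv a = a := by rw [Γ.cut_inv a a]; simp
    have h2 : (Γ.cut a).inv (Γ.inv a) = Γ.inv a := by rw [Γ.cut_inv a (Γ.inv a)]; simp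
    symm
    by_cases h3 : h = a
    · rw [h3]; exact join_inv_left h1 h2
    by_cases h4 : h = Γ.inv a
    · rw [h4]; exact (join_inv_right h1 h2).trans (Γ.inv_inv a).symm
    · refine (join_inv_of_ne h1 h2 h3 h4).trans ?_
      rw [Γ.cut_inv a h, if_neg (by tauto)]; rfl
  map_cyc _ := rfl
  map_genus _ := rfl
  map_bdry _ := rfl

theorem cut_legs (a : Fin Γ.nH) : (Γ.cut a).inv a = a ∧ (Γ.cut a).inv (Γ.inv a) = Γ.inv a := by
  rw [Γ.cut_inv a a, Γ.cut_inv a (Γ.inv a)]; simp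

theorem nV_eq_one (h0 : Γ.edges = ∅) (h : Γ.Connected) : Γ.nV = 1 := by
  have h1 : ∀ v : Fin Γ.nV, v = ⟨0, h.1⟩ := fun v =>
    (h.reach ⟨0, h.1⟩ v).of_closed (fun v => v = ⟨0, h.1⟩) rfl fun x hx => by
      rwa [inv_eq_self_of_edges_eq_empty h0]
  have := Fintype.card_le_one_iff.2 fun v w => (h1 v).trans (h1 w).symm
  rw [Fintype.card_fin] at this
  have := h.1
  omega

theorem exists_totalGenus_eq (h : Γ.Connected) : ∃ i : ℕ, Γ.totalGenus = i := by
  induction hn : Γ.edges.card using Nat.strong_induction_on generalizing Γ with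
  | _ n ih =>
  rcases Γ.edges.eq_empty_or_nonempty with h0 | ⟨a, ha⟩
  · have h1 : Γ.cyc * Γ.inv = Γ.cyc := by
      ext1 x
      rw [Equiv.Perm.mul_apply, inv_eq_self_of_edges_eq_empty h0]
    refine ⟨∑ v, Γ.genus v, ?_⟩
    have h2 : (Γ.nV : ℚ) = 1 := by rw [nV_eq_one h0 h]; simp
    unfold totalGenus
    rw [h2, numBoundaryCycles, h1, h0]
    simp
  · have ha' := Γ.not_leg_of_mem_edges ha
    have hlt : (Γ.cut a).edges.card < n := hn ▸ cut_edges_card_lt ⟨a, ha⟩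
    obtain ⟨l1, l2⟩ := cut_legs a
    rw [totalGenus_iso (cutJoin a)]
    by_cases hc : (Γ.cut a).Connected
    · obtain ⟨i, hi⟩ := ih _ hlt hc rfl
      by_cases hs : ((Γ.cut a).cyc * (Γ.cut a).inv).SameCycle a (Γ.inv a)
      · exact ⟨i, by rw [(bnd_totalGenus_join_of_sameCycle l1 l2 ha'.symm hs).2, hi]⟩
      · exact ⟨i + 1, by rw [(bnd_totalGenus_join_of_not l1 l2 hs).2, hi]; simp⟩
    · have hs : (LG.ofGraph (Γ.cut a)).IsSplit a (Γ.inv a) :=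
        ⟨hc, l1, l2, reach_or_reach l1 l2 (h.iso (cutJoin a).symm)⟩
      obtain ⟨e, he⟩ := exists_block ((LG.ofGraph (Γ.cut a)).compH a)
      obtain ⟨e', he'⟩ := exists_block ((LG.ofGraph (Γ.cut a)).compV a)
      obtain ⟨Γ₁, Γ₂, -, -, c1, c2, -, -, hΓ, -, -⟩ := hs.exists_glue he he'
      have f : (Γ₁.graph.glue Γ₂.graph).Iso (Γ.cut a) := by
        have := LG.mapIso e e' (Γ₁.glue Γ₂)
        rw [hΓ] at this
        exact this
      have hE : (Γ.cut a).edges.card = Γ₁.graph.edges.card + Γ₂.graph.edges.card := by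
        have k1 := nH_iso f; have k2 := card_legs_iso f
        have k3 := nH_eq (Γ.cut a); have k4 := nH_eq Γ₁.graph; have k5 := nH_eq Γ₂.graph
        have k6 := card_legs_glue (Γ₁ := Γ₁.graph) (Γ₂ := Γ₂.graph)
        have k7 : (Γ₁.graph.glue Γ₂.graph).nH = Γ₁.graph.nH + Γ₂.graph.nH := rfl
        omega
      obtain ⟨i1, hi1⟩ := ih _ (by omega) c1 rfl
      obtain ⟨i2, hi2⟩ := ih _ (by omega) c2 rfl
      refine ⟨i1 + i2, ?_⟩
      rw [(bnd_totalGenus_join_of_not l1 l2 fun h => hs.not_reach (reach_of_sameCycle h)).2,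
        totalGenus_iso f, totalGenus_glue, hi1, hi2]
      push_cast; ring

/-- The stability condition. -/
def IsStable (Γ : RibbonGraph) : Prop := ∀ v, 0 < numCycles (Γ.cycAt v) + Γ.bdry v ∧ (3 : ℤ) ≤
  2 * (2 * Γ.genus v + Γ.bdry v + numCycles (Γ.cycAt v) - 1) + Fintype.card (Γ.At v)

theorem isStable_iso (f : Γ.Iso Γ') (h : Γ.IsStable) : Γ'.IsStable := by
  intro v
  obtain ⟨v, rfl⟩ := f.onV.surjective v
  have g : Γ.At v ≃ Γ'.At (f.onV v) := f.at v
  rw [numCycles_congr (f.at v) (C := Γ.cycAt v) fun x => Subtype.ext (f.map_cyc x), f.map_bdry,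
    f.map_genus, ← Fintype.card_congr g]
  exact h v

theorem sum_numCycles_cycAt_le (Γ : RibbonGraph) :
    ∑ v, numCycles (Γ.cycAt v) ≤ numCycles Γ.cyc := by
  unfold numCycles
  rw [← Nat.card_sigma]
  let f : (Σ v, Quotient (Equiv.Perm.SameCycle.setoid (Γ.cycAt v))) →
      Quotient (Equiv.Perm.SameCycle.setoid Γ.cyc) := fun q =>
    Quotient.map Subtype.val (fun _ _ h => Equiv.Perm.sameCycle_subtypePerm.1 h) q.2
  refine Nat.card_le_card_of_injective f ?_
  rintro ⟨v, q⟩ ⟨w, q'⟩ h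
  induction q using Quotient.inductionOn with | _ x => ?_
  induction q' using Quotient.inductionOn with | _ y => ?_
  obtain ⟨x, rfl⟩ := x
  obtain ⟨y, rfl⟩ := y
  have h1 : Γ.cyc.SameCycle x y := Quotient.exact h
  have h2 : Γ.root x = Γ.root y := by
    refine sameCycle_of_forall_apply (r := fun x y => Γ.root x = Γ.root y)
      ⟨fun _ => rfl, fun h => h.symm, fun h h' => h.trans h'⟩ (fun x => (Γ.root_cyc x).symm) h1
  have h3 : ∀ (v : Fin Γ.nV) (hx : Γ.root x = v) (hy : Γ.root y = v),
      (⟨v, Quotient.mk _ ⟨x, hx⟩⟩ : Σ v, Quotient (Equiv.Perm.SameCycle.setoid (Γ.cycAt v))) =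
        ⟨v, Quotient.mk _ ⟨y, hy⟩⟩ := fun v hx hy => by
    congr 1
    exact Quotient.sound (Equiv.Perm.sameCycle_subtypePerm.2 h1)
  have h4 : ∀ (w : Fin Γ.nV) (hy : Γ.root y = w) (hw : w = Γ.root x),
      (⟨Γ.root x, Quotient.mk _ ⟨x, rfl⟩⟩ :
        Σ v, Quotient (Equiv.Perm.SameCycle.setoid (Γ.cycAt v))) = ⟨w, Quotient.mk _ ⟨y, hy⟩⟩ := by
    rintro w hy rfl
    exact h3 _ _ _
  exact h4 _ rfl h2.symm

/-- The size of a connected stable graph is bounded by its invariants. -/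
theorem IsStable.bounds (hs : Γ.IsStable) {i : ℕ} (hi : Γ.totalGenus = i) : Γ.nV + 4 ≤ 4 * i + 2 *
    Γ.bnd + Γ.legs.card ∧ Γ.nH ≤ 5 * (4 * i + 2 * Γ.bnd + Γ.legs.card) ∧ ∀ v, Γ.genus v ≤ 5 *
    (4 * i + 2 * Γ.bnd + Γ.legs.card) ∧ Γ.bdry v ≤ 5 * (4 * i + 2 * Γ.bnd + Γ.legs.card) := by
  have h1 : Γ.nH + 2 * numCycles Γ.cyc + 4 * ∑ v, Γ.genus v + 2 * ∑ v, Γ.bdry v + 4 =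
      4 * Γ.nV + (4 * i + 2 * Γ.bnd + Γ.legs.card) := by
    have h2 := nH_eq Γ
    unfold totalGenus at hi
    unfold bnd
    have h3 : ((2 * Γ.edges.card + Γ.legs.card + 2 * numCycles Γ.cyc + 4 * ∑ v, Γ.genus v +
        2 * ∑ v, Γ.bdry v + 4 : ℕ) : ℚ) = ((4 * Γ.nV + (4 * i + 2 * (Γ.numBoundaryCycles +
        ∑ v, Γ.bdry v) + Γ.legs.card) : ℕ) : ℚ) := by
      push_cast
      linarith
    have h4 := Nat.cast_injective h3
    omega
  have h2 : ∑ v, Fintype.card (Γ.At v) = Γ.nH := by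
    rw [← Fintype.card_sigma, Fintype.card_congr (Equiv.sigmaFiberEquiv Γ.root), Fintype.card_fin]
  have h3 : 5 * Γ.nV ≤ ∑ v, (4 * Γ.genus v + 2 * Γ.bdry v + 2 * numCycles (Γ.cycAt v) +
      Fintype.card (Γ.At v)) := by
    have : ∑ v : Fin Γ.nV, 5 = 5 * Γ.nV := by simp [mul_comm]
    rw [← this]
    refine Finset.sum_le_sum fun v _ => ?_
    have := (hs v).2
    omega
  simp only [sum_add_distrib, ← Finset.mul_sum] at h3
  have h4 := Γ.sum_numCycles_cycAt_le
  refine ⟨by omega, by omega, fun v => ⟨?_, ?_⟩⟩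
  · have := Finset.single_le_sum (f := Γ.genus) (fun v _ => Nat.zero_le _) (mem_univ v)
    omega
  · have := Finset.single_le_sum (f := Γ.bdry) (fun v _ => Nat.zero_le _) (mem_univ v)
    omega

end RibbonGraph

namespace LG

variable {n m : ℕ}

/-- The labelled graphs whose vertices have genus and boundary less than `B`. -/
theorem finite_bounded (B n m : ℕ) : {Γ : LG n m | ∀ v, Γ.genus v < B ∧ Γ.bdry v < B}.Finite := by
  let f : {Γ : LG n m // ∀ v, Γ.genus v < B ∧ Γ.bdry v < B} →
      (Fin n → Fin m) × Perm (Fin n) × Perm (Fin n) × (Fin m → Fin B) × (Fin m → Fin B) ×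
        (Fin n → Bool) := fun Γ => (Γ.1.root, Γ.1.inv, Γ.1.cyc, fun v => ⟨_, (Γ.2 v).1⟩,
          fun v => ⟨_, (Γ.2 v).2⟩, Γ.1.mark)
  have hf : Injective f := by
    rintro ⟨Γ, h⟩ ⟨Γ', h'⟩ hh
    simp only [f, Prod.mk.injEq, funext_iff, Fin.mk.injEq] at hh
    exact Subtype.ext (LG.ext (funext hh.1) hh.2.1 hh.2.2.1 (funext hh.2.2.2.1)
      (funext hh.2.2.2.2.1) (funext hh.2.2.2.2.2))
  exact Set.finite_coe_iff.1 (Finite.of_injective f hf)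

end LG


open RibbonGraph LG

theorem exists_perm_last {l : ℕ} {x y : Fin (l + 2)} (h : x ≠ y) :
    ∃ e : Perm (Fin (l + 2)), e (last₁ l) = x ∧ e (last₂ l) = y := by
  refine ⟨swap (swap (last₁ l) x (last₂ l)) y * swap (last₁ l) x, ?_, ?_⟩
  · rw [Equiv.Perm.mul_apply, Equiv.swap_apply_left, swap_apply_of_ne_of_ne _ h]
    intro h1
    have := (swap (last₁ l) x).injective ((Equiv.swap_apply_left _ _).trans h1)
    exact last_ne this
  · rw [Equiv.Perm.mul_apply, Equiv.swap_apply_left]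

open Nat in
theorem card_perm_last {l : ℕ} {x y : Fin (l + 2)} (h : x ≠ y) :
    (Finset.univ.filter fun e : Perm (Fin (l + 2)) =>
      e (last₁ l) = x ∧ e (last₂ l) = y).card = l ! := by
  obtain ⟨e0, h1, h2⟩ := exists_perm_last h
  have h3 : l ! = (univ : Finset (Perm (Fin l))).card := by
    rw [Finset.card_univ, Fintype.card_perm, Fintype.card_fin]
  rw [h3]
  symm
  refine Finset.card_bij
    (fun π _ => e0 * (finAddEquiv π (Equiv.refl (Fin 2)) : Perm (Fin (l + 2)))) ?_ ?_ ?_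
  · intro π _
    simp only [mem_filter, mem_univ, true_and, Equiv.Perm.mul_apply,
      finAddEquiv_natAdd, Equiv.refl_apply]
    exact ⟨h1, h2⟩
  · intro π _ π' _ hh
    ext1 i
    have := DFunLike.congr_fun (mul_left_cancel hh) (castAdd 2 i)
    simpa using this
  · intro e he
    simp only [mem_filter, mem_univ, true_and] at he
    have k1 : (e0⁻¹ * e) (last₁ l) = last₁ l := by rw [Equiv.Perm.mul_apply, he.1, ← h1]; simp
    have k2 : (e0⁻¹ * e) (last₂ l) = last₂ l := by rw [Equiv.Perm.mul_apply, he.2, ← h2]; simp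
    obtain ⟨σ, τ, hσ⟩ := LG.exists_finAddEquiv (e0⁻¹ * e) fun i => by
      rcases castAdd_or_last ((e0⁻¹ * e) (castAdd 2 i)) with h | h | h
      · exact h
      · exact absurd ((e0⁻¹ * e).injective (h.trans k1.symm)) (castAdd_ne_last i).1
      · exact absurd ((e0⁻¹ * e).injective (h.trans k2.symm)) (castAdd_ne_last i).2
    refine ⟨σ, mem_univ _, ?_⟩
    have hτ : τ = Equiv.refl _ := by
      rw [hσ, finAddEquiv_natAdd] at k1 k2
      ext1 i
      fin_cases i
      · exact natAdd_injective _ _ k1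
      · exact natAdd_injective _ _ k2
    rw [← hτ, ← hσ, mul_inv_cancel_left]

open Nat in
theorem sum_perm_last {M : Type*} [AddCommMonoid M] {l : ℕ} (g : Fin (l + 2) → Fin (l + 2) → M) :
    ∑ e : Perm (Fin (l + 2)), g (e.symm (last₁ l)) (e.symm (last₂ l)) =
      l ! • ∑ x, ∑ y, if x ≠ y then g x y else 0 := by
  rw [← Equiv.sum_comp (Equiv.inv (Perm (Fin (l + 2))))]
  change ∑ e : Perm (Fin (l + 2)), g (e (last₁ l)) (e (last₂ l)) = _
  rw [← Finset.sum_product', smul_sum,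
    ← Finset.sum_fiberwise univ (fun e : Perm (Fin (l + 2)) => (e (last₁ l), e (last₂ l)))]
  refine sum_congr (by simp) fun p _ => ?_
  have h1 : ∀ e ∈ Finset.univ.filter
      (fun e : Perm (Fin (l + 2)) => (e (last₁ l), e (last₂ l)) = p),
      g (e (last₁ l)) (e (last₂ l)) = g p.1 p.2 := by
    intro e he
    rw [← (mem_filter.1 he).2]
  rw [sum_congr rfl h1, sum_const]
  by_cases hp : p.1 = p.2
  · rw [if_neg (not_not.2 hp), smul_zero, Finset.card_eq_zero.2, zero_smul]
    refine Finset.filter_eq_empty_iff.2 fun e _ he => ?_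
    rw [← he] at hp
    exact last_ne (e.injective hp)
  · rw [if_pos hp, ← card_perm_last hp]
    congr 2
    ext e
    simp [Prod.ext_iff]

section Operators

open Classical in
variable (ℰ) in
/-- The class of a functional attached to a cyclic decomposition, or zero if the number of cycles
is not `k`. -/
def cls {l : ℕ} (k : ℕ) (σ : Perm (Fin l)) : Multi 𝕂 E A l →ₗ[𝕂] CycWords A ℰ k l :=
  if h : numCycles σ = k then
    (relations A ℰ k l).mkQ.comp (LinearMap.single 𝕂 (fun _ : CycDec k l => Multi 𝕂 E A l) ⟨σ, h⟩)
  else 0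

theorem cls_of_eq {k l : ℕ} {σ : Perm (Fin l)} (h : numCycles σ = k) (F : Multi 𝕂 E A l) :
    cls ℰ k σ F = Submodule.Quotient.mk (Pi.single ⟨σ, h⟩ F) := by
  rw [cls, dif_pos h]; rfl

theorem cls_of_ne {k l : ℕ} {σ : Perm (Fin l)} (h : numCycles σ ≠ k) (F : Multi 𝕂 E A l) :
    cls ℰ k σ F = 0 := by
  rw [cls, dif_neg h]; rfl

theorem cls_transport {k l : ℕ} (e : Perm (Fin l)) (σ : Perm (Fin l))
    (F : Multi 𝕂 E A l) : cls ℰ k (e.permCongr σ) (transport hℰ e F) = cls ℰ k σ F := by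
  have h1 : numCycles (e.permCongr σ) = numCycles σ := numCycles_congr e fun x => by simp
  by_cases h : numCycles σ = k
  · rw [cls_of_eq h, cls_of_eq (h1.trans h)]
    symm
    rw [Submodule.Quotient.eq]
    refine Submodule.subset_span ⟨⟨σ, h⟩, ⟨_, h1.trans h⟩, e, F, _, ?_,
      (isTransport_iff hℰ _ _ _).2 rfl, rfl⟩
    ext1 x
    simp
  · rw [cls_of_ne h, cls_of_ne fun h2 => h (h1.symm.trans h2)]

variable (ℰ) in
/-- The contribution of an ordering `e` of the slots, the last two of which are joined. -/
def contractTerm {N : ℕ} (P : Tensor3 𝕂 E A) (k l : ℕ) (σ : Perm (Fin N))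
    (e : Fin N ≃ Fin (l + 2)) : Multi 𝕂 E A N →ₗ[𝕂] CycWords A ℰ k l :=
  (cls ℰ k (cutLast (e.permCongr σ))).comp ((contract P).comp (transport hℰ e))

open Classical Nat in
/-- The sum over the pairs of slots in the relation `C`, which are contracted with `P`. -/
def kernel {N : ℕ} (P : Tensor3 𝕂 E A) (C : Fin N → Fin N → Prop) (k l : ℕ)
    (σ : Perm (Fin N)) : Multi 𝕂 E A N →ₗ[𝕂] CycWords A ℰ k l :=
  (l ! : 𝕂)⁻¹ • ∑ e : Fin N ≃ Fin (l + 2),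
    if C (e.symm (last₁ l)) (e.symm (last₂ l)) then contractTerm ℰ hℰ P k l σ e else 0

theorem kernel_of_ne {N : ℕ} (P : Tensor3 𝕂 E A) (C : Fin N → Fin N → Prop) (k : ℕ) {l : ℕ}
    (h : N ≠ l + 2) (σ : Perm (Fin N)) : kernel (ℰ := ℰ) hℰ P C k l σ = 0 := by
  have : IsEmpty (Fin N ≃ Fin (l + 2)) := ⟨fun e => h (by simpa using Fintype.card_congr e)⟩
  rw [kernel, Finset.univ_eq_empty, Finset.sum_empty, smul_zero]

theorem kernel_transport {N : ℕ} (P : Tensor3 𝕂 E A) {C C' : Fin N → Fin N → Prop} (k l : ℕ)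
    (ρ : Perm (Fin N)) (hC : ∀ x y, C' (ρ x) (ρ y) ↔ C x y) (σ : Perm (Fin N))
    (F : Multi 𝕂 E A N) : kernel (ℰ := ℰ) hℰ P C' k l (ρ.permCongr σ) (transport hℰ ρ F) =
      kernel hℰ P C k l σ F := by
  classical
  simp only [kernel, LinearMap.smul_apply, LinearMap.sum_apply]
  congr 1
  refine Fintype.sum_equiv (Equiv.equivCongr ρ.symm (Equiv.refl _)) _ _ fun e => ?_
  have h1 : ∀ z, (Equiv.equivCongr ρ.symm (Equiv.refl _) e).symm z = ρ.symm (e.symm z) := fun z => rfl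
  have h2 : Equiv.equivCongr ρ.symm (Equiv.refl _) e = ρ.trans e := rfl
  have h3 : C' (e.symm (last₁ l)) (e.symm (last₂ l)) ↔
      C (ρ.symm (e.symm (last₁ l))) (ρ.symm (e.symm (last₂ l))) := by
    rw [← hC, apply_symm_apply, apply_symm_apply]
  rw [h1, h1]
  by_cases h : C' (e.symm (last₁ l)) (e.symm (last₂ l))
  · rw [if_pos h, if_pos (h3.1 h), h2]
    simp only [contractTerm, LinearMap.comp_apply, transport_trans]
    congr 2
  · rw [if_neg h, if_neg fun h4 => h (h3.2 h4)]
    rfl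

open Classical in
/-- The class of the amplitude of a graph. -/
def cw (I : Functional A ℰ) (Γ : RibbonGraph) (t : Fin Γ.nH → Tensor3 𝕂 E A) (k l : ℕ) :
    CycWords A ℰ k l :=
  if hl : Γ.legs.card = l then
    cls ℰ k (Γ.sortedLegs hl).perm (ampl hℰ I h𝒜 (Γ.sortedLegs hl) t)
  else 0

variable {Γ Γ' : RibbonGraph} {l : ℕ}

theorem cw_of_ne (t : Fin Γ.nH → Tensor3 𝕂 E A) (k : ℕ) (hl : Γ.legs.card ≠ l) :
    cw hℰ h𝒜 I Γ t k l = 0 := dif_neg hl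

include hc hI in
theorem cls_iso (f : Γ.Iso Γ') (ψ : Γ.LegEnum l) (ψ' : Γ'.LegEnum l) (k : ℕ)
    {t : Fin Γ.nH → Tensor3 𝕂 E A} {t' : Fin Γ'.nH → Tensor3 𝕂 E A}
    (ht : EdgeLabel ℰ 𝒜 Γ t) (ht' : ∀ h, t' (f.onH h) = t h) :
    cls ℰ k ψ'.perm (ampl hℰ I h𝒜 ψ' t') = cls ℰ k ψ.perm (ampl hℰ I h𝒜 ψ t) := by
  let e : Perm (Fin l) := (ψ.map f).legEquiv.trans ψ'.legEquiv.symm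
  have he : ∀ i, ψ'.toFun (e i) = f.onH (ψ.toFun i) := fun i =>
    congrArg Subtype.val (ψ'.legEquiv.apply_symm_apply ((ψ.map f).legEquiv i))
  have h1 : ψ'.perm = e.permCongr ψ.perm := LegEnum.perm_eq fun i => by
    obtain ⟨i, rfl⟩ := e.surjective i
    rw [permCongr_apply, symm_apply_apply, he, he, contractAll_iso, ψ.perm_spec]
  rw [ampl_iso hℰ h𝒜 hc hI f ψ ψ' e he ht ht', h1, cls_transport]

include hc hI in
theorem cw_eq (ψ : Γ.LegEnum l) (k : ℕ) {t : Fin Γ.nH → Tensor3 𝕂 E A}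
    (ht : EdgeLabel ℰ 𝒜 Γ t) : cw hℰ h𝒜 I Γ t k l = cls ℰ k ψ.perm (ampl hℰ I h𝒜 ψ t) := by
  rw [cw, dif_pos ψ.card_legs]
  exact cls_iso hℰ h𝒜 hc hI (Iso.refl Γ) ψ _ k ht fun _ => rfl

include hc hI in
theorem cw_iso (f : Γ.Iso Γ') (k l : ℕ) {t : Fin Γ.nH → Tensor3 𝕂 E A}
    {t' : Fin Γ'.nH → Tensor3 𝕂 E A} (ht : EdgeLabel ℰ 𝒜 Γ t) (ht' : ∀ h, t' (f.onH h) = t h) :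
    cw hℰ h𝒜 I Γ' t' k l = cw hℰ h𝒜 I Γ t k l := by
  by_cases hl : Γ.legs.card = l
  · rw [cw, cw, dif_pos hl, dif_pos ((card_legs_iso f).trans hl)]
    exact cls_iso hℰ h𝒜 hc hI f _ _ k ht ht'
  · rw [cw_of_ne hℰ h𝒜 _ _ hl, cw_of_ne]
    rwa [card_legs_iso f]

/-- The tensors at the edges after joining the legs `a` and `b` by an edge with tensor `P`. -/
def joinLabel {n : ℕ} (P : Tensor3 𝕂 E A) (t : Fin n → Tensor3 𝕂 E A) (a b : Fin n) :
    Fin n → Tensor3 𝕂 E A := fun h => if h = a ∨ h = b then P else t h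

theorem EdgeLabel.join {P : Tensor3 𝕂 E A} (hP : IsPropagator ℰ 𝒜 P)
    {t : Fin Γ.nH → Tensor3 𝕂 E A} (ht : EdgeLabel ℰ 𝒜 Γ t) {a b : Fin Γ.nH} (ha : Γ.inv a = a)
    (hb : Γ.inv b = b) : EdgeLabel ℰ 𝒜 (Γ.join a b) (joinLabel P t a b) where
  propagator h := by
    unfold joinLabel
    split_ifs
    · exact hP
    · exact ht.propagator h
  symm h := by
    unfold joinLabel
    by_cases h1 : h = a
    · rw [h1, join_inv_left ha hb]; simp
    by_cases h2 : h = b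
    · rw [h2, join_inv_right ha hb]; simp
    have h3 : Γ.inv h ≠ a := fun h3 => h1 (Γ.inv.injective (h3.trans ha.symm))
    have h4 : Γ.inv h ≠ b := fun h4 => h2 (Γ.inv.injective (h4.trans hb.symm))
    rw [join_inv_of_ne ha hb h1 h2, if_neg (by tauto), if_neg (by tauto), ht.symm]

include hc hI in
theorem ampl_join (ψ : Γ.LegEnum (l + 2)) {P : Tensor3 𝕂 E A} (hP : IsPropagator ℰ 𝒜 P)
    {t : Fin Γ.nH → Tensor3 𝕂 E A} (ht : EdgeLabel ℰ 𝒜 Γ t) : ampl hℰ I h𝒜 ψ.join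
    (joinLabel P t (ψ.toFun (last₁ l)) (ψ.toFun (last₂ l))) = contract P (ampl hℰ I h𝒜 ψ t) := by
  set a := ψ.toFun (last₁ l) with ha
  set b := ψ.toFun (last₂ l) with hb
  have hab : a ≠ b := fun h => last_ne (ψ.injective h)
  have hia : Γ.inv a = a := ψ.leg _
  have hib : Γ.inv b = b := ψ.leg _
  have hj := EdgeLabel.join hP ht hia hib
  have hne : (Γ.join a b).inv a ≠ a := by rw [join_inv_left hia hib]; exact hab.symm
  have e0 : ampl hℰ I h𝒜 ψ t = ampl hℰ I h𝒜 ψ (joinLabel P t a b) := by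
    refine ampl_congr hℰ h𝒜 I ψ fun e he => ?_
    have := Γ.not_leg_of_mem_edges he
    rw [joinLabel, if_neg]
    rintro (rfl | rfl)
    · exact this hia
    · exact this hib
  have hj' : EdgeLabel ℰ 𝒜 Γ (joinLabel P t a b) := ⟨hj.propagator, fun h => by
    have := (hj.cut a).symm h
    rwa [show ((Γ.join a b).cut a).inv h = _ from (joinCut hia hib).map_inv h] at this⟩
  rw [ampl_cut hℰ h𝒜 hc hI ψ.join a hne hj, e0]
  have e1 := ampl_iso hℰ h𝒜 hc hI (joinCut hia hib) ψ (ψ.join.cut a hne) (Equiv.refl _) ?_ hj'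
    fun _ => rfl
  · rw [e1, transport_refl]
    congr 1
    simp [joinLabel]
  · intro i
    rcases castAdd_or_last i with ⟨j, rfl⟩ | rfl | rfl
    · exact LegEnum.cut_castAdd _ _ _ _
    · exact LegEnum.cut_natAdd _ _ _ _
    · exact (LegEnum.cut_natAdd _ _ _ _).trans (join_inv_left hia hib)

open Classical in
include hc hI in
/-- Joining two legs of a graph in all possible ways. -/
theorem sum_cw_join {N : ℕ} (ψ : Γ.LegEnum N) {P : Tensor3 𝕂 E A} (hP : IsPropagator ℰ 𝒜 P)
    {t : Fin Γ.nH → Tensor3 𝕂 E A} (ht : EdgeLabel ℰ 𝒜 Γ t) (C : Fin N → Fin N → Prop) (k l : ℕ) :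
    (∑ x, ∑ y, if x ≠ y then if C x y then
      cw hℰ h𝒜 I (Γ.join (ψ.toFun x) (ψ.toFun y)) (joinLabel P t (ψ.toFun x) (ψ.toFun y)) k l
      else 0 else 0) = kernel hℰ P C k l ψ.perm (ampl hℰ I h𝒜 ψ t) := by
  by_cases hN : N = l + 2
  · subst hN
    simp only [kernel, LinearMap.smul_apply, LinearMap.sum_apply]
    have h1 : ∀ e : Perm (Fin (l + 2)), (if C (e.symm (last₁ l)) (e.symm (last₂ l)) then
        contractTerm ℰ hℰ P k l ψ.perm e else 0) (ampl hℰ I h𝒜 ψ t) =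
        (fun x y => if C x y then cw hℰ h𝒜 I (Γ.join (ψ.toFun x) (ψ.toFun y))
          (joinLabel P t (ψ.toFun x) (ψ.toFun y)) k l else 0)
          (e.symm (last₁ l)) (e.symm (last₂ l)) := by
      intro e
      dsimp only
      split_ifs with h
      · have e1 := cw_eq hℰ h𝒜 hc hI (ψ.reindex e).join k
          (EdgeLabel.join hP ht (LegEnum.leg _ _) (LegEnum.leg _ _))
        refine Eq.trans ?_ e1.symm
        rw [LegEnum.perm_join, LegEnum.perm_reindex, ampl_join hℰ h𝒜 hc hI (ψ.reindex e) hP ht]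
        have e2 := ampl_iso hℰ h𝒜 hc hI (Iso.refl Γ) ψ (ψ.reindex e) e (fun i => by
          simp [LegEnum.reindex, Iso.refl]) ht (t' := t) fun _ => rfl
        rw [e2]
        rfl
      · rfl
    rw [sum_congr rfl fun e _ => h1 e, sum_perm_last (l := l) (fun x y => if C x y then
      cw hℰ h𝒜 I (Γ.join (ψ.toFun x) (ψ.toFun y)) (joinLabel P t (ψ.toFun x) (ψ.toFun y)) k l
      else 0), ← Nat.cast_smul_eq_nsmul 𝕂, smul_smul,
      inv_mul_cancel₀ (Nat.cast_ne_zero.2 (Nat.factorial_ne_zero l)), one_smul]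
  · rw [kernel_of_ne hℰ P C k hN, LinearMap.zero_apply]
    refine sum_eq_zero fun x _ => sum_eq_zero fun y _ => ?_
    split_ifs with h1 h2
    · refine cw_of_ne hℰ h𝒜 _ _ fun h3 => hN ?_
      rw [← ψ.card_legs, ← card_legs_join (ψ.leg x) (ψ.leg y) fun h => h1 (ψ.injective h), h3]
    · rfl
    · rfl

end Operators



/-- The degrees `(i, s, k, l)` of a functional: powers of `γ` and of `ν` plus the number of words,
number of words, number of letters. -/
abbrev Idx : Type := ℕ × ℕ × ℕ × ℕ

/-- The size bounding the graphs that contribute in a given degree. -/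
def Idx.size (x : Idx) : ℕ := 4 * x.1 + 2 * x.2.1 + x.2.2.2

/-- The effect on degrees of joining two letters, depending on whether they are in one word. -/
def Idx.shift (same : Prop) (y x : Idx) : Prop :=
  (same → x.1 = y.1 ∧ x.2.1 = y.2.1 + 1) ∧ (¬ same → x.1 = y.1 + 1 ∧ x.2.1 + 1 = y.2.1)

namespace RibbonGraph

variable {Γ Γ₁ Γ₂ : RibbonGraph} {a b : Fin Γ.nH}

/-- The genus of a connected graph as a natural number. -/
def gen (Γ : RibbonGraph) : ℕ := ⌊Γ.totalGenus⌋₊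

/-- The degrees of the weight of a graph. -/
@[reducible]
def idx (Γ : RibbonGraph) : Idx := (Γ.gen, Γ.bnd, numCycles Γ.canonical, Γ.legs.card)

theorem gen_eq {i : ℕ} (h : Γ.totalGenus = i) : Γ.gen = i := by rw [gen, h, Nat.floor_natCast]

theorem Connected.totalGenus_eq (h : Γ.Connected) : Γ.totalGenus = Γ.gen := by
  obtain ⟨i, hi⟩ := exists_totalGenus_eq h
  rw [gen_eq hi, hi]

theorem shift_join (h : Γ.Connected) (ha : Γ.inv a = a) (hb : Γ.inv b = b) (hab : a ≠ b) (x : Idx) :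
    Idx.shift ((Γ.cyc * Γ.inv).SameCycle a b) Γ.idx x ↔
      (Γ.join a b).gen = x.1 ∧ (Γ.join a b).bnd = x.2.1 := by
  by_cases hs : (Γ.cyc * Γ.inv).SameCycle a b
  · obtain ⟨h1, h2⟩ := bnd_totalGenus_join_of_sameCycle ha hb hab hs
    rw [h.totalGenus_eq] at h2
    rw [h1, gen_eq h2]
    simp [Idx.shift, hs, eq_comm]
  · obtain ⟨h1, h2⟩ := bnd_totalGenus_join_of_not ha hb hs
    rw [h.totalGenus_eq] at h2
    rw [gen_eq (i := Γ.gen + 1) (by rw [h2]; simp)]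
    simp only [Idx.shift, hs, ← h1, false_implies, not_false_iff, true_implies, true_and]
    omega

theorem isStable_glue : (Γ₁.glue Γ₂).IsStable ↔ Γ₁.IsStable ∧ Γ₂.IsStable := by
  have h1 : ∀ v, numCycles ((Γ₁.glue Γ₂).cycAt (castAdd Γ₂.nV v)) = numCycles (Γ₁.cycAt v) :=
    fun v => numCycles_congr (glueAtLeft v) fun x => Subtype.ext (finAddEquiv_castAdd _ _ _)
  have h2 : ∀ v, numCycles ((Γ₁.glue Γ₂).cycAt (natAdd Γ₁.nV v)) = numCycles (Γ₂.cycAt v) :=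
    fun v => numCycles_congr (glueAtRight v) fun x => Subtype.ext (finAddEquiv_natAdd _ _ _)
  have h3 : (Γ₁.glue Γ₂).IsStable ↔
      (∀ v, _) ∧ ∀ v, _ := ⟨fun h => ⟨fun v => h (castAdd Γ₂.nV v), fun v => h (natAdd Γ₁.nV v)⟩,
        fun h v => addCases h.1 h.2 v⟩
  rw [h3]
  simp only [h1, h2, ← Fintype.card_congr (glueAtLeft (Γ₁ := Γ₁) (Γ₂ := Γ₂) _),
    ← Fintype.card_congr (glueAtRight (Γ₁ := Γ₁) (Γ₂ := Γ₂) _), append_left, append_right]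
  rfl

theorem LegEnum.sum_legs {M : Type*} [AddCommMonoid M] {l : ℕ} (ψ : Γ.LegEnum l)
    (f : Fin Γ.nH → M) : ∑ a ∈ Γ.legs, f a = ∑ i, f (ψ.toFun i) := by
  rw [← Finset.sum_coe_sort, ← Equiv.sum_comp ψ.legEquiv]; rfl

end RibbonGraph

theorem CycWords.hom_ext {M : Type*} [AddCommGroup M] [Module 𝕂 M] {k l : ℕ}
    {f g : CycWords A ℰ k l →ₗ[𝕂] M} (h : ∀ σ F, f (cls ℰ k σ F) = g (cls ℰ k σ F)) : f = g := by
  refine Submodule.linearMap_qext _ (LinearMap.pi_ext' fun σ => LinearMap.ext fun F => ?_)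
  have := h σ.1 F
  rwa [cls_of_eq σ.2] at this

/-- A linear map on sums of products of cyclic words. -/
def CycWords.lift {M : Type*} [AddCommGroup M] [Module 𝕂 M] {k l : ℕ}
    (f : Perm (Fin l) → Multi 𝕂 E A l →ₗ[𝕂] M)
    (hf : ∀ ρ σ F, f (ρ.permCongr σ) (transport hℰ ρ F) = f σ F) : CycWords A ℰ k l →ₗ[𝕂] M :=
  (relations A ℰ k l).liftQ (∑ σ : CycDec k l, (f σ.1).comp (LinearMap.proj σ)) <| by
    rw [relations, Submodule.span_le]
    rintro _ ⟨σ, σ', ρ, T, T', hσ, hT, rfl⟩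
    have h1 : ∀ (σ : CycDec k l) T, (∑ σ : CycDec k l, (f σ.1).comp (LinearMap.proj σ))
        (Pi.single σ T : CycDec k l → Multi 𝕂 E A l) = f σ.1 T := fun σ T => by
      rw [LinearMap.sum_apply, sum_eq_single σ]
      · simp
      · intro τ _ hτ
        simp [Pi.single_eq_of_ne hτ]
      · simp
    rw [SetLike.mem_coe, LinearMap.mem_ker, map_sub, h1, h1, sub_eq_zero,
      (isTransport_iff hℰ _ _ _).1 hT, hσ]
    exact (hf ρ σ.1 T).symm

theorem CycWords.lift_cls {M : Type*} [AddCommGroup M] [Module 𝕂 M] {k l : ℕ}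
    (f : Perm (Fin l) → Multi 𝕂 E A l →ₗ[𝕂] M)
    (hf : ∀ ρ σ F, f (ρ.permCongr σ) (transport hℰ ρ F) = f σ F) {σ : Perm (Fin l)}
    (h : numCycles σ = k) (F : Multi 𝕂 E A l) :
    CycWords.lift (ℰ := ℰ) hℰ f hf (cls ℰ k σ F) = f σ F := by
  rw [cls_of_eq h, CycWords.lift]
  refine (Submodule.liftQ_apply _ _ _).trans ?_
  rw [LinearMap.sum_apply, sum_eq_single ⟨σ, h⟩]
  · simp
  · intro τ _ hτ
    simp [Pi.single_eq_of_ne hτ]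
  · simp

/-- The part of a functional in degree `x`. -/
abbrev Part (A : Type*) [Ring A] [Algebra 𝕂 A] [TopologicalSpace A] [IsTopologicalRing A]
    [ContinuousConstSMul 𝕂 A] (ℰ : ℤ → Submodule 𝕂 E) (x : Idx) : Type _ :=
  CycWords A ℰ x.2.2.1 x.2.2.2

theorem sameCycle_permCongr {X : Type*} (ρ σ : Perm X) (a b : X) :
    (ρ.permCongr σ).SameCycle (ρ a) (ρ b) ↔ σ.SameCycle a b := by
  have : ρ.permCongr σ = ρ * σ * ρ⁻¹ := rfl
  rw [this, Equiv.Perm.sameCycle_conj]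
  simp

/-- Contraction of two letters of a product of cyclic words. -/
def lap (P : Tensor3 𝕂 E A) (y x : Idx) : Part A ℰ y →ₗ[𝕂] Part A ℰ x :=
  CycWords.lift hℰ (fun σ => kernel hℰ P (fun a b => Idx.shift (σ.SameCycle a b) y x) _ _ σ)
    fun ρ σ F => kernel_transport hℰ P _ _ ρ (fun a b => by rw [sameCycle_permCongr]) σ F

/-- Products of functionals as a bilinear map. -/
def tensorL (a b : ℕ) : Multi 𝕂 E A a →ₗ[𝕂] Multi 𝕂 E A b →ₗ[𝕂] Multi 𝕂 E A (a + b) :=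
  LinearMap.mk₂ 𝕂 tensor
    (fun _ _ _ => by ext; simp [tensor_apply, add_mul])
    (fun _ _ _ => by ext; simp [tensor_apply])
    (fun _ _ _ => by ext; simp [tensor_apply, mul_add])
    (fun _ _ _ => by ext; simp [tensor_apply])

theorem finAddEquiv_permCongr {a b : ℕ} (ρ σ : Perm (Fin a)) (ρ' σ' : Perm (Fin b)) : finAddEquiv
    (ρ.permCongr σ) (ρ'.permCongr σ') = Equiv.permCongr (finAddEquiv ρ ρ') (finAddEquiv σ σ') := by
  ext1 i
  refine addCases (fun i => ?_) (fun i => ?_) i <;>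
    simp [finAddEquiv_symm]

/-- The relation on letters contracted by the bracket. -/
def crossing (y z x : Idx) (a b : Fin (y.2.2.2 + z.2.2.2)) : Prop :=
  (x.1 = y.1 + z.1 ∧ x.2.1 + 1 = y.2.1 + z.2.1) ∧
    ∃ i j, a = castAdd z.2.2.2 i ∧ b = natAdd y.2.2.2 j

theorem crossing_finAddEquiv {y z x : Idx} (ρ : Perm (Fin y.2.2.2))
    (ρ' : Perm (Fin z.2.2.2)) (a b : Fin (y.2.2.2 + z.2.2.2)) :
    crossing y z x (finAddEquiv ρ ρ' a) (finAddEquiv ρ ρ' b) ↔ crossing y z x a b := by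
  refine and_congr_right fun _ => ⟨?_, ?_⟩
  · rintro ⟨i, j, h1, h2⟩
    refine ⟨ρ.symm i, ρ'.symm j, (finAddEquiv ρ ρ').injective ?_, (finAddEquiv ρ ρ').injective ?_⟩
    · rw [h1, finAddEquiv_castAdd, apply_symm_apply]
    · rw [h2, finAddEquiv_natAdd, apply_symm_apply]
  · rintro ⟨i, j, rfl, rfl⟩
    exact ⟨ρ i, ρ' j, finAddEquiv_castAdd _ _ _, finAddEquiv_natAdd _ _ _⟩

/-- Contraction of a letter of one product of cyclic words with a letter of another one, the former
being given by a functional. -/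
def brackFun (P : Tensor3 𝕂 E A) (y z x : Idx) (σ : Perm (Fin y.2.2.2))
    (F : Multi 𝕂 E A y.2.2.2) : Part A ℰ z →ₗ[𝕂] Part A ℰ x :=
  CycWords.lift hℰ (fun τ => (kernel hℰ P (crossing y z x) _ _ (finAddEquiv σ τ)).comp
    (tensorL _ _ F)) fun ρ τ G => by
      have := kernel_transport (ℰ := ℰ) hℰ P x.2.2.1 x.2.2.2 (finAddEquiv (Equiv.refl _) ρ)
        (crossing_finAddEquiv (x := x) _ _) (finAddEquiv σ τ) (tensor F G)
      rw [← finAddEquiv_permCongr, transport_tensor, transport_refl] at this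
      exact this

theorem brackFun_cls (P : Tensor3 𝕂 E A) (y z x : Idx) (σ : Perm (Fin y.2.2.2))
    (F : Multi 𝕂 E A y.2.2.2) {τ : Perm (Fin z.2.2.2)} (h : numCycles τ = z.2.2.1)
    (G : Multi 𝕂 E A z.2.2.2) : brackFun (ℰ := ℰ) hℰ P y z x σ F (cls ℰ _ τ G) =
      kernel hℰ P (crossing y z x) _ _ (finAddEquiv σ τ) (tensor F G) :=
  CycWords.lift_cls hℰ _ _ h G

theorem cls_hom_ext {M : Type*} [AddCommGroup M] [Module 𝕂 M] {k l : ℕ}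
    {f g : CycWords A ℰ k l →ₗ[𝕂] M}
    (h : ∀ σ, numCycles σ = k → ∀ F, f (cls ℰ k σ F) = g (cls ℰ k σ F)) : f = g :=
  CycWords.hom_ext fun σ F => by
    by_cases hσ : numCycles σ = k
    · exact h σ hσ F
    · rw [cls_of_ne hσ, map_zero, map_zero]

/-- Contraction of a letter of one product of cyclic words with a letter of another one. -/
def brack (P : Tensor3 𝕂 E A) (y z x : Idx) : Part A ℰ y →ₗ[𝕂] Part A ℰ z →ₗ[𝕂] Part A ℰ x :=
  CycWords.lift hℰ (fun σ =>
    { toFun := brackFun hℰ P y z x σ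
      map_add' := fun F F' => cls_hom_ext fun τ hτ G => by
        rw [LinearMap.add_apply]
        simp only [brackFun_cls hℰ P y z x σ _ hτ, ← map_add]
        exact congrArg _ (LinearMap.map_add₂ (tensorL _ _) F F' G)
      map_smul' := fun r F => cls_hom_ext fun τ hτ G => by
        rw [RingHom.id_apply, LinearMap.smul_apply]
        simp only [brackFun_cls hℰ P y z x σ _ hτ, ← map_smul]
        exact congrArg _ (LinearMap.map_smul₂ (tensorL _ _) r F G) }) fun ρ σ F =>
    cls_hom_ext fun τ hτ G => by
      have := kernel_transport (ℰ := ℰ) hℰ P x.2.2.1 x.2.2.2 (finAddEquiv ρ (Equiv.refl _))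
        (crossing_finAddEquiv (x := x) _ _) (finAddEquiv σ τ) (tensor F G)
      rw [← finAddEquiv_permCongr, transport_tensor, transport_refl] at this
      simp only [LinearMap.coe_mk, AddHom.coe_mk, brackFun_cls hℰ P y z x _ _ hτ]
      exact this

theorem brack_cls (P : Tensor3 𝕂 E A) (y z x : Idx) {σ : Perm (Fin y.2.2.2)}
    (hσ : numCycles σ = y.2.2.1) (F : Multi 𝕂 E A y.2.2.2) {τ : Perm (Fin z.2.2.2)}
    (hτ : numCycles τ = z.2.2.1) (G : Multi 𝕂 E A z.2.2.2) :
    brack (ℰ := ℰ) hℰ P y z x (cls ℰ _ σ F) (cls ℰ _ τ G) =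
      kernel hℰ P (crossing y z x) _ _ (finAddEquiv σ τ) (tensor F G) := by
  rw [brack, CycWords.lift_cls hℰ _ _ hσ]
  exact brackFun_cls hℰ P y z x σ F hτ G

variable (A ℰ) in
/-- Functionals with finitely many nonzero parts. -/
abbrev Graded : Type _ := DirectSum Idx (Part A ℰ)

/-- Contraction of two letters, in degree `x`. -/
def laplacian (P : Tensor3 𝕂 E A) (x : Idx) : Graded A ℰ →ₗ[𝕂] Part A ℰ x :=
  DirectSum.toModule 𝕂 Idx _ fun y => lap hℰ P y x

/-- Contraction of a letter of one functional with a letter of another one, in degree `x`. -/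
def bracket (P : Tensor3 𝕂 E A) (x : Idx) : Graded A ℰ →ₗ[𝕂] Graded A ℰ →ₗ[𝕂] Part A ℰ x :=
  DirectSum.toModule 𝕂 Idx _ fun y =>
    (DirectSum.toModule 𝕂 Idx _ fun z => (brack hℰ P y z x).flip).flip

open Classical in
/-- The weight of a connected stable graph of size at most `W`. -/
def wt (I : Functional A ℰ) (W : ℕ) (Γ : RibbonGraph) (t : Fin Γ.nH → Tensor3 𝕂 E A) : Graded A ℰ :=
  if Γ.Connected ∧ Γ.IsStable ∧ Γ.idx.size ≤ W then
    DirectSum.lof 𝕂 Idx (Part A ℰ) Γ.idx (cw hℰ h𝒜 I Γ t _ _) else 0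

open Classical in
theorem wt_apply (W : ℕ) (Γ : RibbonGraph) (t : Fin Γ.nH → Tensor3 𝕂 E A) (x : Idx) :
    wt hℰ h𝒜 I W Γ t x = if Γ.Connected ∧ Γ.IsStable ∧ x.size ≤ W ∧ Γ.gen = x.1 ∧ Γ.bnd = x.2.1 then
      cw hℰ h𝒜 I Γ t x.2.2.1 x.2.2.2 else 0 := by
  rw [wt]
  by_cases hx : Γ.idx = x
  · subst hx
    by_cases h : Γ.Connected ∧ Γ.IsStable ∧ Γ.idx.size ≤ W
    · rw [if_pos h, if_pos ⟨h.1, h.2.1, h.2.2, rfl, rfl⟩, DirectSum.lof_apply]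
    · rw [if_neg h, if_neg fun h' => h ⟨h'.1, h'.2.1, h'.2.2.1⟩]; rfl
  · have h1 : (if Γ.Connected ∧ Γ.IsStable ∧ Γ.idx.size ≤ W then
        DirectSum.lof 𝕂 Idx (Part A ℰ) Γ.idx (cw hℰ h𝒜 I Γ t _ _) else 0) x = 0 := by
      split_ifs
      · exact DFinsupp.single_eq_of_ne (Ne.symm hx)
      · rfl
    rw [h1]
    split_ifs with h
    · unfold cw
      split_ifs with hl
      · rw [cls_of_ne]
        rw [LegEnum.numCycles_perm]
        exact fun hk => hx (by rw [idx, h.2.2.2.1, h.2.2.2.2, hk, hl])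
      · rfl
    · rfl

include hc hI in
/-- Joining two legs of a connected graph. -/
theorem sum_wt_join {W : ℕ} {Γ : RibbonGraph} (h : Γ.Connected) {P : Tensor3 𝕂 E A}
    (hP : IsPropagator ℰ 𝒜 P) {t : Fin Γ.nH → Tensor3 𝕂 E A} (ht : EdgeLabel ℰ 𝒜 Γ t) {x : Idx}
    (hx : x.size ≤ W) : (∑ a ∈ Γ.legs, ∑ b ∈ Γ.legs, if a ≠ b then wt hℰ h𝒜 I W (Γ.join a b)
    (joinLabel P t a b) x else 0) = laplacian hℰ P x (wt hℰ h𝒜 I W Γ t) := by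
  classical
  let ψ := Γ.sortedLegs rfl
  rw [ψ.sum_legs]
  simp only [ψ.sum_legs, wt_apply, ψ.injective.ne_iff]
  have h1 : ∀ i j, i ≠ j → ((Γ.join (ψ.toFun i) (ψ.toFun j)).gen = x.1 ∧
      (Γ.join (ψ.toFun i) (ψ.toFun j)).bnd = x.2.1 ↔ Idx.shift (ψ.perm.SameCycle i j) Γ.idx x) :=
    fun i j hij => by rw [ψ.sameCycle_perm, shift_join h (ψ.leg i) (ψ.leg j) (ψ.injective.ne hij)]
  by_cases hs : Γ.IsStable ∧ Γ.idx.size ≤ W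
  · rw [wt, if_pos ⟨h, hs⟩, laplacian, DirectSum.toModule_lof]
    have e1 : lap hℰ P Γ.idx x (cw hℰ h𝒜 I Γ t Γ.idx.2.2.1 Γ.idx.2.2.2) =
        kernel hℰ P (fun a b => Idx.shift (ψ.perm.SameCycle a b) Γ.idx x) _ _ ψ.perm
          (ampl hℰ I h𝒜 ψ t) :=
      (congrArg _ (cw_eq hℰ h𝒜 hc hI ψ _ ht)).trans (CycWords.lift_cls hℰ _ _ ψ.numCycles_perm _)
    rw [e1, ← sum_cw_join hℰ h𝒜 hc hI ψ hP ht]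
    refine sum_congr rfl fun i _ => sum_congr rfl fun j _ => ?_
    by_cases hij : i = j
    · rw [if_neg (not_not.2 hij), if_neg (not_not.2 hij)]
    rw [if_pos hij, if_pos hij]
    refine if_congr ?_ rfl rfl
    rw [← h1 i j hij]
    exact ⟨fun h => h.2.2.2, fun h' => ⟨h.join (ψ.leg i) (ψ.leg j), hs.1, hx, h'⟩⟩
  · rw [wt, if_neg fun h => hs h.2, map_zero]
    refine sum_eq_zero fun i _ => sum_eq_zero fun j _ => ?_
    split_ifs with hij hh
    · refine cw_of_ne hℰ h𝒜 _ _ fun hl => hs ⟨hh.2.1, ?_⟩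
      have h2 := (h1 i j hij).1 hh.2.2.2
      have h3 := card_legs_join (ψ.leg i) (ψ.leg j) (ψ.injective.ne hij)
      unfold Idx.size at hx ⊢
      by_cases hs : ψ.perm.SameCycle i j
      · have := h2.1 hs
        simp only at this ⊢
        omega
      · have := h2.2 hs
        simp only at this ⊢
        omega
    · rfl
    · rfl

theorem size_idx (Γ : RibbonGraph) : Γ.idx.size = 4 * Γ.gen + 2 * Γ.bnd + Γ.legs.card := rfl

include hc hI in
/-- Joining a leg of one connected graph with a leg of another one. -/
theorem sum_wt_join_glue {W : ℕ} {Γ₁ Γ₂ : RibbonGraph} (h₁ : Γ₁.Connected) (h₂ : Γ₂.Connected)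
    {P : Tensor3 𝕂 E A} (hP : IsPropagator ℰ 𝒜 P) {t : Fin (Γ₁.glue Γ₂).nH → Tensor3 𝕂 E A}
    (ht : EdgeLabel ℰ 𝒜 (Γ₁.glue Γ₂) t) {x : Idx} (hx : x.size ≤ W) : (∑ a ∈ Γ₁.legs, ∑ b ∈ Γ₂.legs,
    wt hℰ h𝒜 I W ((Γ₁.glue Γ₂).join (castAdd Γ₂.nH a) (natAdd Γ₁.nH b)) (joinLabel P t (castAdd
    Γ₂.nH a) (natAdd Γ₁.nH b)) x) = bracket hℰ P x (wt hℰ h𝒜 I W Γ₁ (t ∘ castAdd Γ₂.nH))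
    (wt hℰ h𝒜 I W Γ₂ (t ∘ natAdd Γ₁.nH)) := by
  classical
  let ψ₁ := Γ₁.sortedLegs rfl
  let ψ₂ := Γ₂.sortedLegs rfl
  rw [ψ₁.sum_legs]
  simp only [ψ₂.sum_legs, wt_apply]
  have hne : ∀ (i : Fin Γ₁.nH) (j : Fin Γ₂.nH), castAdd Γ₂.nH i ≠ natAdd Γ₁.nH j :=
    fun i j h => by have := congrArg Fin.val h; simp at this; omega
  have hl₁ : ∀ i, (Γ₁.glue Γ₂).inv (castAdd Γ₂.nH (ψ₁.toFun i)) =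
      castAdd Γ₂.nH (ψ₁.toFun i) := fun i => by
    rw [← LegEnum.glue_castAdd ψ₁ ψ₂]; exact (ψ₁.glue ψ₂).leg _
  have hl₂ : ∀ i, (Γ₁.glue Γ₂).inv (natAdd Γ₁.nH (ψ₂.toFun i)) =
      natAdd Γ₁.nH (ψ₂.toFun i) := fun i => by
    rw [← LegEnum.glue_natAdd ψ₁ ψ₂]; exact (ψ₁.glue ψ₂).leg _
  have hconn : ∀ i j, ((Γ₁.glue Γ₂).join (castAdd Γ₂.nH (ψ₁.toFun i))
      (natAdd Γ₁.nH (ψ₂.toFun j))).Connected := fun i j =>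
    connected_join_of_reach_or (hl₁ i) (hl₂ j) (reach_glue_or h₁ h₂ _ _)
  have h1 : ∀ i j, (((Γ₁.glue Γ₂).join (castAdd Γ₂.nH (ψ₁.toFun i))
      (natAdd Γ₁.nH (ψ₂.toFun j))).gen = x.1 ∧ ((Γ₁.glue Γ₂).join (castAdd Γ₂.nH (ψ₁.toFun i))
      (natAdd Γ₁.nH (ψ₂.toFun j))).bnd = x.2.1 ↔
      x.1 = Γ₁.gen + Γ₂.gen ∧ x.2.1 + 1 = Γ₁.bnd + Γ₂.bnd) := fun i j => by
    obtain ⟨h3, h4⟩ := bnd_totalGenus_join_of_not (hl₁ i) (hl₂ j) (by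
      rw [glue_cyc_mul_inv]; exact not_sameCycle_finAddEquiv _ _ _ _)
    rw [totalGenus_glue, h₁.totalGenus_eq, h₂.totalGenus_eq] at h4
    rw [gen_eq (i := Γ₁.gen + Γ₂.gen) (by rw [h4]; push_cast; ring), ← bnd_glue]
    omega
  by_cases hs : (Γ₁.IsStable ∧ Γ₁.idx.size ≤ W) ∧ (Γ₂.IsStable ∧ Γ₂.idx.size ≤ W)
  · rw [wt, if_pos ⟨h₁, hs.1⟩, wt, if_pos ⟨h₂, hs.2⟩, bracket, DirectSum.toModule_lof,
      LinearMap.flip_apply, DirectSum.toModule_lof, LinearMap.flip_apply]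
    have e1 : brack hℰ P Γ₁.idx Γ₂.idx x
        (cw hℰ h𝒜 I Γ₁ (t ∘ castAdd Γ₂.nH) Γ₁.idx.2.2.1 Γ₁.idx.2.2.2)
        (cw hℰ h𝒜 I Γ₂ (t ∘ natAdd Γ₁.nH) Γ₂.idx.2.2.1 Γ₂.idx.2.2.2) =
        kernel (N := Γ₁.legs.card + Γ₂.legs.card) hℰ P (crossing Γ₁.idx Γ₂.idx x) _ _
          (ψ₁.glue ψ₂).perm (ampl hℰ I h𝒜 (ψ₁.glue ψ₂) t) := by
      rw [show ampl hℰ I h𝒜 (ψ₁.glue ψ₂) t = _ from ampl_glue hℰ h𝒜 hc hI ψ₁ ψ₂ ht,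
        LegEnum.perm_glue]
      exact (congrArg₂ (fun a b => brack hℰ P Γ₁.idx Γ₂.idx x a b)
        (cw_eq hℰ h𝒜 hc hI ψ₁ _ ht.left) (cw_eq hℰ h𝒜 hc hI ψ₂ _ ht.right)).trans
        (brack_cls hℰ P _ _ _ ψ₁.numCycles_perm _ ψ₂.numCycles_perm _)
    rw [e1, ← sum_cw_join hℰ h𝒜 hc hI (ψ₁.glue ψ₂) hP ht, Fin.sum_univ_add]
    have hn : ∀ {p q : ℕ} (i : Fin p) (j : Fin q), castAdd q i ≠ natAdd p j :=
      fun i j h => by have := congrArg Fin.val h; simp at this; omega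
    have c1 : ∀ i i', ¬ crossing Γ₁.idx Γ₂.idx x (castAdd _ i) (castAdd _ i') :=
      fun i i' h => by obtain ⟨-, a, b, -, h⟩ := h; exact hn _ _ h
    have c2 : ∀ j b, ¬ crossing Γ₁.idx Γ₂.idx x (natAdd _ j) b :=
      fun i i' h => by obtain ⟨-, a, b, h, -⟩ := h; exact hn _ _ h.symm
    have c3 : ∀ i j, crossing Γ₁.idx Γ₂.idx x (castAdd _ i) (natAdd _ j) ↔
        x.1 = Γ₁.gen + Γ₂.gen ∧ x.2.1 + 1 = Γ₁.bnd + Γ₂.bnd :=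
      fun i j => ⟨fun h => h.1, fun h => ⟨h, i, j, rfl, rfl⟩⟩
    simp only [Fin.sum_univ_add, c1, c2, if_false, ite_self, sum_const_zero, add_zero, zero_add]
    refine sum_congr rfl fun i _ => sum_congr rfl fun j _ => ?_
    rw [if_pos (hn _ _), LegEnum.glue_castAdd, LegEnum.glue_natAdd]
    refine if_congr ?_ rfl rfl
    rw [c3, ← h1 i j]
    exact ⟨fun h => h.2.2.2, fun h' => ⟨hconn i j, isStable_glue.2 ⟨hs.1.1, hs.2.1⟩, hx, h'⟩⟩
  · have hz : bracket hℰ P x (wt hℰ h𝒜 I W Γ₁ (t ∘ castAdd Γ₂.nH))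
        (wt hℰ h𝒜 I W Γ₂ (t ∘ natAdd Γ₁.nH)) = 0 := by
      by_cases h : Γ₁.IsStable ∧ Γ₁.idx.size ≤ W
      · rw [wt.eq_def hℰ h𝒜 I W Γ₂, if_neg fun h' => hs ⟨h, h'.2⟩, map_zero]
      · rw [wt.eq_def hℰ h𝒜 I W Γ₁, if_neg fun h' => h h'.2, map_zero, LinearMap.zero_apply]
    rw [hz]
    refine sum_eq_zero fun i _ => sum_eq_zero fun j _ => ?_
    split_ifs with hh
    · refine cw_of_ne hℰ h𝒜 _ _ fun hl => hs ?_
      obtain ⟨s1, s2⟩ := isStable_glue.1 hh.2.1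
      have k1 := (s1.bounds h₁.totalGenus_eq).1
      have k2 := (s2.bounds h₂.totalGenus_eq).1
      have k3 := (h1 i j).1 hh.2.2.2
      have k4 := card_legs_join (hl₁ i) (hl₂ j) (hne _ _)
      rw [hl, card_legs_glue] at k4
      have k5 := h₁.1
      have k6 := h₂.1
      rw [size_idx, size_idx]
      unfold Idx.size at hx
      refine ⟨⟨s1, ?_⟩, s2, ?_⟩ <;> omega
    · rfl



theorem sum_range_antidiagonal {M : Type*} [AddCommMonoid M] (D : ℕ) (f : ℕ → ℕ → M)
    (h : ∀ p q, D ≤ p + q → f p q = 0) : ∑ n ∈ range D, ∑ p ∈ Finset.HasAntidiagonal.antidiagonal n, f p.1 p.2 =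
      ∑ p ∈ range D, ∑ q ∈ range D, f p q := by
  rw [← Finset.sum_product', ← Finset.sum_filter_add_sum_filter_not (range D ×ˢ range D)
    (fun p => p.1 + p.2 < D), sum_eq_zero (s := (range D ×ˢ range D).filter fun p => ¬ p.1 + p.2 < D),
    add_zero, Finset.sum_sigma']
  · refine Finset.sum_bij' (fun x _ => x.2) (fun p _ => ⟨p.1 + p.2, p⟩) ?_ ?_ ?_ ?_ ?_
    · rintro ⟨n, p⟩ hp
      simp only [mem_sigma, mem_range, Finset.HasAntidiagonal.mem_antidiagonal] at hp
      simp only [mem_filter, mem_product, mem_range]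
      omega
    · rintro ⟨p, q⟩ hp
      simp only [mem_filter, mem_product, mem_range] at hp
      simp only [mem_sigma, mem_range, Finset.HasAntidiagonal.mem_antidiagonal]
      exact ⟨hp.2, trivial⟩
    · rintro ⟨n, p⟩ hp
      simp only [mem_sigma, mem_range, Finset.HasAntidiagonal.mem_antidiagonal] at hp
      obtain ⟨-, rfl⟩ := hp
      rfl
    · intro p _; rfl
    · intro x _; rfl
  · exact fun p hp => h _ _ (not_lt.1 (mem_filter.1 hp).2)

open Nat in
theorem sum_subsets {𝕂 M : Type*} [Field 𝕂] [CharZero 𝕂] [AddCommGroup M] [Module 𝕂 M] (D : ℕ)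
    (f : ℕ → ℕ → M) (h : ∀ p q, D ≤ p + q → f p q = 0) :
    ∑ n ∈ range D, (n ! : 𝕂)⁻¹ • ∑ A : Finset (Fin n), f A.card (n - A.card) =
      ∑ p ∈ range D, ∑ q ∈ range D, ((p ! : 𝕂)⁻¹ * (q ! : 𝕂)⁻¹) • f p q := by
  rw [← sum_range_antidiagonal D (fun p q => ((p ! : 𝕂)⁻¹ * (q ! : 𝕂)⁻¹) • f p q)
    fun p q hpq => by rw [h p q hpq, smul_zero]]
  refine sum_congr rfl fun n _ => ?_
  rw [Finset.Nat.sum_antidiagonal_eq_sum_range_succ (fun p q => ((p ! : 𝕂)⁻¹ * (q ! : 𝕂)⁻¹) • f p q),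
    ← Finset.powerset_univ, Finset.sum_powerset_apply_card (fun p => f p (n - p)), Finset.card_univ,
    Fintype.card_fin, smul_sum]
  refine sum_congr rfl fun p hp => ?_
  rw [← Nat.cast_smul_eq_nsmul 𝕂, smul_smul, Nat.cast_choose 𝕂 (Nat.lt_succ_iff.1 (mem_range.1 hp))]
  congr 1
  have := (Nat.cast_ne_zero (R := 𝕂)).2 n.factorial_ne_zero
  field_simp

namespace LG

variable {n m n' m' n₁ n₂ m₁ m₂ : ℕ}

/-- The number of marked half-edges. -/
def nu (Γ : LG n m) : ℕ := (Finset.univ.filter fun h => Γ.mark h = true).card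

theorem nu_map (e : Fin n ≃ Fin n') (e' : Fin m ≃ Fin m') (Γ : LG n m) : (Γ.map e e').nu = Γ.nu := by
  simp only [nu, Finset.card_filter]
  exact Equiv.sum_comp e.symm fun h => if Γ.mark h = true then 1 else 0

theorem nu_glue (Γ₁ : LG n₁ m₁) (Γ₂ : LG n₂ m₂) : (Γ₁.glue Γ₂).nu = Γ₁.nu + Γ₂.nu := by
  simp only [nu, Finset.card_filter, Fin.sum_univ_add, append_left, append_right]

/-- Cutting the edge through `a` and removing its mark. -/
@[reducible]
def cut (Γ : LG n m) (a : Fin n) : LG n m where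
  root := Γ.root
  inv := (Γ.graph.cut a).inv
  cyc := Γ.cyc
  genus := Γ.genus
  bdry := Γ.bdry
  mark h := Γ.mark h && !decide (h = a ∨ h = Γ.inv a)
  inv_inv := (Γ.graph.cut a).inv_inv
  root_cyc := Γ.root_cyc
  mark_inv h := by
    rw [show (Γ.graph.cut a).inv h = _ from Γ.graph.cut_inv a h]
    split_ifs with h1
    · rfl
    · have h2 : ¬ (Γ.inv h = a ∨ Γ.inv h = Γ.inv a) := fun h2 => h1 (h2.symm.imp
        (fun h => Γ.inv.injective h) fun h => by rw [← h, Γ.inv_inv])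
      change (Γ.mark (Γ.inv h) && _) = _
      rw [Γ.mark_inv, decide_eq_false h1, decide_eq_false h2]
  mark_leg h hh := by
    rw [show (Γ.graph.cut a).inv h = _ from Γ.graph.cut_inv a h] at hh
    split_ifs at hh with h1
    · rw [decide_eq_true h1]; simp
    · rw [Γ.mark_leg h hh]; rfl

theorem cut_inv_eq (Γ : LG n m) (a h : Fin n) :
    (Γ.cut a).inv h = if h = a ∨ h = Γ.inv a then h else Γ.inv h := Γ.graph.cut_inv a h

theorem cut_injective {Γ Γ' : LG n m} {a : Fin n} (h : Γ.cut a = Γ'.cut a) (hi : Γ.inv a = Γ'.inv a)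
    (hm : Γ.mark a = true) (hm' : Γ'.mark a = true) : Γ = Γ' := by
  have h1 : ∀ x, (x = a ∨ x = Γ.inv a) → Γ.inv x = Γ'.inv x ∧ Γ.mark x = Γ'.mark x := by
    rintro x (rfl | rfl)
    · exact ⟨hi, hm.trans hm'.symm⟩
    · rw [Γ.inv_inv, hi, Γ'.inv_inv, ← hi, Γ.mark_inv, hi, Γ'.mark_inv]
      exact ⟨rfl, hm.trans hm'.symm⟩
  have h2 : ∀ x, Γ.inv x = Γ'.inv x ∧ Γ.mark x = Γ'.mark x := fun x => by
    by_cases hx : x = a ∨ x = Γ.inv a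
    · exact h1 x hx
    · have e1 := DFunLike.congr_fun (congrArg LG.inv h) x
      have e2 := congrFun (congrArg LG.mark h) x
      rw [cut_inv_eq, cut_inv_eq, ← hi, if_neg hx, if_neg hx] at e1
      simp only [← hi, decide_eq_false hx, Bool.not_false, Bool.and_true] at e2
      exact ⟨e1, e2⟩
  ext x
  · exact congrArg Fin.val (congrFun (congrArg LG.root h) x)
  · exact congrArg Fin.val (h2 x).1
  · exact congrArg Fin.val (DFunLike.congr_fun (congrArg LG.cyc h) x)
  · exact congrFun (congrArg LG.genus h) x
  · exact congrFun (congrArg LG.bdry h) x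
  · rw [(h2 x).2]

theorem inv_ne_of_mark {Γ : LG n m} {a : Fin n} (h : Γ.mark a = true) : Γ.inv a ≠ a := fun h1 => by
  rw [Γ.mark_leg a h1] at h
  exact Bool.false_ne_true h

theorem nu_cut {Γ : LG n m} {a : Fin n} (h : Γ.mark a = true) : (Γ.cut a).nu + 2 = Γ.nu := by
  have h1 : (Finset.univ.filter fun h => (Γ.cut a).mark h = true) =
      ((Finset.univ.filter fun h => Γ.mark h = true).erase a).erase (Γ.inv a) := by
    ext x
    simp only [mem_filter, mem_univ, true_and, Finset.mem_erase, Bool.and_eq_true,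
      Bool.not_eq_true', decide_eq_false_iff_not]
    tauto
  have h2 := Finset.card_erase_add_one (s := Finset.univ.filter fun h => Γ.mark h = true) (a := a)
    (by simpa using h)
  have h3 := Finset.card_erase_add_one (s := (Finset.univ.filter fun h => Γ.mark h = true).erase a)
    (a := Γ.inv a) (Finset.mem_erase.2 ⟨inv_ne_of_mark h, by simpa [Γ.mark_inv] using h⟩)
  unfold nu
  rw [h1]
  omega

theorem exists_cut_eq {Γ : LG n m} {a b : Fin n} (ha : Γ.inv a = a) (hb : Γ.inv b = b)
    (hab : a ≠ b) : ∃ Γ' : LG n m, Γ'.cut a = Γ ∧ Γ'.inv a = b ∧ Γ'.mark a = true := by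
  have hl := join_inv_left (Γ := Γ.graph) ha hb
  have hr := join_inv_right (Γ := Γ.graph) ha hb
  have ho := fun {h} => join_inv_of_ne (Γ := Γ.graph) ha hb (h := h)
  have hi : ∀ h, (Γ.inv h = a ∨ Γ.inv h = b) ↔ (h = a ∨ h = b) := fun h => by
    refine or_congr ?_ ?_
    · rw [← Γ.inv.apply_eq_iff_eq (x := h) (y := a), ha]
    · rw [← Γ.inv.apply_eq_iff_eq (x := h) (y := b), hb]
  let Γ' : LG n m :=
    { Γ with
      inv := (Γ.graph.join a b).inv
      inv_inv := (Γ.graph.join a b).inv_inv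
      mark := fun h => decide (h = a ∨ h = b) || Γ.mark h
      mark_inv := fun h => by
        by_cases h1 : h = a
        · rw [h1, hl]; simp
        by_cases h2 : h = b
        · rw [h2, hr]; simp
        rw [ho h1 h2, Γ.mark_inv, decide_eq_decide.2 (hi h)]
      mark_leg := fun h hh => by
        by_cases h1 : h = a
        · rw [h1, hl] at hh; exact absurd hh hab.symm
        by_cases h2 : h = b
        · rw [h2, hr] at hh; exact absurd hh hab
        rw [ho h1 h2] at hh
        simp [h1, h2, Γ.mark_leg h hh] }
  have hΓ : Γ'.inv a = b := hl
  refine ⟨Γ', ?_, hΓ, by simp [Γ']⟩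
  ext x
  · rfl
  · rw [cut_inv_eq, hΓ]
    split_ifs with h
    · rcases h with rfl | rfl
      · rw [ha]
      · rw [hb]
    · rw [not_or] at h
      exact congrArg Fin.val (ho h.1 h.2)
  · rfl
  · rfl
  · rfl
  · change ((decide (x = a ∨ x = b) || Γ.mark x) && !decide (x = a ∨ x = Γ'.inv a)) = Γ.mark x
    rw [hΓ]
    by_cases h : x = a ∨ x = b
    · rw [decide_eq_true h]
      rcases h with rfl | rfl
      · simp [Γ.mark_leg _ ha]
      · simp [Γ.mark_leg _ hb]
    · rw [decide_eq_false h]; simp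

theorem mem_graph_legs {Γ : LG n m} {a : Fin n} : a ∈ Γ.graph.legs ↔ Γ.inv a = a :=
  mem_legs (Γ := Γ.graph) a

/-- The labelled graphs with bounded genera and boundaries. -/
def bounded (B n m : ℕ) : Finset (LG n m) := (finite_bounded B n m).toFinset

theorem mem_bounded {B : ℕ} {Γ : LG n m} :
    Γ ∈ bounded B n m ↔ ∀ v, Γ.genus v < B ∧ Γ.bdry v < B := by simp [bounded]

/-- Graphs with a marked half-edge correspond to graphs with two legs. -/
theorem sum_marked {M : Type*} [AddCommMonoid M] (B ν : ℕ) {F : LG n m → M}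
    {G : LG n m → Fin n → Fin n → M} (h : ∀ Γ a, Γ.mark a = true → G (Γ.cut a) a (Γ.inv a) = F Γ) :
    (ν + 2) • ∑ Γ ∈ (bounded B n m).filter (·.nu = ν + 2), F Γ = ∑ Γ ∈ (bounded B n m).filter
    (·.nu = ν), ∑ a ∈ Γ.graph.legs, ∑ b ∈ Γ.graph.legs, if a ≠ b then G Γ a b else 0 := by
  have h1 : (ν + 2) • ∑ Γ ∈ (bounded B n m).filter (·.nu = ν + 2), F Γ =
      ∑ Γ ∈ (bounded B n m).filter (·.nu = ν + 2), ∑ a ∈ Finset.univ.filter (Γ.mark · = true), F Γ := by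
    rw [smul_sum]
    refine sum_congr rfl fun Γ hΓ => ?_
    rw [sum_const, ← (mem_filter.1 hΓ).2, nu]
  have h2 : ∀ Γ : LG n m, (∑ a ∈ Γ.graph.legs, ∑ b ∈ Γ.graph.legs, if a ≠ b then G Γ a b else 0) =
      ∑ p ∈ (Γ.graph.legs ×ˢ Γ.graph.legs : Finset (Fin n × Fin n)).filter (fun p => p.1 ≠ p.2),
        G Γ p.1 p.2 := fun Γ => by
    rw [sum_filter, sum_product]
  simp only [h2]
  rw [h1, Finset.sum_sigma', Finset.sum_sigma']
  refine Finset.sum_bij (fun x _ => ⟨x.1.cut x.2, x.2, x.1.inv x.2⟩) ?_ ?_ ?_ ?_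
  · rintro ⟨Γ, a⟩ hx
    simp only [mem_sigma, mem_filter, mem_bounded, mem_univ, true_and, mem_product] at hx ⊢
    have := nu_cut hx.2
    have hl := cut_legs (Γ := Γ.graph) a
    exact ⟨⟨hx.1.1, by omega⟩, ⟨mem_graph_legs.2 hl.1, mem_graph_legs.2 hl.2⟩, (inv_ne_of_mark hx.2).symm⟩
  · rintro ⟨Γ, a⟩ hx ⟨Γ', a'⟩ hx' hh
    simp only [Sigma.mk.injEq, heq_eq_eq, Prod.mk.injEq] at hh
    obtain ⟨h1, rfl, h2⟩ := hh
    simp only [mem_sigma, mem_filter, mem_univ, true_and] at hx hx'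
    rw [cut_injective h1 h2 hx.2 hx'.2]
  · rintro ⟨Γ, a, b⟩ hx
    simp only [mem_sigma, mem_filter, mem_product] at hx
    obtain ⟨Γ', h1, h2, h3⟩ := exists_cut_eq (mem_graph_legs.1 hx.2.1.1) (mem_graph_legs.1 hx.2.1.2) hx.2.2
    refine ⟨⟨Γ', a⟩, ?_, by simp only [h1, h2]⟩
    have := nu_cut h3
    simp only [mem_sigma, mem_filter, mem_univ, true_and]
    refine ⟨⟨?_, by rw [← this, h1, hx.1.2]⟩, h3⟩
    rw [mem_bounded]
    rw [← h1, mem_bounded] at hx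
    exact hx.1.1
  · rintro ⟨Γ, a⟩ hx
    simp only [mem_sigma, mem_filter, mem_univ, true_and] at hx
    exact (h Γ a hx.2).symm

open Classical in
/-- Graphs with a leg in each of two components correspond to pairs of connected graphs with a
leg. -/
theorem sum_isSplit {M : Type*} [AddCommMonoid M] (B ν : ℕ) (G : LG n m → Fin n → Fin n → M)
    (g : ∀ n₁ n₂ m₁ m₂, LG n₁ m₁ → LG n₂ m₂ → Fin n₁ → Fin n₂ → M) (h : ∀ n₁ n₂ m₁ m₂ (Γ₁ : LG n₁
    m₁) (Γ₂ : LG n₂ m₂) (e : Fin (n₁ + n₂) ≃ Fin n) (e' : Fin (m₁ + m₂) ≃ Fin m) a b, Γ₁.inv a = a →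
    Γ₂.inv b = b → G ((Γ₁.glue Γ₂).map e e') (e (castAdd n₂ a)) (e (natAdd n₁ b)) = g _ _ _ _ Γ₁ Γ₂
    a b) : (∑ Γ ∈ (bounded B n m).filter (·.nu = ν), ∑ a, ∑ b, if Γ.IsSplit a b then G Γ a b else 0)
    = ∑ H : Finset (Fin n), ∑ V : Finset (Fin m), ∑ Γ₁ ∈ (bounded B H.card V.card).filter
    (·.graph.Connected), ∑ Γ₂ ∈ (bounded B (n - H.card) (m - V.card)).filter (·.graph.Connected), if
    Γ₁.nu + Γ₂.nu = ν then ∑ a ∈ Γ₁.graph.legs, ∑ b ∈ Γ₂.graph.legs, g _ _ _ _ Γ₁ Γ₂ a b else 0 :=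
    by
  have h1 : ∀ H : Finset (Fin n), ∀ V : Finset (Fin m),
      (∑ Γ₁ ∈ (bounded B H.card V.card).filter (·.graph.Connected),
        ∑ Γ₂ ∈ (bounded B (n - H.card) (m - V.card)).filter (·.graph.Connected),
          if Γ₁.nu + Γ₂.nu = ν then ∑ a ∈ Γ₁.graph.legs, ∑ b ∈ Γ₂.graph.legs,
            g _ _ _ _ Γ₁ Γ₂ a b else 0) =
      ∑ p ∈ ((bounded B n m).filter (·.nu = ν) ×ˢ univ ×ˢ univ).filter
        (fun p : LG n m × Fin n × Fin n => p.1.IsSplit p.2.1 p.2.2 ∧ (p.1.compH p.2.1, p.1.compV p.2.1) = (H, V)),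
          G p.1 p.2.1 p.2.2 := by
    intro H V
    obtain ⟨e, he⟩ := exists_block H
    obtain ⟨e', he'⟩ := exists_block V
    have h2 : ∀ S₁ : Finset (LG H.card V.card), ∀ S₂ : Finset (LG (n - H.card) (m - V.card)),
        (∑ Γ₁ ∈ S₁, ∑ Γ₂ ∈ S₂, if Γ₁.nu + Γ₂.nu = ν then ∑ a ∈ Γ₁.graph.legs, ∑ b ∈ Γ₂.graph.legs,
          g _ _ _ _ Γ₁ Γ₂ a b else 0) =
        ∑ x ∈ ((S₁ ×ˢ S₂).filter fun p => p.1.nu + p.2.nu = ν).sigma fun p =>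
          (p.1.graph.legs ×ˢ p.2.graph.legs : Finset (Fin H.card × Fin (n - H.card))),
          g _ _ _ _ x.1.1 x.1.2 x.2.1 x.2.2 := fun S₁ S₂ => by
      rw [Finset.sum_sigma, sum_filter, sum_product]
      simp only [sum_product]
    rw [h2]
    refine Finset.sum_bij (fun x _ => ((x.1.1.glue x.1.2).map e e', e (castAdd _ x.2.1),
      e (natAdd _ x.2.2))) ?_ ?_ ?_ ?_
    · rintro ⟨⟨Γ₁, Γ₂⟩, a, b⟩ hx
      simp only [mem_sigma, mem_filter, mem_bounded, mem_product] at hx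
      obtain ⟨⟨⟨⟨b1, c1⟩, b2, c2⟩, h4⟩, h5, h6⟩ := hx
      obtain ⟨s1, s2, s3⟩ := isSplit_map_glue c1 c2 (mem_graph_legs.1 h5) (mem_graph_legs.1 h6) he he'
      simp only [mem_filter, mem_bounded, mem_product, mem_univ, and_true, nu_map, nu_glue]
      refine ⟨⟨fun v => ?_, h4⟩, s1, by rw [s2, s3]⟩
      generalize e'.symm v = w
      refine addCases (fun w => ?_) (fun w => ?_) w
      · simpa using b1 w
      · simpa using b2 w
    · rintro ⟨⟨Γ₁, Γ₂⟩, a, b⟩ - ⟨⟨Γ₁', Γ₂'⟩, a', b'⟩ - hh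
      simp only [Prod.mk.injEq, EmbeddingLike.apply_eq_iff_eq, Fin.castAdd_inj, Fin.natAdd_inj] at hh
      obtain ⟨h3, rfl, rfl⟩ := hh
      have h4 : Γ₁.glue Γ₂ = Γ₁'.glue Γ₂' := by
        rw [← map_symm_map e e' (Γ₁.glue Γ₂), h3, map_symm_map]
      obtain ⟨rfl, rfl⟩ := glue_injective h4
      rfl
    · rintro ⟨Γ, a, b⟩ hx
      simp only [mem_filter, mem_bounded, mem_product, mem_univ, and_true, Prod.mk.injEq] at hx
      obtain ⟨⟨b1, h4⟩, hs, rfl, rfl⟩ := hx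
      obtain ⟨Γ₁, Γ₂, a₁, b₂, c1, c2, l1, l2, h3, h5, h6⟩ := hs.exists_glue he he'
      refine ⟨⟨(Γ₁, Γ₂), a₁, b₂⟩, ?_, by rw [h3, h5, h6]⟩
      simp only [mem_sigma, mem_filter, mem_bounded, mem_product]
      rw [← h3, nu_map, nu_glue] at h4
      rw [← h3] at b1
      refine ⟨⟨⟨⟨fun v => ?_, c1⟩, fun v => ?_, c2⟩, h4⟩, mem_graph_legs.2 l1, mem_graph_legs.2 l2⟩
      · simpa using b1 (e' (castAdd _ v))
      · simpa using b1 (e' (natAdd _ v))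
    · rintro ⟨⟨Γ₁, Γ₂⟩, a, b⟩ hx
      simp only [mem_sigma, mem_filter, mem_product] at hx
      exact (h _ _ _ _ Γ₁ Γ₂ e e' a b (mem_graph_legs.1 hx.2.1)
        (mem_graph_legs.1 hx.2.2)).symm
  simp only [h1]
  rw [← Finset.sum_product' (univ : Finset (Finset (Fin n))) univ fun H V => ∑ p ∈ ((bounded B n
    m).filter (·.nu = ν) ×ˢ univ ×ˢ univ).filter (fun p : LG n m × Fin n × Fin n => p.1.IsSplit
    p.2.1 p.2.2 ∧ (p.1.compH p.2.1, p.1.compV p.2.1) = (H, V)), G p.1 p.2.1 p.2.2]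
  simp only [← Finset.filter_filter, Prod.mk.eta]
  rw [Finset.univ_product_univ, Finset.sum_fiberwise]
  symm
  rw [sum_filter, sum_product]
  simp only [sum_product]

end LG



section Operators

theorem isStable_iff_of_iso {Γ Γ' : RibbonGraph} (f : Γ.Iso Γ') : Γ'.IsStable ↔ Γ.IsStable :=
  ⟨isStable_iso f.symm, isStable_iso f⟩

include hc hI in
theorem wt_iso (W : ℕ) {Γ Γ' : RibbonGraph} (f : Γ.Iso Γ') {t : Fin Γ.nH → Tensor3 𝕂 E A}
    {t' : Fin Γ'.nH → Tensor3 𝕂 E A} (ht : EdgeLabel ℰ 𝒜 Γ t) (ht' : ∀ h, t' (f.onH h) = t h) :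
    wt hℰ h𝒜 I W Γ' t' = wt hℰ h𝒜 I W Γ t := by
  refine DFinsupp.ext fun x => ?_
  rw [wt_apply, wt_apply, cw_iso hℰ h𝒜 hc hI f _ _ ht ht', connected_iso f, isStable_iff_of_iso f,
    bnd_iso f, gen, totalGenus_iso f, gen]

theorem wt_of_not_connected (W : ℕ) {Γ : RibbonGraph} (h : ¬ Γ.Connected)
    (t : Fin Γ.nH → Tensor3 𝕂 E A) : wt hℰ h𝒜 I W Γ t = 0 := if_neg fun h' => h h'.1

theorem wt_of_le (W : ℕ) {Γ : RibbonGraph} (h : 5 * W + 1 ≤ Γ.nH ∨ 5 * W + 1 ≤ Γ.nV)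
    (t : Fin Γ.nH → Tensor3 𝕂 E A) : wt hℰ h𝒜 I W Γ t = 0 := if_neg fun h' => by
  have h1 := h'.2.1.bounds h'.1.totalGenus_eq
  have h2 := h'.2.2
  rw [size_idx] at h2
  omega

theorem wt_apply_of_lt {W : ℕ} {Γ : RibbonGraph} (t : Fin Γ.nH → Tensor3 𝕂 E A) {x : Idx}
    (hx : W < x.size) : wt hℰ h𝒜 I W Γ t x = 0 := by
  classical
  rw [wt_apply, if_neg fun h => absurd h.2.2.1 (not_le.2 hx)]

/-- The tensors at the half-edges: `P` at the marked ones and `Q` at the others. -/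
def label (P Q : Tensor3 𝕂 E A) {n m : ℕ} (Γ : LG n m) (h : Fin n) : Tensor3 𝕂 E A :=
  if Γ.mark h = true then P else Q

variable {P Q : Tensor3 𝕂 E A} (hP : IsPropagator ℰ 𝒜 P) (hQ : IsPropagator ℰ 𝒜 Q)

include hP hQ in
theorem edgeLabel_label {n m : ℕ} (Γ : LG n m) : EdgeLabel ℰ 𝒜 Γ.graph (label P Q Γ) where
  propagator h := by unfold label; split_ifs <;> assumption
  symm h := by unfold label; rw [Γ.mark_inv]

variable (I P Q) in
/-- The weight of a labelled graph. -/
def lwt (W : ℕ) {n m : ℕ} (Γ : LG n m) : Graded A ℰ := wt hℰ h𝒜 I W Γ.graph (label P Q Γ)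

variable (I P Q) in
/-- The sum of the weights of the labelled graphs with `ν` marked half-edges. -/
def markedSum (W ν n m : ℕ) : Graded A ℰ :=
  ∑ Γ ∈ (bounded (5 * W + 1) n m).filter (·.nu = ν), lwt hℰ h𝒜 I P Q W Γ

open Nat in
variable (I P Q) in
/-- The exponential generating function of the sums of weights with `ν` marked half-edges. -/
def genSum (W ν : ℕ) : Graded A ℰ :=
  ∑ n ∈ range (5 * W + 1), (n ! : 𝕂)⁻¹ • ∑ m ∈ range (5 * W + 1), (m ! : 𝕂)⁻¹ •
    markedSum hℰ h𝒜 I P Q W ν n m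

include hc hI hP hQ in
theorem wt_join_map_glue (W : ℕ) {n m n₁ n₂ m₁ m₂ : ℕ} (Γ₁ : LG n₁ m₁) (Γ₂ : LG n₂ m₂)
    (e : Fin (n₁ + n₂) ≃ Fin n) (e' : Fin (m₁ + m₂) ≃ Fin m) {a : Fin n₁} {b : Fin n₂}
    (ha : Γ₁.inv a = a) (hb : Γ₂.inv b = b) : wt hℰ h𝒜 I W
    (((Γ₁.glue Γ₂).map e e').graph.join (e (castAdd n₂ a)) (e (natAdd n₁ b)))
    (joinLabel P (label P Q ((Γ₁.glue Γ₂).map e e')) (e (castAdd n₂ a)) (e (natAdd n₁ b))) = wt hℰ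
    h𝒜 I W ((Γ₁.glue Γ₂).graph.join (castAdd n₂ a) (natAdd n₁ b))
    (joinLabel P (label P Q (Γ₁.glue Γ₂)) (castAdd n₂ a) (natAdd n₁ b)) := by
  have ha' : (Γ₁.glue Γ₂).inv (castAdd n₂ a) = castAdd n₂ a := by simp [ha]
  have hb' : (Γ₁.glue Γ₂).inv (natAdd n₁ b) = natAdd n₁ b := by simp [hb]
  have hl := EdgeLabel.join (Γ := (Γ₁.glue Γ₂).graph) hP
    (edgeLabel_label hP hQ (Γ₁.glue Γ₂)) ha' hb'
  refine wt_iso hℰ h𝒜 hc hI W ⟨e, e', fun h => by simp, fun h => ?_, fun h => by simp,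
    fun v => by simp, fun v => by simp⟩ hl fun h => ?_
  · have ha2 : ((Γ₁.glue Γ₂).map e e').inv (e (castAdd n₂ a)) = e (castAdd n₂ a) := by
      simp [ha]
    have hb2 : ((Γ₁.glue Γ₂).map e e').inv (e (natAdd n₁ b)) = e (natAdd n₁ b) := by simp [hb]
    by_cases h1 : h = castAdd n₂ a
    · rw [h1, join_inv_left ha2 hb2, join_inv_left ha' hb']
    by_cases h2 : h = natAdd n₁ b
    · rw [h2, join_inv_right ha2 hb2, join_inv_right ha' hb']
    refine (join_inv_of_ne ha2 hb2 (fun h => h1 (e.injective h)) fun h => h2 (e.injective h)).trans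
      (Eq.trans ?_ (congrArg e (join_inv_of_ne (Γ := (Γ₁.glue Γ₂).graph) ha' hb' h1 h2).symm))
    simp
  · simp [joinLabel, label]

include hc hI hP hQ in
theorem sum_pairs (W ν : ℕ) {n₁ n₂ m₁ m₂ : ℕ} {x : Idx} (hx : x.size ≤ W) : (∑ p ∈
    Finset.HasAntidiagonal.antidiagonal ν, bracket hℰ P x (markedSum hℰ h𝒜 I P Q W p.1 n₁ m₁)
    (markedSum hℰ h𝒜 I P Q W p.2 n₂ m₂)) = open Classical in ∑ Γ₁ ∈
    (bounded (5 * W + 1) n₁ m₁).filter (·.graph.Connected), ∑ Γ₂ ∈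
    (bounded (5 * W + 1) n₂ m₂).filter (·.graph.Connected), if Γ₁.nu + Γ₂.nu = ν then ∑ a ∈
    Γ₁.graph.legs, ∑ b ∈ Γ₂.graph.legs, wt hℰ h𝒜 I W
    ((Γ₁.glue Γ₂).graph.join (castAdd n₂ a) (natAdd n₁ b))
    (joinLabel P (label P Q (Γ₁.glue Γ₂)) (castAdd n₂ a) (natAdd n₁ b)) x else 0 := by
  classical
  have h0 : ∀ {n m : ℕ} {Γ : LG n m}, ¬ Γ.graph.Connected → lwt hℰ h𝒜 I P Q W Γ = 0 :=
    fun h => wt_of_not_connected hℰ h𝒜 W h _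
  have h1 : ∀ p : ℕ × ℕ,
      bracket hℰ P x (markedSum hℰ h𝒜 I P Q W p.1 n₁ m₁) (markedSum hℰ h𝒜 I P Q W p.2 n₂ m₂) =
      ∑ Γ₁ ∈ bounded (5 * W + 1) n₁ m₁, ∑ Γ₂ ∈ bounded (5 * W + 1) n₂ m₂,
        if p = (Γ₁.nu, Γ₂.nu) then
          bracket hℰ P x (lwt hℰ h𝒜 I P Q W Γ₁) (lwt hℰ h𝒜 I P Q W Γ₂) else 0 := fun p => by
    rw [markedSum, LinearMap.map_sum₂, sum_filter]
    refine sum_congr rfl fun Γ₁ _ => ?_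
    rw [markedSum, map_sum, sum_filter]
    by_cases h : Γ₁.nu = p.1
    · rw [if_pos h]
      refine sum_congr rfl fun Γ₂ _ => if_congr ?_ rfl rfl
      rw [Prod.ext_iff]; tauto
    · rw [if_neg h]
      refine (sum_eq_zero fun Γ₂ _ => if_neg fun hp => h ?_).symm
      rw [hp]
  simp only [h1]
  rw [sum_comm, sum_filter]
  refine sum_congr rfl fun Γ₁ _ => ?_
  rw [sum_comm]
  split_ifs with c1
  · rw [sum_filter]
    refine sum_congr rfl fun Γ₂ _ => ?_
    split_ifs with c2 hν
    · rw [Finset.sum_ite_eq', if_pos (by simpa using hν)]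
      have e1 : label P Q (Γ₁.glue Γ₂) ∘ castAdd n₂ = label P Q Γ₁ := by funext h; simp [label]
      have e2 : label P Q (Γ₁.glue Γ₂) ∘ natAdd n₁ = label P Q Γ₂ := by funext h; simp [label]
      refine Eq.trans ?_ (sum_wt_join_glue hℰ h𝒜 hc hI c1 c2 hP
        (edgeLabel_label hP hQ (Γ₁.glue Γ₂)) hx).symm
      rw [e1, e2]
      rfl
    · rw [Finset.sum_ite_eq', if_neg (by simpa using hν)]
    · refine sum_eq_zero fun p _ => ?_
      rw [h0 c2, map_zero, ite_self]
  · refine sum_eq_zero fun Γ₂ _ => sum_eq_zero fun p _ => ?_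
    rw [h0 c1, map_zero, LinearMap.zero_apply, ite_self]

theorem markedSum_apply (W ν n m : ℕ) (x : Idx) : markedSum hℰ h𝒜 I P Q W ν n m x =
    ∑ Γ ∈ (bounded (5 * W + 1) n m).filter (·.nu = ν), lwt hℰ h𝒜 I P Q W Γ x :=
  DFinsupp.finsetSum_apply _ _ _

include hc hI hP hQ in
theorem smul_markedSum (W ν n m : ℕ) {x : Idx} (hx : x.size ≤ W) : (ν + 2) • markedSum hℰ h𝒜 I P Q W
    (ν + 2) n m x = laplacian hℰ P x (markedSum hℰ h𝒜 I P Q W ν n m) + ∑ H : Finset (Fin n), ∑ V :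
    Finset (Fin m), ∑ p ∈ Finset.HasAntidiagonal.antidiagonal ν, bracket hℰ P x
    (markedSum hℰ h𝒜 I P Q W p.1 H.card V.card)
    (markedSum hℰ h𝒜 I P Q W p.2 (n - H.card) (m - V.card)) := by
  classical
  let G : LG n m → Fin n → Fin n → Part A ℰ x := fun Γ a b =>
    wt hℰ h𝒜 I W (Γ.graph.join a b) (joinLabel P (label P Q Γ) a b) x
  have hG : ∀ Γ : LG n m, (∑ a ∈ Γ.graph.legs, ∑ b ∈ Γ.graph.legs, if a ≠ b then G Γ a b else 0) =
      laplacian hℰ P x (lwt hℰ h𝒜 I P Q W Γ) + ∑ a, ∑ b, if Γ.IsSplit a b then G Γ a b else 0 := by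
    intro Γ
    by_cases h : Γ.graph.Connected
    · refine (sum_wt_join hℰ h𝒜 hc hI h hP (edgeLabel_label hP hQ Γ) hx).trans ?_
      rw [sum_eq_zero, add_zero]
      · rfl
      · exact fun a _ => sum_eq_zero fun b _ => if_neg fun hs => hs.not_connected h
    · have h0 : lwt hℰ h𝒜 I P Q W Γ = 0 := wt_of_not_connected hℰ h𝒜 W h _
      rw [h0, map_zero, zero_add, legs, sum_filter]
      refine sum_congr rfl fun a _ => ?_
      split_ifs with ha
      · rw [sum_filter]
        refine sum_congr rfl fun b _ => ?_
        by_cases hb : Γ.inv b = b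
        · rw [if_pos hb]
          by_cases hs : Γ.IsSplit a b
          · rw [if_pos hs, if_pos]
            rintro rfl
            exact hs.not_reach (reach_refl (Γ := Γ.graph) _)
          · rw [if_neg hs]
            refine ite_eq_right_iff.2 fun _ => ?_
            have : ¬ (Γ.graph.join a b).Connected := fun hj =>
              hs ⟨h, ha, hb, reach_or_reach (Γ := Γ.graph) ha hb hj⟩
            exact DFunLike.congr_fun (wt_of_not_connected hℰ h𝒜 W this _) x
        · rw [if_neg hb, if_neg fun hs => hb hs.right]
      · exact (sum_eq_zero fun b _ => if_neg fun hs => ha hs.left).symm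
  rw [markedSum_apply, sum_marked (F := fun Γ => lwt hℰ h𝒜 I P Q W Γ x) (G := G)]
  · simp only [hG]
    rw [sum_add_distrib, ← map_sum, sum_isSplit _ _ G (fun n₁ n₂ m₁ m₂ Γ₁ Γ₂ a b =>
      wt hℰ h𝒜 I W ((Γ₁.glue Γ₂).graph.join (castAdd n₂ a) (natAdd n₁ b))
        (joinLabel P (label P Q (Γ₁.glue Γ₂)) (castAdd n₂ a) (natAdd n₁ b)) x)]
    · simp only [sum_pairs hℰ h𝒜 hc hI hP hQ W ν hx]
      rfl
    · intro n₁ n₂ m₁ m₂ Γ₁ Γ₂ e e' a b ha hb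
      exact DFunLike.congr_fun (wt_join_map_glue hℰ h𝒜 hc hI hP hQ W Γ₁ Γ₂ e e' ha hb) x
  · intro Γ a ha
    have l := cut_legs (Γ := Γ.graph) a
    refine DFunLike.congr_fun (wt_iso hℰ h𝒜 hc hI W (cutJoin (Γ := Γ.graph) a)
      (EdgeLabel.join hP (edgeLabel_label hP hQ (Γ.cut a)) l.1 l.2) fun h => ?_).symm x
    by_cases h1 : h = a ∨ h = Γ.inv a
    · have h2 : Γ.mark h = true := by
        rcases h1 with h3 | h3
        · rw [h3, ha]
        · rw [h3, Γ.mark_inv, ha]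
      simp [cutJoin, joinLabel, label, h1, h2]
    · simp [cutJoin, joinLabel, label, h1]
      rfl

include hc hI hP hQ in
theorem bracket_markedSum_eq_zero {W ν₁ ν₂ n₁ n₂ m₁ m₂ : ℕ} {x : Idx} (hx : x.size ≤ W)
    (h : 5 * W + 1 ≤ n₁ + n₂ ∨ 5 * W + 1 ≤ m₁ + m₂) :
    bracket hℰ P x (markedSum hℰ h𝒜 I P Q W ν₁ n₁ m₁) (markedSum hℰ h𝒜 I P Q W ν₂ n₂ m₂) = 0 := by
  rw [markedSum, LinearMap.map_sum₂, sum_eq_zero]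
  intro Γ₁ _
  rw [markedSum, map_sum, sum_eq_zero]
  intro Γ₂ _
  by_cases c1 : Γ₁.graph.Connected
  · by_cases c2 : Γ₂.graph.Connected
    · have e1 : label P Q (Γ₁.glue Γ₂) ∘ castAdd n₂ = label P Q Γ₁ := by
        funext h; simp [label]
      have e2 : label P Q (Γ₁.glue Γ₂) ∘ natAdd n₁ = label P Q Γ₂ := by funext h; simp [label]
      have := sum_wt_join_glue hℰ h𝒜 hc hI c1 c2 hP (edgeLabel_label hP hQ (Γ₁.glue Γ₂)) hx
      rw [e1, e2] at this
      refine this.symm.trans (sum_eq_zero fun a _ => sum_eq_zero fun b _ => ?_)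
      exact DFunLike.congr_fun (wt_of_le hℰ h𝒜 W
        (Γ := (Γ₁.graph.glue Γ₂.graph).join (castAdd n₂ a) (natAdd n₁ b)) h _) x
    · rw [lwt.eq_def hℰ h𝒜 I P Q W Γ₂, wt_of_not_connected hℰ h𝒜 W c2, map_zero]
  · rw [lwt.eq_def hℰ h𝒜 I P Q W Γ₁, wt_of_not_connected hℰ h𝒜 W c1, map_zero, LinearMap.zero_apply]

theorem map_sum_smul₂ {R M N L ι κ : Type*} [CommSemiring R] [AddCommMonoid M] [AddCommMonoid N]
    [AddCommMonoid L] [Module R M] [Module R N] [Module R L] (B : M →ₗ[R] N →ₗ[R] L)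
    (s : Finset ι) (t : Finset κ) (c : ι → R) (d : κ → R) (X : ι → M) (Y : κ → N) :
    B (∑ i ∈ s, c i • X i) (∑ j ∈ t, d j • Y j) = ∑ i ∈ s, ∑ j ∈ t, (c i * d j) • B (X i) (Y j) := by
  rw [LinearMap.map_sum₂]
  simp only [LinearMap.smul_apply, map_sum, map_smul, smul_smul, mul_comm]

theorem genSum_apply (W ν : ℕ) (x : Idx) : genSum hℰ h𝒜 I P Q W ν x =
    ∑ n ∈ range (5 * W + 1), (n.factorial : 𝕂)⁻¹ • ∑ m ∈ range (5 * W + 1),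
      (m.factorial : 𝕂)⁻¹ • markedSum hℰ h𝒜 I P Q W ν n m x := by
  change DirectSum.component 𝕂 Idx (Part A ℰ) x _ = _
  rw [genSum]
  simp only [map_sum, map_smul]
  rfl

include hc hI hP hQ in
/-- The flow equation. -/
theorem smul_genSum (W ν : ℕ) {x : Idx} (hx : x.size ≤ W) : (ν + 2) • genSum hℰ h𝒜 I P Q W (ν + 2) x
    = laplacian hℰ P x (genSum hℰ h𝒜 I P Q W ν) + ∑ p ∈ Finset.HasAntidiagonal.antidiagonal ν,
    bracket hℰ P x (genSum hℰ h𝒜 I P Q W p.1) (genSum hℰ h𝒜 I P Q W p.2) := by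
  have h1 : ∀ p : ℕ × ℕ,
      bracket hℰ P x (genSum hℰ h𝒜 I P Q W p.1) (genSum hℰ h𝒜 I P Q W p.2) =
      ∑ n ∈ range (5 * W + 1), (n.factorial : 𝕂)⁻¹ • ∑ m ∈ range (5 * W + 1),
        (m.factorial : 𝕂)⁻¹ • ∑ H : Finset (Fin n), ∑ V : Finset (Fin m),
          bracket hℰ P x (markedSum hℰ h𝒜 I P Q W p.1 H.card V.card)
            (markedSum hℰ h𝒜 I P Q W p.2 (n - H.card) (m - V.card)) := fun p => by
    rw [genSum, genSum, map_sum_smul₂]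
    simp only [map_sum_smul₂]
    have h2 : ∀ n₁ n₂, (∑ r ∈ range (5 * W + 1), ∑ s ∈ range (5 * W + 1),
        ((r.factorial : 𝕂)⁻¹ * (s.factorial : 𝕂)⁻¹) • bracket hℰ P x
          (markedSum hℰ h𝒜 I P Q W p.1 n₁ r) (markedSum hℰ h𝒜 I P Q W p.2 n₂ s)) =
        ∑ m ∈ range (5 * W + 1), (m.factorial : 𝕂)⁻¹ • ∑ V : Finset (Fin m),
          bracket hℰ P x (markedSum hℰ h𝒜 I P Q W p.1 n₁ V.card)
            (markedSum hℰ h𝒜 I P Q W p.2 n₂ (m - V.card)) := fun n₁ n₂ =>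
      (sum_subsets _ (fun r s => bracket hℰ P x (markedSum hℰ h𝒜 I P Q W p.1 n₁ r)
        (markedSum hℰ h𝒜 I P Q W p.2 n₂ s)) fun r s hrs =>
          bracket_markedSum_eq_zero hℰ h𝒜 hc hI hP hQ hx (Or.inr hrs)).symm
    simp only [h2]
    rw [← sum_subsets (5 * W + 1) (fun n₁ n₂ => ∑ m ∈ range (5 * W + 1), (m.factorial : 𝕂)⁻¹ • ∑ V :
      Finset (Fin m), bracket hℰ P x (markedSum hℰ h𝒜 I P Q W p.1 n₁ V.card) (markedSum hℰ h𝒜 I P Q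
      W p.2 n₂ (m - V.card)))]
    · refine sum_congr rfl fun n _ => ?_
      rw [sum_comm]
      simp only [smul_sum]
    · intro n₁ n₂ h
      refine sum_eq_zero fun m _ => ?_
      rw [sum_eq_zero, smul_zero]
      exact fun V _ => bracket_markedSum_eq_zero hℰ h𝒜 hc hI hP hQ hx (Or.inl h)
  simp only [h1]
  rw [genSum_apply, genSum]
  simp only [map_sum, map_smul]
  rw [sum_comm, ← sum_add_distrib, smul_sum]
  refine sum_congr rfl fun n _ => ?_
  rw [← smul_sum, ← smul_add, smul_comm, sum_comm, ← sum_add_distrib, smul_sum]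
  congr 1
  refine sum_congr rfl fun m _ => ?_
  rw [← smul_sum, ← smul_add, smul_comm, smul_markedSum hℰ h𝒜 hc hI hP hQ W ν n m hx]
  refine congrArg _ (congrArg _ ?_)
  symm
  rw [sum_comm]
  refine sum_congr rfl fun H _ => ?_
  rw [sum_comm]

theorem genSum_apply_of_lt (W ν : ℕ) {x : Idx} (hx : W < x.size) :
    genSum hℰ h𝒜 I P Q W ν x = 0 := by
  have h : ∀ n m, markedSum hℰ h𝒜 I P Q W ν n m x = 0 := fun n m => by
    rw [markedSum_apply]
    exact sum_eq_zero fun Γ _ => wt_apply_of_lt hℰ h𝒜 _ hx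
  rw [genSum_apply]
  simp only [h, smul_zero, sum_const_zero]

theorem genSum_one (W : ℕ) : genSum hℰ h𝒜 I P Q W 1 = 0 := by
  have h : ∀ n m, markedSum hℰ h𝒜 I P Q W 1 n m = 0 := fun n m => by
    rw [markedSum, sum_eq_zero]
    intro Γ hΓ
    have h1 := (mem_filter.1 hΓ).2
    obtain ⟨a, ha⟩ := Finset.card_pos.1 (h1 ▸ Nat.one_pos : 0 < Γ.nu)
    have := nu_cut (mem_filter.1 ha).2
    omega
  refine DFinsupp.ext fun x => ?_
  rw [genSum_apply]
  simp only [h, DFinsupp.zero_apply, smul_zero, sum_const_zero]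

include hc hI hP hQ in
/-- Solutions of the flow equation are determined by their initial values. -/
theorem genSum_eq_genSum {J : Functional A ℰ} (hJ : IsInteraction ℰ 𝒜 J) {Q' : Tensor3 𝕂 E A}
    (hQ' : IsPropagator ℰ 𝒜 Q') {W : ℕ} (h0 : genSum hℰ h𝒜 I P Q W 0 = genSum hℰ h𝒜 J P Q' W 0)
    (ν : ℕ) : genSum hℰ h𝒜 I P Q W ν = genSum hℰ h𝒜 J P Q' W ν := by
  induction ν using Nat.strong_induction_on with
  | _ ν ih =>
  match ν, ih with
  | 0, _ => exact h0
  | 1, _ => rw [genSum_one, genSum_one]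
  | ν + 2, ih =>
    refine DFinsupp.ext fun x => ?_
    rcases lt_or_ge W x.size with hx | hx
    · rw [genSum_apply_of_lt hℰ h𝒜 _ _ hx, genSum_apply_of_lt hℰ h𝒜 _ _ hx]
    · have h1 := smul_genSum hℰ h𝒜 hc hI hP hQ W ν hx
      have h2 := smul_genSum hℰ h𝒜 hc hJ hP hQ' W ν hx
      rw [ih ν (by omega), sum_congr rfl fun p hp => by
        have := Finset.HasAntidiagonal.mem_antidiagonal.1 hp
        rw [ih p.1 (by omega), ih p.2 (by omega)], ← h2, ← Nat.cast_smul_eq_nsmul 𝕂,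
        ← Nat.cast_smul_eq_nsmul 𝕂] at h1
      exact smul_right_injective _ (Nat.cast_ne_zero.2 (by omega)) h1

end Operators



theorem mem_graphClasses {i j k l : ℕ} {γ : GraphClass} : γ ∈ graphClasses i j k l ↔
    γ.out.Connected ∧ γ.out.toRibbonGraph.idx = (i, j + k, k, l) := by
  have h2 := γ.out.totalBdry_eq
  rw [graphClasses, Set.mem_ofPred_eq]
  refine and_congr_right fun h => ?_
  rw [Connected.totalGenus_eq h, idx, Prod.ext_iff, Prod.ext_iff, Prod.ext_iff, Nat.cast_inj]
  exact and_congr_right fun _ => by simp only; omega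

theorem out_injective : Injective fun γ : GraphClass => γ.out.toRibbonGraph := fun γ γ' h =>
  Quotient.out_equiv_out.1 ⟨by
    have : γ.out.toRibbonGraph = γ'.out.toRibbonGraph := h
    rw [this]
    exact Iso.refl _⟩

theorem out_bounds {i j k l : ℕ} {γ : GraphClass} (h : γ ∈ graphClasses i j k l) : γ.out.nH < 5 *
    (4 * i + 2 * (j + k) + l) + 1 ∧ γ.out.nV < 5 * (4 * i + 2 * (j + k) + l) + 1 ∧ ∀ v, γ.out.genus
    v < 5 * (4 * i + 2 * (j + k) + l) + 1 ∧ γ.out.bdry v < 5 * (4 * i + 2 * (j + k) + l) + 1 := by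
  rw [mem_graphClasses, idx, Prod.ext_iff, Prod.ext_iff, Prod.ext_iff] at h
  obtain ⟨h1, h2, h3, h4, h5⟩ := h
  simp only at h2 h3 h4 h5
  have hs : γ.out.toRibbonGraph.IsStable := fun v => ⟨γ.out.pos v, γ.out.stable v⟩
  obtain ⟨b1, b2, b3⟩ := hs.bounds h1.totalGenus_eq
  rw [h2, h3, h5] at b1 b2 b3
  exact ⟨by omega, by omega, fun v => by have := b3 v; omega⟩

theorem finite_graphClasses (i j k l : ℕ) : (graphClasses i j k l).Finite := by
  refine Set.Finite.of_finite_image (f := fun γ : GraphClass => γ.out.toRibbonGraph)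
    (Set.Finite.subset (s := ⋃ n ∈ range (5 * (4 * i + 2 * (j + k) + l) + 1),
      ⋃ m ∈ range (5 * (4 * i + 2 * (j + k) + l) + 1),
        (fun Γ : LG n m => Γ.graph) '' (bounded (5 * (4 * i + 2 * (j + k) + l) + 1) n m)) ?_ ?_)
    out_injective.injOn
  · exact Set.Finite.biUnion (Finset.finite_toSet _) fun n _ =>
      Set.Finite.biUnion (Finset.finite_toSet _) fun m _ => (Finset.finite_toSet _).image _
  · rintro _ ⟨γ, hγ, rfl⟩
    obtain ⟨b1, b2, b3⟩ := out_bounds hγ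
    simp only [Set.mem_iUnion, mem_range]
    exact ⟨_, b1, _, b2, ofGraph γ.out.toRibbonGraph, Finset.mem_coe.2 (mem_bounded.2 b3), rfl⟩

namespace LG

variable {n m : ℕ}

theorem nu_eq_zero {Γ : LG n m} : Γ.nu = 0 ↔ ∀ h, Γ.mark h = false := by
  simp [nu, Finset.filter_eq_empty_iff]

theorem eq_ofGraph {Γ : LG n m} (h : Γ.nu = 0) : Γ = ofGraph Γ.graph := by
  ext x <;> try rfl
  exact nu_eq_zero.1 h x

open Classical in
/-- Marking a set of edges. -/
def markEdges (Γ : RibbonGraph) (s : Finset Γ.edges) : LG Γ.nH Γ.nV :=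
  { ofGraph Γ with
    mark := fun h => decide (∃ e ∈ s, e.1 = min h (Γ.inv h))
    mark_inv := fun h => by
      rw [decide_eq_decide]
      change (∃ e ∈ s, e.1 = min (Γ.inv h) (Γ.inv (Γ.inv h))) ↔ _
      rw [Γ.inv_inv, min_comm]
    mark_leg := fun h hh => decide_eq_false fun ⟨e, _, he⟩ => by
      have hh : Γ.inv h = h := hh
      rw [hh, min_self] at he
      exact Γ.not_leg_of_mem_edges e.2 (he ▸ hh) }

theorem markEdges_mark_iff (Γ : RibbonGraph) (s : Finset Γ.edges) (h : Fin Γ.nH) :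
    (markEdges Γ s).mark h = true ↔ ∃ e ∈ s, e.1 = min h (Γ.inv h) := decide_eq_true_iff

open Classical in
theorem markEdges_mark (Γ : RibbonGraph) (s : Finset Γ.edges) (e : Γ.edges) :
    (markEdges Γ s).mark e = decide (e ∈ s) := by
  rw [Bool.eq_iff_iff, markEdges_mark_iff, decide_eq_true_iff, min_eq_left (mem_filter.1 e.2).2.le]
  exact ⟨fun ⟨e', h1, h2⟩ => Subtype.ext h2 ▸ h1, fun h => ⟨e, h, rfl⟩⟩

/-- A sum over all marked graphs is a sum over graphs and sets of edges. -/
theorem sum_bounded {M : Type*} [AddCommMonoid M] (B : ℕ) (F : LG n m → M) :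
    ∑ Γ ∈ bounded B n m, F Γ = ∑ Γ ∈ (bounded B n m).filter (·.nu = 0),
      ∑ s : Finset Γ.graph.edges, F (markEdges Γ.graph s) := by
  classical
  rw [Finset.sum_sigma']
  symm
  refine Finset.sum_bij (fun x _ => markEdges x.1.graph x.2) ?_ ?_ ?_ fun _ _ => rfl
  · rintro ⟨Γ, s⟩ h
    simp only [mem_sigma, mem_filter, mem_bounded] at h ⊢
    exact h.1.1
  · rintro ⟨Γ, s⟩ h ⟨Γ', s'⟩ h' hh
    simp only [mem_sigma, mem_filter] at h h' hh
    have h1 : Γ = Γ' := by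
      rw [eq_ofGraph h.1.2, eq_ofGraph h'.1.2]
      let u : LG n m → LG n m := fun Γ => ofGraph Γ.graph
      exact congrArg u (a₁ := markEdges Γ.graph s) (a₂ := markEdges Γ'.graph s') hh
    subst h1
    refine Sigma.ext rfl (heq_of_eq (Finset.ext fun e => ?_))
    rw [← decide_eq_decide, ← markEdges_mark, ← markEdges_mark, hh]
  · intro Γ h
    refine ⟨⟨ofGraph Γ.graph, Finset.univ.filter fun e => Γ.mark e.1 = true⟩, ?_, ?_⟩
    · simp only [mem_sigma, mem_filter, mem_univ, and_true]
      exact ⟨mem_bounded.2 fun v => mem_bounded.1 h v, nu_eq_zero.2 fun _ => rfl⟩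
    · ext x <;> try rfl
      rw [Bool.eq_iff_iff]
      refine (markEdges_mark_iff _ _ _).trans ?_
      change (∃ e : Γ.graph.edges, _ ∧ e.1 = min x (Γ.inv x)) ↔ _
      simp only [mem_filter, mem_univ, true_and]
      have hm : Γ.mark (min x (Γ.inv x)) = Γ.mark x := by
        rcases min_choice x (Γ.inv x) with h | h <;> rw [h]
        exact Γ.mark_inv x
      refine ⟨fun ⟨e, h1, h2⟩ => by rw [← hm, ← h2, h1], fun hx => ⟨⟨min x (Γ.inv x), ?_⟩, ?_, rfl⟩⟩
      · have hne := inv_ne_of_mark hx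
        refine mem_filter.2 ⟨mem_univ _, ?_⟩
        change min x (Γ.inv x) < Γ.inv (min x (Γ.inv x))
        rcases lt_or_gt_of_ne hne with h | h
        · rwa [min_eq_right h.le, Γ.inv_inv]
        · rwa [min_eq_left h.le]
      · rw [hm, hx]

/-- Relabellings of a graph with a given result are isomorphisms. -/
def mapEquiv (G : RibbonGraph) (Γ : LG G.nH G.nV) (h : Γ.nu = 0) :
    {p : Perm (Fin G.nH) × Perm (Fin G.nV) // (ofGraph G).map p.1 p.2 = Γ} ≃
      G.Iso Γ.graph where
  toFun p := by
    have := mapIso p.1.1 p.1.2 (ofGraph G)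
    exact ⟨p.1.1, p.1.2, fun h => by simp [← p.2, ofGraph], fun h => by simp [← p.2, ofGraph],
      fun h => by simp [← p.2, ofGraph], fun h => by simp [← p.2, ofGraph],
      fun h => by simp [← p.2, ofGraph]⟩
  invFun f := ⟨(f.onH, f.onV), by
    have e1 := fun x => f.onH.apply_symm_apply x
    ext x
    · exact congrArg Fin.val ((f.map_root _).symm.trans (congrArg Γ.root (e1 x)))
    · exact congrArg Fin.val ((f.map_inv _).symm.trans (congrArg Γ.inv (e1 x)))
    · exact congrArg Fin.val ((f.map_cyc _).symm.trans (congrArg Γ.cyc (e1 x)))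
    · exact (f.map_genus _).symm.trans (congrArg Γ.genus (f.onV.apply_symm_apply x))
    · exact (f.map_bdry _).symm.trans (congrArg Γ.bdry (f.onV.apply_symm_apply x))
    · exact (nu_eq_zero.1 h x).symm⟩
  left_inv _ := rfl
  right_inv _ := rfl

/-- Isomorphisms to a graph isomorphic to `G` correspond to automorphisms of `G`. -/
def isoEquiv {G G' : RibbonGraph} (f : G.Iso G') : G.Iso G' ≃ G.Iso G where
  toFun g := g.trans f.symm
  invFun g := g.trans f
  left_inv g := by cases g; simp [Iso.trans, Iso.symm, Equiv.trans_assoc]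
  right_inv g := by cases g; simp [Iso.trans, Iso.symm, Equiv.trans_assoc]

open Classical Nat in
theorem card_iso_mul (G : RibbonGraph) {B : ℕ} (hB : ∀ v, G.genus v < B ∧ G.bdry v < B) :
    ((bounded B G.nH G.nV).filter fun Γ => Γ.nu = 0 ∧ Nonempty (G.Iso Γ.graph)).card *
      Nat.card (G.Iso G) = G.nH ! * G.nV ! := by
  have h1 : (univ : Finset (Perm (Fin G.nH) × Perm (Fin G.nV))).card =
      G.nH ! * G.nV ! := by
    rw [Finset.card_univ, Fintype.card_prod, Fintype.card_perm, Fintype.card_perm,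
      Fintype.card_fin, Fintype.card_fin]
  rw [← h1, Finset.card_eq_sum_card_fiberwise (f := fun p : Perm (Fin G.nH) × Perm (Fin G.nV) => (ofGraph G).map p.1 p.2)
    (t := (bounded B G.nH G.nV).filter fun Γ => Γ.nu = 0 ∧ Nonempty (G.Iso Γ.graph)),
    Finset.sum_const_nat]
  · intro Γ hΓ
    obtain ⟨-, h0, ⟨f⟩⟩ := mem_filter.1 hΓ
    rw [← Nat.card_congr (isoEquiv f), ← Nat.card_congr (mapEquiv G Γ h0), Nat.card_eq_fintype_card,
      Fintype.card_subtype]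
  · intro p _
    refine Finset.mem_coe.2 (mem_filter.2 ⟨mem_bounded.2 fun v => hB _, ?_, ⟨mapIso _ _ (ofGraph G)⟩⟩)
    exact nu_eq_zero.2 fun _ => rfl

open Classical in
/-- Every isomorphism class appears with the reciprocal of the order of its automorphism group in
the exponential generating function of labelled graphs. -/
theorem sum_iso {𝕂 M : Type*} [Field 𝕂] [CharZero 𝕂] [AddCommGroup M] [Module 𝕂 M] (G : RibbonGraph)
    {B : ℕ} (h1 : G.nH < B) (h2 : G.nV < B) (hB : ∀ v, G.genus v < B ∧ G.bdry v < B) (c : M) : ∑ n ∈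
    range B, (n.factorial : 𝕂)⁻¹ • ∑ m ∈ range B, (m.factorial : 𝕂)⁻¹ •
    (∑ Γ ∈ (bounded B n m).filter (·.nu = 0), if Nonempty (G.Iso Γ.graph) then c else 0) =
    (Nat.card (G.Iso G) : 𝕂)⁻¹ • c := by
  rw [sum_eq_single_of_mem _ (mem_range.2 h1), sum_eq_single_of_mem _ (mem_range.2 h2)]
  · rw [← sum_filter, Finset.filter_filter, sum_const, ← Nat.cast_smul_eq_nsmul 𝕂,
      smul_smul, smul_smul]
    congr 1
    have h := congrArg (Nat.cast : ℕ → 𝕂) (card_iso_mul G hB)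
    have e1 := (Nat.cast_ne_zero (R := 𝕂)).2 G.nH.factorial_ne_zero
    have e2 := (Nat.cast_ne_zero (R := 𝕂)).2 G.nV.factorial_ne_zero
    push_cast at h
    have e3 : (Nat.card (G.Iso G) : 𝕂) ≠ 0 := fun h0 => by
      rw [h0, mul_zero] at h
      exact mul_ne_zero e1 e2 h.symm
    field_simp
    rw [h]
  · intro m _ hm
    rw [sum_eq_zero, smul_zero]
    exact fun Γ _ => if_neg fun ⟨f⟩ => hm (nV_iso f)
  · intro n _ hn
    rw [sum_eq_zero, smul_zero]
    intro m _
    rw [sum_eq_zero, smul_zero]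
    exact fun Γ _ => if_neg fun ⟨f⟩ => hn (nH_iso f)

end LG

section Operators

variable {P Q : Tensor3 𝕂 E A}

theorem wt_add (W : ℕ) (Γ : RibbonGraph) : wt hℰ h𝒜 I W Γ (fun _ => P + Q) = ∑ s : Finset Γ.edges,
    wt hℰ h𝒜 I W Γ (label P Q (markEdges Γ s)) := by
  classical
  have h1 : ampl hℰ I h𝒜 (Γ.sortedLegs rfl) (fun _ => P + Q) =
      ∑ s : Finset Γ.edges, ampl hℰ I h𝒜 (Γ.sortedLegs rfl) (label P Q (markEdges Γ s)) := by
    ext y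
    rw [_root_.sum_apply]
    refine ((amplitudeFun hℰ I h𝒜 (Γ.sortedLegs rfl) y).toMultilinearMap.map_add_univ
      (fun _ => P) (fun _ => Q)).trans (sum_congr rfl fun s _ => ?_)
    refine congrArg (amplitudeFun hℰ I h𝒜 (Γ.sortedLegs rfl) y) (funext fun e => ?_)
    simp only [Finset.piecewise, label, markEdges_mark, decide_eq_true_eq]
  by_cases h : Γ.Connected ∧ Γ.IsStable ∧ Γ.idx.size ≤ W
  · simp only [wt, if_pos h]
    rw [← map_sum]
    congr 1
    have h2 : ∀ t : Fin Γ.nH → Tensor3 𝕂 E A, cw hℰ h𝒜 I Γ t (numCycles Γ.canonical) Γ.legs.card =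
      cls ℰ _ (Γ.sortedLegs rfl).perm (ampl hℰ I h𝒜 (Γ.sortedLegs rfl) t) := fun t => dif_pos rfl
    rw [h2, h1, map_sum]
    exact sum_congr rfl fun s _ => (h2 _).symm
  · simp only [wt, if_neg h, sum_const_zero]

/-- The sum over all ways of marking edges. -/
theorem sum_genSum (W : ℕ) : ∑ ν ∈ range (5 * W + 1), genSum hℰ h𝒜 I P Q W ν =
    genSum hℰ h𝒜 I P (P + Q) W 0 := by
  have h0 : ∀ n ∈ range (5 * W + 1), ∀ m, ∑ ν ∈ range (5 * W + 1),
      markedSum hℰ h𝒜 I P Q W ν n m = markedSum hℰ h𝒜 I P (P + Q) W 0 n m := fun n hn m => by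
    unfold markedSum
    rw [Finset.sum_fiberwise_of_maps_to, sum_bounded]
    · refine sum_congr rfl fun Γ hΓ => ?_
      have h1 : label P (P + Q) Γ = fun _ => P + Q := funext fun h => if_neg (by
        rw [nu_eq_zero.1 (mem_filter.1 hΓ).2]; simp)
      rw [lwt.eq_def hℰ h𝒜 I P (P + Q), h1, wt_add]
      rfl
    · intro Γ _
      have : Γ.nu ≤ n := (Finset.card_le_univ _).trans_eq (Fintype.card_fin n)
      have := mem_range.1 hn
      exact mem_range.2 (by omega)
  refine DFinsupp.ext fun x => ?_
  rw [DFinsupp.finsetSum_apply]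
  simp only [genSum_apply]
  rw [sum_comm]
  refine sum_congr rfl fun n hn => ?_
  rw [← smul_sum, sum_comm]
  congr 1
  refine sum_congr rfl fun m _ => ?_
  rw [← smul_sum, ← h0 n hn, DFinsupp.finsetSum_apply]

variable {R : Tensor3 𝕂 E A} (hR : IsPropagator ℰ 𝒜 R)

theorem weight_eq (Γ : RibbonGraph) (k l : ℕ) :
    Γ.weight 𝒜 I R k l = cw hℰ h𝒜 I Γ (fun _ => R) k l := by
  have hp : ∀ hl : Γ.legs.card = l, (Γ.sortedLegs hl).perm =
      (Γ.legs.orderIsoOfFin hl).symm.toEquiv.permCongr Γ.canonical := fun hl =>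
    LegEnum.perm_eq fun i => congrArg Subtype.val
      ((Γ.legs.orderIsoOfFin hl).apply_symm_apply (Γ.canonical (Γ.legs.orderIsoOfFin hl i)))
  unfold weight cw
  split_ifs with hl hk
  · rw [hp, cls_of_eq hk, amplitude_eq hℰ I h𝒜 hl]
  · rw [hp, cls_of_ne hk]
  · rfl

theorem of_wt_ne_zero {W : ℕ} {Γ : RibbonGraph} {t : Fin Γ.nH → Tensor3 𝕂 E A} {x : Idx}
    (h : wt hℰ h𝒜 I W Γ t x ≠ 0) : (Γ.Connected ∧ Γ.IsStable) ∧ Γ.idx = x := by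
  by_cases hh : Γ.Connected ∧ Γ.IsStable ∧ Γ.idx.size ≤ W
  · refine ⟨⟨hh.1, hh.2.1⟩, by_contra fun hx => h ?_⟩
    rw [wt, if_pos hh]
    exact DFinsupp.single_eq_of_ne (Ne.symm hx)
  · rw [wt, if_neg hh] at h
    exact absurd rfl h

include hc hI hR in
/-- The flow as a sum over labelled graphs. -/
theorem rgFlow_eq_genSum {i j k l W : ℕ} (hW : Idx.size (i, j + k, k, l) ≤ W) :
    rgFlow 𝒜 I R i j k l = genSum hℰ h𝒜 I P R W 0 (i, j + k, k, l) := by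
  classical
  set x : Idx := (i, j + k, k, l) with hx
  let S := (finite_graphClasses i j k l).toFinset
  let v : GraphClass → Part A ℰ x := fun γ => wt hℰ h𝒜 I W γ.out.toRibbonGraph (fun _ => R) x
  have hl : ∀ Γ : RibbonGraph, EdgeLabel ℰ 𝒜 Γ fun _ => R := fun Γ => ⟨fun _ => hR, fun _ => rfl⟩
  have hiso : ∀ {Γ Γ' : RibbonGraph} (_ : Γ.Iso Γ'),
      wt hℰ h𝒜 I W Γ' (fun _ => R) x = wt hℰ h𝒜 I W Γ (fun _ => R) x := fun f =>
    DFunLike.congr_fun (wt_iso hℰ h𝒜 hc hI W f (hl _) fun _ => rfl) x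
  have h1 : ∀ n m, ∀ Γ ∈ (bounded (5 * W + 1) n m).filter (·.nu = 0), lwt hℰ h𝒜 I P R W Γ x =
      ∑ γ ∈ S, if Nonempty (γ.out.toRibbonGraph.Iso Γ.graph) then v γ else 0 := fun n m Γ hΓ => by
    have h1 : label P R Γ = fun _ => R := funext fun h => if_neg (by
      rw [nu_eq_zero.1 (mem_filter.1 hΓ).2]; simp)
    rw [lwt, h1]
    by_cases h0 : wt hℰ h𝒜 I W Γ.graph (fun _ => R) x = 0
    · rw [h0]
      exact (sum_eq_zero fun γ _ => ite_eq_right_iff.2 fun ⟨f⟩ => (hiso f).symm.trans h0).symm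
    · obtain ⟨⟨c, s⟩, hx⟩ := of_wt_ne_zero hℰ h𝒜 h0
      let Γs : StableRibbonGraph := ⟨Γ.graph, fun v => (s v).1, fun v => (s v).2⟩
      obtain ⟨f⟩ : Nonempty ((⟦Γs⟧ : GraphClass).out.toRibbonGraph.Iso Γ.graph) :=
        Quotient.mk_out (s := StableRibbonGraph.isoSetoid) Γs
      rw [sum_eq_single ⟦Γs⟧, if_pos ⟨f⟩]
      · exact hiso f
      · intro γ _ hne
        refine if_neg fun ⟨g⟩ => hne ?_
        rw [← γ.out_eq]
        exact Quotient.sound (s := StableRibbonGraph.isoSetoid) ⟨g⟩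
      · intro hn
        have h2 := (hiso f).symm.trans_ne h0
        obtain ⟨⟨c, -⟩, hx⟩ := of_wt_ne_zero hℰ h𝒜 h2
        exact absurd ((Set.Finite.mem_toFinset _).2 (mem_graphClasses.2 ⟨c, hx⟩)) hn
  have hv : ∀ γ ∈ S, γ.out.weight 𝒜 I R k l = v γ := fun γ hγ => by
    obtain ⟨c, h⟩ := mem_graphClasses.1 ((Set.Finite.mem_toFinset _).1 hγ)
    rw [weight_eq hℰ h𝒜]
    have hs : γ.out.toRibbonGraph.IsStable := fun v => ⟨γ.out.pos v, γ.out.stable v⟩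
    refine Eq.trans ?_ (wt_apply hℰ h𝒜 W _ _ x).symm
    rw [if_pos ⟨c, hs, hW, congrArg Prod.fst h, congrArg (fun y : Idx => y.2.1) h⟩]
  rw [genSum_apply, rgFlow, finsum_mem_eq_finite_toFinset_sum _ (finite_graphClasses i j k l)]
  simp only [markedSum_apply]
  have h2 : ∀ n m, (∑ Γ ∈ (bounded (5 * W + 1) n m).filter (·.nu = 0), lwt hℰ h𝒜 I P R W Γ x) =
      ∑ γ ∈ S, ∑ Γ ∈ (bounded (5 * W + 1) n m).filter (·.nu = 0),
        if Nonempty (γ.out.toRibbonGraph.Iso Γ.graph) then v γ else 0 := fun n m => by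
    rw [sum_congr rfl (h1 n m), sum_comm]
  have h3 : ∀ n, (∑ m ∈ range (5 * W + 1), (m.factorial : 𝕂)⁻¹ •
      ∑ Γ ∈ (bounded (5 * W + 1) n m).filter (·.nu = 0), lwt hℰ h𝒜 I P R W Γ x) =
      ∑ γ ∈ S, ∑ m ∈ range (5 * W + 1), (m.factorial : 𝕂)⁻¹ •
        ∑ Γ ∈ (bounded (5 * W + 1) n m).filter (·.nu = 0),
          if Nonempty (γ.out.toRibbonGraph.Iso Γ.graph) then v γ else 0 := fun n => by
    rw [sum_comm]
    refine sum_congr rfl fun m _ => ?_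
    rw [h2, smul_sum]
  symm
  rw [sum_congr rfl fun n _ => by rw [h3 n, smul_sum], sum_comm]
  refine sum_congr rfl fun γ hγ => ?_
  obtain ⟨b1, b2, b3⟩ := out_bounds ((Set.Finite.mem_toFinset _).1 hγ)
  have hW' : 4 * i + 2 * (j + k) + l ≤ W := hW
  rw [hv γ hγ, StableRibbonGraph.autOrder]
  exact sum_iso (𝕂 := 𝕂) γ.out.toRibbonGraph (B := 5 * W + 1)
    (by omega) (by omega) (fun w => by have := b3 w; omega) _

end Operators



instance : PolynormableSpace 𝕂 (ProjTensor 𝕂 E A) := PolynormableSpace.sInf fun _ ht => ht.2.2.1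

theorem ProjTensor.continuous_of_pure {B : Type*} [AddCommGroup B] [Module 𝕂 B] [TopologicalSpace B]
    [IsTopologicalAddGroup B] [ContinuousSMul 𝕂 B] [PolynormableSpace 𝕂 B]
    (L : ProjTensor 𝕂 E A →ₗ[𝕂] B)
    (h : Continuous fun z : E × E × A => L (ProjTensor.pure 𝕂 E A z.1 z.2.1 z.2.2)) :
    Continuous L :=
  continuous_iff_le_induced.2 <| sInf_le ⟨topologicalAddGroup_induced L, continuousSMul_induced L,
    PolynormableSpace.induced L, continuous_induced_rng.2 h⟩

/-- The sign in the definition of the flip. -/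
def flipSign (i j : ℤ) : ℤ := if Odd i ∧ Odd j then -1 else 1

include hℰ in
theorem exists_flip : ∃ τ : Tensor3 𝕂 E A →L[𝕂] Tensor3 𝕂 E A,
    ∀ i j : ℤ, ∀ p ∈ ℰ i, ∀ q ∈ ℰ j, ∀ a : A, τ (Tensor3.pure 𝕂 E A p q a) =
      (if Odd i ∧ Odd j then (-1 : ℤ) else 1) • Tensor3.pure 𝕂 E A q p a := by
  let M : ℤ → ℤ → ProjTensor 𝕂 E A →ₗ[𝕂] ProjTensor 𝕂 E A := fun i j =>
    LinearMap.rTensor A ((TensorProduct.comm 𝕂 E E).toLinearMap ∘ₗ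
      TensorProduct.map (hℰ.proj i).toLinearMap (hℰ.proj j).toLinearMap)
  let L : ProjTensor 𝕂 E A →ₗ[𝕂] ProjTensor 𝕂 E A := ∑ i ∈ hℰ.degrees, ∑ j ∈ hℰ.degrees,
    flipSign i j • M i j
  have hL : ∀ p q a, L (ProjTensor.pure 𝕂 E A p q a) = ∑ i ∈ hℰ.degrees, ∑ j ∈ hℰ.degrees,
      flipSign i j • ProjTensor.pure 𝕂 E A (hℰ.proj j q) (hℰ.proj i p) a := fun p q a => by
    simp only [L, LinearMap.sum_apply, LinearMap.smul_apply]
    rfl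
  have hc : Continuous L := ProjTensor.continuous_of_pure L <| by
    simp only [hL]
    refine continuous_finsetSum _ fun i _ => continuous_finsetSum _ fun j _ => Continuous.zsmul ?_ _
    exact ProjTensor.continuous_pure.comp (f := fun z : E × E × A =>
      (hℰ.proj j z.2.1, hℰ.proj i z.1, z.2.2)) (by fun_prop)
  let L' : ProjTensor 𝕂 E A →L[𝕂] Tensor3 𝕂 E A := Tensor3.coeL.comp ⟨L, hc⟩
  refine ⟨L'.extend Tensor3.coeL, fun i j p hp q hq a => ?_⟩
  refine (ContinuousLinearMap.extend_eq L' Tensor3.dense_coe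
    (UniformSpace.Completion.isUniformInducing_coe _) (ProjTensor.pure 𝕂 E A p q a)).trans ?_
  have h0 : ∀ q a, ProjTensor.pure 𝕂 E A 0 q a = 0 := fun q a =>
    (ProjTensor.pure_trilinear.left q a).map_zero
  have h0' : ∀ p a, ProjTensor.pure 𝕂 E A p 0 a = 0 := fun p a =>
    (ProjTensor.pure_trilinear.middle p a).map_zero
  have h1 : L (ProjTensor.pure 𝕂 E A p q a) = flipSign i j • ProjTensor.pure 𝕂 E A q p a := by
    rw [hL, sum_eq_single i, sum_eq_single j, hℰ.proj_same hp, hℰ.proj_same hq]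
    · intro j' _ hj
      rw [hℰ.proj_ne hq hj.symm, h0, smul_zero]
    · intro hj
      rw [hℰ.eq_zero_of_notMem hq hj, map_zero, h0, smul_zero]
    · intro i' _ hi
      refine sum_eq_zero fun j' _ => ?_
      rw [hℰ.proj_ne hp hi.symm, h0', smul_zero]
    · intro hi
      refine sum_eq_zero fun j' _ => ?_
      rw [hℰ.eq_zero_of_notMem hp hi, map_zero, h0', smul_zero]
  change Tensor3.coeL (L (ProjTensor.pure 𝕂 E A p q a)) = _
  rw [h1, map_zsmul]
  rfl

theorem IsPropagator.flip_eq {P : Tensor3 𝕂 E A} (hP : IsPropagator ℰ 𝒜 P)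
    {τ : Tensor3 𝕂 E A →L[𝕂] Tensor3 𝕂 E A}
    (hτ : ∀ i j : ℤ, ∀ p ∈ ℰ i, ∀ q ∈ ℰ j, ∀ a : A, τ (Tensor3.pure 𝕂 E A p q a) =
      (if Odd i ∧ Odd j then (-1 : ℤ) else 1) • Tensor3.pure 𝕂 E A q p a) : τ P = P := by
  obtain ⟨τ', h1, h2⟩ := hP.symmetric
  refine (degreeZero_ext (ℰ := ℰ) (𝒜 := 𝒜) τ.toLinearMap.isLinear τ'.toLinearMap.isLinear
    τ.continuous τ'.continuous ?_ hP.degree_zero).trans h2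
  rintro _ ⟨i, j, k, -, p, hp, q, hq, a, -, rfl⟩
  exact (hτ i j p hp q hq a).trans (h1 i j p hp q hq a).symm

include hℰ in
theorem IsPropagator.zero : IsPropagator ℰ 𝒜 (0 : Tensor3 𝕂 E A) :=
  ⟨zero_mem_degreeZero, let ⟨τ, hτ⟩ := exists_flip hℰ; ⟨τ, hτ, map_zero τ⟩⟩

include hℰ in
theorem IsPropagator.add {P Q : Tensor3 𝕂 E A} (hP : IsPropagator ℰ 𝒜 P)
    (hQ : IsPropagator ℰ 𝒜 Q) : IsPropagator ℰ 𝒜 (P + Q) :=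
  ⟨add_mem_degreeZero hP.degree_zero hQ.degree_zero, let ⟨τ, hτ⟩ := exists_flip hℰ
    ⟨τ, hτ, by rw [map_add, hP.flip_eq hτ, hQ.flip_eq hτ]⟩⟩

theorem numCycles_pos {X : Type*} [Finite X] [Nonempty X] (σ : Perm X) : 0 < numCycles σ :=
  have : Nonempty (Quotient (Equiv.Perm.SameCycle.setoid σ)) := ⟨Quotient.mk _ (Classical.arbitrary X)⟩
  Nat.card_pos

theorem graphClasses_eq_empty {i j k l : ℕ}
    (h : (j = 0 ∧ k = 0) ∨ 2 * (2 * (i : ℤ) + j + k - 1) + l < 3) : graphClasses i j k l = ∅ := by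
  refine Set.eq_empty_iff_forall_notMem.2 fun γ hγ => ?_
  obtain ⟨c, hx⟩ := mem_graphClasses.1 hγ
  rw [idx, Prod.ext_iff, Prod.ext_iff, Prod.ext_iff] at hx
  obtain ⟨h1, h2, -, h4⟩ := hx
  simp only at h1 h2 h4
  have hs : γ.out.toRibbonGraph.IsStable := fun v => ⟨γ.out.pos v, γ.out.stable v⟩
  have b := (hs.bounds c.totalGenus_eq).1
  rw [h1, h2, h4] at b
  have := c.1
  rcases h with ⟨rfl, rfl⟩ | h
  · have h3 : numCycles (γ.out.cyc * γ.out.inv) + ∑ v, γ.out.bdry v = 0 := h2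
    have h5 := Finset.sum_eq_zero_iff.1 (Nat.eq_zero_of_add_eq_zero_left h3) ⟨0, c.1⟩
      (mem_univ _)
    have h6 := γ.out.pos ⟨0, c.1⟩
    rw [h5, add_zero] at h6
    have h7 : Nonempty (γ.out.At ⟨0, c.1⟩) := by
      by_contra hn
      have : IsEmpty (γ.out.At ⟨0, c.1⟩) := not_nonempty_iff.1 hn
      have : IsEmpty (Quotient (Equiv.Perm.SameCycle.setoid (γ.out.cycAt ⟨0, c.1⟩))) :=
        ⟨fun q => Quotient.inductionOn q fun x => isEmptyElim x⟩
      rw [numCycles, Nat.card_of_isEmpty] at h6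
      exact absurd h6 (lt_irrefl 0)
    have : Nonempty (Fin γ.out.nH) := h7.map Subtype.val
    have := numCycles_pos (γ.out.cyc * γ.out.inv)
    omega
  · omega

section Operators

variable {P Q : Tensor3 𝕂 E A}

include hℰ h𝒜 hc hI in
theorem isInteraction_rgFlow (hP : IsPropagator ℰ 𝒜 P) : IsInteraction ℰ 𝒜 (rgFlow 𝒜 I P) where
  degree_zero i j k l := by
    refine finsum_mem_induction (p := fun u : CycWords A ℰ k l => ∃ T : CycDec k l → Multi 𝕂 E A l,
      Submodule.Quotient.mk T = u ∧
        ∀ σ (d : Fin l → ℤ) (x : ∀ m, ℰ (d m)), T σ (fun m => x m) ∈ 𝒜 (∑ m, d m))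
      ⟨0, rfl, fun _ _ _ => Submodule.zero_mem _⟩ ?_ fun γ _ => ?_
    · rintro _ _ ⟨T, rfl, h⟩ ⟨T', rfl, h'⟩
      exact ⟨T + T', rfl, fun σ d x => Submodule.add_mem _ (h σ d x) (h' σ d x)⟩
    · obtain ⟨T, h1, h2⟩ : ∃ T : CycDec k l → Multi 𝕂 E A l,
          Submodule.Quotient.mk T = γ.out.weight 𝒜 I P k l ∧
          ∀ σ (d : Fin l → ℤ) (x : ∀ m, ℰ (d m)), T σ (fun m => x m) ∈ 𝒜 (∑ m, d m) := by
        unfold weight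
        split_ifs with hl hk
        · refine ⟨_, rfl, fun σ d x => ?_⟩
          by_cases hσ : σ = ⟨_, hk⟩
          · rw [hσ, Pi.single_eq_same, amplitude_eq hℰ I h𝒜 hl]
            exact ampl_mem hℰ h𝒜 hc hI _ (fun _ _ => hP.degree_zero) d _ fun m => (x m).2
          · rw [Pi.single_eq_of_ne hσ]
            exact Submodule.zero_mem _
        · exact ⟨0, rfl, fun _ _ _ => Submodule.zero_mem _⟩
        · exact ⟨0, rfl, fun _ _ _ => Submodule.zero_mem _⟩
      exact ⟨(γ.out.autOrder : 𝕂)⁻¹ • T, by rw [Submodule.Quotient.mk_smul, h1], fun σ d x =>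
        Submodule.smul_mem _ _ (h2 σ d x)⟩
  no_constant i l := by rw [rgFlow, graphClasses_eq_empty (Or.inl ⟨rfl, rfl⟩), finsum_mem_empty]
  stable i j k l h := by rw [rgFlow, graphClasses_eq_empty (Or.inr h), finsum_mem_empty]

include hℰ h𝒜 hc hI in
theorem rgFlow_add (h0 : ∀ J : Functional A ℰ, IsInteraction ℰ 𝒜 J → rgFlow 𝒜 J 0 = J)
    (hP : IsPropagator ℰ 𝒜 P) (hQ : IsPropagator ℰ 𝒜 Q) :
    rgFlow 𝒜 I (P + Q) = rgFlow 𝒜 (rgFlow 𝒜 I P) Q := by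
  have hJ := isInteraction_rgFlow hℰ h𝒜 hc hI hP
  have hZ : IsPropagator ℰ 𝒜 (0 : Tensor3 𝕂 E A) := IsPropagator.zero hℰ
  funext i j k l
  let W := Idx.size (i, j + k, k, l)
  have h1 : genSum hℰ h𝒜 I Q P W 0 = genSum hℰ h𝒜 (rgFlow 𝒜 I P) Q 0 W 0 := by
    refine DFinsupp.ext fun ⟨i, s, k, l⟩ => ?_
    rcases lt_or_ge W (Idx.size (i, s, k, l)) with hx | hx
    · rw [genSum_apply_of_lt hℰ h𝒜 _ _ hx, genSum_apply_of_lt hℰ h𝒜 _ _ hx]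
    rcases lt_or_ge s k with hs | hs
    · have h2 : ∀ (J : Functional A ℰ) R, genSum hℰ h𝒜 J Q R W 0 (i, s, k, l) = 0 := fun J R => by
        have h3 : ∀ n m, markedSum hℰ h𝒜 J Q R W 0 n m (i, s, k, l) = 0 := fun n m => by
          rw [markedSum_apply]
          refine sum_eq_zero fun Γ _ => by_contra fun hne => ?_
          have h4 := (of_wt_ne_zero hℰ h𝒜 hne).2
          have h5 := numCycles_canonical_le_bnd Γ.graph
          rw [idx, Prod.ext_iff, Prod.ext_iff, Prod.ext_iff] at h4
          simp only at h4
          omega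
        rw [genSum_apply]
        simp only [h3, smul_zero, sum_const_zero]
      rw [h2, h2]
    · obtain ⟨j, rfl⟩ := Nat.exists_eq_add_of_le' hs
      rw [← rgFlow_eq_genSum hℰ h𝒜 hc hI hP hx, ← rgFlow_eq_genSum hℰ h𝒜 hc hJ hZ hx, h0 _ hJ]
  have h2 := sum_genSum hℰ h𝒜 (I := I) (P := Q) (Q := P) W
  have h3 := sum_genSum hℰ h𝒜 (I := rgFlow 𝒜 I P) (P := Q) (Q := 0) W
  rw [sum_congr rfl fun ν _ => genSum_eq_genSum hℰ h𝒜 hc hI hQ hP hJ hZ h1 ν, h3, add_zero,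
    add_comm] at h2
  rw [rgFlow_eq_genSum hℰ h𝒜 hc hI (hP.add hℰ hQ) (P := Q) (le_refl W),
    rgFlow_eq_genSum hℰ h𝒜 hc hJ hQ (P := Q) (le_refl W), h2]

end Operators



namespace LG

variable {l : ℕ} (σ : Perm (Fin l)) (g b : ℕ)

/-- The graph with one vertex and no edges. -/
@[reducible]
def corolla : LG l 1 :=
  ⟨fun _ => 0, Equiv.refl _, σ, fun _ => g, fun _ => b, fun _ => false, fun _ => rfl, fun _ => rfl,
    fun _ => rfl, fun _ _ => rfl⟩

theorem corolla_edges : (corolla σ g b).graph.edges = ∅ := by simp [edges]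

/-- The enumeration of the legs of a graph with one vertex and no edges. -/
def corollaLegs : (corolla σ g b).graph.LegEnum l :=
  ⟨id, injective_id, fun h => ⟨fun _ => rfl, fun _ => ⟨h, rfl⟩⟩⟩

theorem corolla_perm : (corollaLegs σ g b).perm = σ := LegEnum.perm_eq fun i => by
  rw [contractAll_of_edges_eq_empty (corolla_edges σ g b)]; rfl

theorem idx_corolla : (corolla σ g b).graph.idx = (g, numCycles σ + b, numCycles σ, l) := by
  have h1 : (corolla σ g b).graph.totalGenus = g := by
    rw [totalGenus, corolla_edges]
    simp [numBoundaryCycles, ← Equiv.Perm.one_def]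
  have h2 : (corolla σ g b).graph.bnd = numCycles σ + b := by
    simp [bnd, numBoundaryCycles, ← Equiv.Perm.one_def]
  rw [idx, gen_eq h1, h2, ← (corollaLegs σ g b).numCycles_perm, corolla_perm,
    (corollaLegs σ g b).card_legs]

/-- The half-edges at the vertex of a graph with one vertex. -/
def corollaAt (v : Fin 1) : Fin l ≃ (corolla σ g b).graph.At v :=
  ⟨fun i => ⟨i, Subsingleton.elim _ _⟩, Subtype.val, fun _ => rfl, fun _ => rfl⟩

theorem isStable_corolla : (corolla σ g b).graph.IsStable ↔ 0 < numCycles σ + b ∧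
    (3 : ℤ) ≤ 2 * (2 * g + b + numCycles σ - 1) + l := by
  have h1 : ∀ v, numCycles ((corolla σ g b).graph.cycAt v) = numCycles σ := fun v =>
    numCycles_congr (corollaAt σ g b v) fun _ => rfl
  have h2 : ∀ v, Fintype.card ((corolla σ g b).graph.At v) = l := fun v =>
    (Fintype.card_congr (corollaAt σ g b v)).symm.trans (Fintype.card_fin l)
  refine ⟨fun h => ?_, fun h v => ?_⟩
  · have := h (0 : Fin 1)
    rwa [h1, h2] at this
  · rwa [h1, h2]

theorem connected_corolla : (corolla σ g b).graph.Connected :=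
  ⟨Nat.one_pos, fun v w => by rw [show v = w from Subsingleton.elim (α := Fin 1) _ _]⟩

theorem eq_corolla {Γ : LG l 1} (h0 : Γ.graph.edges = ∅) (hn : Γ.nu = 0) :
    Γ = corolla Γ.cyc (Γ.genus 0) (Γ.bdry 0) := by
  ext x
  · simp
  · exact congrArg Fin.val (inv_eq_self_of_edges_eq_empty h0 x)
  · rfl
  · rw [Subsingleton.elim x 0]
  · rw [Subsingleton.elim x 0]
  · exact nu_eq_zero.1 hn x

end LG

theorem card_cycIso {k l : ℕ} (τ : CycDec k l) :
    ∑ σ : CycDec k l, Fintype.card (CycIso τ.1 σ.1) = l.factorial := by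
  rw [← Fintype.card_sigma]
  refine .trans (Fintype.card_congr (β := Perm (Fin l)) ⟨fun p => p.2.1, fun φ => ⟨⟨φ.permCongr τ.1, ?_⟩, φ, fun i => by simp⟩,
    ?_, fun _ => rfl⟩) (by rw [Fintype.card_perm, Fintype.card_fin])
  · exact (numCycles_congr φ fun i => by simp).trans τ.2
  · rintro ⟨⟨σ, hσ⟩, φ, hφ⟩
    obtain rfl : φ.permCongr τ.1 = σ := by
      ext1 i
      rw [permCongr_apply, hφ, apply_symm_apply]
    rfl

theorem vertexFun_eq {X : Type*} [Fintype X] [LinearOrder X] {C : Perm X} {k l : ℕ}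
    (hk : numCycles C = k) (hl : Fintype.card X = l) (g b : ℕ) (d : X → ℤ) (x : X → E) :
    vertexFun hℰ I C g b d x = attachFun hℰ C d (I g b k l) x := by
  subst hk hl
  rfl

theorem ampl_corolla {k l g b : ℕ} (σ : CycDec k l) {T : CycDec k l → Multi 𝕂 E A l}
    (hT : Submodule.Quotient.mk T = I g b k l) (t : Fin l → Tensor3 𝕂 E A) : ampl hℰ I h𝒜
    (corollaLegs σ.1 g b) t = ∑ τ : CycDec k l, ∑ φ : CycIso τ.1 σ.1, transport hℰ φ.1 (T τ) := by
  refine multi_ext hℰ fun d x hx => ?_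
  refine (ampl_of_edges_eq_empty hℰ h𝒜 (corolla_edges σ.1 g b) (corollaLegs σ.1 g b) t hx).trans ?_
  rw [koszulSign_eq_one, one_smul, vertexProd_eq_vertexFun]
  · change (List.map _ (List.finRange 1)).prod = _
    rw [List.finRange_succ, List.finRange_zero, List.map_nil, List.map_singleton, List.prod_singleton]
    refine (vertexFun_iso hℰ I (corollaAt σ.1 g b 0) (fun _ => rfl) g b _ _).trans ?_
    rw [koszulSign_eq_one, one_smul, vertexFun_eq hℰ σ.2 (Fintype.card_fin l), attachFun_apply, ← hT,
      attach_mk]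
    · simp only [_root_.sum_apply]
      refine sum_congr rfl fun τ _ => sum_congr rfl fun φ _ => ?_
      rw [transport_apply hℰ _ _ hx]
      refine congrArg _ (congrArg (T τ) (funext fun i => ?_))
      exact hℰ.proj_same (hx _)
    · exact fun i j _ _ h h' => absurd h (lt_asymm h')
  · intro i j _ _ h h'
    have e : ∀ i : Fin l, (corollaLegs σ.1 g b).key (.inl i) = toLex (0, toLex ((i : ℕ), 0)) :=
      (corollaLegs σ.1 g b).key_leg
    rw [e, e] at h
    simp [rootKey, toLex_lt_toLex] at h h'
    omega

theorem edges_eq_empty_of_wt_ne_zero {W : ℕ} {Γ : RibbonGraph} {x : Idx}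
    (h : wt hℰ h𝒜 I W Γ (fun _ => 0) x ≠ 0) : Γ.edges = ∅ := by
  classical
  by_contra he
  obtain ⟨e, he⟩ := Finset.nonempty_iff_ne_empty.2 he
  refine h ?_
  rw [wt_apply, cw]
  split_ifs with h1 h2
  · have h3 : ampl hℰ I h𝒜 (Γ.sortedLegs h2) (fun _ => 0) = 0 := by
      ext y
      exact (amplitudeFun hℰ I h𝒜 (Γ.sortedLegs h2) y).map_coord_zero ⟨e, he⟩ rfl
    rw [h3, map_zero]
  · rfl
  · rfl

include hℰ h𝒜 hc hI in
theorem rgFlow_zero : rgFlow 𝒜 I 0 = I := by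
  classical
  funext i j k l
  by_cases hs : (j = 0 ∧ k = 0) ∨ 2 * (2 * (i : ℤ) + j + k - 1) + l < 3
  · rw [rgFlow, graphClasses_eq_empty hs, finsum_mem_empty]
    rcases hs with ⟨rfl, rfl⟩ | h
    · exact (hI.no_constant i l).symm
    · exact (hI.stable i j k l h).symm
  obtain ⟨T, hT, -⟩ := hI.degree_zero i j k l
  set x : Idx := (i, j + k, k, l) with hx
  have hZ : IsPropagator ℰ 𝒜 (0 : Tensor3 𝕂 E A) := IsPropagator.zero hℰ
  set W := x.size + 1 with hW
  have hxs : x.size = 4 * i + 2 * (j + k) + l := rfl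
  have hl : ∀ {n m} (Γ : LG n m), lwt hℰ h𝒜 I 0 0 W Γ = wt hℰ h𝒜 I W Γ.graph fun _ => 0 :=
    fun Γ => congrArg (wt hℰ h𝒜 I W Γ.graph) (funext fun _ => ite_self _)
  have h1 : ∀ {n m} (Γ : LG n m), lwt hℰ h𝒜 I 0 0 W Γ x ≠ 0 → n = l ∧ m = 1 := fun {n m} Γ h => by
    rw [hl] at h
    have h0 := edges_eq_empty_of_wt_ne_zero hℰ h𝒜 h
    obtain ⟨⟨c, -⟩, h2⟩ := of_wt_ne_zero hℰ h𝒜 h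
    have h3 := nH_eq Γ.graph
    rw [h0, Finset.card_empty] at h3
    have h4 : Γ.graph.legs.card = l := congrArg (fun y : Idx => y.2.2.2) h2
    exact ⟨by simp only at h3; omega, nV_eq_one h0 c⟩
  have h2 : ∀ n m, ¬ (n = l ∧ m = 1) → markedSum hℰ h𝒜 I 0 0 W 0 n m x = 0 := fun n m h => by
    rw [markedSum_apply]
    exact sum_eq_zero fun Γ _ => by_contra fun hne => h (h1 Γ hne)
  have h3 : markedSum hℰ h𝒜 I 0 0 W 0 l 1 x =
      ∑ σ : CycDec k l, wt hℰ h𝒜 I W (corolla σ.1 i j).graph (fun _ => 0) x := by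
    rw [markedSum_apply]
    symm
    refine Finset.sum_of_injOn (fun σ : CycDec k l => corolla σ.1 i j) ?_ ?_ ?_ ?_
    · exact fun σ _ σ' _ h => Subtype.ext (congrArg LG.cyc h)
    · intro σ _
      refine Finset.mem_coe.2 (mem_filter.2 ⟨mem_bounded.2 fun v => ⟨?_, ?_⟩,
        nu_eq_zero.2 fun _ => rfl⟩) <;> simp only <;> omega
    · intro Γ hΓ hn
      by_contra hne
      rw [hl] at hne
      have h0 := eq_corolla (edges_eq_empty_of_wt_ne_zero hℰ h𝒜 hne) (mem_filter.1 hΓ).2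
      have h4 := (of_wt_ne_zero hℰ h𝒜 hne).2
      rw [h0, idx_corolla, hx, Prod.ext_iff, Prod.ext_iff, Prod.ext_iff] at h4
      obtain ⟨e1, e2, e3, -⟩ := h4
      simp only at e1 e2 e3
      refine hn ⟨⟨Γ.cyc, e3⟩, Finset.mem_coe.2 (mem_univ _), ?_⟩
      simp only
      rw [← e1, show j = Γ.bdry 0 by omega]
      exact h0.symm
    · intro σ _
      rw [hl]
  have h4 : ∀ σ : CycDec k l, wt hℰ h𝒜 I W (corolla σ.1 i j).graph (fun _ => 0) x =
      ∑ τ : CycDec k l, Fintype.card (CycIso τ.1 σ.1) • cls ℰ k τ.1 (T τ) := fun σ => by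
    have e := idx_corolla σ.1 i j
    rw [idx, Prod.ext_iff, Prod.ext_iff, Prod.ext_iff] at e
    obtain ⟨e1, e2, -⟩ := e
    simp only at e1 e2
    rw [wt_apply, if_pos ⟨connected_corolla _ _ _, (isStable_corolla _ _ _).2 (by
      have := σ.2; omega), by omega, e1, e2.trans (by rw [σ.2, hx, add_comm])⟩]
    refine (cw_eq hℰ h𝒜 hc hI (corollaLegs σ.1 i j) k ⟨fun _ => hZ, fun _ => rfl⟩).trans ?_
    rw [corolla_perm, ampl_corolla hℰ h𝒜 σ hT, map_sum]
    refine sum_congr rfl fun τ _ => ?_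
    rw [map_sum, ← Finset.card_univ, ← sum_const]
    refine sum_congr rfl fun φ _ => ?_
    rw [← cls_transport hℰ φ.1 τ.1]
    congr 1
    congr 1
    ext1 a
    rw [permCongr_apply, φ.2, apply_symm_apply]
  have hne : (l.factorial : 𝕂) ≠ 0 := Nat.cast_ne_zero.2 l.factorial_ne_zero
  rw [rgFlow_eq_genSum hℰ h𝒜 hc hI (P := 0) hZ (W := W) (Nat.le_succ _), genSum_apply,
    sum_eq_single_of_mem l (mem_range.2 (by omega)),
    sum_eq_single_of_mem 1 (mem_range.2 (by omega)), h3,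
    sum_congr rfl fun σ _ => h4 σ, sum_comm, Nat.factorial_one, Nat.cast_one, inv_one,
    one_smul]
  · rw [sum_congr rfl fun τ _ => show _ = l.factorial • (relations A ℰ k l).mkQ
        (Pi.single τ (T τ)) by rw [← Finset.sum_smul, card_cycIso τ, cls_of_eq τ.2]; rfl,
      ← smul_sum, ← Nat.cast_smul_eq_nsmul 𝕂, smul_smul, inv_mul_cancel₀ hne, one_smul, ← hT,
      ← map_sum, Finset.univ_sum_single]
    rfl
  · intro m _ hm
    rw [h2 l m fun h => hm h.2, smul_zero]
  · intro n _ hn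
    rw [sum_eq_zero fun m _ => by rw [h2 n m fun h => hn h.1, smul_zero], smul_zero]

end Flow

end NCRG

end

theorem mainTheorem3 {𝕂 E A : Type*} [RCLike 𝕂]
    [AddCommGroup E] [Module 𝕂 E] [TopologicalSpace E] [IsTopologicalAddGroup E]
    [ContinuousSMul 𝕂 E] [PolynormableSpace 𝕂 E] [T2Space E]
    (ℰ : ℤ → Submodule 𝕂 E) [DirectSum.Decomposition ℰ] (hℰ : NCRG.IsTopologicalGrading ℰ)
    [Ring A] [Algebra 𝕂 A] [UniformSpace A] [IsUniformAddGroup A] [IsTopologicalRing A]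
    [ContinuousSMul 𝕂 A] [PolynormableSpace 𝕂 A] [T2Space A] [CompleteSpace A]
    (𝒜 : ℤ → Submodule 𝕂 A) [GradedAlgebra 𝒜] (h𝒜 : NCRG.IsTopologicalGrading 𝒜)
    (hcomm : NCRG.IsGradedCommutative 𝒜) :
    -- the sum defining the flow is finite in each multidegree, and `g(Γ)`, `b(Γ)` are natural numbers
    (∀ i j k l : ℕ, (NCRG.graphClasses i j k l).Finite) ∧
    (∀ Γ : NCRG.StableRibbonGraph, Γ.Connected →
      ∃ i j : ℕ, Γ.totalGenus = i ∧ Γ.totalBdry = j) ∧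
    -- the Feynman amplitudes exist, and the flow maps interactions to interactions
    (∀ I : NCRG.Functional A ℰ, NCRG.IsInteraction ℰ 𝒜 I →
      ∀ P : NCRG.Tensor3 𝕂 E A, NCRG.IsPropagator ℰ 𝒜 P →
        (∀ (Γ : NCRG.StableRibbonGraph) (l : ℕ) (hl : Γ.legs.card = l),
          ∃! F, Γ.IsAmplitude 𝒜 I P hl F) ∧
        NCRG.IsInteraction ℰ 𝒜 (NCRG.rgFlow 𝒜 I P)) ∧
    -- the additive group of propagators acts on the interactions
    (∀ I : NCRG.Functional A ℰ, NCRG.IsInteraction ℰ 𝒜 I → NCRG.rgFlow 𝒜 I 0 = I) ∧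
    (∀ I : NCRG.Functional A ℰ, NCRG.IsInteraction ℰ 𝒜 I →
      ∀ P₁ P₂ : NCRG.Tensor3 𝕂 E A, NCRG.IsPropagator ℰ 𝒜 P₁ → NCRG.IsPropagator ℰ 𝒜 P₂ →
        NCRG.rgFlow 𝒜 I (P₁ + P₂) = NCRG.rgFlow 𝒜 (NCRG.rgFlow 𝒜 I P₁) P₂) :=
  ⟨NCRG.finite_graphClasses,
    fun Γ h => ⟨Γ.toRibbonGraph.gen, Γ.toRibbonGraph.bnd - NCRG.numCycles Γ.canonical,
      NCRG.RibbonGraph.Connected.totalGenus_eq h, by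
        rw [NCRG.RibbonGraph.totalBdry_eq,
          Nat.cast_sub (NCRG.RibbonGraph.numCycles_canonical_le_bnd _)]⟩,
    fun I hI P hP =>
      ⟨fun Γ _ hl => NCRG.RibbonGraph.existsUnique_isAmplitude hℰ I h𝒜 hl P,
        NCRG.isInteraction_rgFlow hℰ h𝒜 hcomm hI hP⟩,
    fun _ hI => NCRG.rgFlow_zero hℰ h𝒜 hcomm hI,
    fun _ hI _ _ h₁ h₂ => NCRG.rgFlow_add hℰ h𝒜 hcomm hI
      (fun _ hJ => NCRG.rgFlow_zero hℰ h𝒜 hcomm hJ) h₁ h₂⟩
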